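/- **Setting.** Let $m\ge 1$, let $U\subset\mathbb C^n$ be open, and let $\Lambda\subset U\times\mathbb C^m$ be a holomorphic lattice bundle: every $\Lambda_z\subset\mathbb C^m$ is a lattice of rank $2m$, and locally on $U$ there is a holomorphic matrix $T(z)\in\mathbb C^{m\times 2m}$ whose columns $\tau_1,\dots,\tau_{2m}$ generate $\Lambda_z$. Put $X=(U\times\mathbb C^m)/\Lambda$, a family of complex tori $X_z=\mathbb C^m/\Lambda_z$, with coordinates $z$ on $U$ and $w$ along the fibers and with the zero section. (Every holomorphic family of complex $m$-tori with a section has this form over small coordinate domains of the base.) Tensors on $X$ are $\Lambda$-invariant tensors on $U\times\mathbb C^m$. The Kähler form of a hermitian metric $g$ is $\omega(u,v)=g(iu,v)$, and $h=\frac12(g+i\omega)$. The Ricci form of a Kähler metric with Kähler form $\omega=i\sum h_{jk}dz^j\wedge d\bar z^k$ is $\rho(\omega)=-i\partial\bar\partial\log\det(h_{jk})$. A *constant polarization* is a smooth real $2$-form $\omega$ on $X$ that restricts to a Kähler form on every $X_z$ and for which there are $c_i\in\mathbb R$ and $\xi_i(z)\in H^2(X_z,\mathbb Z)$ with $[\omega|_{X_z}]=\sum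 c_i\xi_i(z)$ for all $z$. Let $\epsilon>0$. Let $g_{z,\epsilon}$ be the flat Kähler metric on $X_z$ of volume $\epsilon$ whose Kähler class is a multiple of $[\omega|_{X_z}]$, and let $h_\epsilon$ be the hermitian metric it induces on $E$, the bundle of vertical vectors along the zero section. Let $\mathcal H$ be the horizontal distribution on $X$ tangent to the local sections $\sum x^a\tau_a$, $x^a\in\mathbb R$ constant. Consider two cases. * *Hyperkähler setting:* $n=m$, and $\Upsilon=g\sum_j dz^j\wedge dw^j$, with $g:U\to\mathbb C$ holomorphic, is a holomorphic symplectic form on $X$. Then $g_{S,\epsilon}$ is the hermitian metric on $U$ for which the pairing $E\otimes T^{1,0}U\to\mathbb C$ defined by $\Upsilon$ is isometric (i.e. identifies $T^{1,0}U$ isometrically with the dual of $(E,h_\epsilon)$). * *Calabi–Yau setting:* $n=1$, and $\Omega=g\,dz\wedge dw^1\wedge\dots\wedge dw^m$, with $g:U\to\mathbb C$ holomorphic, is a holomorphic volume form on $X$. Then $g_{S,\epsilon}$ is the hermitian metric on $U$ for which the pairing $\wedge^mE\otimes T^{1,0}U\to\mathbb C$ defined by $\Omega$ is isometric, with the metric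 on $\wedge^mE$ induced by $h_\epsilon$. The semi-flat metric is $g_{\mathrm{sf},\epsilon}(u,v)=g_{S,\epsilon}(f_*u,f_*v)+g_{z,\epsilon}(Pu,Pv)$, where $f:X\to U$ is the projection and $P$ is the projection to the vertical space along $\mathcal H$. **Lemma.** In both settings these metrics exist on $X$, and $g_{S,\epsilon}$ and $g_{\mathrm{sf},\epsilon}$ are Kähler. Moreover: $\omega_{\mathrm{sf},\epsilon}^{2m}=\binom{2m}{m}\Upsilon^m\wedge\bar\Upsilon^m$, and $g_{\mathrm{sf},\epsilon}$ is hyperkähler, in the hyperkähler setting; $\omega_{\mathrm{sf},\epsilon}^{m+1}=(m+1)!\,i^{(m+1)^2}\,\Omega\wedge\bar\Omega$, and $g_{\mathrm{sf},\epsilon}$ is Calabi–Yau, i.e. Kähler and Ricci-flat, in the Calabi–Yau setting. Let $W\subset U$ be a connected nonempty open set on which a holomorphic frame $T=(\tau_1,\dots,\tau_{2m})$ of $\Lambda$ exists. Then there is a constant real skew matrix $Q$ with $\det Q>0$ such that for all $z\in W$, with $\xi^a$ the $\mathbb R$-dual basis of $\tau_a$, $$[\omega|_{X_z}]=\big[\tfrac12\textstyle\sum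 Q_{ab}\xi^a\wedge\xi^b\big],\qquad \tfrac12\textstyle\sum Q_{ab}\xi^a\wedge\xi^b=i\sum H_{jk}dw^j\wedge d\bar w^k,\qquad H^{-1}=i\bar TQ^{-1}T^{\mathrm{tr}}.$$ Put $H(\epsilon)=(\epsilon/\sqrt{\det Q})^{1/m}H$ and $\Gamma_p(z,w)=\frac{\partial T}{\partial z^p}\binom{T}{\bar T}^{-1}\binom{w}{\bar w}\in\mathbb C^m$. The Kähler form of $g_{z,\epsilon}$ is $i\sum H(\epsilon)_{jk}dw^j\wedge d\bar w^k$, and over $W$: (ia) in the hyperkähler setting, $$\omega_{\mathrm{sf},\epsilon}=i|g|^2\sum_{j,k}(H(\epsilon)^{-1})_{kj}\,dz^j\wedge d\bar z^k+i\sum_{j,k}H(\epsilon)_{jk}\Big(dw^j-\sum_p\Gamma^j_p\,dz^p\Big)\wedge\Big(d\bar w^k-\sum_q\bar\Gamma^k_q\,d\bar z^q\Big);$$ (ib) in the Calabi–Yau setting, $$\omega_{\mathrm{sf},\epsilon}=i|g|^2\det(H(\epsilon))^{-1}dz\wedge d\bar z+i\sum_{j,k}H(\epsilon)_{jk}(dw^j-\Gamma^jdz)\wedge(d\bar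 w^k-\bar\Gamma^kd\bar z);$$ (ii) in both settings there are real matrices $S$ with $S^{\mathrm{tr}}QS=\begin{pmatrix}0&1\\-1&0\end{pmatrix}$. For each of them $TS=R(1,Z)$ on $W$ with $R$ holomorphic and invertible and $Z$ holomorphic with values in the Siegel upper half space $\mathfrak H_m=\{Z\in\mathbb C^{m\times m}:Z^{\mathrm{tr}}=Z,\ \mathrm{Im}\,Z>0\}$ (the period map). Then $H^{-1}=2\bar R(\mathrm{Im}\,Z)R^{\mathrm{tr}}$ and $$\rho(\omega_{S,\epsilon})=-i\partial\bar\partial\log\det(\mathrm{Im}\,Z)=\frac i4\sum(\mathrm{Im}\,Z)^{ab}dZ_{bc}\wedge(\mathrm{Im}\,Z)^{cd}d\bar Z_{da},$$ with $(\mathrm{Im}\,Z)^{ab}$ the entries of $(\mathrm{Im}\,Z)^{-1}$. This is the pullback under $Z$ of the Kähler form $\frac i4\sum Y^{ab}dZ_{bc}\wedge Y^{cd}d\bar Z_{da}$ on $\mathfrak H_m$ (where $Y^{ab}$ are the entries of $(\mathrm{Im}\,Z)^{-1}$), which is invariant under $\mathrm{Sp}(2m,\mathbb R)$. **Corollary.**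 Let $n=m=1$ and let $\Omega$ be a holomorphic symplectic form on $X$. Then $\Omega=g\,dz\wedge dw$ with $g:U\to\mathbb C$ holomorphic. Let $\omega_{\mathrm{sf},\epsilon}$, $\omega_{S,\epsilon}$ be constructed as in the hyperkähler setting from $\Upsilon=\frac1{\sqrt2}\Omega$ and the flat Kähler metrics of area $\epsilon$ on the fibers. These metrics exist, $\omega_{\mathrm{sf},\epsilon}$ is hyperkähler, $\omega_{S,\epsilon}$ is Kähler, and $\omega_{\mathrm{sf},\epsilon}^2=\Omega\wedge\bar\Omega$. On each open $W\subset U$ where $\Lambda=\mathbb Z\tau_1+\mathbb Z\tau_2$ with $\tau_1,\tau_2$ holomorphic and $\mathrm{Im}(\bar\tau_1\tau_2)>0$, $$\omega_{\mathrm{sf},\epsilon}=i|g|^2\frac{\mathrm{Im}(\bar\tau_1\tau_2)}{\epsilon}dz\wedge d\bar z+\frac i2\frac{\epsilon}{\mathrm{Im}(\bar\tau_1\tau_2)}(dw-\Gamma dz)\wedge(d\bar w-\bar\Gamma d\bar z),$$ $$\Gamma(z,w)=\frac1{\mathrm{Im}(\bar\tau_1\tau_2)}\big(\mathrm{Im}(\bar\tau_1w)\tau_2'-\mathrm{Im}(\bar\tau_2w)\tau_1'\big),$$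 and with $\tau=\tau_2/\tau_1$, which maps $W$ holomorphically to the upper half plane, $$\rho(\omega_{S,\epsilon})=-i\partial\bar\partial\log\mathrm{Im}(\tau)=\frac i4\frac{d\tau\wedge d\bar\tau}{\mathrm{Im}(\tau)^2}.$$ This is the pullback under $\tau$ of the Kähler form of the hyperbolic metric $|d\tau|^2/(2\,\mathrm{Im}(\tau)^2)$, which has constant Gauß curvature $-2$. -/

import Mathlib

noncomputable section

/-! ## Forms and metrics on open subsets of `ι → ℂ`

Differential forms are complex valued; a field of forms is a function on the whole space, and only
its values on a given open set matter.  Multiplication by `Complex.I` is the complex structure. -/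

/-- Complex valued alternating `p`-forms (over `ℝ`) on `V`. -/
abbrev CForm (V : Type*) [NormedAddCommGroup V] [NormedSpace ℝ V] (p : ℕ) : Type _ :=
  V [⋀^Fin p]→L[ℝ] ℂ

/-- Real bilinear forms on `V`. -/
abbrev Bilin (V : Type*) [NormedAddCommGroup V] [NormedSpace ℝ V] : Type _ :=
  V →L[ℝ] V →L[ℝ] ℝ

section LinearAlgebra

variable {V : Type*} [NormedAddCommGroup V] [NormedSpace ℝ V]

/-- `θ 0 ∧ ⋯ ∧ θ (p - 1)` for complex valued `1`-forms `θ i`, that is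
`∑ σ, sign σ * ∏ i, θ i (v (σ i))`. -/
def wedgeOne {p : ℕ} (θ : Fin p → V →L[ℝ] ℂ) : CForm V p :=
  ContinuousMultilinearMap.alternatization
    ((ContinuousMultilinearMap.mkPiAlgebra ℝ (Fin p) ℂ).compContinuousLinearMap θ)

/-- The complex conjugate of a complex valued `1`-form. -/
def conjOne (θ : V →L[ℝ] ℂ) : V →L[ℝ] ℂ := (Complex.conjCLE : ℂ →L[ℝ] ℂ).comp θ

/-- The wedge product of alternating forms (sum over shuffles). -/
def wedge {p q : ℕ} (α : V [⋀^Fin p]→ₗ[ℝ] ℂ) (β : V [⋀^Fin q]→ₗ[ℝ] ℂ) :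
    V [⋀^Fin (p + q)]→ₗ[ℝ] ℂ :=
  ((LinearMap.mul' ℝ ℂ).compAlternatingMap (α.domCoprod β)).domDomCongr finSumFinEquiv

/-- The wedge power `α ∧ ⋯ ∧ α` (`k` factors). -/
def wedgePow {p : ℕ} (α : V [⋀^Fin p]→ₗ[ℝ] ℂ) : (k : ℕ) → V [⋀^Fin (p * k)]→ₗ[ℝ] ℂ
  | 0 =>
    haveI : IsEmpty (Fin (p * 0)) := inferInstanceAs (IsEmpty (Fin 0))
    AlternatingMap.constOfIsEmpty ℝ V (Fin (p * 0)) (1 : ℂ)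
  | k + 1 => wedge (wedgePow α k) α

/-- The complex conjugate of a form. -/
def conjForm {p : ℕ} (α : V [⋀^Fin p]→ₗ[ℝ] ℂ) : V [⋀^Fin p]→ₗ[ℝ] ℂ :=
  (Complex.conjCLE : ℂ →L[ℝ] ℂ).toLinearMap.compAlternatingMap α

/-- The `2`-form `(u, v) ↦ (g (A u) v - g (A v) u) / 2`.  If `A` is skew with respect to the
symmetric form `g`, this is `(u, v) ↦ g (A u) v`. -/
def fundForm (g : Bilin V) (A : V →L[ℝ] V) : CForm V 2 :=
  Complex.ofRealCLM.compContinuousAlternatingMap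
    ((1 / 2 : ℝ) • ContinuousMultilinearMap.alternatization
      ((g.comp A).uncurryBilinear.compContinuousLinearMap
        (fun _ => (ContinuousLinearMap.id ℝ V).prod (ContinuousLinearMap.id ℝ V))))

end LinearAlgebra

section Coordinates

variable {ι : Type*} [Fintype ι]

/-- The complex structure, multiplication by `i`. -/
def cpx (ι : Type*) [Fintype ι] : (ι → ℂ) →L[ℝ] (ι → ℂ) :=
  Complex.I • ContinuousLinearMap.id ℝ (ι → ℂ)

/-- The coordinate `1`-form `dx^i`. -/
def dcoord (i : ι) : (ι → ℂ) →L[ℝ] ℂ := ContinuousLinearMap.proj i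

/-- The Kähler form `ω(u, v) = g(iu, v)` of a hermitian inner product `g`. -/
def kahlerForm (g : Bilin (ι → ℂ)) : CForm (ι → ℂ) 2 := fundForm g (cpx ι)

/-- `g` is a real inner product which is invariant under multiplication by `i`. -/
def IsHermInner (g : Bilin (ι → ℂ)) : Prop :=
  (∀ u v, g u v = g v u) ∧ (∀ u v, g (Complex.I • u) (Complex.I • v) = g u v) ∧
    ∀ u, u ≠ 0 → 0 < g u u

/-- The hermitian form `h = (g + iω) / 2` induced by `g`. -/
def hermOf (g : Bilin (ι → ℂ)) (u v : ι → ℂ) : ℂ :=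
  (1 / 2) * ((g u v : ℂ) + Complex.I * (g (Complex.I • u) v : ℂ))

/-- `g` is a smooth Kähler metric on the open set `W`. -/
def IsKahlerMetric (W : Set (ι → ℂ)) (g : (ι → ℂ) → Bilin (ι → ℂ)) : Prop :=
  ContDiffOn ℝ (⊤ : ℕ∞) g W ∧ (∀ x ∈ W, IsHermInner (g x)) ∧
    ∀ x ∈ W, extDeriv (fun y => kahlerForm (g y)) x = 0

/-- `α` is a smooth real `2`-form on `W`. -/
def IsRealTwoForm (W : Set (ι → ℂ)) (α : (ι → ℂ) → CForm (ι → ℂ) 2) : Prop :=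
  ContDiffOn ℝ (⊤ : ℕ∞) α W ∧ ∀ x ∈ W, ∀ v, (α x v).im = 0

/-- `α` is a Kähler form on `W`: a smooth real closed positive `(1,1)`-form. -/
def IsKahlerForm (W : Set (ι → ℂ)) (α : (ι → ℂ) → CForm (ι → ℂ) 2) : Prop :=
  IsRealTwoForm W α ∧ (∀ x ∈ W, extDeriv α x = 0) ∧
    (∀ x ∈ W, ∀ u v, α x ![Complex.I • u, Complex.I • v] = α x ![u, v]) ∧
    ∀ x ∈ W, ∀ u, u ≠ 0 → 0 < (α x ![u, Complex.I • u]).re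

/-- `α` is a holomorphic `p`-form on `W`: complex multilinear, with holomorphic coefficients. -/
def IsHolForm {p : ℕ} (W : Set (ι → ℂ)) (α : (ι → ℂ) → CForm (ι → ℂ) p) : Prop :=
  (∀ x ∈ W, ∀ v k, α x (Function.update v k (Complex.I • v k)) = Complex.I * α x v) ∧
    ∀ v, DifferentiableOn ℂ (fun x => α x v) W

/-- `Υ` is a holomorphic symplectic form on `W`: a closed nondegenerate holomorphic `2`-form. -/
def IsHolSymplectic (W : Set (ι → ℂ)) (Υ : (ι → ℂ) → CForm (ι → ℂ) 2) : Prop :=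
  IsHolForm W Υ ∧ (∀ x ∈ W, extDeriv Υ x = 0) ∧
    ∀ x ∈ W, ∀ u, (∀ v, Υ x ![u, v] = 0) → u = 0

/-- `Ω` is a holomorphic volume form on `W`: a nowhere vanishing holomorphic form of top degree `p`
(used only with `p` the complex dimension). -/
def IsHolVolume {p : ℕ} (W : Set (ι → ℂ)) (Ω : (ι → ℂ) → CForm (ι → ℂ) p) : Prop :=
  IsHolForm W Ω ∧ ∀ x ∈ W, Ω x ≠ 0

variable [DecidableEq ι]

/-- The Wirtinger derivative `∂f/∂x^j`. -/
def wirt (j : ι) (f : (ι → ℂ) → ℂ) (x : ι → ℂ) : ℂ :=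
  (1 / 2) * (fderiv ℝ f x (Pi.single j 1) - Complex.I * fderiv ℝ f x (Pi.single j Complex.I))

/-- The Wirtinger derivative `∂f/∂x̄^j`. -/
def wirtBar (j : ι) (f : (ι → ℂ) → ℂ) (x : ι → ℂ) : ℂ :=
  (1 / 2) * (fderiv ℝ f x (Pi.single j 1) + Complex.I * fderiv ℝ f x (Pi.single j Complex.I))

/-- The form `∂∂̄f = ∑ j k, ∂²f/∂x^j∂x̄^k dx^j ∧ dx̄^k`. -/
def ddbar (f : (ι → ℂ) → ℂ) (x : ι → ℂ) : CForm (ι → ℂ) 2 :=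
  ∑ j, ∑ k, wirt j (wirtBar k f) x • wedgeOne ![dcoord j, conjOne (dcoord k)]

/-- The Ricci form `-i∂∂̄ log det (h_{jk})` of a Kähler metric, where `h_{jk}` are the coefficients
of the hermitian form in the holomorphic coordinates. -/
def ricciForm (g : (ι → ℂ) → Bilin (ι → ℂ)) (x : ι → ℂ) : CForm (ι → ℂ) 2 :=
  (-Complex.I) • ddbar (fun y => ((Real.log (Matrix.det (Matrix.of fun j k : ι =>
    hermOf (g y) (Pi.single j 1) (Pi.single k 1))).re : ℝ) : ℂ)) x

end Coordinates

section Curvature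

variable {V : Type*} [NormedAddCommGroup V] [NormedSpace ℝ V]

/-- `D + Γ` is the Levi-Civita connection of `g` on `W`: torsion free and metric. -/
def IsLeviCivita (W : Set V) (g : V → Bilin V) (Γ : V → V →L[ℝ] V →L[ℝ] V) : Prop :=
  ContDiffOn ℝ (⊤ : ℕ∞) Γ W ∧ (∀ x ∈ W, ∀ u v, Γ x u v = Γ x v u) ∧
    ∀ x ∈ W, ∀ u v w, fderiv ℝ g x u v w = g x (Γ x u v) w + g x v (Γ x u w)

/-- The curvature `R(u, v) w` of the connection `D + Γ`. -/
def curvature (Γ : V → V →L[ℝ] V →L[ℝ] V) (x u v w : V) : V :=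
  fderiv ℝ Γ x u v w - fderiv ℝ Γ x v u w + Γ x u (Γ x v w) - Γ x v (Γ x u w)

/-- `g` has constant sectional curvature `κ` on `W` (flat if `κ = 0`; in real dimension two `κ` is
the Gauß curvature). -/
def HasConstCurvature (W : Set V) (g : V → Bilin V) (κ : ℝ) : Prop :=
  ∃ Γ, IsLeviCivita W g Γ ∧
    ∀ x ∈ W, ∀ u v w, curvature Γ x u v w = κ • (g x v w • u - g x u w • v)

end Curvature

section HyperkahlerCY

variable {ι : Type*} [Fintype ι]

/-- The Kähler metric `g` is hyperkähler on `W`: besides the given complex structure `I` there is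
an orthogonal almost complex structure `J` with `IJ = -JI`, such that the fundamental forms of
`I`, `J` and `K = IJ` are all closed (integrability of `J` and `K`, and the fact that `I`, `J`, `K`
are parallel, are then automatic). -/
def IsHyperkahler (W : Set (ι → ℂ)) (g : (ι → ℂ) → Bilin (ι → ℂ)) : Prop :=
  IsKahlerMetric W g ∧ ∃ J : (ι → ℂ) → (ι → ℂ) →L[ℝ] (ι → ℂ), ContDiffOn ℝ (⊤ : ℕ∞) J W ∧
    (∀ x ∈ W, ∀ u, J x (J x u) = -u) ∧
    (∀ x ∈ W, ∀ u, J x (Complex.I • u) = -(Complex.I • J x u)) ∧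
    (∀ x ∈ W, ∀ u v, g x (J x u) (J x v) = g x u v) ∧
    (∀ x ∈ W, extDeriv (fun y => fundForm (g y) (J y)) x = 0) ∧
    ∀ x ∈ W, extDeriv (fun y => fundForm (g y) ((cpx ι).comp (J y))) x = 0

/-- The metric `g` is Calabi-Yau, i.e. Kähler and Ricci-flat, on `W`. -/
def IsCalabiYau [DecidableEq ι] (W : Set (ι → ℂ)) (g : (ι → ℂ) → Bilin (ι → ℂ)) : Prop :=
  IsKahlerMetric W g ∧ ∀ x ∈ W, ricciForm g x = 0

end HyperkahlerCY

/-! ## Complex tori `(Fin m → ℂ) / L`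

Tensors on the torus are `L`-periodic tensors on `Fin m → ℂ`. -/

section Tori

variable {m : ℕ}

/-- `τ` is a `ℤ`-basis of `L` and an `ℝ`-basis of `ℂ^m` (so that `L` is a lattice). -/
def IsLatticeBasis (L : AddSubgroup (Fin m → ℂ)) (τ : Fin m ⊕ Fin m → Fin m → ℂ) : Prop :=
  LinearIndependent ℝ τ ∧ L = AddSubgroup.closure (Set.range τ)

/-- Invariance of a tensor field under translation by the elements of `L`. -/
def IsPeriodic {Y : Type*} (L : AddSubgroup (Fin m → ℂ)) (f : (Fin m → ℂ) → Y) : Prop :=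
  ∀ l ∈ L, ∀ w, f (w + l) = f w

/-- The torus with the metric `g` has volume `ε`: the integral of the Riemannian density over a
fundamental cell. -/
def HasVolume (L : AddSubgroup (Fin m → ℂ)) (g : (Fin m → ℂ) → Bilin (Fin m → ℂ)) (ε : ℝ) : Prop :=
  ∃ τ, IsLatticeBasis L τ ∧
    ∫ t in Set.Icc (0 : Fin m ⊕ Fin m → ℝ) 1,
      Real.sqrt (Matrix.det (Matrix.of fun a b : Fin m ⊕ Fin m =>
        g (∑ c, t c • τ c) (τ a) (τ b))) = ε

/-- `α` and `β` define the same de Rham class on the torus: their difference is the exterior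
derivative of a smooth periodic `1`-form. -/
def Cohomologous (L : AddSubgroup (Fin m → ℂ)) (α β : (Fin m → ℂ) → CForm (Fin m → ℂ) 2) : Prop :=
  ∃ γ : (Fin m → ℂ) → CForm (Fin m → ℂ) 1, ContDiff ℝ (⊤ : ℕ∞) γ ∧ IsPeriodic L γ ∧
    ∀ w, α w - β w = extDeriv γ w

/-- The translation invariant form `ξ` represents a class in the integral cohomology
`H²((Fin m → ℂ) / L, ℤ)`, the group of integral alternating forms on `L`. -/
def IsIntegralClass (L : AddSubgroup (Fin m → ℂ)) (ξ : CForm (Fin m → ℂ) 2) : Prop :=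
  ∀ l ∈ L, ∀ l' ∈ L, ∃ k : ℤ, ξ ![l, l'] = k

/-- `g` is a flat Kähler metric of volume `ε` on the torus. -/
def IsFlatKahlerTorus (L : AddSubgroup (Fin m → ℂ)) (ε : ℝ)
    (g : (Fin m → ℂ) → Bilin (Fin m → ℂ)) : Prop :=
  IsKahlerMetric Set.univ g ∧ IsPeriodic L g ∧ HasConstCurvature Set.univ g 0 ∧ HasVolume L g ε

end Tori

/-! ## Families of tori

The total space is `X = (U × ℂ^m) / Λ` over an open set `U ⊆ ℂ^n`, with `Λ` a lattice bundle and the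
zero section as reference section.  The space `Fin n ⊕ Fin m → ℂ` contains the covering `U × ℂ^m` of
`X`; its coordinates are `z^j = x (inl j)` and `w^k = x (inr k)`.  Tensors on `X` are tensors on
`U × ℂ^m` invariant under translation by the local holomorphic sections of `Λ`. -/

section Families

variable {n m : ℕ}

/-- The point, or tangent vector, `x = (z, w)` is mapped to `z`. -/
def basePart (x : Fin n ⊕ Fin m → ℂ) : Fin n → ℂ := fun j => x (Sum.inl j)

/-- The point, or tangent vector, `x = (z, w)` is mapped to `w`. -/
def fibPart (x : Fin n ⊕ Fin m → ℂ) : Fin m → ℂ := fun k => x (Sum.inr k)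

/-- The inclusion of the fibre direction, `w ↦ (0, w)`. -/
def vert (n m : ℕ) : (Fin m → ℂ) →L[ℝ] (Fin n ⊕ Fin m → ℂ) :=
  ContinuousLinearMap.pi (Sum.elim (fun _ => 0) (fun k => dcoord k))

/-- The subset `U × ℂ^m`. -/
def totalSet (m : ℕ) (U : Set (Fin n → ℂ)) : Set (Fin n ⊕ Fin m → ℂ) := {x | basePart x ∈ U}

/-- The columns of `T` are a holomorphic frame of `Λ` on the open set `W`. -/
def IsFrame (Λ : (Fin n → ℂ) → AddSubgroup (Fin m → ℂ)) (W : Set (Fin n → ℂ))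
    (T : (Fin n → ℂ) → Matrix (Fin m) (Fin m ⊕ Fin m) ℂ) : Prop :=
  IsOpen W ∧ (∀ j a, DifferentiableOn ℂ (fun z => T z j a) W) ∧
    ∀ z ∈ W, IsLatticeBasis (Λ z) (fun a j => T z j a)

/-- `Λ` is a holomorphic lattice bundle over the open set `U`: it has holomorphic frames locally,
but in general no global one (the generators are multi-valued on `U`). -/
def IsLatticeBundle (U : Set (Fin n → ℂ)) (Λ : (Fin n → ℂ) → AddSubgroup (Fin m → ℂ)) : Prop :=
  IsOpen U ∧ ∀ z ∈ U, ∃ W T, z ∈ W ∧ W ⊆ U ∧ IsFrame Λ W T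

/-- The translation `(z, w) ↦ (z, w + s z)`. -/
def fibTranslate (s : (Fin n → ℂ) → Fin m → ℂ) (x : Fin n ⊕ Fin m → ℂ) : Fin n ⊕ Fin m → ℂ :=
  Sum.elim (basePart x) (fibPart x + s (basePart x))

/-- The form `α` on `U × ℂ^m` descends to `X`: it is invariant under pullback by the translations
given by local holomorphic sections of `Λ`. -/
def Descends {p : ℕ} (U : Set (Fin n → ℂ)) (Λ : (Fin n → ℂ) → AddSubgroup (Fin m → ℂ))
    (α : (Fin n ⊕ Fin m → ℂ) → CForm (Fin n ⊕ Fin m → ℂ) p) : Prop :=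
  ∀ (W : Set (Fin n → ℂ)) (s : (Fin n → ℂ) → Fin m → ℂ), IsOpen W → W ⊆ U →
    DifferentiableOn ℂ s W → (∀ z ∈ W, s z ∈ Λ z) → ∀ x ∈ totalSet m W,
      (α (fibTranslate s x)).compContinuousLinearMap (fderiv ℝ (fibTranslate s) x) = α x

/-- The restriction of a form to the fibre over `z`. -/
def restrictFib {p : ℕ} (α : (Fin n ⊕ Fin m → ℂ) → CForm (Fin n ⊕ Fin m → ℂ) p) (z : Fin n → ℂ)
    (w : Fin m → ℂ) : CForm (Fin m → ℂ) p :=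
  (α (Sum.elim z w)).compContinuousLinearMap (vert n m)

/-- `ω` is a constant polarization: a real `2`-form on `X` that restricts to a Kähler form on
every fibre, such that for some real constants `c i` the class of the restriction to each fibre is
`∑ i, c i ξ_i` with integral classes `ξ_i`. -/
def IsConstPolarization (U : Set (Fin n → ℂ)) (Λ : (Fin n → ℂ) → AddSubgroup (Fin m → ℂ))
    (ω : (Fin n ⊕ Fin m → ℂ) → CForm (Fin n ⊕ Fin m → ℂ) 2) : Prop :=
  IsRealTwoForm (totalSet m U) ω ∧ Descends U Λ ω ∧
    (∀ z ∈ U, IsKahlerForm Set.univ (restrictFib ω z)) ∧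
    ∃ (N : ℕ) (c : Fin N → ℝ), ∀ z ∈ U, ∃ ξ : Fin N → CForm (Fin m → ℂ) 2,
      (∀ i, IsIntegralClass (Λ z) (ξ i)) ∧
      Cohomologous (Λ z) (restrictFib ω z) (fun _ => ∑ i, (c i : ℂ) • ξ i)

/-- The tangent vector `u` at `x = (z, w)` is horizontal for the flat connection defined by `Λ`:
it is tangent at `x` to a local section `∑ a, c a • τ_a`, where the `τ_a` generate `Λ` and the
`c a` are real constants. -/
def IsHorizontal (U : Set (Fin n → ℂ)) (Λ : (Fin n → ℂ) → AddSubgroup (Fin m → ℂ))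
    (x u : Fin n ⊕ Fin m → ℂ) : Prop :=
  ∃ W T, basePart x ∈ W ∧ W ⊆ U ∧ IsFrame Λ W T ∧ ∃ c : Fin m ⊕ Fin m → ℝ,
    (∀ j, fibPart x j = ∑ a, (c a : ℂ) * T (basePart x) j a) ∧
    ∀ j, fibPart u j = ∑ a, (c a : ℂ) * fderiv ℂ (fun z => T z j a) (basePart x) (basePart u)

/-- The family of flat Kähler metrics of volume `ε` on the fibres `X_z`. -/
def IsFlatFibreMetric (U : Set (Fin n → ℂ)) (Λ : (Fin n → ℂ) → AddSubgroup (Fin m → ℂ)) (ε : ℝ)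
    (gF : (Fin n → ℂ) → (Fin m → ℂ) → Bilin (Fin m → ℂ)) : Prop :=
  ∀ z ∈ U, IsFlatKahlerTorus (Λ z) ε (gF z)

/-- The Kähler class of the fibre metric is a scalar multiple of the polarization. -/
def HasPolarizedClass (U : Set (Fin n → ℂ)) (Λ : (Fin n → ℂ) → AddSubgroup (Fin m → ℂ))
    (ω : (Fin n ⊕ Fin m → ℂ) → CForm (Fin n ⊕ Fin m → ℂ) 2)
    (gF : (Fin n → ℂ) → (Fin m → ℂ) → Bilin (Fin m → ℂ)) : Prop :=
  ∀ z ∈ U, ∃ c : ℝ, Cohomologous (Λ z) (fun w => kahlerForm (gF z w))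
    (fun w => (c : ℂ) • restrictFib ω z w)

/-- The base metric in the hyperkähler setting: a hermitian metric such that the pairing between
`E` (the vertical vectors along the zero section) and `T^{1,0}S` defined by `Υ` is isometric, i.e.
the norm of a base vector is the dual norm of the functional on `E` that it defines through `Υ`. -/
def IsBaseMetricHK (U : Set (Fin n → ℂ)) (Υ : (Fin n ⊕ Fin m → ℂ) → CForm (Fin n ⊕ Fin m → ℂ) 2)
    (gF : (Fin n → ℂ) → (Fin m → ℂ) → Bilin (Fin m → ℂ))
    (gS : (Fin n → ℂ) → Bilin (Fin n → ℂ)) : Prop :=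
  ∀ z ∈ U, IsHermInner (gS z) ∧ ∀ u : Fin n ⊕ Fin m → ℂ,
    IsLUB {r : ℝ | ∃ v : Fin m → ℂ, (hermOf (gF z 0) v v).re ≤ 1 ∧
        r = ‖Υ (Sum.elim z 0) ![u, vert n m v]‖ ^ 2}
      (hermOf (gS z) (basePart u) (basePart u)).re

/-- The base metric in the Calabi-Yau setting: a hermitian metric such that the pairing between
`⋀^m E` and `T^{1,0}S` defined by `Ω` is isometric, where `⋀^m E` carries the hermitian metric
`|v_1 ∧ ⋯ ∧ v_m|² = det (h (v_i, v_j))`. -/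
def IsBaseMetricCY (U : Set (Fin n → ℂ))
    (Ω : (Fin n ⊕ Fin m → ℂ) → CForm (Fin n ⊕ Fin m → ℂ) (m + 1))
    (gF : (Fin n → ℂ) → (Fin m → ℂ) → Bilin (Fin m → ℂ))
    (gS : (Fin n → ℂ) → Bilin (Fin n → ℂ)) : Prop :=
  ∀ z ∈ U, IsHermInner (gS z) ∧ ∀ (u : Fin n ⊕ Fin m → ℂ) (v : Fin m → Fin m → ℂ),
    hermOf (gS z) (basePart u) (basePart u) *
        Matrix.det (Matrix.of fun i j => hermOf (gF z 0) (v i) (v j)) =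
      ((‖Ω (Sum.elim z 0) (Fin.cons u fun i => vert n m (v i))‖ ^ 2 : ℝ) : ℂ)

/-- `g` is the submersion metric on the total space built from the base metric, the fibre metrics
and the flat horizontal distribution: `g(u, v) = gS(f_* u, f_* v) + gF(P u, P v)`, where `P` is the
projection to the vertical space along the horizontal space. -/
def IsSubmersionMetric (U : Set (Fin n → ℂ)) (Λ : (Fin n → ℂ) → AddSubgroup (Fin m → ℂ))
    (gF : (Fin n → ℂ) → (Fin m → ℂ) → Bilin (Fin m → ℂ))
    (gS : (Fin n → ℂ) → Bilin (Fin n → ℂ))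
    (g : (Fin n ⊕ Fin m → ℂ) → Bilin (Fin n ⊕ Fin m → ℂ)) : Prop :=
  ∀ x ∈ totalSet m U, ∀ u v : Fin n ⊕ Fin m → ℂ, ∀ p q : Fin m → ℂ,
    IsHorizontal U Λ x (u - vert n m p) → IsHorizontal U Λ x (v - vert n m q) →
      g x u v = gS (basePart x) (basePart u) (basePart v) + gF (basePart x) (fibPart x) p q

/-- `g` is the semi-flat metric on the total space of the family, with fibre metrics `gF` and base
metric `gS`, in the hyperkähler setting. -/
def IsSemiFlatHK (U : Set (Fin n → ℂ)) (Λ : (Fin n → ℂ) → AddSubgroup (Fin m → ℂ))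
    (ω Υ : (Fin n ⊕ Fin m → ℂ) → CForm (Fin n ⊕ Fin m → ℂ) 2) (ε : ℝ)
    (gF : (Fin n → ℂ) → (Fin m → ℂ) → Bilin (Fin m → ℂ))
    (gS : (Fin n → ℂ) → Bilin (Fin n → ℂ))
    (g : (Fin n ⊕ Fin m → ℂ) → Bilin (Fin n ⊕ Fin m → ℂ)) : Prop :=
  IsFlatFibreMetric U Λ ε gF ∧ HasPolarizedClass U Λ ω gF ∧ IsBaseMetricHK U Υ gF gS ∧
    IsSubmersionMetric U Λ gF gS g

/-- `g` is the semi-flat metric on the total space of the family, with fibre metrics `gF` and base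
metric `gS`, in the Calabi-Yau setting. -/
def IsSemiFlatCY (U : Set (Fin n → ℂ)) (Λ : (Fin n → ℂ) → AddSubgroup (Fin m → ℂ))
    (ω : (Fin n ⊕ Fin m → ℂ) → CForm (Fin n ⊕ Fin m → ℂ) 2)
    (Ω : (Fin n ⊕ Fin m → ℂ) → CForm (Fin n ⊕ Fin m → ℂ) (m + 1)) (ε : ℝ)
    (gF : (Fin n → ℂ) → (Fin m → ℂ) → Bilin (Fin m → ℂ))
    (gS : (Fin n → ℂ) → Bilin (Fin n → ℂ))
    (g : (Fin n ⊕ Fin m → ℂ) → Bilin (Fin n ⊕ Fin m → ℂ)) : Prop :=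
  IsFlatFibreMetric U Λ ε gF ∧ HasPolarizedClass U Λ ω gF ∧ IsBaseMetricCY U Ω gF gS ∧
    IsSubmersionMetric U Λ gF gS g

/-! ## The explicit formulas -/

/-- The entrywise complex conjugate of a matrix. -/
def conjMat {k l : Type*} (A : Matrix k l ℂ) : Matrix k l ℂ := A.map (starRingEnd ℂ)

/-- A real matrix as a complex matrix. -/
def realMat {k l : Type*} (A : Matrix k l ℝ) : Matrix k l ℂ := A.map Complex.ofReal

/-- The matrix `H` with `H⁻¹ = i T̄ Q⁻¹ Tᵗ`. -/
def matH (Q : Matrix (Fin m ⊕ Fin m) (Fin m ⊕ Fin m) ℝ) (T : Matrix (Fin m) (Fin m ⊕ Fin m) ℂ) :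
    Matrix (Fin m) (Fin m) ℂ :=
  (Complex.I • (conjMat T * realMat Q⁻¹ * T.transpose))⁻¹

/-- `H(ε) = (ε / √(det Q))^{1/m} H`. -/
def matHeps (ε : ℝ) (Q : Matrix (Fin m ⊕ Fin m) (Fin m ⊕ Fin m) ℝ)
    (T : Matrix (Fin m) (Fin m ⊕ Fin m) ℂ) : Matrix (Fin m) (Fin m) ℂ :=
  (((ε / Real.sqrt Q.det) ^ (1 / (m : ℝ)) : ℝ) : ℂ) • matH Q T

/-- The translation invariant form `i ∑ j k, H_{jk} dw^j ∧ dw̄^k`. -/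
def hermForm {ι : Type*} [Fintype ι] (H : Matrix ι ι ℂ) : CForm (ι → ℂ) 2 :=
  ∑ j, ∑ k, (Complex.I * H j k) • wedgeOne ![dcoord j, conjOne (dcoord k)]

/-- The Christoffel symbols `Γ_p(z, w) = ∂T/∂z^p (T; T̄)⁻¹ (w; w̄)`. -/
def christoffel (T : (Fin n → ℂ) → Matrix (Fin m) (Fin m ⊕ Fin m) ℂ) (p : Fin n)
    (x : Fin n ⊕ Fin m → ℂ) : Fin m → ℂ :=
  (Matrix.of fun j a => fderiv ℂ (fun z => T z j a) (basePart x) (Pi.single p 1)).mulVec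
    ((Matrix.fromRows (T (basePart x)) (conjMat (T (basePart x))))⁻¹.mulVec
      (Sum.elim (fibPart x) (fun k => starRingEnd ℂ (fibPart x k))))

/-- The `1`-form `dz^j` on the total space. -/
def dz (j : Fin n) : (Fin n ⊕ Fin m → ℂ) →L[ℝ] ℂ := dcoord (Sum.inl j)

/-- The `1`-form `dw^k` on the total space. -/
def dw (k : Fin m) : (Fin n ⊕ Fin m → ℂ) →L[ℝ] ℂ := dcoord (Sum.inr k)

/-- The `1`-form `dw^k - ∑ p, Γ^k_p dz^p` at the point `x`. -/
def thetaForm (T : (Fin n → ℂ) → Matrix (Fin m) (Fin m ⊕ Fin m) ℂ) (x : Fin n ⊕ Fin m → ℂ)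
    (k : Fin m) : (Fin n ⊕ Fin m → ℂ) →L[ℝ] ℂ :=
  dw k - ∑ p, christoffel T p x k • dz p

/-- The vertical part `i ∑ j k, H_{jk} θ^j ∧ θ̄^k` with `θ^j = dw^j - ∑ p, Γ^j_p dz^p`. -/
def vertForm (H : Matrix (Fin m) (Fin m) ℂ)
    (T : (Fin n → ℂ) → Matrix (Fin m) (Fin m ⊕ Fin m) ℂ) (x : Fin n ⊕ Fin m → ℂ) :
    CForm (Fin n ⊕ Fin m → ℂ) 2 :=
  ∑ j, ∑ k, (Complex.I * H j k) • wedgeOne ![thetaForm T x j, conjOne (thetaForm T x k)]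

/-- `Q` is the constant matrix of the polarization in the frame `T`: the class of `ω` on the fibre
over `z` is represented by `1/2 ∑ Q_{ab} ξ^a ∧ ξ^b`, with `ξ^a` dual to the columns `τ_a` of `T z`,
i.e. by the invariant form with values `Q_{ab}` on `(τ_a, τ_b)`. -/
def IsPolarizationMatrix (Λ : (Fin n → ℂ) → AddSubgroup (Fin m → ℂ))
    (ω : (Fin n ⊕ Fin m → ℂ) → CForm (Fin n ⊕ Fin m → ℂ) 2) (W : Set (Fin n → ℂ))
    (T : (Fin n → ℂ) → Matrix (Fin m) (Fin m ⊕ Fin m) ℂ)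
    (Q : Matrix (Fin m ⊕ Fin m) (Fin m ⊕ Fin m) ℝ) : Prop :=
  Q.transpose = -Q ∧ ∀ z ∈ W, ∃ η : CForm (Fin m → ℂ) 2,
    (∀ a b, η ![fun j => T z j a, fun j => T z j b] = (Q a b : ℂ)) ∧
    Cohomologous (Λ z) (restrictFib ω z) (fun _ => η)

end Families

/-! ## The Siegel upper half space

A symmetric `m × m` matrix is a function on unordered pairs of indices, so that the space of
symmetric matrices is `Sym2 (Fin m) → ℂ`, with the entries as holomorphic coordinates. -/

section Siegel

variable {m : ℕ}

/-- The symmetric matrix with entries `x`. -/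
def symMat (x : Sym2 (Fin m) → ℂ) : Matrix (Fin m) (Fin m) ℂ := Matrix.of fun a b => x s(a, b)

/-- The entrywise imaginary part. -/
def imMat (Z : Matrix (Fin m) (Fin m) ℂ) : Matrix (Fin m) (Fin m) ℝ := Z.map Complex.im

/-- The Siegel upper half space: `Zᵗ = Z` and `Im Z > 0`. -/
def siegelSpace (m : ℕ) : Set (Sym2 (Fin m) → ℂ) := {x | (imMat (symMat x)).PosDef}

/-- `(i/4) ∑ Y^{ab} Y^{cd} ζ_{bc} ∧ ζ̄_{da}`, where `Y^{ab}` are the entries of `(Im Z)⁻¹` and `ζ` is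
a symmetric matrix of `1`-forms. -/
def siegelWith {V : Type*} [NormedAddCommGroup V] [NormedSpace ℝ V] (x : Sym2 (Fin m) → ℂ)
    (ζ : Sym2 (Fin m) → V →L[ℝ] ℂ) : CForm V 2 :=
  ∑ a, ∑ b, ∑ c, ∑ d,
    (Complex.I / 4 * (((imMat (symMat x))⁻¹ a b : ℝ) : ℂ) *
      (((imMat (symMat x))⁻¹ c d : ℝ) : ℂ)) •
      wedgeOne ![ζ s(b, c), conjOne (ζ s(d, a))]

/-- The form `(i/4) ∑ Y^{ab} dZ_{bc} ∧ Y^{cd} dZ̄_{da}` on the Siegel upper half space. -/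
def siegelForm (x : Sym2 (Fin m) → ℂ) : CForm (Sym2 (Fin m) → ℂ) 2 := siegelWith x dcoord

/-- The fractional linear action `(AZ + B)(CZ + D)⁻¹` of a block matrix. -/
def mobius (M : Matrix (Fin m ⊕ Fin m) (Fin m ⊕ Fin m) ℝ) (Z : Matrix (Fin m) (Fin m) ℂ) :
    Matrix (Fin m) (Fin m) ℂ :=
  (realMat M.toBlocks₁₁ * Z + realMat M.toBlocks₁₂) *
    (realMat M.toBlocks₂₁ * Z + realMat M.toBlocks₂₂)⁻¹

/-- The `2`-form `α` on the Siegel upper half space is invariant under `Sp(2m, ℝ)`. -/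
def IsSpInvariant (α : (Sym2 (Fin m) → ℂ) → CForm (Sym2 (Fin m) → ℂ) 2) : Prop :=
  ∀ M ∈ Matrix.symplecticGroup (Fin m) ℝ, ∃ φ : (Sym2 (Fin m) → ℂ) → Sym2 (Fin m) → ℂ,
    DifferentiableOn ℂ φ (siegelSpace m) ∧ Set.MapsTo φ (siegelSpace m) (siegelSpace m) ∧
    ∀ x ∈ siegelSpace m, symMat (φ x) = mobius M (symMat x) ∧
      (α (φ x)).compContinuousLinearMap (fderiv ℝ φ x) = α x

/-- `Z` is the period map on `W` associated with the frame `T` and the symplectic basis change `S`: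
`T S = R (1, Z)` with `R` holomorphic and invertible and `Z` holomorphic with values in the Siegel
upper half space. -/
def IsPeriodMap {n : ℕ} (W : Set (Fin n → ℂ))
    (T : (Fin n → ℂ) → Matrix (Fin m) (Fin m ⊕ Fin m) ℂ)
    (S : Matrix (Fin m ⊕ Fin m) (Fin m ⊕ Fin m) ℝ)
    (R : (Fin n → ℂ) → Matrix (Fin m) (Fin m) ℂ) (Z : (Fin n → ℂ) → Sym2 (Fin m) → ℂ) : Prop :=
  (∀ j k, DifferentiableOn ℂ (fun z => R z j k) W) ∧ DifferentiableOn ℂ Z W ∧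
    ∀ z ∈ W, IsUnit (R z) ∧ Z z ∈ siegelSpace m ∧
      T z * realMat S = R z * Matrix.fromCols 1 (symMat (Z z))

/-- The hyperbolic metric `|dτ|² / (2 (Im τ)²)` on the upper half plane. -/
def hyperbolicMetric (x : Fin 1 → ℂ) : Bilin (Fin 1 → ℂ) :=
  (1 / (2 * (x 0).im ^ 2)) • LinearMap.toContinuousBilinearMap
    (LinearMap.mk₂ ℝ (fun u v : Fin 1 → ℂ => (u 0 * starRingEnd ℂ (v 0)).re)
      (by intros; simp; ring) (by intros; simp; ring)
      (by intros; simp; ring) (by intros; simp; ring))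

/-- The upper half plane in `Fin 1 → ℂ`. -/
def upperHalf : Set (Fin 1 → ℂ) := {x | 0 < (x 0).im}

end Siegel

/-- The frame `(τ₁, τ₂)` of a lattice bundle of rank two. -/
def frameTwo (τ₁ τ₂ : (Fin 1 → ℂ) → ℂ) (z : Fin 1 → ℂ) : Matrix (Fin 1) (Fin 1 ⊕ Fin 1) ℂ :=
  Matrix.of fun _ => Sum.elim (fun _ => τ₁ z) (fun _ => τ₂ z)

end

noncomputable section

/-! ### Evaluation of 1-forms, 2-forms and fundamental forms -/

section FormEvaluation

variable {V : Type*} [NormedAddCommGroup V] [NormedSpace ℝ V]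

/-! In real fibre coordinates the vertical geometry is constant. Over a frame write w = ∑ x^a
τ_a(z). Differentiating gives dw - ∑ Γ_p dz^p = ∑ τ_a dx^a, so the forms θ = dw - ∑ Γ_p dz^p are the
projection along the horizontal distribution, and an invariant fibre form with matrix Q on the τ_a
extends to ½ ∑ Q_ab dx^a ∧ dx^b on the total space. This form is closed once Q does not depend on z
(`FlatSubmersion.isKahlerMetric`). Translation by a lattice section only adds integers to the x^a,
so the construction descends to X.

The constant Q comes from the polarization. The average of ω over a fibre is the unique invariant
representative of its class, and it inherits reality, type (1,1) and positivity from ω. Its values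
on (τ_a, τ_b) are continuous in z and lie in the countable set of integral combinations of the c_i,
so they are constant on connected W (`IsConstPolarization.exists_class`). The flat metrics on the
fibres are themselves invariant: the Levi-Civita connection of a flat Kähler metric on a torus is
holomorphic, hence constant by Liouville, and a maximum argument shows that it vanishes
(`isPeriodic_flatKahler_const`). The fibre metric is therefore a positive multiple of the averaged
form, and the volume fixes the factor.

Inverting the relation between Q and H gives H⁻¹ = i T̄ Q⁻¹ Tᵗ together with the Riemann relation T
Q⁻¹ Tᵗ = 0 (`matH_relations`). In the hyperkähler setting the first formula makes ω_S a constant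
combination of products of the real and imaginary parts of α_a = g ∑ T_ja dz^j. These forms are
closed because Υ is closed and invariant under translation by τ_a (`baseMetric_isKahlerMetric`). In
the Calabi-Yau setting the base is a real surface and closedness is automatic.

The volume identities are pointwise. If e = Aθ is a unitary vertical coframe, then f = g A⁻ᵗ dz is a
unitary base coframe and Υ = ∑ f_l ∧ e_l. The 2-forms f∧f̄, e∧ē, f∧e, f̄∧ē commute and have square
zero, so both sides are multiples of one product (`wedgePow_quaternionic`). In the same coframe the
endomorphism J defined by G(Ju, v) = 2 Re Υ(u, v) is (f, e) ↦ (-ē, f̄), a complex structure; the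
fundamental forms of J and IJ are 2 Re Υ and 2 Im Υ. In the Calabi-Yau setting f = (g / det A) dz, Ω
is the product of the coframe, and the metric on X has determinant |g|², whence Ricci-flatness.

For the base Ricci form write T S = R (1, Z) in a symplectic basis. Then H⁻¹ = 2 R̄ (Im Z) Rᵗ, so
the determinant of the base metric is a constant times |h|² det Im Z with h holomorphic and nowhere
zero, and ∂∂̄ log |h|² = 0. What remains is the Hessian of log det Im Z, the Siegel form. That form
has the primitive ½ tr(Y⁻¹ dZ̄), is positive because it is a Frobenius norm, and is symplectically
invariant because a Möbius map with N = CZ + D has differential N⁻ᵗ dZ N⁻¹ and changes Im Z to N̄⁻ᵗ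
(Im Z) N⁻¹.

For elliptic fibres the area alone determines the flat metric, so no polarization enters; the
coefficient of Ω is constant along the fibres by Liouville. -/

theorem wedgeOne_apply {p : ℕ} (θ : Fin p → V →L[ℝ] ℂ) (v : Fin p → V) :
    wedgeOne θ v = Matrix.det (Matrix.of fun i j => θ i (v j)) := by
  rw [← Matrix.det_transpose, Matrix.det_apply]
  simp only [wedgeOne, ContinuousMultilinearMap.alternatization_apply_apply]
  refine Finset.sum_congr rfl fun σ _ => ?_
  rfl

@[simp]
theorem wedgeOne_two (a b : V →L[ℝ] ℂ) (u v : V) :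
    wedgeOne ![a, b] ![u, v] = a u * b v - a v * b u := by
  rw [wedgeOne_apply, Matrix.det_fin_two]
  simp

theorem CForm.ext_two {α β : CForm V 2} (h : ∀ u v, α ![u, v] = β ![u, v]) : α = β := by
  ext v
  have : v = ![v 0, v 1] := by ext i; fin_cases i <;> rfl
  rw [this]; exact h _ _

theorem CForm.two_swap (α : CForm V 2) (u v : V) : α ![v, u] = -α ![u, v] := by
  have := α.toAlternatingMap.map_swap ![u, v] (i := 0) (j := 1) (by decide)
  have e : (![u, v] ∘ ⇑(Equiv.swap (0 : Fin 2) 1)) = ![v, u] := by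
    ext i; fin_cases i <;> simp
  rw [e] at this
  exact this

theorem CForm.two_add_left (α : CForm V 2) (u u' v : V) :
    α ![u + u', v] = α ![u, v] + α ![u', v] := by
  have h := α.toAlternatingMap.map_update_add ![u, v] 0 u u'
  have e0 : Function.update ![u, v] 0 (u + u') = ![u + u', v] := by
    ext i; fin_cases i <;> simp
  have e1 : Function.update ![u, v] 0 u = ![u, v] := by
    ext i; fin_cases i <;> simp
  have e2 : Function.update ![u, v] 0 u' = ![u', v] := by
    ext i; fin_cases i <;> simp
  rw [e0, e1, e2] at h
  exact h

theorem CForm.two_smul_left (α : CForm V 2) (c : ℝ) (u v : V) :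
    α ![c • u, v] = c • α ![u, v] := by
  have h := α.toAlternatingMap.map_update_smul ![u, v] 0 c u
  have e0 : Function.update ![u, v] 0 (c • u) = ![c • u, v] := by
    ext i; fin_cases i <;> simp
  have e1 : Function.update ![u, v] 0 u = ![u, v] := by
    ext i; fin_cases i <;> simp
  rw [e0, e1] at h
  exact h

theorem CForm.two_add_right (α : CForm V 2) (u v v' : V) :
    α ![u, v + v'] = α ![u, v] + α ![u, v'] := by
  have h := α.toAlternatingMap.map_update_add ![u, v] 1 v v'
  have e0 : Function.update ![u, v] 1 (v + v') = ![u, v + v'] := by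
    ext i; fin_cases i <;> simp
  have e1 : Function.update ![u, v] 1 v = ![u, v] := by
    ext i; fin_cases i <;> simp
  have e2 : Function.update ![u, v] 1 v' = ![u, v'] := by
    ext i; fin_cases i <;> simp
  rw [e0, e1, e2] at h
  exact h

theorem CForm.two_smul_right (α : CForm V 2) (c : ℝ) (u v : V) :
    α ![u, c • v] = c • α ![u, v] := by
  have h := α.toAlternatingMap.map_update_smul ![u, v] 1 c v
  have e0 : Function.update ![u, v] 1 (c • v) = ![u, c • v] := by
    ext i; fin_cases i <;> simp
  have e1 : Function.update ![u, v] 1 v = ![u, v] := by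
    ext i; fin_cases i <;> simp
  rw [e0, e1] at h
  exact h

theorem compContinuousLinearMap_two {V' : Type*} [NormedAddCommGroup V'] [NormedSpace ℝ V']
    (α : CForm V 2) (f : V' →L[ℝ] V) (u v : V') :
    α.compContinuousLinearMap f ![u, v] = α ![f u, f v] := by
  rw [ContinuousAlternatingMap.compContinuousLinearMap_apply]
  congr 1; ext i; fin_cases i <;> rfl

theorem fundForm_apply (g : Bilin V) (A : V →L[ℝ] V) (u v : V) :
    fundForm g A ![u, v] = (((g (A u) v - g (A v) u) / 2 : ℝ) : ℂ) := by
  have h : (Finset.univ : Finset (Equiv.Perm (Fin 2))) = {1, Equiv.swap 0 1} := by decide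
  simp only [fundForm, ContinuousLinearMap.compContinuousAlternatingMap_coe, Function.comp_apply,
    ContinuousAlternatingMap.smul_apply, ContinuousMultilinearMap.alternatization_apply_apply, h]
  rw [Finset.sum_pair (by decide)]
  simp [ContinuousLinearMap.uncurryBilinear, Fin.tail]
  ring

/-- Invariance under i makes (u, v) ↦ g(iu, v) skew already, so the antisymmetrization in `fundForm`
changes nothing. -/
theorem kahlerForm_apply {ι : Type*} [Fintype ι] {g : Bilin (ι → ℂ)} (hg : IsHermInner g)
    (u v : ι → ℂ) : kahlerForm g ![u, v] = (g (Complex.I • u) v : ℂ) := by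
  have h : g (Complex.I • v) u = - g (Complex.I • u) v := by
    rw [hg.1, ← hg.2.1, smul_smul, Complex.I_mul_I]; simp
  rw [kahlerForm, fundForm_apply]
  have e : ∀ u : ι → ℂ, cpx ι u = Complex.I • u := fun _ => rfl
  rw [e, e, h]; push_cast; ring

end FormEvaluation

/-! ### Exterior derivatives in low degree -/

section ExteriorDerivative

variable {V : Type*} [NormedAddCommGroup V] [NormedSpace ℝ V]

theorem fderiv_cform_apply {p : ℕ} {α : V → CForm V p} {x : V} (h : DifferentiableAt ℝ α x)
    (v : Fin p → V) (u : V) : fderiv ℝ (fun y => α y v) x u = fderiv ℝ α x u v :=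
  congrArg (fun f => f u) (fderiv_continuousAlternatingMap_apply_const h v)

theorem extDeriv_two_apply {α : V → CForm V 2} {x : V} (h : DifferentiableAt ℝ α x) (u v w : V) :
    extDeriv α x ![u, v, w] = fderiv ℝ (fun y => α y ![v, w]) x u -
      fderiv ℝ (fun y => α y ![u, w]) x v + fderiv ℝ (fun y => α y ![u, v]) x w := by
  rw [extDeriv_apply h]
  have e0 : (0 : Fin 3).removeNth ![u, v, w] = ![v, w] := by ext i; fin_cases i <;> rfl
  have e1 : (1 : Fin 3).removeNth ![u, v, w] = ![u, w] := by ext i; fin_cases i <;> rfl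
  have e2 : (2 : Fin 3).removeNth ![u, v, w] = ![u, v] := by ext i; fin_cases i <;> rfl
  rw [Fin.sum_univ_three, e0, e1, e2]
  simp
  ring

theorem extDeriv_one_apply {α : V → CForm V 1} {x : V} (h : DifferentiableAt ℝ α x) (u v : V) :
    extDeriv α x ![u, v] = fderiv ℝ (fun y => α y ![v]) x u - fderiv ℝ (fun y => α y ![u]) x v := by
  rw [extDeriv_apply h]
  have e0 : (0 : Fin 2).removeNth ![u, v] = ![v] := by ext i; fin_cases i; rfl
  have e1 : (1 : Fin 2).removeNth ![u, v] = ![u] := by ext i; fin_cases i; rfl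
  rw [Fin.sum_univ_two, e0, e1]
  simp
  ring

/-- Only constant vector fields are inserted, so Cartan's formula has no bracket terms and
closedness becomes the vanishing of a cyclic sum. -/
theorem extDeriv_two_eq_zero_iff {α : V → CForm V 2} {x : V} (h : DifferentiableAt ℝ α x) :
    extDeriv α x = 0 ↔ ∀ u v w, fderiv ℝ (fun y => α y ![v, w]) x u +
      fderiv ℝ (fun y => α y ![w, u]) x v + fderiv ℝ (fun y => α y ![u, v]) x w = 0 := by
  have key : ∀ u v w, extDeriv α x ![u, v, w] = fderiv ℝ (fun y => α y ![v, w]) x u +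
      fderiv ℝ (fun y => α y ![w, u]) x v + fderiv ℝ (fun y => α y ![u, v]) x w := by
    intro u v w
    rw [extDeriv_two_apply h, fderiv_cform_apply h ![u, w], fderiv_cform_apply h ![w, u],
      CForm.two_swap _ u w]
    ring
  constructor
  · intro h0 u v w
    rw [← key, h0]; rfl
  · intro h0
    ext v
    have : v = ![v 0, v 1, v 2] := by ext i; fin_cases i <;> rfl
    rw [this, key, h0]; rfl

end ExteriorDerivative

/-! ### Smoothness and closedness of metrics through their components -/

section Smoothness

variable {V : Type*} [NormedAddCommGroup V] [NormedSpace ℝ V]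

/-- The fundamental form as a linear map of the metric. -/
def fundFormLin (A : V →L[ℝ] V) : Bilin V →ₗ[ℝ] CForm V 2 where
  toFun g := fundForm g A
  map_add' g g' := CForm.ext_two fun u v => by
    simp only [ContinuousAlternatingMap.add_apply, fundForm_apply, add_apply]
    push_cast; ring
  map_smul' c g := CForm.ext_two fun u v => by
    simp only [ContinuousAlternatingMap.smul_apply, fundForm_apply, smul_apply,
      RingHom.id_apply, smul_eq_mul, Complex.real_smul]
    push_cast; ring

variable {ι : Type*} [Fintype ι]

/-- The Kähler form as a continuous linear map of the metric. -/
def kahlerFormCLM (ι : Type*) [Fintype ι] : Bilin (ι → ℂ) →L[ℝ] CForm (ι → ℂ) 2 :=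
  ⟨fundFormLin (cpx ι), by
    have h := @LinearMap.continuous_of_finiteDimensional ℝ _ (Bilin (ι → ℂ)) _ _ _ _ _
      (CForm (ι → ℂ) 2) _ _ _ _ _ _ inferInstance _ (fundFormLin (cpx ι))
    exact h⟩

theorem kahlerForm_contDiff {n : WithTop ℕ∞} :
    ContDiff ℝ n (kahlerForm : Bilin (ι → ℂ) → CForm (ι → ℂ) 2) := by
  have h := ContinuousLinearMap.contDiff (𝕜 := ℝ) (E := Bilin (ι → ℂ)) (F := CForm (ι → ℂ) 2)
    (n := n) (kahlerFormCLM ι)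
  exact h

theorem kahlerForm_differentiableAt {E : Type*} [NormedAddCommGroup E] [NormedSpace ℝ E]
    {g : E → Bilin (ι → ℂ)} {x : E} (h : DifferentiableAt ℝ g x) :
    DifferentiableAt ℝ (fun y => kahlerForm (g y)) x :=
  DifferentiableAt.comp (g := (kahlerForm : Bilin (ι → ℂ) → CForm (ι → ℂ) 2)) x
    ((kahlerForm_contDiff (ι := ι) (n := 1)).differentiable one_ne_zero (g x)) h

theorem contDiffOn_bilin_iff {E : Type*} [NormedAddCommGroup E] [NormedSpace ℝ E]
    [FiniteDimensional ℝ V] {g : E → Bilin V} {W : Set E} {n : WithTop ℕ∞} :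
    ContDiffOn ℝ n g W ↔ ∀ u v, ContDiffOn ℝ n (fun x => g x u v) W := by
  rw [contDiffOn_clm_apply]
  exact forall_congr' fun u => contDiffOn_clm_apply

theorem fderiv_bilin_apply {g : V → Bilin V} {x : V} (h : DifferentiableAt ℝ g x) (u v w : V) :
    fderiv ℝ (fun y => g y v w) x u = fderiv ℝ g x u v w := by
  rw [fderiv_clm_apply (by fun_prop) (by fun_prop), fderiv_clm_apply (by fun_prop) (by fun_prop)]
  simp

/-- The identity ω(u, v) = g(iu, v) is differentiated here, so it has to hold near `x` and not only
at `x`. -/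
theorem extDeriv_kahlerForm_eq_zero_iff {g : (ι → ℂ) → Bilin (ι → ℂ)} {x : ι → ℂ}
    (h : DifferentiableAt ℝ g x) (hg : ∀ᶠ y in nhds x, IsHermInner (g y)) :
    extDeriv (fun y => kahlerForm (g y)) x = 0 ↔ ∀ u v w,
      fderiv ℝ (fun y => g y (Complex.I • v) w) x u +
      fderiv ℝ (fun y => g y (Complex.I • w) u) x v +
      fderiv ℝ (fun y => g y (Complex.I • u) v) x w = 0 := by
  have hd : DifferentiableAt ℝ (fun y => kahlerForm (g y)) x :=
    kahlerForm_differentiableAt h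
  rw [extDeriv_two_eq_zero_iff hd]
  have key : ∀ u v w, fderiv ℝ (fun y => kahlerForm (g y) ![v, w]) x u =
      ((fderiv ℝ (fun y => g y (Complex.I • v) w) x u : ℝ) : ℂ) := by
    intro u v w
    have e : (fun y => kahlerForm (g y) ![v, w]) =ᶠ[nhds x]
        fun y => ((g y (Complex.I • v) w : ℝ) : ℂ) := by
      filter_upwards [hg] with y hy using kahlerForm_apply hy v w
    rw [e.fderiv_eq]
    have h1 : DifferentiableAt ℝ (fun y => g y (Complex.I • v) w) x := by fun_prop
    exact congrArg (fun f => f u)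
      (HasFDerivAt.comp (g := Complex.ofRealCLM) x Complex.ofRealCLM.hasFDerivAt
        h1.hasFDerivAt).fderiv
  refine forall_congr' fun u => forall_congr' fun v => forall_congr' fun w => ?_
  rw [key, key, key]
  norm_cast

end Smoothness

end

noncomputable section

/-! ### Wedge products as products in the exterior algebra -/

section WedgePower

variable {V : Type*} [NormedAddCommGroup V] [NormedSpace ℝ V]

theorem wedge_add_left {p q : ℕ} (α α' : V [⋀^Fin p]→ₗ[ℝ] ℂ) (β : V [⋀^Fin q]→ₗ[ℝ] ℂ) :
    wedge (α + α') β = wedge α β + wedge α' β := by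
  simp only [wedge, ← AlternatingMap.domCoprod'_apply, TensorProduct.add_tmul, map_add]
  ext v; simp

theorem wedge_add_right {p q : ℕ} (α : V [⋀^Fin p]→ₗ[ℝ] ℂ) (β β' : V [⋀^Fin q]→ₗ[ℝ] ℂ) :
    wedge α (β + β') = wedge α β + wedge α β' := by
  simp only [wedge, ← AlternatingMap.domCoprod'_apply, TensorProduct.tmul_add, map_add]
  ext v; simp

theorem wedge_smul_left {p q : ℕ} (c : ℂ) (α : V [⋀^Fin p]→ₗ[ℝ] ℂ) (β : V [⋀^Fin q]→ₗ[ℝ] ℂ) :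
    wedge (c • α) β = c • wedge α β := by
  ext v
  simp only [wedge, AlternatingMap.domDomCongr_apply, LinearMap.compAlternatingMap_apply,
    AlternatingMap.domCoprod_apply, AlternatingMap.smul_apply, sum_apply, map_sum, smul_eq_mul,
    Finset.mul_sum]
  refine Finset.sum_congr rfl fun σ _ => ?_
  induction σ using Quotient.inductionOn' with | h σ => ?_
  rcases Int.units_eq_one_or (Equiv.Perm.sign σ) with h | h <;>
    simp [AlternatingMap.domCoprod.summand_mk'', h, mul_assoc]

theorem wedge_smul_right {p q : ℕ} (c : ℂ) (α : V [⋀^Fin p]→ₗ[ℝ] ℂ) (β : V [⋀^Fin q]→ₗ[ℝ] ℂ) :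
    wedge α (c • β) = c • wedge α β := by
  ext v
  simp only [wedge, AlternatingMap.domDomCongr_apply, LinearMap.compAlternatingMap_apply,
    AlternatingMap.domCoprod_apply, AlternatingMap.smul_apply, sum_apply, map_sum, smul_eq_mul,
    Finset.mul_sum]
  refine Finset.sum_congr rfl fun σ _ => ?_
  induction σ using Quotient.inductionOn' with | h σ => ?_
  rcases Int.units_eq_one_or (Equiv.Perm.sign σ) with h | h <;>
    simp [AlternatingMap.domCoprod.summand_mk'', h, mul_left_comm]

theorem conjForm_wedge {p q : ℕ} (α : V [⋀^Fin p]→ₗ[ℝ] ℂ) (β : V [⋀^Fin q]→ₗ[ℝ] ℂ) :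
    conjForm (wedge α β) = wedge (conjForm α) (conjForm β) := by
  ext v
  simp only [wedge, conjForm, AlternatingMap.domDomCongr_apply, LinearMap.compAlternatingMap_apply,
    AlternatingMap.domCoprod_apply, sum_apply, map_sum]
  refine Finset.sum_congr rfl fun σ _ => ?_
  induction σ using Quotient.inductionOn' with | h σ => ?_
  rcases Int.units_eq_one_or (Equiv.Perm.sign σ) with h | h <;>
    simp [AlternatingMap.domCoprod.summand_mk'', h]

theorem conjForm_wedgePow {p : ℕ} (α : V [⋀^Fin p]→ₗ[ℝ] ℂ) (k : ℕ) :
    conjForm (wedgePow α k) = wedgePow (conjForm α) k := by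
  induction k with
  | zero => ext v; simp [conjForm, wedgePow]
  | succ k ih => rw [wedgePow, wedgePow, conjForm_wedge, ih]

/-- The wedge product of `1`-forms as an alternating map of the forms. -/
def wedgeAlt (V : Type*) [NormedAddCommGroup V] [NormedSpace ℝ V] (p : ℕ) :
    (V →L[ℝ] ℂ) [⋀^Fin p]→ₗ[ℂ] (V [⋀^Fin p]→ₗ[ℝ] ℂ) where
  toFun θ := (wedgeOne θ).toAlternatingMap
  map_update_add' θ i x y := by
    ext v
    have h (z : V →L[ℝ] ℂ) : (Matrix.of fun a j => Function.update θ i z a (v j)) =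
        Matrix.updateRow (Matrix.of fun a j => θ a (v j)) i (fun j => z (v j)) := by
      ext a j
      by_cases h : a = i
      · subst h; simp
      · simp [h]
    have e : (fun j => (x + y) (v j)) = (fun j => x (v j)) + fun j => y (v j) := rfl
    convert Matrix.det_updateRow_add (Matrix.of fun a j => θ a (v j)) i
      (fun j => x (v j)) (fun j => y (v j)) using 1
    · simp only [ContinuousAlternatingMap.coe_toAlternatingMap, wedgeOne_apply]
      rw [← e, ← h (x + y)]; congr!
    · simp only [AlternatingMap.add_apply, ContinuousAlternatingMap.coe_toAlternatingMap,
        wedgeOne_apply]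
      rw [← h, ← h]; congr!
  map_update_smul' θ i c x := by
    ext v
    have h (z : V →L[ℝ] ℂ) : (Matrix.of fun a j => Function.update θ i z a (v j)) =
        Matrix.updateRow (Matrix.of fun a j => θ a (v j)) i (fun j => z (v j)) := by
      ext a j
      by_cases h : a = i
      · subst h; simp
      · simp [h]
    have e : (fun j => (c • x) (v j)) = c • (fun j => x (v j)) := rfl
    convert Matrix.det_updateRow_smul (Matrix.of fun a j => θ a (v j)) i c
      (fun j => x (v j)) using 1
    · simp only [ContinuousAlternatingMap.coe_toAlternatingMap, wedgeOne_apply]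
      rw [← e, ← h (c • x)]; congr!
    · simp only [AlternatingMap.smul_apply, ContinuousAlternatingMap.coe_toAlternatingMap,
        wedgeOne_apply]
      rw [← h]; congr!
  map_eq_zero_of_eq' θ i j h hij := by
    ext v
    simp only [ContinuousAlternatingMap.coe_toAlternatingMap, wedgeOne_apply]
    exact Matrix.det_zero_of_row_eq hij (by ext a; simp [h])

/-- The exterior algebra of complex valued `1`-forms. -/
abbrev FormAlg (V : Type*) [NormedAddCommGroup V] [NormedSpace ℝ V] : Type _ :=
  ExteriorAlgebra ℂ (V →L[ℝ] ℂ)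

/-- Elements of the exterior algebra of `1`-forms as alternating forms. -/
def toForm (V : Type*) [NormedAddCommGroup V] [NormedSpace ℝ V] (p : ℕ) :
    FormAlg V →ₗ[ℂ] (V [⋀^Fin p]→ₗ[ℝ] ℂ) :=
  -- Components of degree other than `p` are sent to zero.
  ExteriorAlgebra.liftAlternating (fun i => if h : p = i then h ▸ wedgeAlt V p else 0)

theorem toForm_ιMulti {p : ℕ} (θ : Fin p → V →L[ℝ] ℂ) :
    toForm V p (ExteriorAlgebra.ιMulti ℂ p θ) = (wedgeOne θ).toAlternatingMap := by
  rw [toForm, ExteriorAlgebra.liftAlternating_apply_ιMulti]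
  simp
  rfl

/-- The shuffle product of two alternatizations is the alternatization of the tensor product, with
no factorials, so both sides alternate the same product of 1-forms. -/
theorem wedge_wedgeOne {p q : ℕ} (θ : Fin p → V →L[ℝ] ℂ) (φ : Fin q → V →L[ℝ] ℂ) :
    wedge (wedgeOne θ).toAlternatingMap (wedgeOne φ).toAlternatingMap =
      (wedgeOne (Fin.append θ φ)).toAlternatingMap := by
  have h : ∀ {p : ℕ} (θ : Fin p → V →L[ℝ] ℂ), (wedgeOne θ).toAlternatingMap =
      MultilinearMap.alternatization ((MultilinearMap.mkPiAlgebra ℝ (Fin p) ℂ).compLinearMap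
        fun i => (θ i).toLinearMap) := by
    intro p θ
    ext v
    simp only [ContinuousAlternatingMap.coe_toAlternatingMap, wedgeOne,
      ContinuousMultilinearMap.alternatization_apply_apply, MultilinearMap.alternatization_apply]
    rfl
  rw [h, h, wedge, ← MultilinearMap.domCoprod_alternization]
  ext v
  simp only [AlternatingMap.domDomCongr_apply, LinearMap.compAlternatingMap_apply,
    MultilinearMap.alternatization_apply, ContinuousAlternatingMap.coe_toAlternatingMap, wedgeOne,
    ContinuousMultilinearMap.alternatization_apply_apply, map_sum]
  refine Fintype.sum_equiv finSumFinEquiv.permCongr _ _ fun σ => ?_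
  rcases Int.units_eq_one_or (Equiv.Perm.sign σ) with h | h <;> simp [h, Fin.prod_univ_add]

theorem ιMulti_append {p q : ℕ} (θ : Fin p → V →L[ℝ] ℂ) (φ : Fin q → V →L[ℝ] ℂ) :
    ExteriorAlgebra.ιMulti ℂ (p + q) (Fin.append θ φ) =
      ExteriorAlgebra.ιMulti ℂ p θ * ExteriorAlgebra.ιMulti ℂ q φ := by
  simp only [ExteriorAlgebra.ιMulti_apply]
  rw [← List.prod_append, ← List.ofFn_fin_append]
  congr 2
  ext i
  refine Fin.addCases (fun i => ?_) (fun i => ?_) i <;> simp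

/-- Both sides are bilinear and decomposable elements span each degree, so the decomposable case
suffices. It moves all computations with `wedge` into an associative algebra. -/
theorem wedge_toForm {p q : ℕ} {x y : FormAlg V} (hx : x ∈ ⋀[ℂ]^p (V →L[ℝ] ℂ))
    (hy : y ∈ ⋀[ℂ]^q (V →L[ℝ] ℂ)) :
    wedge (toForm V p x) (toForm V q y) = toForm V (p + q) (x * y) := by
  rw [← ExteriorAlgebra.ιMulti_span_fixedDegree] at hx hy
  induction hx using Submodule.span_induction with
  | mem x hx =>
    obtain ⟨θ, rfl⟩ := hx
    induction hy using Submodule.span_induction with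
    | mem y hy =>
      obtain ⟨φ, rfl⟩ := hy
      rw [toForm_ιMulti, toForm_ιMulti, wedge_wedgeOne, ← ιMulti_append, toForm_ιMulti]
    | zero => simpa using wedge_smul_right 0 (toForm V p (ExteriorAlgebra.ιMulti ℂ p θ)) 0
    | add y y' _ _ h h' => rw [map_add, wedge_add_right, h, h', mul_add, map_add]
    | smul c y _ h => rw [map_smul, wedge_smul_right, h, mul_smul_comm, map_smul]
  | zero => simpa using wedge_smul_left 0 0 (toForm V q y)
  | add y y' _ _ h h' => rw [map_add, wedge_add_left, h, h', add_mul, map_add]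
  | smul c y _ h => rw [map_smul, wedge_smul_left, h, smul_mul_assoc, map_smul]

theorem wedgePow_toForm {p : ℕ} {x : FormAlg V} (hx : x ∈ ⋀[ℂ]^p (V →L[ℝ] ℂ)) (k : ℕ) :
    wedgePow (toForm V p x) k = toForm V (p * k) (x ^ k) := by
  induction k with
  | zero =>
    have h := toForm_ιMulti (V := V) (p := 0) ![]
    rw [ExteriorAlgebra.ιMulti_apply, List.ofFn_zero, List.prod_nil] at h
    rw [pow_zero]
    -- The degree `p * 0` is definitionally `0`.
    change _ = toForm V 0 1
    rw [h]
    ext v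
    simp [wedgePow, wedgeOne_apply]
  | succ k ih =>
    have hk : x ^ k ∈ ⋀[ℂ]^(p * k) (V →L[ℝ] ℂ) := by
      rw [mul_comm]
      exact SetLike.pow_mem_graded k hx
    rw [wedgePow, ih, wedge_toForm hk hx, pow_succ]
    rfl

theorem ιMulti_mem (p : ℕ) (θ : Fin p → V →L[ℝ] ℂ) :
    ExteriorAlgebra.ιMulti ℂ p θ ∈ ⋀[ℂ]^p (V →L[ℝ] ℂ) :=
  ExteriorAlgebra.ιMulti_range ℂ p ⟨θ, rfl⟩

theorem toForm_domDomCongr {p q : ℕ} (h : p = q) (x : FormAlg V) :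
    (toForm V p x).domDomCongr (finCongr h) = toForm V q x := by
  subst h
  ext v; rfl

end WedgePower

/-- In the multinomial expansion only the squarefree monomial survives, with coefficient the
factorial of the number of terms; one more power leaves nothing. The second claim is what drives the
induction for the first. -/
theorem sum_pow_card_of_sq_eq_zero {R κ : Type*} [CommRing R] [DecidableEq κ] (x : κ → R) (s : Finset κ)
    (h : ∀ i ∈ s, x i ^ 2 = 0) :
    (∑ i ∈ s, x i) ^ s.card = (s.card.factorial : R) * ∏ i ∈ s, x i ∧
      (∑ i ∈ s, x i) ^ (s.card + 1) = 0 := by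
  induction s using Finset.induction_on with
  | empty => simp
  | insert a s ha ih =>
    obtain ⟨h1, h2⟩ := ih fun i hi => h i (Finset.mem_insert_of_mem hi)
    have hx := h a (Finset.mem_insert_self a s)
    -- The binomial theorem stops after the linear term in `y`.
    have key : ∀ (y S : R) (n : ℕ), y ^ 2 = 0 →
        (y + S) ^ (n + 1) = S ^ (n + 1) + (n + 1) * y * S ^ n := by
      intro y S n hy
      induction n with
      | zero => simp; ring
      | succ n ih => rw [pow_succ, ih]; push_cast; linear_combination (n + 1) * S ^ n * hy
    rw [Finset.sum_insert ha, Finset.prod_insert ha, Finset.card_insert_of_notMem ha]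
    constructor
    · rw [key _ _ _ hx, h2, h1, Nat.factorial_succ]; push_cast; ring
    · rw [key _ _ _ hx, h2, pow_succ, h2]; ring

/-- To be read with a = f∧f̄, b = e∧ē, c = f∧e, d = f̄∧ē. Both sides are multiples of ∏ a_l b_l: the
left with factor (2m)! i^(2m), the right with binomial(2m, m) (m!)² (-1)^m, one sign for each l from
`h`. -/
theorem pow_two_mul_sum_of_sq_eq_zero {R : Type*} [CommRing R] [Algebra ℂ R] {m : ℕ}
    (a b c d : Fin m → R) (ha : ∀ l, a l ^ 2 = 0) (hb : ∀ l, b l ^ 2 = 0) (hc : ∀ l, c l ^ 2 = 0)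
    (hd : ∀ l, d l ^ 2 = 0) (h : ∀ l, c l * d l = -(a l * b l)) :
    (Complex.I • ∑ l, Sum.elim a b l) ^ (2 * m) =
      ((2 * m).choose m : ℂ) • ((∑ l, c l) ^ m * (∑ l, d l) ^ m) := by
  have k1 := (sum_pow_card_of_sq_eq_zero c Finset.univ fun l _ => hc l).1
  have k2 := (sum_pow_card_of_sq_eq_zero d Finset.univ fun l _ => hd l).1
  have k3 := (sum_pow_card_of_sq_eq_zero (Sum.elim a b) Finset.univ fun l _ => by
    cases l <;> simp [ha, hb]).1
  rw [Finset.card_univ, Fintype.card_fin] at k1 k2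
  rw [Finset.card_univ, Fintype.card_sum, Fintype.card_fin, Fintype.prod_sum_type, ← two_mul] at k3
  have k4 : (∏ l, c l) * ∏ l, d l = (-1) ^ m * ((∏ l, a l) * ∏ l, b l) := by
    have : ((-1) ^ m : R) = ∏ _l : Fin m, (-1) := by simp
    rw [← Finset.prod_mul_distrib, ← Finset.prod_mul_distrib, this, ← Finset.prod_mul_distrib]
    exact Finset.prod_congr rfl fun l _ => by rw [h]; ring
  have k5 : ((2 * m).factorial : R) = (2 * m).choose m * m.factorial * m.factorial := by
    have := Nat.choose_mul_factorial_mul_factorial (show m ≤ 2 * m by omega)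
    rw [show 2 * m - m = m by omega] at this
    exact_mod_cast congrArg (Nat.cast (R := R)) this.symm
  rw [smul_pow, k3, k1, k2, pow_mul Complex.I, Complex.I_sq, k5, Algebra.smul_def, Algebra.smul_def]
  simp only [Sum.elim_inl, Sum.elim_inr, map_pow, map_neg, map_one, map_natCast]
  linear_combination (-((2 * m).choose m * m.factorial * m.factorial : R)) * k4

/-! ### Top powers of Kähler forms in a coframe -/

section Coframe

variable {V : Type*} [NormedAddCommGroup V] [NormedSpace ℝ V]

theorem altSum_apply {p : ℕ} {κ : Type*} (s : Finset κ) (α : κ → V [⋀^Fin p]→ₗ[ℝ] ℂ) (v : Fin p → V) :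
    (∑ i ∈ s, α i) v = ∑ i ∈ s, α i v := by
  classical
  induction s using Finset.induction_on with
  | empty => simp
  | insert a s ha ih => rw [Finset.sum_insert ha, Finset.sum_insert ha, AlternatingMap.add_apply, ih]

theorem cformSum_apply {p : ℕ} {κ : Type*} (s : Finset κ) (α : κ → CForm V p) (v : Fin p → V) :
    (∑ i ∈ s, α i) v = ∑ i ∈ s, α i v := by
  simp

theorem ι_mul_swap (a b : V →L[ℝ] ℂ) : ExteriorAlgebra.ι ℂ a * ExteriorAlgebra.ι ℂ b = -(ExteriorAlgebra.ι ℂ b * ExteriorAlgebra.ι ℂ a) :=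
  eq_neg_of_add_eq_zero_left (ExteriorAlgebra.ι_add_mul_swap a b)

/-- Moving a 1-form past two others costs two signs. Hence the computations with 2-forms take place
in a commutative ring. -/
theorem ι_mul_ι_mem_center (a b : V →L[ℝ] ℂ) :
    ExteriorAlgebra.ι ℂ a * ExteriorAlgebra.ι ℂ b ∈ Subalgebra.center ℂ (FormAlg V) := by
  rw [Subalgebra.mem_center_iff]
  intro x
  induction x using ExteriorAlgebra.induction with
  | algebraMap r => exact Algebra.commutes r _
  | ι c =>
    rw [mul_assoc, ι_mul_swap b c, mul_neg, ← mul_assoc, ← mul_assoc, ι_mul_swap a c, neg_mul,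
      neg_neg]
  | mul x y hx hy => rw [mul_assoc, hy, ← mul_assoc, hx, mul_assoc]
  | add x y hx hy => rw [add_mul, mul_add, hx, hy]

/-- `a ∧ b` as an element of the center of the exterior algebra. -/
def wedgeTwo (a b : V →L[ℝ] ℂ) : Subalgebra.center ℂ (FormAlg V) :=
  ⟨ExteriorAlgebra.ι ℂ a * ExteriorAlgebra.ι ℂ b, ι_mul_ι_mem_center a b⟩

theorem wedgeTwo_sq (a b : V →L[ℝ] ℂ) : wedgeTwo a b ^ 2 = 0 := by
  apply Subtype.ext
  change (ExteriorAlgebra.ι ℂ a * ExteriorAlgebra.ι ℂ b) ^ 2 = 0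
  rw [pow_two, mul_assoc, ← mul_assoc (ExteriorAlgebra.ι ℂ b), ι_mul_swap b a, neg_mul, mul_neg, mul_assoc (ExteriorAlgebra.ι ℂ a) (ExteriorAlgebra.ι ℂ b),
    ExteriorAlgebra.ι_sq_zero, mul_zero, mul_zero, neg_zero]

theorem wedgeTwo_mul_wedgeTwo (a b c d : V →L[ℝ] ℂ) :
    wedgeTwo a b * wedgeTwo c d = -(wedgeTwo a c * wedgeTwo b d) := by
  apply Subtype.ext
  change (ExteriorAlgebra.ι ℂ a * ExteriorAlgebra.ι ℂ b) * (ExteriorAlgebra.ι ℂ c * ExteriorAlgebra.ι ℂ d) = -((ExteriorAlgebra.ι ℂ a * ExteriorAlgebra.ι ℂ c) * (ExteriorAlgebra.ι ℂ b * ExteriorAlgebra.ι ℂ d))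
  rw [mul_assoc, ← mul_assoc (ExteriorAlgebra.ι ℂ b), ι_mul_swap b c]; simp [mul_assoc]

theorem wedgeTwo_coe (a b : V →L[ℝ] ℂ) :
    (wedgeTwo a b : FormAlg V) = ExteriorAlgebra.ιMulti ℂ 2 ![a, b] := by
  simp [ExteriorAlgebra.ιMulti_apply, wedgeTwo]

theorem ιMulti_succ_cons {k : ℕ} (a : V →L[ℝ] ℂ) (θ : Fin k → V →L[ℝ] ℂ) :
    ExteriorAlgebra.ιMulti ℂ (k + 1) (Fin.cons a θ) = ExteriorAlgebra.ι ℂ a * ExteriorAlgebra.ιMulti ℂ k θ := by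
  simp [ExteriorAlgebra.ιMulti_apply]
  rfl

theorem ιMulti_mul_ι {k : ℕ} (θ : Fin k → V →L[ℝ] ℂ) (b : V →L[ℝ] ℂ) :
    ExteriorAlgebra.ιMulti ℂ k θ * ExteriorAlgebra.ι ℂ b = (-1 : ℂ) ^ k • (ExteriorAlgebra.ι ℂ b * ExteriorAlgebra.ιMulti ℂ k θ) := by
  induction k with
  | zero => simp [ExteriorAlgebra.ιMulti_apply]
  | succ k ih =>
    rw [← Fin.cons_self_tail θ, ιMulti_succ_cons, mul_assoc, ih, mul_smul_comm, ← mul_assoc,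
      ι_mul_swap (θ 0) b, pow_succ, mul_smul]
    simp [mul_assoc]

/-- Interleaving the two lists takes k(k-1)/2 transpositions, and i^(k²) = i^k (-1)^(k(k-1)/2), so
the power of i absorbs the sign. -/
theorem ιMulti_mul_ιMulti (k : ℕ) (θ φ : Fin k → V →L[ℝ] ℂ) :
    Complex.I ^ (k ^ 2) • (ExteriorAlgebra.ιMulti ℂ k θ * ExteriorAlgebra.ιMulti ℂ k φ) =
      ((Complex.I ^ k • ∏ l, wedgeTwo (θ l) (φ l) : Subalgebra.center ℂ (FormAlg V)) :
        FormAlg V) := by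
  induction k with
  | zero => simp [ExteriorAlgebra.ιMulti_apply]
  | succ k ih =>
    have h1 : ExteriorAlgebra.ιMulti ℂ (k + 1) θ * ExteriorAlgebra.ιMulti ℂ (k + 1) φ =
        (-1 : ℂ) ^ k • ((ExteriorAlgebra.ι ℂ (θ 0) * ExteriorAlgebra.ι ℂ (φ 0)) * (ExteriorAlgebra.ιMulti ℂ k (Fin.tail θ) *
          ExteriorAlgebra.ιMulti ℂ k (Fin.tail φ))) := by
      conv_lhs => rw [← Fin.cons_self_tail θ, ← Fin.cons_self_tail φ, ιMulti_succ_cons,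
        ιMulti_succ_cons, mul_assoc, ← mul_assoc (ExteriorAlgebra.ιMulti ℂ k _), ιMulti_mul_ι]
      simp [mul_assoc]
    have h2 : Complex.I ^ ((k + 1) ^ 2) * (-1 : ℂ) ^ k = Complex.I * Complex.I ^ (k ^ 2) := by
      have : (k + 1) ^ 2 = k ^ 2 + 2 * k + 1 := by ring
      rw [this, pow_succ, pow_add, pow_mul Complex.I 2 k, Complex.I_sq]
      have : ((-1 : ℂ) ^ k) * (-1) ^ k = 1 := by rw [← mul_pow]; simp
      linear_combination Complex.I ^ (k ^ 2) * Complex.I * this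
    rw [h1, smul_smul, h2, mul_smul, ← mul_smul_comm, ih, Fin.prod_univ_succ, pow_succ']
    have h3 : ExteriorAlgebra.ι ℂ (θ 0) * ExteriorAlgebra.ι ℂ (φ 0) = (wedgeTwo (θ 0) (φ 0) : FormAlg V) := rfl
    rw [h3, ← Subalgebra.coe_mul, ← Subalgebra.coe_smul]
    congr 1
    rw [mul_smul_comm, smul_smul]
    rfl

theorem coe_sum_wedgeTwo_mem {κ : Type*} (s : Finset κ) (c : κ → ℂ) (a b : κ → V →L[ℝ] ℂ) :
    ((∑ l ∈ s, c l • wedgeTwo (a l) (b l) : Subalgebra.center ℂ (FormAlg V)) : FormAlg V) ∈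
      ⋀[ℂ]^2 (V →L[ℝ] ℂ) := by
  push_cast
  refine Submodule.sum_mem _ fun l _ => ?_
  rw [wedgeTwo_coe]
  exact Submodule.smul_mem _ _ (ιMulti_mem 2 _)

theorem toForm_coe_sum_wedgeTwo {κ : Type*} (s : Finset κ) (c : κ → ℂ) (a b : κ → V →L[ℝ] ℂ) :
    toForm V 2 ((∑ l ∈ s, c l • wedgeTwo (a l) (b l) : Subalgebra.center ℂ (FormAlg V)) :
      FormAlg V) = (∑ l ∈ s, c l • wedgeOne ![a l, b l] : CForm V 2).toAlternatingMap := by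
  ext v
  simp only [AddSubmonoidClass.coe_finsetSum, map_sum, SetLike.val_smul, map_smul, wedgeTwo_coe, toForm_ιMulti]
  simp [altSum_apply]

theorem conjForm_wedgeOne {p : ℕ} (θ : Fin p → V →L[ℝ] ℂ) :
    conjForm (wedgeOne θ).toAlternatingMap = (wedgeOne fun i => conjOne (θ i)).toAlternatingMap := by
  ext v
  simp only [conjForm, LinearMap.compAlternatingMap_apply,
    ContinuousAlternatingMap.coe_toAlternatingMap, wedgeOne_apply]
  change (starRingEnd ℂ) _ = _
  rw [RingHom.map_det]
  rfl

theorem conjForm_smul {p : ℕ} (c : ℂ) (α : V [⋀^Fin p]→ₗ[ℝ] ℂ) :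
    conjForm (c • α) = starRingEnd ℂ c • conjForm α := by
  ext v
  simp [conjForm]

theorem conjForm_sum {p : ℕ} {κ : Type*} (s : Finset κ) (α : κ → V [⋀^Fin p]→ₗ[ℝ] ℂ) :
    conjForm (∑ i ∈ s, α i) = ∑ i ∈ s, conjForm (α i) := by
  ext v
  simp [conjForm, altSum_apply]

/-- The top power of `i ∑ e^l ∧ ē^l` in terms of the form `e^0 ∧ ⋯ ∧ e^{k-1}`. -/
theorem wedgePow_unitary {k : ℕ} (e : Fin k → V →L[ℝ] ℂ) :
    wedgePow (∑ l, Complex.I • wedgeOne ![e l, conjOne (e l)] : CForm V 2).toAlternatingMap k =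
      (((k.factorial : ℂ) * Complex.I ^ (k ^ 2)) • wedge (wedgeOne e).toAlternatingMap
        (conjForm (wedgeOne e).toAlternatingMap)).domDomCongr (finCongr (by ring)) := by
  rw [conjForm_wedgeOne, ← toForm_ιMulti, ← toForm_ιMulti, wedge_toForm (ιMulti_mem _ _)
    (ιMulti_mem _ _), ← map_smul, toForm_domDomCongr (by ring : k + k = 2 * k), mul_smul,
    ιMulti_mul_ιMulti, ← toForm_coe_sum_wedgeTwo, wedgePow_toForm (coe_sum_wedgeTwo_mem _ _ _ _)]
  congr 1
  have h := (sum_pow_card_of_sq_eq_zero (fun l => wedgeTwo (e l) (conjOne (e l)))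
    Finset.univ fun l _ => wedgeTwo_sq _ _).1
  rw [Finset.card_univ, Fintype.card_fin] at h
  rw [← Subalgebra.coe_pow, ← Subalgebra.coe_smul, ← Finset.smul_sum, smul_pow, h]
  congr 1
  rw [Algebra.smul_def (k.factorial : ℂ), map_natCast, mul_smul_comm]

/-- The volume identity of the hyperkähler setting at one point, with `f` a unitary coframe of the
base and `e` one of the fibre. It is an algebraic identity that holds for arbitrary 1-forms. -/
theorem wedgePow_quaternionic {m : ℕ} (f e : Fin m → V →L[ℝ] ℂ) :
    wedgePow (∑ l, Complex.I • wedgeOne ![f l, conjOne (f l)] +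
        ∑ l, Complex.I • wedgeOne ![e l, conjOne (e l)] : CForm V 2).toAlternatingMap (2 * m) =
      (((2 * m).choose m : ℂ) •
        wedge (wedgePow (∑ l, wedgeOne ![f l, e l] : CForm V 2).toAlternatingMap m)
        (conjForm (wedgePow (∑ l, wedgeOne ![f l, e l] : CForm V 2).toAlternatingMap m))).domDomCongr
          (finCongr (by ring)) := by
  have h0 : conjForm (∑ l, wedgeOne ![f l, e l] : CForm V 2).toAlternatingMap =
      toForm V 2 ((∑ l, (1 : ℂ) • wedgeTwo (conjOne (f l)) (conjOne (e l)) :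
        Subalgebra.center ℂ (FormAlg V)) : FormAlg V) := by
    rw [toForm_coe_sum_wedgeTwo]
    have : (∑ l, wedgeOne ![f l, e l] : CForm V 2).toAlternatingMap =
      ∑ l, (wedgeOne ![f l, e l]).toAlternatingMap := by
      ext v; simp [altSum_apply]
    rw [this, conjForm_sum]
    ext v
    simp only [conjForm_wedgeOne, one_smul]
    simp only [altSum_apply, cformSum_apply, ContinuousAlternatingMap.coe_toAlternatingMap]
    refine Finset.sum_congr rfl fun l _ => ?_
    congr! 2
    ext i; fin_cases i <;> rfl
  have h1 : (∑ l, wedgeOne ![f l, e l] : CForm V 2).toAlternatingMap =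
      toForm V 2 ((∑ l, (1 : ℂ) • wedgeTwo (f l) (e l) :
        Subalgebra.center ℂ (FormAlg V)) : FormAlg V) := by
    rw [toForm_coe_sum_wedgeTwo]; simp
  have hpow : ∀ {x : FormAlg V}, x ∈ ⋀[ℂ]^2 (V →L[ℝ] ℂ) → x ^ m ∈ ⋀[ℂ]^(2 * m) (V →L[ℝ] ℂ) := by
    intro x hx
    rw [mul_comm]
    exact SetLike.pow_mem_graded m hx
  have h2 : (∑ l, Complex.I • wedgeOne ![f l, conjOne (f l)] +
        ∑ l, Complex.I • wedgeOne ![e l, conjOne (e l)] : CForm V 2) =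
      ∑ l : Fin m ⊕ Fin m, Complex.I • wedgeOne ![Sum.elim f e l, conjOne (Sum.elim f e l)] := by
    simp [Fintype.sum_sum_type]
  rw [conjForm_wedgePow, h0, h1, h2, wedgePow_toForm (coe_sum_wedgeTwo_mem _ _ _ _),
    wedgePow_toForm (coe_sum_wedgeTwo_mem _ _ _ _),
    wedge_toForm (hpow (coe_sum_wedgeTwo_mem _ _ _ _)) (hpow (coe_sum_wedgeTwo_mem _ _ _ _)),
    ← map_smul, toForm_domDomCongr (by ring : 2 * m + 2 * m = 2 * (2 * m)),
    ← toForm_coe_sum_wedgeTwo, wedgePow_toForm (coe_sum_wedgeTwo_mem _ _ _ _)]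
  congr 1
  rw [← Subalgebra.coe_pow, ← Subalgebra.coe_pow, ← Subalgebra.coe_pow, ← Subalgebra.coe_mul,
    ← Subalgebra.coe_smul]
  congr 1
  simp only [one_smul]
  have h3 := pow_two_mul_sum_of_sq_eq_zero (fun l => wedgeTwo (f l) (conjOne (f l)))
    (fun l => wedgeTwo (e l) (conjOne (e l))) (fun l => wedgeTwo (f l) (e l))
    (fun l => wedgeTwo (conjOne (f l)) (conjOne (e l))) (fun _ => wedgeTwo_sq _ _)
    (fun _ => wedgeTwo_sq _ _) (fun _ => wedgeTwo_sq _ _) (fun _ => wedgeTwo_sq _ _)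
    (fun l => wedgeTwo_mul_wedgeTwo _ _ _ _)
  rw [← h3, Finset.smul_sum]
  congr 1
  refine Finset.sum_congr rfl fun l _ => ?_
  cases l <;> rfl

end Coframe
end

noncomputable section

/-! ### Flat Kähler metrics on tori are translation invariant -/

section FlatKahler

open Complex

variable {V : Type*} [NormedAddCommGroup V] [NormedSpace ℝ V]

theorem fderiv_clm₂_apply {Γ : V → V →L[ℝ] V →L[ℝ] V} {x : V} (h : DifferentiableAt ℝ Γ x)
    (u v w : V) : fderiv ℝ (fun y => Γ y v w) x u = fderiv ℝ Γ x u v w := by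
  rw [fderiv_clm_apply (by fun_prop) (by fun_prop), fderiv_clm_apply (by fun_prop) (by fun_prop)]
  simp

theorem differentiableAt_complex_of_real {E F : Type*} [NormedAddCommGroup E] [NormedSpace ℂ E]
    [NormedAddCommGroup F] [NormedSpace ℂ F] {f : E → F} {x : E} (h : DifferentiableAt ℝ f x)
    (hI : ∀ u, fderiv ℝ f x (I • u) = I • fderiv ℝ f x u) : DifferentiableAt ℂ f x := by
  let f' : E →L[ℂ] F :=
    { toFun := fderiv ℝ f x
      map_add' := map_add _
      map_smul' := by
        intro c u
        conv_lhs => rw [← re_add_im c, add_smul, mul_comm, mul_smul]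
        rw [map_add, hI]
        have e : ∀ (r : ℝ) (u : E), (r : ℂ) • u = r • u := fun r u => rfl
        rw [e, e, map_smul, map_smul]
        conv_rhs => rw [RingHom.id_apply, ← re_add_im c, add_smul, mul_comm, mul_smul]
        rfl
      cont := (fderiv ℝ f x).cont }
  exact (hasFDerivAt_of_restrictScalars (𝕜 := ℝ) (𝕜' := ℂ) (f := f) (f' := f') h.hasFDerivAt
    (by ext u; rfl)).differentiableAt

/-- If `c` were positive, the maximum at 0 would also be a local minimum. Then φ would be constant
near 0 and the second derivative would vanish. -/
theorem not_isMax_of_second_deriv_pos {φ φ' : ℝ → ℝ} {c : ℝ} (h1 : ∀ t, HasDerivAt φ (φ' t) t)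
    (h2 : HasDerivAt φ' c 0) (hmax : ∀ t, φ t ≤ φ 0) : c ≤ 0 := by
  by_contra! hc
  have hd : deriv φ = φ' := funext fun t => (h1 t).deriv
  have hM : IsLocalMax φ 0 := Filter.Eventually.of_forall hmax
  have h0 : deriv φ 0 = 0 := hM.deriv_eq_zero
  have hm : IsLocalMin φ 0 :=
    isLocalMin_of_deriv_deriv_pos (by rw [hd, h2.deriv]; exact hc) h0 (h1 0).continuousAt
  have hconst : φ =ᶠ[nhds 0] fun _ => φ 0 := by
    filter_upwards [hm] with t ht using le_antisymm (hmax t) ht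
  have h3 : φ' =ᶠ[nhds 0] fun _ => 0 := by
    rw [← hd]
    filter_upwards [hconst.eventuallyEq_nhds] with t ht
    rw [ht.deriv_eq]; simp
  have := h3.deriv_eq
  rw [h2.deriv] at this
  simp at this
  exact hc.ne' this

/-- Expresses the connection by first derivatives of the metric. Periodicity and complex linearity
of the connection are deduced from it. -/
theorem IsLeviCivita.koszul {W : Set V} {g : V → Bilin V} {Γ : V → V →L[ℝ] V →L[ℝ] V}
    (h : IsLeviCivita W g Γ) {x : V} (hx : x ∈ W) (hs : ∀ u v, g x u v = g x v u) (u v w : V) :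
    2 * g x (Γ x u v) w = fderiv ℝ g x u v w + fderiv ℝ g x v u w - fderiv ℝ g x w u v := by
  rw [h.2.2 x hx, h.2.2 x hx, h.2.2 x hx, h.2.1 x hx v u, h.2.1 x hx w u, h.2.1 x hx w v,
    hs u (Γ x v w), hs v (Γ x u w)]
  ring

end FlatKahler

section FlatKahlerTorus

open Complex

variable {m : ℕ}

/-- The complex structure of a Kähler metric is parallel. By the Koszul formula g(Γ_u(iv), w) and
g(Γ_u v, iw) add up to zero once dω = 0 is used for the triples (u, v, w) and (u, iv, iw). -/
theorem IsLeviCivita.complexLinear {g : (Fin m → ℂ) → Bilin (Fin m → ℂ)} (hK : IsKahlerMetric Set.univ g)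
    {Γ : (Fin m → ℂ) → (Fin m → ℂ) →L[ℝ] (Fin m → ℂ) →L[ℝ] (Fin m → ℂ)} (hΓ : IsLeviCivita Set.univ g Γ) (x u v : (Fin m → ℂ)) :
    Γ x u (I • v) = I • Γ x u v := by
  obtain ⟨hg, hh, hc⟩ := hK
  have hd : DifferentiableAt ℝ g x := (hg.contDiffAt Filter.univ_mem).differentiableAt (by simp)
  have hI : ∀ v : (Fin m → ℂ), I • I • v = -v := fun v => by rw [smul_smul, I_mul_I, neg_one_smul]
  have hsk : ∀ y v w, g y (I • v) w = - g y v (I • w) := fun y v w => by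
    rw [← (hh y trivial).2.1 (I • v) w, hI]; simp
  have hD : ∀ u v w, fderiv ℝ g x u (I • v) w = - fderiv ℝ g x u v (I • w) := by
    intro u v w
    rw [← fderiv_bilin_apply hd, ← fderiv_bilin_apply hd]
    simp only [hsk]
    rw [fderiv_fun_neg]; rfl
  have hS : ∀ u v w, fderiv ℝ g x u v w = fderiv ℝ g x u w v := by
    intro u v w
    rw [← fderiv_bilin_apply hd, ← fderiv_bilin_apply hd]
    simp only [fun y => (hh y trivial).1 v w]
  have hcl := (extDeriv_kahlerForm_eq_zero_iff hd
    (Filter.Eventually.of_forall fun y => hh y trivial)).1 (hc x trivial)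
  simp only [fderiv_bilin_apply hd] at hcl
  have key : ∀ w, g x (Γ x u (I • v) - I • Γ x u v) w = 0 := by
    intro w
    have k1 := hΓ.koszul (Set.mem_univ x) (hh x trivial).1 u (I • v) w
    have k2 := hΓ.koszul (Set.mem_univ x) (hh x trivial).1 u v (I • w)
    have c1 := hcl u v w
    have c2 := hcl u (I • v) (I • w)
    simp only [hI, map_neg, neg_apply] at c2
    have := hsk x (Γ x u v) w
    have s1 := hD w u v
    have s2 := hD v w u
    have s3 := hD u v w
    have s4 := hD (I • w) u (I • v)
    simp only [hI, map_neg] at s4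
    rw [map_sub, sub_apply, this]
    have e1 := hS v w (I • u)
    have e2 := hS v (I • u) w
    have e3 := hD v u w
    have e4 := hS (I • v) u w
    linarith
  by_contra hne
  exact ((hh x trivial).2.2 _ (sub_ne_zero.2 hne)).ne' (key _)

/-- The cell is cut out by fractional parts of the real coordinates, the lattice vector by their
integral parts. A periodic function takes all its values on this compact set. -/
theorem IsLatticeBasis.exists_cell {L : AddSubgroup (Fin m → ℂ)} {τ : Fin m ⊕ Fin m → (Fin m → ℂ)}
    (h : IsLatticeBasis L τ) :
    ∃ K : Set (Fin m → ℂ), IsCompact K ∧ K.Nonempty ∧ ∀ x, ∃ y ∈ K, ∃ l ∈ L, x = y + l := by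
  have hcard : Fintype.card (Fin m ⊕ Fin m) = Module.finrank ℝ (Fin m → ℂ) := by
    rw [Module.finrank_pi_fintype]; simp; ring
  let b := basisOfLinearIndependentOfCardEqFinrank' τ h.1 hcard
  refine ⟨(fun t : Fin m ⊕ Fin m → ℝ => ∑ a, t a • τ a) '' Set.Icc 0 1,
    isCompact_Icc.image (by fun_prop), ⟨_, 0, by simp, rfl⟩, fun x => ?_⟩
  refine ⟨_, ⟨fun a => Int.fract (b.repr x a), ⟨fun a => Int.fract_nonneg _,
    fun a => (Int.fract_lt_one _).le⟩, rfl⟩, ∑ a, ⌊b.repr x a⌋ • τ a, ?_, ?_⟩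
  · rw [h.2]
    exact AddSubgroup.sum_mem _ fun a _ => AddSubgroup.zsmul_mem _
      (AddSubgroup.subset_closure (Set.mem_range_self a)) _
  · rw [← Finset.sum_add_distrib]
    conv_lhs => rw [← b.sum_repr x]
    refine Finset.sum_congr rfl fun a _ => ?_
    have hb : b a = τ a := by simp [b]
    simp only [hb]
    conv_lhs => rw [← Int.fract_add_floor (b.repr x a), add_smul]
    rw [Int.cast_smul_eq_zsmul]

/-- The connection is complex bilinear, flatness makes it holomorphic in the base point, and
periodicity makes it bounded, so Liouville's theorem makes it constant. A constant connection is
then excluded unless it is zero by looking at a maximum of g(v, v). Vanishing of the connection says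
that the metric is constant. -/
theorem isPeriodic_flatKahler_const {L : AddSubgroup (Fin m → ℂ)} {τ : Fin m ⊕ Fin m → (Fin m → ℂ)}
    (hτ : IsLatticeBasis L τ) {g : (Fin m → ℂ) → Bilin (Fin m → ℂ)} (hK : IsKahlerMetric Set.univ g)
    (hp : IsPeriodic L g) (hc : HasConstCurvature Set.univ g 0) (w : (Fin m → ℂ)) : g w = g 0 := by
  obtain ⟨K, hKc, hKn, hK'⟩ := hτ.exists_cell
  obtain ⟨Γ, hΓ, hR⟩ := hc
  have hlin := hΓ.complexLinear hK
  obtain ⟨hg, hh, -⟩ := hK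
  have hdg : ∀ x, DifferentiableAt ℝ g x := fun x =>
    (hg.contDiffAt Filter.univ_mem).differentiableAt (by simp)
  have hdΓ : ∀ x, DifferentiableAt ℝ Γ x := fun x =>
    (hΓ.1.contDiffAt Filter.univ_mem).differentiableAt (by simp)
  have hlin' : ∀ x u v, Γ x (I • u) v = I • Γ x u v := fun x u v => by
    rw [hΓ.2.1 x trivial, hlin, hΓ.2.1 x trivial]
  have hDlin : ∀ x z u v, fderiv ℝ Γ x z (I • u) v = I • fderiv ℝ Γ x z u v := by
    intro x z u v
    rw [← fderiv_clm₂_apply (hdΓ x), ← fderiv_clm₂_apply (hdΓ x)]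
    simp only [hlin']
    have h1 : DifferentiableAt ℝ (fun y => Γ y u v) x := by
      have := hdΓ x
      fun_prop
    rw [fderiv_fun_const_smul h1]; rfl
  -- Subtract i times the flatness equation for z from the one for iz. All terms except the
  -- derivative in direction z are complex linear in z and cancel, which leaves the Cauchy-Riemann
  -- equation for the connection.
  have hhol : ∀ x z u v, fderiv ℝ Γ x (I • z) u v = I • fderiv ℝ Γ x z u v := by
    intro x z u v
    have h1 := hR x trivial (I • z) u v
    have h2 := hR x trivial z u v
    simp only [curvature, zero_smul, hlin', hDlin, hlin] at h1 h2
    have h3 : fderiv ℝ Γ x (I • z) u v - I • fderiv ℝ Γ x z u v = 0 := by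
      rw [← sub_eq_zero.2 (h1.trans (smul_zero I).symm), ← h2]
      simp only [smul_sub, smul_add]
      abel
    exact sub_eq_zero.1 h3
  have hpΓ : IsPeriodic L Γ := by
    intro l hl x
    have hD : fderiv ℝ g (x + l) = fderiv ℝ g x := by
      rw [← (fderiv_comp_add_right (𝕜 := ℝ) (F := Bilin (Fin m → ℂ)) (f := g) (x := x) l : fderiv ℝ (fun y => g (y + l)) x = fderiv ℝ g (x + l))]
      congr 1
      exact funext fun y => hp l hl y
    ext1 u; ext1 v
    have key : ∀ w, g x (Γ (x + l) u v - Γ x u v) w = 0 := by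
      intro w
      have k1 := hΓ.koszul (Set.mem_univ x) (hh x trivial).1 u v w
      have k2 := hΓ.koszul (Set.mem_univ (x + l)) (hh _ trivial).1 u v w
      rw [hD, hp l hl] at k2
      rw [map_sub, sub_apply]
      linarith
    by_contra hne
    exact ((hh x trivial).2.2 _ (sub_ne_zero.2 hne)).ne' (key _)
  have hΓc : ∀ x u v, Γ x u v = Γ 0 u v := by
    intro x u v
    refine Differentiable.apply_eq_apply_of_bounded (f := fun y => Γ y u v) (fun y => ?_) ?_ x 0
    · refine differentiableAt_complex_of_real (by have := hdΓ y; fun_prop) fun z => ?_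
      rw [fderiv_clm₂_apply (hdΓ y), fderiv_clm₂_apply (hdΓ y), hhol]
    · have hcont : Continuous fun y => Γ y u v := by
        have : Continuous Γ := continuous_iff_continuousAt.2 fun y => (hdΓ y).continuousAt
        fun_prop
      refine (hKc.image hcont).isBounded.subset ?_
      rintro _ ⟨y, rfl⟩
      obtain ⟨y', hy', l, hl, rfl⟩ := hK' y
      exact ⟨y', hy', by simp only [hpΓ l hl]⟩
  have hmet : ∀ x u v w, fderiv ℝ g x u v w = g x (Γ 0 u v) w + g x v (Γ 0 u w) := by
    intro x u v w
    rw [hΓ.2.2 x trivial, hΓc, hΓc x u w]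
  have hΓ0 : ∀ u v, Γ 0 u v = 0 := by
    intro u v
    have hcont : Continuous fun y => g y v v := by
      have : Continuous g := continuous_iff_continuousAt.2 fun y => (hdg y).continuousAt
      fun_prop
    obtain ⟨x, -, hx⟩ := hKc.exists_isMaxOn hKn hcont.continuousOn
    have hmax : ∀ y, g y v v ≤ g x v v := by
      intro y
      obtain ⟨y', hy', l, hl, rfl⟩ := hK' y
      rw [hp l hl]; exact hx hy'
    have hder : ∀ (z a b : (Fin m → ℂ)) (t : ℝ), HasDerivAt (fun t : ℝ => g (x + t • z) a b)
        (g (x + t • z) (Γ 0 z a) b + g (x + t • z) a (Γ 0 z b)) t := by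
      intro z a b t
      have h1 : HasFDerivAt (fun y => g y a b) (fderiv ℝ (fun y => g y a b) (x + t • z))
          (x + t • z) := by
        have := hdg (x + t • z)
        exact DifferentiableAt.hasFDerivAt (by fun_prop)
      have h2 : HasDerivAt (fun t : ℝ => x + t • z) z t := by
        simpa using ((hasDerivAt_id t).smul_const z).const_add x
      have := h1.comp_hasDerivAt t h2
      rwa [fderiv_bilin_apply (hdg _), hmet] at this
    -- Half the second derivative of g(v, v) in direction z at its maximum; with constant Γ it is
    -- g(Γ_z Γ_z v, v) + g(Γ_z v, Γ_z v).
    have hsec : ∀ z : (Fin m → ℂ), g x (Γ 0 z (Γ 0 z v)) v + g x (Γ 0 z v) (Γ 0 z v) ≤ 0 := by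
      intro z
      have h2 := ((hder z (Γ 0 z v) v 0).add (hder z v (Γ 0 z v) 0))
      have := not_isMax_of_second_deriv_pos (φ := fun t : ℝ => g (x + t • z) v v) (hder z v v) h2
        (fun t => by simpa using hmax _)
      simp only [zero_smul, add_zero] at this
      rw [(hh x trivial).1 v] at this
      linarith
    by_contra hne
    have p := (hh x trivial).2.2 _ hne
    -- Since Γ_{iu} Γ_{iu} = -Γ_u Γ_u, adding the inequalities for u and iu leaves 2 g(Γ_u v, Γ_u v)
    -- ≤ 0.
    have s1 := hsec u
    have s2 := hsec (I • u)
    simp only [hlin', hlin, smul_smul, I_mul_I, neg_smul, one_smul, map_neg, neg_apply] at s2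
    rw [(hh x trivial).2.1] at s2
    linarith
  refine is_const_of_fderiv_eq_zero (𝕜 := ℝ) (f := g) (fun x => hdg x) (fun x => ?_) w 0
  ext u v w
  rw [hmet, hΓ0, hΓ0]; simp

end FlatKahlerTorus

/-! ### Averages over a period cell and invariant representatives -/

section Averaging

open MeasureTheory

/-- The divergence theorem on the unit cube, for the vector field whose only component is F in
direction `a`. The two faces orthogonal to `a` cancel by periodicity, the other faces carry no flux.
-/
theorem integral_fderiv_periodic {κ : Type*} [Fintype κ] [DecidableEq κ] [Nonempty κ] {F : (κ → ℝ) → ℂ}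
    (hF : ContDiff ℝ 1 F) (a : κ) (hp : ∀ t, F (t + Pi.single a 1) = F t) :
    ∫ t in Set.Icc (0 : κ → ℝ) 1, fderiv ℝ F t (Pi.single a 1) = 0 := by
  obtain ⟨n, hn⟩ : ∃ n, Fintype.card κ = n + 1 := Nat.exists_eq_succ_of_ne_zero Fintype.card_ne_zero
  let e : κ ≃ Fin (n + 1) := (Fintype.equivFin κ).trans (finCongr hn)
  let eL : (κ → ℝ) ≃L[ℝ] (Fin (n + 1) → ℝ) := ContinuousLinearEquiv.piCongrLeft ℝ (fun _ => ℝ) e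
  have heL : ∀ t i, eL t (e i) = t i := fun t i =>
    Equiv.piCongrLeft_apply_apply (fun _ : Fin (n + 1) => ℝ) e t i
  have heL' : ∀ t i, eL t i = t (e.symm i) := fun t i => by
    conv_lhs => rw [← e.apply_symm_apply i]
    rw [heL]
  have hsym : ∀ s i, eL.symm s i = s (e i) := fun s i => by
    have := heL (eL.symm s) i
    rw [eL.apply_symm_apply] at this
    exact this.symm
  have hd : Differentiable ℝ F := hF.differentiable one_ne_zero
  have hsingle : ∀ i : Fin (n + 1), eL.symm (Pi.single i 1) = Pi.single (e.symm i) 1 := by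
    intro i
    ext j
    rw [hsym]
    by_cases h : e j = i
    · subst h; simp
    · rw [Pi.single_eq_of_ne h, Pi.single_eq_of_ne]
      rintro rfl; simp at h
  rw [integral_divergence_of_hasFDerivAt_off_countable_of_equiv eL
    (fun x y => by
      constructor
      · intro h i; have := h (e i); rwa [heL, heL] at this
      · intro h i; rw [heL', heL']; exact h _)
    (volume_measurePreserving_piCongrLeft (fun _ => ℝ) e)
    (fun i => if i = e a then F else 0) (fun i t => if i = e a then fderiv ℝ F t else 0) ∅
    Set.countable_empty 0 1 zero_le_one
    (fun i => by split_ifs; exacts [hF.continuous.continuousOn, continuousOn_const])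
    (fun x _ i => by
      split_ifs
      · exact (hd x).hasFDerivAt
      · exact hasFDerivAt_const _ _)
    _ (fun x => by
      rw [Finset.sum_eq_single (e a)]
      · rw [if_pos rfl, hsingle, e.symm_apply_apply]
      · intro i _ hi; rw [if_neg hi]; rfl
      · simp)
    ((Continuous.continuousOn (by
      have := hF.continuous_fderiv one_ne_zero
      fun_prop)).integrableOn_compact isCompact_Icc)]
  refine Finset.sum_eq_zero fun i _ => ?_
  rw [sub_eq_zero]
  refine setIntegral_congr_fun measurableSet_Icc fun s _ => ?_
  by_cases hi : i = e a
  · simp only [if_pos hi]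
    subst hi
    rw [← hp (eL.symm ((e a).insertNth (eL 0 (e a)) s))]
    congr 1
    ext j
    rw [Pi.add_apply, hsym, hsym, heL', heL', e.symm_apply_apply]
    by_cases hj : j = a
    · subst hj; simp
    · have : e j ≠ e a := fun h => hj (e.injective h)
      obtain ⟨k, hk⟩ := Fin.exists_succAbove_eq this
      rw [← hk]; simp [hj]
  · simp [if_neg hi]

variable {m : ℕ}

/-- The average of a function over the cell spanned by `τ`. -/
def cellAverage (τ : Fin m ⊕ Fin m → Fin m → ℂ) (f : (Fin m → ℂ) → ℂ) : ℂ :=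
  ∫ t in Set.Icc (0 : Fin m ⊕ Fin m → ℝ) 1, f (∑ c, t c • τ c)

theorem cellAverage_const (τ : Fin m ⊕ Fin m → Fin m → ℂ) (c : ℂ) :
    cellAverage τ (fun _ => c) = c := by
  simp [cellAverage, Measure.real, Real.volume_Icc_pi]

theorem sum_smul_add_single (τ : Fin m ⊕ Fin m → Fin m → ℂ) (t : Fin m ⊕ Fin m → ℝ)
    (a : Fin m ⊕ Fin m) :
    ∑ c, (t + (Pi.single a 1 : Fin m ⊕ Fin m → ℝ)) c • τ c = ∑ c, t c • τ c + τ a := by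
  simp only [Pi.add_apply, add_smul, Finset.sum_add_distrib]
  simp [Pi.single_apply, ite_smul]

/-- A lattice basis as a basis of the real vector space. -/
def IsLatticeBasis.basis {L : AddSubgroup (Fin m → ℂ)} {τ : Fin m ⊕ Fin m → Fin m → ℂ}
    (h : IsLatticeBasis L τ) : Module.Basis (Fin m ⊕ Fin m) ℝ (Fin m → ℂ) :=
  basisOfLinearIndependentOfCardEqFinrank' τ h.1 (by
    rw [Module.finrank_pi_fintype]; simp; ring)

theorem IsLatticeBasis.basis_apply {L : AddSubgroup (Fin m → ℂ)} {τ : Fin m ⊕ Fin m → Fin m → ℂ}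
    (h : IsLatticeBasis L τ) (a : Fin m ⊕ Fin m) : h.basis a = τ a := by
  simp [IsLatticeBasis.basis]

/-- In cell coordinates the derivative along τ_a is a partial derivative, and a general direction is
a real combination of the τ_a. -/
theorem cellAverage_fderiv (hm : 0 < m) {L : AddSubgroup (Fin m → ℂ)} {τ : Fin m ⊕ Fin m → Fin m → ℂ}
    (hτ : IsLatticeBasis L τ) {f : (Fin m → ℂ) → ℂ} (hf : ContDiff ℝ 1 f) (hp : IsPeriodic L f)
    (u : Fin m → ℂ) : cellAverage τ (fun w => fderiv ℝ f w u) = 0 := by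
  have : Nonempty (Fin m ⊕ Fin m) := ⟨Sum.inl ⟨0, hm⟩⟩
  let A : (Fin m ⊕ Fin m → ℝ) →L[ℝ] (Fin m → ℂ) :=
    ∑ c, (ContinuousLinearMap.proj c : (Fin m ⊕ Fin m → ℝ) →L[ℝ] ℝ).smulRight (τ c)
  have hA : ∀ t, A t = ∑ c, t c • τ c := fun t => by simp [A, sum_apply]
  have hbase : ∀ a, cellAverage τ (fun w => fderiv ℝ f w (τ a)) = 0 := by
    intro a
    have h1 := integral_fderiv_periodic (F := fun t => f (A t)) (hf.comp A.contDiff) a (fun t => by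
      rw [hA, hA, sum_smul_add_single, hp]
      rw [hτ.2]; exact AddSubgroup.subset_closure (Set.mem_range_self a))
    rw [← h1, cellAverage]
    refine integral_congr_ae (Filter.Eventually.of_forall fun t => ?_)
    have h2 : HasFDerivAt (fun t => f (A t)) ((fderiv ℝ f (A t)).comp A) t :=
      ((hf.differentiable one_ne_zero (A t)).hasFDerivAt).comp t A.hasFDerivAt
    have h3 : A (Pi.single a 1) = τ a := by
      rw [hA]; simp [Pi.single_apply, ite_smul]
    simp only [← hA]
    rw [h2.fderiv, ContinuousLinearMap.comp_apply, h3]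
  have hint : ∀ a, IntegrableOn (fun t : Fin m ⊕ Fin m → ℝ => fderiv ℝ f (∑ c, t c • τ c) (τ a))
      (Set.Icc 0 1) := by
    intro a
    refine Continuous.integrableOn_Icc ?_
    have := hf.continuous_fderiv one_ne_zero
    fun_prop
  conv_lhs => rw [← hτ.basis.sum_repr u]
  simp only [hτ.basis_apply, map_sum, map_smul, cellAverage]
  refine (integral_finsetSum _ fun a _ => (hint a).smul (hτ.basis.repr u a)).trans ?_
  refine Finset.sum_eq_zero fun a _ => ?_
  refine (integral_smul (G := ℂ) (hτ.basis.repr u a) _).trans ?_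
  have := hbase a
  rw [cellAverage] at this
  rw [this, smul_zero]

/-- On constant vectors dγ is a difference of derivatives of periodic functions, and these have
average zero. -/
theorem Cohomologous.cellAverage_eq (hm : 0 < m) {L : AddSubgroup (Fin m → ℂ)}
    {τ : Fin m ⊕ Fin m → Fin m → ℂ} (hτ : IsLatticeBasis L τ)
    {α β : (Fin m → ℂ) → CForm (Fin m → ℂ) 2} (h : Cohomologous L α β) (hα : Continuous α)
    (u v : Fin m → ℂ) :
    cellAverage τ (fun w => α w ![u, v]) = cellAverage τ (fun w => β w ![u, v]) := by
  obtain ⟨γ, hγ, hp, he⟩ := h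
  have hd : Differentiable ℝ γ := hγ.differentiable (by simp)
  have h1 : ∀ v : Fin 1 → Fin m → ℂ, ContDiff ℝ 1 fun w => γ w v := by
    intro v
    have := hγ.of_le (show (1 : WithTop ℕ∞) ≤ ((⊤ : ℕ∞) : WithTop ℕ∞) by exact_mod_cast le_top)
    exact (ContinuousAlternatingMap.apply ℝ (Fin m → ℂ) ℂ v).contDiff.comp this
  have h2 : ∀ v u, cellAverage τ (fun w => fderiv ℝ (fun w => γ w v) w u) = 0 := fun v u =>
    cellAverage_fderiv hm hτ (h1 v) (fun l hl w => by simp only [hp l hl]) u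
  have h3 : ∀ w, α w ![u, v] = β w ![u, v] + (fderiv ℝ (fun w => γ w ![v]) w u -
      fderiv ℝ (fun w => γ w ![u]) w v) := by
    intro w
    rw [← extDeriv_one_apply (hd w), ← he w]
    simp
  have hc : ∀ v u, IntegrableOn (fun t : Fin m ⊕ Fin m → ℝ =>
      fderiv ℝ (fun w => γ w v) (∑ c, t c • τ c) u) (Set.Icc 0 1) := by
    intro v u
    refine Continuous.integrableOn_Icc ?_
    have := (h1 v).continuous_fderiv one_ne_zero
    fun_prop
  have hcα : IntegrableOn (fun t : Fin m ⊕ Fin m → ℝ => α (∑ c, t c • τ c) ![u, v]) (Set.Icc 0 1) := by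
    refine Continuous.integrableOn_Icc ?_
    have : Continuous fun w => α w ![u, v] :=
      (ContinuousAlternatingMap.apply ℝ (Fin m → ℂ) ℂ ![u, v]).continuous.comp hα
    fun_prop
  -- Continuity is assumed for α only; β is integrable because it differs from α by dγ.
  have hcβ : IntegrableOn (fun t : Fin m ⊕ Fin m → ℝ => β (∑ c, t c • τ c) ![u, v]) (Set.Icc 0 1) := by
    have := hcα.sub ((hc ![v] u).sub (hc ![u] v))
    refine this.congr (Filter.Eventually.of_forall fun t => ?_)
    simp [h3]
  have k1 := h2 ![v] u
  have k2 := h2 ![u] v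
  simp only [cellAverage] at k1 k2
  simp only [h3, cellAverage]
  refine (integral_add hcβ ((hc ![v] u).sub (hc ![u] v))).trans ?_
  have k3 := integral_sub (hc ![v] u) (hc ![u] v)
  rw [k1, k2, sub_zero] at k3
  exact (congrArg _ k3).trans (add_zero _)

/-- An invariant form equals its average, so a class has at most one invariant representative. -/
theorem Cohomologous.const_eq (hm : 0 < m) {L : AddSubgroup (Fin m → ℂ)}
    {τ : Fin m ⊕ Fin m → Fin m → ℂ} (hτ : IsLatticeBasis L τ) {α β : CForm (Fin m → ℂ) 2}
    (h : Cohomologous L (fun _ => α) (fun _ => β)) : α = β :=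
  CForm.ext_two fun u v => by
    have := h.cellAverage_eq hm hτ continuous_const u v
    rwa [cellAverage_const, cellAverage_const] at this

end Averaging
end

noncomputable section

/-! ### Hermitian inner products and their Kähler forms -/

section HermitianForms

open Complex

/-- Since i = s² for a complex number s, the real determinant of multiplication by i is a square,
hence nonnegative. Its fourth power is 1 because i⁴ = 1. -/
theorem det_I_smul_eq_one {ι κ : Type*} [Fintype κ] [DecidableEq κ] (b : Module.Basis κ ℝ (ι → ℂ)) :
    (LinearMap.toMatrix b b (I • (LinearMap.id : (ι → ℂ) →ₗ[ℝ] ι → ℂ))).det = 1 := by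
  obtain ⟨s, hs⟩ := IsAlgClosed.exists_pow_nat_eq I (n := 2) (by norm_num)
  set K : (ι → ℂ) →ₗ[ℝ] ι → ℂ := s • LinearMap.id with hK
  have h1 : I • (LinearMap.id : (ι → ℂ) →ₗ[ℝ] ι → ℂ) = K * K := by
    ext u i
    simp [hK, ← hs, pow_two, mul_assoc]
  have h2 : (K * K) * (K * K) * ((K * K) * (K * K)) = 1 := by
    rw [← h1]
    ext u i
    simp [← mul_assoc]
  rw [LinearMap.det_toMatrix, h1]
  have h3 := congrArg LinearMap.det h2
  simp only [map_mul, map_one] at h3 ⊢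
  have h4 : 0 ≤ LinearMap.det K * LinearMap.det K := mul_self_nonneg _
  set d := LinearMap.det K * LinearMap.det K
  have h5 : d ^ 4 = 1 := by linear_combination h3
  exact (pow_eq_one_iff_of_nonneg h4 (by norm_num)).1 h5

variable {ι : Type*} [Fintype ι]

/-- The bilinear form `(u, v) ↦ Re (η (u, iv))`. -/
def metricOfForm (η : CForm (ι → ℂ) 2) : Bilin (ι → ℂ) :=
  LinearMap.toContinuousBilinearMap
    (LinearMap.mk₂ ℝ (fun u v : ι → ℂ => (η ![u, I • v]).re)
      (fun u u' v => by rw [CForm.two_add_left, add_re])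
      (fun c u v => by rw [CForm.two_smul_left]; simp)
      (fun u v v' => by rw [smul_add, CForm.two_add_right, add_re])
      (fun c u v => by rw [smul_comm, CForm.two_smul_right]; simp))

theorem metricOfForm_apply (η : CForm (ι → ℂ) 2) (u v : ι → ℂ) :
    metricOfForm η u v = (η ![u, I • v]).re := rfl

theorem isHermInner_metricOfForm {η : CForm (ι → ℂ) 2}
    (hI : ∀ u v, η ![I • u, I • v] = η ![u, v]) (hpos : ∀ u, u ≠ 0 → 0 < (η ![u, I • u]).re) :
    IsHermInner (metricOfForm η) := by
  refine ⟨fun u v => ?_, fun u v => ?_, fun u hu => hpos u hu⟩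
  · rw [metricOfForm_apply, metricOfForm_apply, ← hI v, smul_smul, I_mul_I, CForm.two_swap]
    have := CForm.two_smul_right η (-1) (I • v) u
    rw [neg_one_smul, neg_one_smul] at this
    rw [neg_one_smul, this]
  · rw [metricOfForm_apply, metricOfForm_apply, hI]

theorem kahlerForm_metricOfForm {η : CForm (ι → ℂ) 2} (hr : ∀ v, (η v).im = 0)
    (hI : ∀ u v, η ![I • u, I • v] = η ![u, v]) (hpos : ∀ u, u ≠ 0 → 0 < (η ![u, I • u]).re) :
    kahlerForm (metricOfForm η) = η := by
  refine CForm.ext_two fun u v => ?_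
  rw [kahlerForm_apply (isHermInner_metricOfForm hI hpos), metricOfForm_apply, hI]
  exact Complex.ext (by simp) (by simp [hr])

theorem IsHermInner.smul {g : Bilin (ι → ℂ)} (hg : IsHermInner g) {c : ℝ} (hc : 0 < c) :
    IsHermInner (c • g) := by
  refine ⟨fun u v => ?_, fun u v => ?_, fun u hu => ?_⟩
  · simp [hg.1 u v]
  · simp [hg.2.1 u v]
  · simpa using mul_pos hc (hg.2.2 u hu)

theorem kahlerForm_smul (g : Bilin (ι → ℂ)) (c : ℝ) : kahlerForm (c • g) = (c : ℂ) • kahlerForm g := by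
  have : kahlerForm (c • g) = c • kahlerForm g := (fundFormLin (cpx ι)).map_smul c g
  rw [this]; ext v; simp

theorem IsHermInner.apply_eq_kahlerForm {g : Bilin (ι → ℂ)} (hg : IsHermInner g) (u v : ι → ℂ) :
    (g u v : ℂ) = kahlerForm g ![u, I • v] := by
  rw [kahlerForm_apply hg, hg.2.1]

/-- The two matrices differ by the matrix of multiplication by i, of determinant 1. So the
Riemannian volume of a cell can be read off from the Kähler form on a lattice basis, that is, from
the matrix Q. -/
theorem kahler_gram_eq {κ : Type*} [Fintype κ] [DecidableEq κ] (b : Module.Basis κ ℝ (ι → ℂ))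
    {g : Bilin (ι → ℂ)} :
    (Matrix.of fun i j => g (I • b i) (b j)).det = (Matrix.of fun i j => g (b i) (b j)).det := by
  have : (Matrix.of fun i j => g (I • b i) (b j)) =
      (LinearMap.toMatrix b b (I • (LinearMap.id : (ι → ℂ) →ₗ[ℝ] ι → ℂ))).transpose *
        Matrix.of fun i j => g (b i) (b j) := by
    ext i j
    have h : I • b i = ∑ k, LinearMap.toMatrix b b (I • (LinearMap.id : (ι → ℂ) →ₗ[ℝ] ι → ℂ)) k i • b k := by
      conv_lhs => rw [← b.sum_repr (I • b i)]
      simp [LinearMap.toMatrix_apply]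
    rw [Matrix.of_apply, h, Matrix.mul_apply]
    simp [map_sum, sum_apply]
  rw [this, Matrix.det_mul, Matrix.det_transpose, det_I_smul_eq_one, one_mul]

theorem IsHermInner.gram_det_pos {κ : Type*} [Fintype κ] [DecidableEq κ]
    (b : Module.Basis κ ℝ (ι → ℂ)) {g : Bilin (ι → ℂ)} (hg : IsHermInner g) :
    0 < (Matrix.of fun i j => g (b i) (b j)).det := by
  have : (Matrix.of fun i j => g (b i) (b j)).PosDef := by
    refine Matrix.PosDef.of_dotProduct_mulVec_pos ?_ fun x hx => ?_
    · ext i j; simp [hg.1 (b i) (b j)]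
    · have h : star x ⬝ᵥ (Matrix.of fun i j => g (b i) (b j)).mulVec x =
          g (∑ i, x i • b i) (∑ i, x i • b i) := by
        simp [dotProduct, Matrix.mulVec, map_sum, sum_apply, Finset.mul_sum, mul_comm, hg.1]
      rw [h]
      refine hg.2.2 _ fun h0 => hx ?_
      have := Fintype.linearIndependent_iff.1 b.linearIndependent x h0
      exact funext this
  exact this.det_pos

end HermitianForms
-- Lattice bases and the volume of a torus
section LatticeBasis

open Complex MeasureTheory

variable {m : ℕ} {L : AddSubgroup (Fin m → ℂ)} {τ σ : Fin m ⊕ Fin m → Fin m → ℂ}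

theorem IsLatticeBasis.mem (h : IsLatticeBasis L τ) (a : Fin m ⊕ Fin m) : τ a ∈ L := by
  rw [h.2]; exact AddSubgroup.subset_closure (Set.mem_range_self a)

theorem IsLatticeBasis.exists_int (h : IsLatticeBasis L τ) {l : Fin m → ℂ} (hl : l ∈ L) :
    ∃ N : Fin m ⊕ Fin m → ℤ, l = ∑ a, (N a : ℝ) • τ a := by
  rw [h.2, ← Submodule.span_int_eq_addSubgroupClosure, Submodule.mem_toAddSubgroup,
    Submodule.mem_span_range_iff_exists_fun] at hl
  obtain ⟨N, hN⟩ := hl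
  refine ⟨N, ?_⟩
  rw [← hN]
  exact Finset.sum_congr rfl fun a _ => (Int.cast_smul_eq_zsmul ℝ _ _).symm

/-- Two bases of a lattice are related by a unimodular integer matrix. -/
theorem IsLatticeBasis.exists_change (hτ : IsLatticeBasis L τ) (hσ : IsLatticeBasis L σ) :
    ∃ N : Matrix (Fin m ⊕ Fin m) (Fin m ⊕ Fin m) ℤ, N.det ^ 2 = 1 ∧
      ∀ b, σ b = ∑ a, (N a b : ℝ) • τ a := by
  choose N hN using fun b => hτ.exists_int (hσ.mem b)
  choose M hM using fun b => hσ.exists_int (hτ.mem b)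
  refine ⟨Matrix.of fun a b => N b a, ?_, fun b => hN b⟩
  have h1 : (Matrix.of fun a b => N b a) * (Matrix.of fun a b => M b a) = 1 := by
    ext c b
    have h2 : ∑ a, (∑ d, (N d a : ℝ) * M b d) • τ a = ∑ a, (if a = b then (1 : ℝ) else 0) • τ a := by
      simp only [ite_smul, one_smul, zero_smul, Finset.sum_ite_eq', Finset.mem_univ, if_true,
        Finset.sum_smul]
      conv_rhs => rw [hM b]
      rw [Finset.sum_comm]
      refine Finset.sum_congr rfl fun d _ => ?_
      rw [hN d, Finset.smul_sum]
      exact Finset.sum_congr rfl fun a _ => by rw [smul_smul, mul_comm]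
    have h3 := congrFun (hτ.1.fintypeLinearCombination_injective
      (a₁ := fun a => ∑ d, (N d a : ℝ) * M b d) (a₂ := fun a => if a = b then 1 else 0)
      (by rw [Fintype.linearCombination_apply, Fintype.linearCombination_apply]; exact h2)) c
    simp only [Matrix.mul_apply, Matrix.of_apply, Matrix.one_apply]
    exact_mod_cast h3
  have h2 := congrArg Matrix.det h1
  rw [Matrix.det_mul, Matrix.det_one] at h2
  rcases Int.eq_one_or_neg_one_of_mul_eq_one h2 with h | h <;> rw [h] <;> rfl

theorem gram_det_change (g : Bilin (Fin m → ℂ)) (N : Matrix (Fin m ⊕ Fin m) (Fin m ⊕ Fin m) ℤ)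
    (hN : N.det ^ 2 = 1) (h : ∀ b, σ b = ∑ a, (N a b : ℝ) • τ a) :
    (Matrix.of fun a b => g (σ a) (σ b)).det = (Matrix.of fun a b => g (τ a) (τ b)).det := by
  have : (Matrix.of fun a b => g (σ a) (σ b)) = (N.map (Int.cast : ℤ → ℝ)).transpose *
      (Matrix.of fun a b => g (τ a) (τ b)) * N.map (Int.cast : ℤ → ℝ) := by
    ext a b
    simp only [Matrix.of_apply, h, map_sum, map_smul, sum_apply, smul_apply, Matrix.mul_apply,
      Matrix.transpose_apply, Matrix.map_apply, smul_eq_mul, Finset.sum_mul, Finset.mul_sum]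
    refine Finset.sum_congr rfl fun c _ => Finset.sum_congr rfl fun d _ => by ring
  rw [this, Matrix.det_mul, Matrix.det_mul, Matrix.det_transpose]
  have h1 : (N.map (Int.cast : ℤ → ℝ)).det = (N.det : ℝ) := (Int.cast_det N).symm
  have h2 : ((N.det : ℝ)) ^ 2 = 1 := by exact_mod_cast hN
  rw [h1]
  linear_combination (Matrix.of fun a b => g (τ a) (τ b)).det * h2

/-- `HasVolume` refers to some lattice basis. The change to `τ` is unimodular, so it does not affect
the Gram determinant. -/
theorem hasVolume_const_iff (hτ : IsLatticeBasis L τ) {g : (Fin m → ℂ) → Bilin (Fin m → ℂ)}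
    {g₀ : Bilin (Fin m → ℂ)} (hg : ∀ w, g w = g₀) {ε : ℝ} :
    HasVolume L g ε ↔ Real.sqrt (Matrix.of fun a b => g₀ (I • τ a) (τ b)).det = ε := by
  have key : ∀ σ : Fin m ⊕ Fin m → Fin m → ℂ, ∫ t in Set.Icc (0 : Fin m ⊕ Fin m → ℝ) 1, Real.sqrt (Matrix.det (Matrix.of
      fun a b : Fin m ⊕ Fin m => g (∑ c, t c • σ c) (σ a) (σ b))) =
      Real.sqrt (Matrix.of fun a b => g₀ (σ a) (σ b)).det := by
    intro σ
    simp [hg, Measure.real, Real.volume_Icc_pi]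
  have e : (Matrix.of fun a b => g₀ (I • τ a) (τ b)).det =
      (Matrix.of fun a b => g₀ (τ a) (τ b)).det := by
    simpa only [hτ.basis_apply] using kahler_gram_eq hτ.basis (g := g₀)
  rw [e]
  constructor
  · rintro ⟨σ, hσ, h⟩
    obtain ⟨N, hN, h'⟩ := hτ.exists_change hσ
    rw [key, gram_det_change g₀ N hN h'] at h
    exact h
  · intro h
    exact ⟨τ, hτ, (key τ).trans h⟩

theorem hasConstCurvature_const {V : Type*} [NormedAddCommGroup V] [NormedSpace ℝ V] (W : Set V)
    (g : Bilin V) : HasConstCurvature W (fun _ => g) 0 := by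
  refine ⟨fun _ => 0, ⟨contDiffOn_const, fun _ _ _ _ => rfl, fun x _ u v w => ?_⟩,
    fun x _ u v w => ?_⟩
  · simp
  · simp [curvature]

theorem isKahlerMetric_const {ι : Type*} [Fintype ι] (W : Set (ι → ℂ)) {g : Bilin (ι → ℂ)}
    (hg : IsHermInner g) : IsKahlerMetric W fun _ => g := by
  refine ⟨contDiffOn_const, fun _ _ => hg, fun x _ => ?_⟩
  rw [extDeriv_two_eq_zero_iff (differentiableAt_const _)]
  simp

/-- A flat Kähler metric on a torus is translation invariant, and its volume is the square root of
the determinant of its Kähler form on a basis of the lattice. -/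
theorem isFlatKahlerTorus_iff (hτ : IsLatticeBasis L τ) {g : (Fin m → ℂ) → Bilin (Fin m → ℂ)}
    {ε : ℝ} : IsFlatKahlerTorus L ε g ↔ (∀ w, g w = g 0) ∧ IsHermInner (g 0) ∧
      Real.sqrt (Matrix.of fun a b => g 0 (I • τ a) (τ b)).det = ε := by
  constructor
  · rintro ⟨hK, hp, hc, hv⟩
    have h := isPeriodic_flatKahler_const hτ hK hp hc
    exact ⟨h, hK.2.1 0 trivial, (hasVolume_const_iff hτ h).1 hv⟩
  · rintro ⟨h, hh, hv⟩
    have e : g = fun _ => g 0 := funext h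
    refine ⟨?_, fun l _ w => ?_, ?_, (hasVolume_const_iff hτ h).2 hv⟩
    · rw [e]; exact isKahlerMetric_const _ hh
    · rw [h, h w]
    · rw [e]; exact hasConstCurvature_const _ _

end LatticeBasis

/-! ### Constant polarizations and their period matrices -/

section Polarization

open Complex MeasureTheory

variable {m n : ℕ}

theorem cellAverage_re_pos {τ : Fin m ⊕ Fin m → Fin m → ℂ} {f : (Fin m → ℂ) → ℂ} (hf : Continuous f)
    (hpos : ∀ w, 0 < (f w).re) : 0 < (cellAverage τ f).re := by
  have hc : Continuous fun t : Fin m ⊕ Fin m → ℝ => f (∑ c, t c • τ c) := by fun_prop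
  have hint : IntegrableOn (fun t : Fin m ⊕ Fin m → ℝ => f (∑ c, t c • τ c)) (Set.Icc 0 1) :=
    hc.integrableOn_Icc
  have h1 : (cellAverage τ f).re =
      ∫ t in Set.Icc (0 : Fin m ⊕ Fin m → ℝ) 1, (f (∑ c, t c • τ c)).re :=
    (Complex.reCLM.integral_comp_comm hint).symm
  obtain ⟨t₀, -, ht₀⟩ := (isCompact_Icc (a := (0 : Fin m ⊕ Fin m → ℝ)) (b := 1)).exists_isMinOn
    ⟨0, by simp⟩ (f := fun t => (f (∑ c, t c • τ c)).re) (by fun_prop)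
  rw [h1]
  have h2 : ∫ _t in Set.Icc (0 : Fin m ⊕ Fin m → ℝ) 1, (f (∑ c, t₀ c • τ c)).re ≤
      ∫ t in Set.Icc (0 : Fin m ⊕ Fin m → ℝ) 1, (f (∑ c, t c • τ c)).re :=
    setIntegral_mono_on (Continuous.integrableOn_Icc continuous_const) hint.re measurableSet_Icc fun t ht => ht₀ ht
  refine lt_of_lt_of_le (hpos (∑ c, t₀ c • τ c)) (le_trans (le_of_eq ?_) h2)
  simp [Measure.real, Real.volume_Icc_pi]

theorem cellAverage_im {τ : Fin m ⊕ Fin m → Fin m → ℂ} {f : (Fin m → ℂ) → ℂ} (hf : Continuous f)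
    (h : ∀ w, (f w).im = 0) : (cellAverage τ f).im = 0 := by
  have hc : Continuous fun t : Fin m ⊕ Fin m → ℝ => f (∑ c, t c • τ c) := by fun_prop
  have h1 : (cellAverage τ f).im =
      ∫ t in Set.Icc (0 : Fin m ⊕ Fin m → ℝ) 1, (f (∑ c, t c • τ c)).im :=
    (Complex.imCLM.integral_comp_comm hc.integrableOn_Icc).symm
  rw [h1]; simp [h]

theorem totalSet_isOpen {U : Set (Fin n → ℂ)} (hU : IsOpen U) : IsOpen (totalSet m U) :=
  hU.preimage (by unfold basePart; fun_prop)

theorem continuous_elim_pi {X : Type*} [TopologicalSpace X] {f : X → Fin n → ℂ} {g : X → Fin m → ℂ}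
    (hf : Continuous f) (hg : Continuous g) : Continuous fun x => (Sum.elim (f x) (g x) : _ → ℂ) := by
  refine continuous_pi fun i => ?_
  cases i with
  | inl i => exact (continuous_apply i).comp hf
  | inr i => exact (continuous_apply i).comp hg

theorem mem_totalSet_elim {U : Set (Fin n → ℂ)} {z : Fin n → ℂ} {w : Fin m → ℂ} :
    (Sum.elim z w : Fin n ⊕ Fin m → ℂ) ∈ totalSet m U ↔ z ∈ U := Iff.rfl

variable {U : Set (Fin n → ℂ)} {Λ : (Fin n → ℂ) → AddSubgroup (Fin m → ℂ)}
  {ω : (Fin n ⊕ Fin m → ℂ) → CForm (Fin n ⊕ Fin m → ℂ) 2}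

theorem IsFrame.continuousOn {W : Set (Fin n → ℂ)} {T : (Fin n → ℂ) → Matrix (Fin m) (Fin m ⊕ Fin m) ℂ}
    (hT : IsFrame Λ W T) (a : Fin m ⊕ Fin m) : ContinuousOn (fun z j => T z j a) W :=
  continuousOn_pi.2 fun j => (hT.2.1 j a).continuousOn

/-- The constant representatives of the classes of a constant polarization. -/
theorem IsConstPolarization.exists_class (hm : 0 < m) (hL : IsLatticeBundle U Λ)
    (h : IsConstPolarization U Λ ω) : ∃ η : (Fin n → ℂ) → CForm (Fin m → ℂ) 2,
      (∀ z ∈ U, Cohomologous (Λ z) (restrictFib ω z) (fun _ => η z) ∧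
        IsHermInner (metricOfForm (η z)) ∧ kahlerForm (metricOfForm (η z)) = η z) ∧
      ∀ W T, IsFrame Λ W T → W ⊆ U → IsConnected W →
        ∃ Q : Matrix (Fin m ⊕ Fin m) (Fin m ⊕ Fin m) ℝ, ∀ z ∈ W, ∀ a b,
          η z ![fun j => T z j a, fun j => T z j b] = (Q a b : ℂ) := by
  obtain ⟨⟨hω, -⟩, -, hK, N, c, hc⟩ := h
  choose! ξ hξ hco using hc
  have hcont : ∀ z ∈ U, Continuous (restrictFib ω z) := fun z hz =>
    contDiffOn_univ.1 (hK z hz).1.1 |>.continuous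
  have hcont' : ∀ z ∈ U, ∀ v, Continuous fun w => restrictFib ω z w v := fun z hz v => by
    have := hcont z hz
    fun_prop
  -- The combination of integral classes is the fibre average of ω. Reality, type (1,1) and
  -- positivity then pass from ω to this form by averaging.
  have havg : ∀ z ∈ U, ∀ τ, IsLatticeBasis (Λ z) τ → ∀ u v,
      (∑ i, (c i : ℂ) • ξ z i) ![u, v] = cellAverage τ fun w => restrictFib ω z w ![u, v] := by
    intro z hz τ hτ u v
    rw [(hco z hz).cellAverage_eq hm hτ (hcont z hz), cellAverage_const]
  refine ⟨fun z => ∑ i, (c i : ℂ) • ξ z i, fun z hz => ?_, fun W T hT hWU hW => ?_⟩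
  · obtain ⟨W, T, hzW, -, hT⟩ := hL.2 z hz
    have hτ := hT.2.2 z hzW
    have hI : ∀ u v, (∑ i, (c i : ℂ) • ξ z i) ![I • u, I • v] =
        (∑ i, (c i : ℂ) • ξ z i) ![u, v] := by
      intro u v
      rw [havg z hz _ hτ, havg z hz _ hτ]
      congr 1
      funext w
      exact (hK z hz).2.2.1 w trivial u v
    have hpos : ∀ u, u ≠ 0 → 0 < ((∑ i, (c i : ℂ) • ξ z i) ![u, I • u]).re := by
      intro u hu
      rw [havg z hz _ hτ]
      exact cellAverage_re_pos (hcont' z hz _) fun w => (hK z hz).2.2.2 w trivial u hu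
    have hr : ∀ v, ((∑ i, (c i : ℂ) • ξ z i) v).im = 0 := by
      intro v
      have : v = ![v 0, v 1] := by ext i; fin_cases i <;> rfl
      rw [this, havg z hz _ hτ]
      exact cellAverage_im (hcont' z hz _) fun w => (hK z hz).1.2 w trivial _
    exact ⟨hco z hz, isHermInner_metricOfForm hI hpos, kahlerForm_metricOfForm hr hI hpos⟩
  · obtain ⟨z₀, hz₀⟩ := hW.1
    refine ⟨Matrix.of fun a b => ((∑ i, (c i : ℂ) • ξ z₀ i)
      ![fun j => T z₀ j a, fun j => T z₀ j b]).re, fun z hz a b => ?_⟩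
    set q : (Fin n → ℂ) → ℂ := fun z => (∑ i, (c i : ℂ) • ξ z i) ![fun j => T z j a, fun j => T z j b]
    -- The ξ_i are chosen separately for each z, with no continuity. Continuity comes from writing q
    -- as an integral of ω over a moving cell.
    have hq : ContinuousOn q W := by
      have e : ∀ z ∈ W, q z = ∫ t in Set.Icc (0 : Fin m ⊕ Fin m → ℝ) 1,
          ω (Sum.elim z (∑ c, t c • fun j => T z j c))
            ![vert n m fun j => T z j a, vert n m fun j => T z j b] := by
        intro z hz
        have := havg z (hWU hz) _ (hT.2.2 z hz) (fun j => T z j a) (fun j => T z j b)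
        simp only [restrictFib, compContinuousLinearMap_two] at this
        exact this
      refine ContinuousOn.congr ?_ e
      rw [continuousOn_iff_continuous_domRestrict]
      have : LocallyCompactSpace W := hT.1.locallyCompactSpace
      have hTc : ∀ a, Continuous fun z : W => (fun j => T z j a) := fun a =>
        continuousOn_iff_continuous_domRestrict.1 (hT.continuousOn a)
      refine continuous_parametric_integral_of_continuous (X := W)
        (f := fun (z : W) (t : Fin m ⊕ Fin m → ℝ) =>
          ω (Sum.elim z (∑ c, t c • fun j => T z j c))
            ![vert n m fun j => T z j a, vert n m fun j => T z j b]) ?_ isCompact_Icc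
      have h1 : Continuous fun p : W × (Fin m ⊕ Fin m → ℝ) =>
          ω (Sum.elim (p.1 : Fin n → ℂ) (∑ c, p.2 c • fun j => T p.1 j c)) := by
        refine hω.continuousOn.comp_continuous (continuous_elim_pi (by fun_prop) ?_) fun p =>
          mem_totalSet_elim.2 (hWU p.1.2)
        refine continuous_finsetSum _ fun c _ => ?_
        exact ((continuous_apply c).comp continuous_snd).smul ((hTc c).comp continuous_fst)
      have h2 : ∀ a, Continuous fun p : W × (Fin m ⊕ Fin m → ℝ) =>
          vert n m fun j => T p.1 j a := fun a =>
        (vert n m).continuous.comp ((hTc a).comp continuous_fst)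
      refine h1.eval (continuous_pi fun i => ?_)
      fin_cases i
      exacts [h2 a, h2 b]
    -- Integral classes take integer values on lattice vectors, so q has values in a countable set.
    -- A continuous function with countable image on a connected set is constant.
    have hval : ∀ z ∈ W, q z ∈ Set.range fun k : Fin N → ℤ => ∑ i, (c i : ℂ) * (k i : ℂ) := by
      intro z hz
      choose k hk using fun i => hξ z (hWU hz) i _ ((hT.2.2 z hz).mem a) _ ((hT.2.2 z hz).mem b)
      refine ⟨k, ?_⟩
      simp [q, hk]
    have hconst : q z = q z₀ :=
      (Set.countable_range _).isTotallyDisconnected (q '' W) (Set.image_subset_iff.2 hval)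
        (hW.isPreconnected.image q hq) ⟨z, hz, rfl⟩ ⟨z₀, hz₀, rfl⟩
    have hreal : (q z₀).im = 0 := by
      simp only [q]
      rw [havg z₀ (hWU hz₀) _ (hT.2.2 z₀ hz₀)]
      exact cellAverage_im (hcont' _ (hWU hz₀) _) fun w => (hK _ (hWU hz₀)).1.2 w trivial _
    change q z = _
    rw [hconst]
    exact Complex.ext (by simp [q]) (by simp [hreal])

end Polarization
end

noncomputable section

/-! ### Smoothness of holomorphic functions of several variables -/

section SeveralComplexVariables

open Complex Metric MeasureTheory

variable {κ : Type*} [Fintype κ]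

theorem hasDerivAt_line {f : (κ → ℂ) → ℂ} {z v : κ → ℂ} {ζ : ℂ}
    (h : DifferentiableAt ℂ f (z + ζ • v)) :
    HasDerivAt (fun ζ : ℂ => f (z + ζ • v)) (fderiv ℂ f (z + ζ • v) v) ζ := by
  have h2 : HasDerivAt (fun ζ : ℂ => z + ζ • v) v ζ := by
    simpa using ((hasDerivAt_id ζ).smul_const v).const_add z
  exact h.hasFDerivAt.comp_hasDerivAt ζ h2

theorem mem_ball_of_small {z₀ z v : κ → ℂ} {ζ : ℂ} {r s t : ℝ} (hz : z ∈ ball z₀ r)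
    (hζ : ‖ζ‖ ≤ t) (hv : t * ‖v‖ ≤ s) : z + ζ • v ∈ ball z₀ (r + s) := by
  rw [mem_ball, dist_eq_norm] at hz ⊢
  have h1 : ‖ζ • v‖ ≤ s := by
    rw [norm_smul]
    exact (mul_le_mul_of_nonneg_right hζ (norm_nonneg v)).trans hv
  calc ‖z + ζ • v - z₀‖ = ‖(z - z₀) + ζ • v‖ := by congr 1; abel
    _ ≤ ‖z - z₀‖ + ‖ζ • v‖ := norm_add_le _ _
    _ < r + s := add_lt_add_of_lt_of_le hz h1

/-- The Cauchy estimate on the disc of radius r / ‖v‖ in the complex line through z in direction v.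
-/
theorem norm_fderiv_le_of_bounded {f : (κ → ℂ) → ℂ} {z₀ : κ → ℂ} {r M : ℝ} (hr : 0 < r)
    (hf : DifferentiableOn ℂ f (ball z₀ (r + r))) (hM : ∀ z ∈ ball z₀ (r + r), ‖f z‖ ≤ M)
    {z : κ → ℂ} (hz : z ∈ ball z₀ r) : ‖fderiv ℂ f z‖ ≤ M / r := by
  have hM0 : 0 ≤ M := (norm_nonneg _).trans (hM z₀ (mem_ball_self (by linarith)))
  refine ContinuousLinearMap.opNorm_le_bound _ (by positivity) fun v => ?_
  rcases eq_or_ne v 0 with rfl | hv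
  · simp
  have hv' : 0 < ‖v‖ := norm_pos_iff.2 hv
  have hmem : ∀ ζ : ℂ, ‖ζ‖ ≤ r / ‖v‖ → z + ζ • v ∈ ball z₀ (r + r) := fun ζ hζ =>
    mem_ball_of_small hz hζ (by rw [div_mul_cancel₀ _ hv'.ne'])
  have hd : ∀ ζ : ℂ, ‖ζ‖ ≤ r / ‖v‖ → HasDerivAt (fun ζ : ℂ => f (z + ζ • v))
      (fderiv ℂ f (z + ζ • v) v) ζ := fun ζ hζ =>
    hasDerivAt_line (hf.differentiableAt (isOpen_ball.mem_nhds (hmem ζ hζ)))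
  have h1 := norm_deriv_le_of_forall_mem_sphere_norm_le (c := (0 : ℂ)) (R := r / ‖v‖) (C := M)
    (f := fun ζ : ℂ => f (z + ζ • v)) (by positivity)
    (DifferentiableOn.diffContOnCl (fun ζ hζ => by
      have : ‖ζ‖ ≤ r / ‖v‖ := by simpa using closure_ball_subset_closedBall hζ
      exact (hd ζ this).differentiableAt.differentiableWithinAt))
    (fun ζ hζ => hM _ (hmem ζ (by simpa using hζ.le)))
  have h2 := (hd 0 (by simp; positivity)).deriv
  simp only [zero_smul, add_zero] at h2
  rw [h2] at h1
  calc _ ≤ M / (r / ‖v‖) := h1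
    _ = M / r * ‖v‖ := by field_simp

/-- Cauchy's formula on the line z + ζv writes the directional derivative as a circle integral of
values of f. This integral can be differentiated in z under the integral sign, with the Lipschitz
bound supplied by the Cauchy estimate. -/
theorem differentiableAt_fderiv_apply {f : (κ → ℂ) → ℂ} {W : Set (κ → ℂ)} (hW : IsOpen W)
    (hf : DifferentiableOn ℂ f W) {z₀ : κ → ℂ} (hz : z₀ ∈ W) (v : κ → ℂ) :
    DifferentiableAt ℂ (fun z => fderiv ℂ f z v) z₀ := by
  rcases eq_or_ne v 0 with rfl | hv
  · simp
  have hv' : 0 < ‖v‖ := norm_pos_iff.2 hv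
  obtain ⟨M, ρ, hρ, hsub, hM⟩ : ∃ M ρ : ℝ, 0 < ρ ∧ ball z₀ ρ ⊆ W ∧ ∀ z ∈ ball z₀ ρ, ‖f z‖ ≤ M := by
    have hc := (hf.differentiableAt (hW.mem_nhds hz)).continuousAt
    obtain ⟨ρ₁, h1, h1'⟩ := Metric.isOpen_iff.1 hW z₀ hz
    obtain ⟨ρ₂, h2, h2'⟩ := Metric.continuousAt_iff.1 hc 1 one_pos
    refine ⟨‖f z₀‖ + 1, min ρ₁ ρ₂, lt_min h1 h2, (ball_subset_ball (min_le_left _ _)).trans h1',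
      fun z hz => ?_⟩
    have := h2' (lt_of_lt_of_le hz (min_le_right _ _))
    rw [dist_eq_norm] at this
    calc ‖f z‖ = ‖f z₀ + (f z - f z₀)‖ := by congr 1; ring
      _ ≤ _ := (norm_add_le _ _).trans (by linarith)
  -- For z within r of z₀ the points z + ζv stay within 2r, and the Cauchy estimate there needs
  -- another 2r.
  set r := ρ / 4 with hr
  have hr0 : 0 < r := by positivity
  have hρr : ρ = (r + r) + (r + r) := by rw [hr]; ring
  set t := r / ‖v‖ with ht
  have ht0 : 0 < t := by positivity
  have htv : t * ‖v‖ ≤ r := by rw [ht, div_mul_cancel₀ _ hv'.ne']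
  have hfd : ∀ z ∈ ball z₀ ρ, DifferentiableAt ℂ f z := fun z hz =>
    hf.differentiableAt (hW.mem_nhds (hsub hz))
  have hmem : ∀ z ∈ ball z₀ r, ∀ ζ : ℂ, ‖ζ‖ ≤ t → z + ζ • v ∈ ball z₀ (r + r) :=
    fun z hz ζ hζ => mem_ball_of_small hz hζ htv
  have hsub2 : ball z₀ (r + r) ⊆ ball z₀ ρ := ball_subset_ball (by linarith)
  have hbound : ∀ z ∈ ball z₀ (r + r), ‖fderiv ℂ f z‖ ≤ M / (r + r) := fun z hz =>
    norm_fderiv_le_of_bounded (by positivity)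
      (fun z hz => (hfd z (by rwa [hρr])).differentiableWithinAt)
      (fun z hz => hM z (by rwa [hρr])) hz
  have hcirc : ∀ θ : ℝ, ‖circleMap 0 t θ‖ ≤ t := fun θ => by
    simp [abs_of_pos ht0]
  -- The parametrized kernel dζ / ζ² of Cauchy's formula for the first derivative.
  let k : ℝ → ℂ := fun θ => deriv (circleMap 0 t) θ * (1 / (circleMap 0 t θ - 0) ^ 2)
  have hk : Continuous k := by
    have h1 : ∀ θ, circleMap (0 : ℂ) t θ - 0 ≠ 0 := fun θ => by
      rw [sub_zero]; exact circleMap_ne_center ht0.ne'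
    simp only [k, deriv_circleMap]
    have := continuous_circleMap 0 t
    exact (this.mul continuous_const).mul (continuous_const.div ((this.sub continuous_const).pow 2)
      fun θ => pow_ne_zero 2 (h1 θ))
  have hrep : ∀ z ∈ ball z₀ r, fderiv ℂ f z v = (2 * Real.pi * I)⁻¹ *
      ∫ θ in (0 : ℝ)..2 * Real.pi, k θ * f (z + circleMap 0 t θ • v) := by
    intro z hz
    have hd : ∀ ζ ∈ closedBall (0 : ℂ) t, DifferentiableAt ℂ (fun ζ : ℂ => f (z + ζ • v)) ζ := by
      intro ζ hζ
      exact (hasDerivAt_line (hfd _ (hsub2 (hmem z hz ζ (by simpa using hζ))))).differentiableAt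
    have h1 := DifferentiableOn.deriv_eq_smul_circleIntegral (c := (0 : ℂ)) ht0
      (f := fun ζ : ℂ => f (z + ζ • v)) fun ζ hζ => (hd ζ hζ).differentiableWithinAt
    have h2 := (hasDerivAt_line (f := f) (z := z) (v := v) (ζ := 0)
      (hfd _ (hsub2 (hmem z hz 0 (by simpa using ht0.le))))).deriv
    simp only [zero_smul, add_zero] at h2
    rw [h2, circleIntegral] at h1
    have h3 : (2 * Real.pi * I : ℂ) ≠ 0 := by simp [Real.pi_ne_zero]
    rw [eq_inv_mul_iff_mul_eq₀ h3, ← smul_eq_mul, ← h1]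
    refine intervalIntegral.integral_congr fun θ _ => ?_
    simp only [k, smul_eq_mul]
    ring
  have hcont : ∀ z ∈ ball z₀ r, Continuous fun θ => k θ * f (z + circleMap 0 t θ • v) := by
    intro z hz
    refine hk.mul (continuous_iff_continuousAt.2 fun θ => ?_)
    exact ContinuousAt.comp (g := f) (f := fun θ => z + circleMap 0 t θ • v)
      (hfd _ (hsub2 (hmem z hz _ (hcirc θ)))).continuousAt
      (by have := continuous_circleMap 0 t; fun_prop)
  have hz₀ : z₀ ∈ ball z₀ r := mem_ball_self hr0
  obtain ⟨K, hK⟩ := (isCompact_Icc (a := (0 : ℝ)) (b := 2 * Real.pi)).exists_bound_of_continuousOn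
    hk.continuousOn
  have key := intervalIntegral.hasFDerivAt_integral_of_dominated_loc_of_lip (𝕜 := ℂ) (μ := volume)
    (a := 0) (b := 2 * Real.pi) (F := fun z θ => k θ * f (z + circleMap 0 t θ • v))
    (F' := fun θ => k θ • fderiv ℂ f (z₀ + circleMap 0 t θ • v)) (x₀ := z₀) (s := ball z₀ r)
    (bound := fun _ => K * (M / (r + r))) (isOpen_ball.mem_nhds hz₀)
    (by
      filter_upwards [isOpen_ball.mem_nhds hz₀] with z hz
      exact (hcont z hz).aestronglyMeasurable)
    ((hcont z₀ hz₀).intervalIntegrable _ _)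
    (by
      -- Continuity of the derivative is not yet known at this stage; its measurability is enough.
      borelize (κ → ℂ)
      have : ProperSpace ((κ → ℂ) →L[ℂ] ℂ) := FiniteDimensional.proper ℂ _
      borelize ((κ → ℂ) →L[ℂ] ℂ)
      have h1 : Measurable fun θ : ℝ => z₀ + circleMap 0 t θ • v := by
        have := continuous_circleMap 0 t
        exact Continuous.measurable (by fun_prop)
      have h2 := (measurable_fderiv ℂ f).comp h1
      exact (hk.stronglyMeasurable.smul h2.stronglyMeasurable).aestronglyMeasurable)
    (Filter.Eventually.of_forall fun θ hθ => by
      have hθ' : θ ∈ Set.Icc 0 (2 * Real.pi) := by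
        rw [Set.uIoc_of_le (by positivity)] at hθ
        exact Set.Ioc_subset_Icc_self hθ
      have hKθ := hK θ hθ'
      have hK0 : 0 ≤ K := (norm_nonneg _).trans hKθ
      have hM0 : 0 ≤ M := (norm_nonneg _).trans (hM z₀ (mem_ball_self hρ))
      refine LipschitzOnWith.of_dist_le_mul fun x hx y hy => ?_
      have h1 := (convex_ball z₀ (r + r)).norm_image_sub_le_of_norm_fderiv_le (𝕜 := ℂ) (f := f)
        (fun z hz => hfd z (hsub2 hz)) hbound (hmem y hy _ (hcirc θ)) (hmem x hx _ (hcirc θ))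
      have h2 : x + circleMap 0 t θ • v - (y + circleMap 0 t θ • v) = x - y := by abel
      rw [h2] at h1
      rw [dist_eq_norm, dist_eq_norm, ← mul_sub, norm_mul, Real.coe_nnabs, abs_of_nonneg (by positivity),
        mul_assoc]
      exact mul_le_mul hKθ h1 (norm_nonneg _) hK0)
    intervalIntegrable_const
    (Filter.Eventually.of_forall fun θ _ => by
      have h1 := (hfd _ (hsub2 (hmem z₀ hz₀ _ (hcirc θ)))).hasFDerivAt
      have h2 : HasFDerivAt (fun z => f (z + circleMap 0 t θ • v))
          (fderiv ℂ f (z₀ + circleMap 0 t θ • v)) z₀ := by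
        have := h1.comp z₀ ((hasFDerivAt_id z₀).add_const (circleMap 0 t θ • v))
        exact this
      exact h2.const_smul (k θ))
  have h4 : (fun z => fderiv ℂ f z v) =ᶠ[nhds z₀] fun z => (2 * Real.pi * I : ℂ)⁻¹ *
      ∫ θ in (0 : ℝ)..2 * Real.pi, k θ * f (z + circleMap 0 t θ • v) := by
    filter_upwards [isOpen_ball.mem_nhds hz₀] with z hz using hrep z hz
  exact (key.2.differentiableAt.const_mul _).congr_of_eventuallyEq h4

/-- Holomorphic functions of several variables are smooth. -/
theorem DifferentiableOn.contDiffOn_complex {f : (κ → ℂ) → ℂ} {W : Set (κ → ℂ)} (hW : IsOpen W)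
    (hf : DifferentiableOn ℂ f W) : ContDiffOn ℂ (⊤ : ℕ∞) f W := by
  rw [contDiffOn_infty]
  intro k
  induction k generalizing f with
  | zero => exact contDiffOn_zero.2 hf.continuousOn
  | succ k ih =>
    have h : ContDiffOn ℂ ((k : WithTop ℕ∞) + 1) f W := by
      refine contDiffOn_succ_of_fderiv_apply hf (fun h => ?_) fun v => ?_
      · exact absurd h (by simp)
      refine (ih (f := fun z => fderiv ℂ f z v) fun z hz =>
        (differentiableAt_fderiv_apply hW hf hz v).differentiableWithinAt).congr fun z hz => ?_
      rw [fderivWithin_of_isOpen hW hz]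
    exact_mod_cast h

theorem DifferentiableOn.contDiffOn_real {f : (κ → ℂ) → ℂ} {W : Set (κ → ℂ)} (hW : IsOpen W)
    (hf : DifferentiableOn ℂ f W) : ContDiffOn ℝ (⊤ : ℕ∞) f W :=
  (hf.contDiffOn_complex hW).restrict_scalars ℝ

end SeveralComplexVariables

/-! ### Smoothness of determinants and inverses -/

section MatrixCalculus

variable {𝕜 K E κ : Type*} [NontriviallyNormedField 𝕜] [NormedField K] [NormedAlgebra 𝕜 K]
  [NormedAddCommGroup E] [NormedSpace 𝕜 E] [Fintype κ] [DecidableEq κ] {s : Set E} {n : WithTop ℕ∞}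

theorem ContDiffOn.matrix_det {A : E → Matrix κ κ K} (h : ∀ i j, ContDiffOn 𝕜 n (fun x => A x i j) s) :
    ContDiffOn 𝕜 n (fun x => (A x).det) s := by
  simp only [Matrix.det_apply']
  exact ContDiffOn.sum fun σ _ => contDiffOn_const.mul (contDiffOn_prod fun i _ => h _ _)

/-- Cramer's rule: the entries of the inverse are quotients of polynomials in the entries. -/
theorem ContDiffOn.matrix_inv {A : E → Matrix κ κ K} (h : ∀ i j, ContDiffOn 𝕜 n (fun x => A x i j) s)
    (hdet : ∀ x ∈ s, (A x).det ≠ 0) (i j : κ) : ContDiffOn 𝕜 n (fun x => (A x)⁻¹ i j) s := by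
  have h1 : ContDiffOn 𝕜 n (fun x => ((A x).updateRow j (Pi.single i 1)).det) s := by
    refine ContDiffOn.matrix_det fun a b => ?_
    by_cases ha : a = j
    · subst ha; simpa using contDiffOn_const
    · simpa [Matrix.updateRow_ne ha] using h a b
  have h2 : ∀ x, (A x)⁻¹ i j = (A x).det⁻¹ * ((A x).updateRow j (Pi.single i 1)).det := fun x => by
    rw [Matrix.inv_def, Matrix.smul_apply, Matrix.adjugate_apply, Ring.inverse_eq_inv', smul_eq_mul]
  simp only [h2]
  exact ((ContDiffOn.matrix_det h).inv hdet).mul h1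

end MatrixCalculus
end

noncomputable section

/-! ### Real fibre coordinates and the horizontal distribution -/

section FrameCoordinates

open Complex

variable {n m : ℕ}

/-- If Tv = 0 and T̄v = 0, then conjugating the second equation gives T v̄ = 0. So Re v and Im v are
real relations among the columns of T. -/
theorem det_fromRows_conjMat_ne_zero {T : Matrix (Fin m) (Fin m ⊕ Fin m) ℂ}
    (h : LinearIndependent ℝ fun (a : Fin m ⊕ Fin m) j => T j a) :
    (Matrix.fromRows T (conjMat T)).det ≠ 0 := by
  intro h0
  obtain ⟨v, hv, hv0⟩ := Matrix.exists_mulVec_eq_zero_iff.2 h0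
  rw [Matrix.fromRows_mulVec] at hv0
  have h1 : ∀ j, ∑ a, T j a * v a = 0 := fun j => congrFun hv0 (Sum.inl j)
  have h2 : ∀ j, ∑ a, starRingEnd ℂ (T j a) * v a = 0 := fun j => congrFun hv0 (Sum.inr j)
  have h3 : ∀ j, ∑ a, T j a * starRingEnd ℂ (v a) = 0 := fun j => by
    have := congrArg (starRingEnd ℂ) (h2 j)
    simpa [map_sum] using this
  rw [Fintype.linearIndependent_iff] at h
  have hre := h (fun a => (v a).re) (by
    ext j
    have e : ∀ a, (v a).re • T j a = (1 / 2 : ℂ) * (T j a * v a + T j a * starRingEnd ℂ (v a)) := by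
      intro a
      rw [← mul_add, add_conj, real_smul]; push_cast; ring
    simp only [Finset.sum_apply, Pi.smul_apply, e, ← Finset.mul_sum, Finset.sum_add_distrib, h1, h3]
    simp)
  have him := h (fun a => (v a).im) (by
    ext j
    have e : ∀ a, (v a).im • T j a =
        (-I / 2 : ℂ) * (T j a * v a - T j a * starRingEnd ℂ (v a)) := by
      intro a
      rw [← mul_sub, sub_conj, real_smul]; push_cast; ring_nf; rw [I_sq]; ring
    simp only [Finset.sum_apply, Pi.smul_apply, e, ← Finset.mul_sum, Finset.sum_sub_distrib, h1, h3]
    simp)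
  exact hv (funext fun a => Complex.ext (hre a) (him a))

/-- The projection to the base. -/
def baseCLM (n m : ℕ) : (Fin n ⊕ Fin m → ℂ) →L[ℂ] (Fin n → ℂ) :=
  ContinuousLinearMap.pi fun j => ContinuousLinearMap.proj (Sum.inl j)

theorem baseCLM_apply (x : Fin n ⊕ Fin m → ℂ) : baseCLM n m x = basePart x := rfl

/-- The real coordinates along the fibres, with respect to a frame of lattice vectors. -/
def frameCoord (T : (Fin n → ℂ) → Matrix (Fin m) (Fin m ⊕ Fin m) ℂ) (a : Fin m ⊕ Fin m)
    (x : Fin n ⊕ Fin m → ℂ) : ℝ :=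
  ((Matrix.fromRows (T (basePart x)) (conjMat (T (basePart x))))⁻¹.mulVec
    (Sum.elim (fibPart x) (fun k => starRingEnd ℂ (fibPart x k))) a).re

variable {Λ : (Fin n → ℂ) → AddSubgroup (Fin m → ℂ)} {W U : Set (Fin n → ℂ)}
  {T T' : (Fin n → ℂ) → Matrix (Fin m) (Fin m ⊕ Fin m) ℂ} {x : Fin n ⊕ Fin m → ℂ}

/-- The real coordinates c of w satisfy (T; T̄) c = (w; w̄). The complex inverse therefore returns
real numbers, and taking real parts in `frameCoord` loses nothing. -/
theorem IsFrame.inv_mulVec (hT : IsFrame Λ W T) (hx : x ∈ totalSet m W) {c : Fin m ⊕ Fin m → ℝ}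
    (hc : ∀ j, fibPart x j = ∑ a, (c a : ℂ) * T (basePart x) j a) :
    (Matrix.fromRows (T (basePart x)) (conjMat (T (basePart x))))⁻¹.mulVec
      (Sum.elim (fibPart x) (fun k => starRingEnd ℂ (fibPart x k))) = fun a => (c a : ℂ) := by
  have hdet := det_fromRows_conjMat_ne_zero (hT.2.2 _ hx).1
  have : (Sum.elim (fibPart x) (fun k => starRingEnd ℂ (fibPart x k)) : Fin m ⊕ Fin m → ℂ) =
      (Matrix.fromRows (T (basePart x)) (conjMat (T (basePart x)))).mulVec fun a => (c a : ℂ) := by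
    rw [Matrix.fromRows_mulVec]
    congr 1
    · ext j
      rw [hc]; exact Finset.sum_congr rfl fun a _ => mul_comm _ _
    · ext j
      rw [hc, map_sum]
      refine Finset.sum_congr rfl fun a _ => ?_
      rw [map_mul, conj_ofReal, mul_comm]; rfl
  rw [this, Matrix.mulVec_mulVec, Matrix.nonsing_inv_mul _ (isUnit_iff_ne_zero.2 hdet),
    Matrix.one_mulVec]

theorem IsFrame.exists_coord (hT : IsFrame Λ W T) {z : Fin n → ℂ} (hz : z ∈ W) (w : Fin m → ℂ) :
    ∃ c : Fin m ⊕ Fin m → ℝ, ∀ j, w j = ∑ a, (c a : ℂ) * T z j a := by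
  refine ⟨(hT.2.2 z hz).basis.repr w, fun j => ?_⟩
  conv_lhs => rw [← (hT.2.2 z hz).basis.sum_repr w]
  simp only [IsLatticeBasis.basis_apply, Finset.sum_apply, Pi.smul_apply, real_smul]

theorem IsFrame.frameCoord_eq (hT : IsFrame Λ W T) (hx : x ∈ totalSet m W)
    {c : Fin m ⊕ Fin m → ℝ} (hc : ∀ j, fibPart x j = ∑ a, (c a : ℂ) * T (basePart x) j a)
    (a : Fin m ⊕ Fin m) : frameCoord T a x = c a := by
  rw [frameCoord, hT.inv_mulVec hx hc, ofReal_re]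

theorem IsFrame.fibPart_eq (hT : IsFrame Λ W T) (hx : x ∈ totalSet m W) (j : Fin m) :
    fibPart x j = ∑ a, (frameCoord T a x : ℂ) * T (basePart x) j a := by
  obtain ⟨c, hc⟩ := hT.exists_coord hx (fibPart x)
  rw [hc]
  exact Finset.sum_congr rfl fun a _ => by rw [hT.frameCoord_eq hx hc]

theorem IsFrame.christoffel_eq (hT : IsFrame Λ W T) (hx : x ∈ totalSet m W) (p : Fin n)
    (j : Fin m) : christoffel T p x j = ∑ a, (frameCoord T a x : ℂ) *
      fderiv ℂ (fun z => T z j a) (basePart x) (Pi.single p 1) := by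
  rw [christoffel, hT.inv_mulVec hx (hT.fibPart_eq hx), Matrix.mulVec, dotProduct]
  exact Finset.sum_congr rfl fun a _ => mul_comm _ _

theorem fderiv_apply_eq_sum_single {ι : Type*} [Fintype ι] [DecidableEq ι] (L : (ι → ℂ) →L[ℂ] ℂ)
    (u : ι → ℂ) : L u = ∑ p, L (Pi.single p 1) * u p := by
  conv_lhs => rw [← Finset.univ_sum_single u]
  rw [map_sum]
  refine Finset.sum_congr rfl fun p _ => ?_
  rw [show (Pi.single p (u p) : ι → ℂ) = u p • Pi.single p 1 by
    rw [← Pi.single_smul, smul_eq_mul, mul_one], map_smul, smul_eq_mul, mul_comm]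

theorem thetaForm_apply (x u : Fin n ⊕ Fin m → ℂ) (j : Fin m) :
    thetaForm T x j u = fibPart u j - ∑ p, christoffel T p x j * basePart u p := by
  simp [thetaForm, dw, dz, dcoord, fibPart, basePart]

theorem thetaForm_smul (c : ℂ) (x u : Fin n ⊕ Fin m → ℂ) (j : Fin m) :
    thetaForm T x j (c • u) = c * thetaForm T x j u := by
  rw [thetaForm_apply, thetaForm_apply, mul_sub, Finset.mul_sum]
  congr 1
  exact Finset.sum_congr rfl fun p _ => by simp [basePart]; ring

theorem IsFrame.thetaForm_eq (hT : IsFrame Λ W T) (hx : x ∈ totalSet m W)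
    (u : Fin n ⊕ Fin m → ℂ) (j : Fin m) :
    thetaForm T x j u = fibPart u j - ∑ a, (frameCoord T a x : ℂ) *
      fderiv ℂ (fun z => T z j a) (basePart x) (basePart u) := by
  rw [thetaForm_apply]
  congr 1
  simp only [hT.christoffel_eq hx, Finset.sum_mul]
  rw [Finset.sum_comm]
  refine Finset.sum_congr rfl fun a _ => ?_
  rw [fderiv_apply_eq_sum_single _ (basePart u), Finset.mul_sum]
  exact Finset.sum_congr rfl fun p _ => by ring

theorem IsFrame.contDiffOn_entry (hT : IsFrame Λ W T) (j : Fin m) (a : Fin m ⊕ Fin m) :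
    ContDiffOn ℝ (⊤ : ℕ∞) (fun x : Fin n ⊕ Fin m → ℂ => T (basePart x) j a) (totalSet m W) := by
  have h := (hT.2.1 j a).contDiffOn_real hT.1
  exact h.comp ((baseCLM n m).restrictScalars ℝ).contDiff.contDiffOn fun x hx => hx

theorem IsFrame.contDiffOn_frameCoord (hT : IsFrame Λ W T) (a : Fin m ⊕ Fin m) :
    ContDiffOn ℝ (⊤ : ℕ∞) (frameCoord T a : (Fin n ⊕ Fin m → ℂ) → ℝ) (totalSet m W) := by
  have hcj : ContDiff ℝ (⊤ : ℕ∞) (starRingEnd ℂ) := conjCLE.contDiff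
  have h1 : ∀ b, ContDiffOn ℝ (⊤ : ℕ∞) (fun x : Fin n ⊕ Fin m → ℂ =>
      (Matrix.fromRows (T (basePart x)) (conjMat (T (basePart x))))⁻¹ a b) (totalSet m W) := by
    refine fun b => ContDiffOn.matrix_inv (A := fun x : Fin n ⊕ Fin m → ℂ =>
      Matrix.fromRows (T (basePart x)) (conjMat (T (basePart x)))) (fun i j => ?_) (fun x hx =>
      det_fromRows_conjMat_ne_zero (hT.2.2 _ hx).1) a b
    cases i with
    | inl i => exact hT.contDiffOn_entry i j
    | inr i => exact hcj.comp_contDiffOn (hT.contDiffOn_entry i j)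
  have h2 : ∀ b, ContDiff ℝ (⊤ : ℕ∞) (fun x : Fin n ⊕ Fin m → ℂ =>
      (Sum.elim (fibPart x) (fun k => starRingEnd ℂ (fibPart x k)) : Fin m ⊕ Fin m → ℂ) b) := by
    intro b
    cases b with
    | inl b => exact contDiff_apply ℝ ℂ (Sum.inr b : Fin n ⊕ Fin m)
    | inr b => exact hcj.comp (contDiff_apply ℝ ℂ (Sum.inr b : Fin n ⊕ Fin m))
  have h3 := ContDiffOn.sum (s := Finset.univ) fun b _ => (h1 b).mul (h2 b).contDiffOn
  exact reCLM.contDiff.comp_contDiffOn h3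

theorem IsFrame.differentiableAt_frameCoord (hT : IsFrame Λ W T) (hx : x ∈ totalSet m W)
    (a : Fin m ⊕ Fin m) : DifferentiableAt ℝ (frameCoord T a) x :=
  ((hT.contDiffOn_frameCoord a).contDiffAt ((totalSet_isOpen hT.1).mem_nhds hx)).differentiableAt
    (by simp)

theorem IsFrame.hasFDerivAt_entry (hT : IsFrame Λ W T) (hx : x ∈ totalSet m W) (j : Fin m)
    (a : Fin m ⊕ Fin m) : HasFDerivAt (fun y : Fin n ⊕ Fin m → ℂ => T (basePart y) j a)
      (((fderiv ℂ (fun z => T z j a) (basePart x)).comp (baseCLM n m)).restrictScalars ℝ) x := by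
  have h : HasFDerivAt (fun z => T z j a) _ (baseCLM n m x) :=
    ((hT.2.1 j a).differentiableAt (hT.1.mem_nhds hx)).hasFDerivAt
  exact (h.comp x (baseCLM n m).hasFDerivAt).restrictScalars ℝ

/-- Differentiate w = ∑ x^a τ_a: the terms x^a dτ_a add up to ∑ Γ_p dz^p, and the terms τ_a dx^a
remain. This is the formula that makes the vertical part of the Kähler form a combination of exact
forms. -/
theorem IsFrame.thetaForm_eq_sum (hT : IsFrame Λ W T) (hx : x ∈ totalSet m W)
    (u : Fin n ⊕ Fin m → ℂ) (j : Fin m) :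
    thetaForm T x j u = ∑ a, (fderiv ℝ (frameCoord T a) x u : ℂ) * T (basePart x) j a := by
  rw [hT.thetaForm_eq hx, sub_eq_iff_eq_add, ← Finset.sum_add_distrib]
  have h1 : HasFDerivAt (fun y : Fin n ⊕ Fin m → ℂ => fibPart y j)
      (ContinuousLinearMap.proj (Sum.inr j) : (Fin n ⊕ Fin m → ℂ) →L[ℝ] ℂ) x :=
    (ContinuousLinearMap.proj (Sum.inr j) : (Fin n ⊕ Fin m → ℂ) →L[ℝ] ℂ).hasFDerivAt
  have h2 : HasFDerivAt (fun y : Fin n ⊕ Fin m → ℂ => fibPart y j) _ x :=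
    (HasFDerivAt.fun_sum fun a (_ : a ∈ Finset.univ) =>
      ((ofRealCLM.hasFDerivAt.comp x (hT.differentiableAt_frameCoord hx a).hasFDerivAt).mul
        (hT.hasFDerivAt_entry hx j a))).congr_of_eventuallyEq (by
      filter_upwards [(totalSet_isOpen hT.1).mem_nhds hx] with y hy using hT.fibPart_eq hy j)
  have h3 := congrArg (fun L => L u) (h1.unique h2)
  refine h3.trans ?_
  rw [sum_apply]
  refine Finset.sum_congr rfl fun a _ => ?_
  simp [baseCLM_apply]
  ring

/-- The frame coordinates of a section of Λ are integers and continuous, hence locally constant. -/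
theorem IsFrame.exists_int_eventually (hT : IsFrame Λ W T) {W₀ : Set (Fin n → ℂ)} {z₀ : Fin n → ℂ}
    (hW₀ : IsOpen W₀) (h₀ : z₀ ∈ W₀) (hz : z₀ ∈ W) {s : (Fin n → ℂ) → Fin m → ℂ}
    (hs : ContinuousOn s W₀) (hsΛ : ∀ z ∈ W₀, s z ∈ Λ z) :
    ∃ N : Fin m ⊕ Fin m → ℤ, ∀ᶠ z in nhds z₀, ∀ j, s z j = ∑ a, (((N a : ℤ) : ℝ) : ℂ) * T z j a := by
  have hint : ∀ z ∈ W₀ ∩ W, ∃ N : Fin m ⊕ Fin m → ℤ,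
      ∀ j, s z j = ∑ a, (((N a : ℤ) : ℝ) : ℂ) * T z j a := fun z hz => by
    obtain ⟨N, hN⟩ := (hT.2.2 z hz.2).exists_int (hsΛ z hz.1)
    refine ⟨N, fun j => ?_⟩
    rw [hN]
    simp only [Finset.sum_apply, Pi.smul_apply, real_smul]
  obtain ⟨N, hN⟩ := hint z₀ ⟨h₀, hz⟩
  refine ⟨N, ?_⟩
  have hopen := (hW₀.inter hT.1).mem_nhds ⟨h₀, hz⟩
  have hcont : ∀ a, ContinuousAt (fun z => frameCoord T a (Sum.elim z (s z))) z₀ := fun a => by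
    refine ContinuousAt.comp (f := fun z => (Sum.elim z (s z) : Fin n ⊕ Fin m → ℂ))
      (hT.differentiableAt_frameCoord (x := Sum.elim z₀ (s z₀)) hz a).continuousAt ?_
    refine continuousAt_pi.2 fun i => ?_
    cases i with
    | inl i => exact (continuous_apply i).continuousAt
    | inr i => exact (continuous_apply i).continuousAt.comp (hs.continuousAt (hW₀.mem_nhds h₀))
  have h1 : ∀ a, ∀ᶠ z in nhds z₀, |frameCoord T a (Sum.elim z (s z)) - N a| < 1 := fun a => by
    have := Metric.tendsto_nhds.1 (hcont a) 1 one_pos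
    have h0 := hT.frameCoord_eq (x := Sum.elim z₀ (s z₀)) hz hN a
    simp only [h0, Real.dist_eq] at this
    exact this
  filter_upwards [Filter.eventually_all.2 h1, hopen] with z hz1 hz2
  obtain ⟨M, hM⟩ := hint z hz2
  have : M = N := funext fun a => by
    have := hz1 a
    rw [hT.frameCoord_eq (x := Sum.elim z (s z)) hz2.2 hM] at this
    have h2 : |M a - N a| < 1 := by exact_mod_cast this
    have h3 := Int.abs_lt_one_iff.1 h2
    lia
  rwa [this] at hM

theorem fderiv_sum_const_mul (hT : IsFrame Λ W T) {z : Fin n → ℂ} (hz : z ∈ W) {f : (Fin n → ℂ) → ℂ}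
    {j : Fin m} {c : Fin m ⊕ Fin m → ℂ} (h : f =ᶠ[nhds z] fun z => ∑ a, c a * T z j a) (u : Fin n → ℂ) :
    fderiv ℂ f z u = ∑ a, c a * fderiv ℂ (fun z => T z j a) z u := by
  rw [h.fderiv_eq]
  have : HasFDerivAt (fun z => ∑ a, c a * T z j a) (∑ a, c a • fderiv ℂ (fun z => T z j a) z) z :=
    HasFDerivAt.fun_sum fun a _ =>
      ((hT.2.1 j a).differentiableAt (hT.1.mem_nhds hz)).hasFDerivAt.const_mul _
  rw [this.fderiv, sum_apply]
  rfl

/-- `IsHorizontal` allows any frame near the point. Two frames differ by a locally constant integer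
matrix, so they have the same constant-coefficient sections, and every frame computes the same
vertical projection. -/
theorem IsFrame.thetaForm_eq_of_isHorizontal (hT : IsFrame Λ W T) (hx : x ∈ totalSet m W)
    {u : Fin n ⊕ Fin m → ℂ} {p : Fin m → ℂ} (h : IsHorizontal U Λ x (u - vert n m p)) :
    p = fun j => thetaForm T x j u := by
  obtain ⟨W', T', hx', -, hT', c, hc, hu⟩ := h
  choose N hN using fun b : Fin m ⊕ Fin m => hT.exists_int_eventually hT'.1 hx' hx
    (hT'.continuousOn b) (fun z hz => (hT'.2.2 z hz).mem b)
  have h1 : ∀ j b, T' (basePart x) j b = ∑ a, (((N b a : ℤ) : ℝ) : ℂ) * T (basePart x) j a :=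
    fun j b => (hN b).self_of_nhds j
  have h2 : ∀ j b, fderiv ℂ (fun z => T' z j b) (basePart x) (basePart u) =
      ∑ a, (((N b a : ℤ) : ℝ) : ℂ) * fderiv ℂ (fun z => T z j a) (basePart x) (basePart u) :=
    fun j b => fderiv_sum_const_mul hT hx ((hN b).mono fun z hz => hz j) _
  have h3 : ∀ a, frameCoord T a x = ∑ b, c b * N b a := fun a => by
    refine hT.frameCoord_eq hx (c := fun a => ∑ b, c b * N b a) (fun j => ?_) a
    rw [hc]
    simp only [h1, Finset.mul_sum]
    rw [Finset.sum_comm]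
    refine Finset.sum_congr rfl fun a _ => ?_
    push_cast
    rw [Finset.sum_mul]
    exact Finset.sum_congr rfl fun b _ => by ring
  have hb : basePart (u - vert n m p) = basePart u := by
    ext i; simp [basePart, vert]
  ext j
  have h4 := hu j
  have hf : fibPart (u - vert n m p) j = fibPart u j - p j := by simp [fibPart, vert, dcoord]
  rw [hb, hf, sub_eq_iff_eq_add] at h4
  rw [hT.thetaForm_eq hx, h4]
  simp only [h2, h3, Finset.mul_sum]
  rw [Finset.sum_comm]
  have : ∀ a, (((∑ b, c b * N b a : ℝ)) : ℂ) * fderiv ℂ (fun z => T z j a) (basePart x) (basePart u) =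
      ∑ b, (c b : ℂ) * ((((N b a : ℤ) : ℝ) : ℂ) *
        fderiv ℂ (fun z => T z j a) (basePart x) (basePart u)) := fun a => by
    push_cast
    rw [Finset.sum_mul]
    exact Finset.sum_congr rfl fun b _ => by ring
  simp only [this]
  ring

theorem IsFrame.isHorizontal (hT : IsFrame Λ W T) (hW : W ⊆ U) (hx : x ∈ totalSet m W)
    (u : Fin n ⊕ Fin m → ℂ) : IsHorizontal U Λ x (u - vert n m fun j => thetaForm T x j u) := by
  refine ⟨W, T, hx, hW, hT, fun a => frameCoord T a x, hT.fibPart_eq hx, fun j => ?_⟩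
  have hb : ∀ p, basePart (u - vert n m p) = basePart u := fun p => by
    ext i; simp [basePart, vert]
  have hf : ∀ p, fibPart (u - vert n m p) j = fibPart u j - p j := by simp [fibPart, vert, dcoord]
  rw [hf, hb, hT.thetaForm_eq hx]
  ring

theorem fibTranslate_hasFDerivAt {s : (Fin n → ℂ) → Fin m → ℂ} (hs : DifferentiableAt ℂ s (basePart x)) :
    HasFDerivAt (fibTranslate s) ((ContinuousLinearMap.pi (Sum.elim
      (fun j => ContinuousLinearMap.proj (Sum.inl j))
      (fun k => ContinuousLinearMap.proj (Sum.inr k) + (ContinuousLinearMap.proj k).comp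
        ((fderiv ℂ s (basePart x)).comp (baseCLM n m)))) :
          (Fin n ⊕ Fin m → ℂ) →L[ℂ] (Fin n ⊕ Fin m → ℂ)).restrictScalars ℝ) x := by
  refine HasFDerivAt.restrictScalars ℝ (hasFDerivAt_pi.2 fun i => ?_)
  have hs' : HasFDerivAt s (fderiv ℂ s (basePart x)) (baseCLM n m x) := hs.hasFDerivAt
  cases i with
  | inl i => exact (ContinuousLinearMap.proj (R := ℂ) (φ := fun _ : Fin n ⊕ Fin m => ℂ) (Sum.inl i)).hasFDerivAt
  | inr i =>
    refine HasFDerivAt.add (ContinuousLinearMap.proj (R := ℂ) (φ := fun _ : Fin n ⊕ Fin m => ℂ) (Sum.inr i)).hasFDerivAt ?_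
    exact (ContinuousLinearMap.proj (R := ℂ) (φ := fun _ : Fin m => ℂ) i).hasFDerivAt.comp x
      (hs'.comp x (baseCLM n m).hasFDerivAt)

theorem basePart_fderiv_fibTranslate {s : (Fin n → ℂ) → Fin m → ℂ}
    (hs : DifferentiableAt ℂ s (basePart x)) (u : Fin n ⊕ Fin m → ℂ) :
    basePart (fderiv ℝ (fibTranslate s) x u) = basePart u := by
  rw [(fibTranslate_hasFDerivAt hs).fderiv]; rfl

theorem fibPart_fderiv_fibTranslate {s : (Fin n → ℂ) → Fin m → ℂ}
    (hs : DifferentiableAt ℂ s (basePart x)) (u : Fin n ⊕ Fin m → ℂ) :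
    fibPart (fderiv ℝ (fibTranslate s) x u) = fibPart u + fderiv ℂ s (basePart x) (basePart u) := by
  rw [(fibTranslate_hasFDerivAt hs).fderiv]; rfl

/-- Translation by a section of Λ adds locally constant integers to the x^a, so the dx^a and hence θ
are preserved. -/
theorem IsFrame.thetaForm_fibTranslate (hT : IsFrame Λ W T) {W₀ : Set (Fin n → ℂ)}
    (hW₀ : IsOpen W₀) (h₀ : basePart x ∈ W₀) (hx : x ∈ totalSet m W) {s : (Fin n → ℂ) → Fin m → ℂ}
    (hs : DifferentiableOn ℂ s W₀) (hsΛ : ∀ z ∈ W₀, s z ∈ Λ z) (u : Fin n ⊕ Fin m → ℂ) (j : Fin m) :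
    thetaForm T (fibTranslate s x) j (fderiv ℝ (fibTranslate s) x u) = thetaForm T x j u := by
  obtain ⟨N, hN⟩ := hT.exists_int_eventually hW₀ h₀ hx hs.continuousOn hsΛ
  have hsd := hs.differentiableAt (hW₀.mem_nhds h₀)
  have hb : basePart (fibTranslate s x) = basePart x := rfl
  have hx' : fibTranslate s x ∈ totalSet m W := hx
  have hd : fderiv ℂ s (basePart x) (basePart u) j = ∑ a, (((N a : ℤ) : ℝ) : ℂ) *
      fderiv ℂ (fun z => T z j a) (basePart x) (basePart u) := by
    rw [← fderiv_sum_const_mul hT hx (hN.mono fun z hz => hz j),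
      fderiv_apply hsd]
    rfl
  have hc : ∀ a, frameCoord T a (fibTranslate s x) = frameCoord T a x + N a := fun a => by
    refine hT.frameCoord_eq hx' (c := fun a => frameCoord T a x + N a) (fun j => ?_) a
    have : fibPart (fibTranslate s x) j = fibPart x j + s (basePart x) j := rfl
    rw [this, hT.fibPart_eq hx, hN.self_of_nhds j, hb, ← Finset.sum_add_distrib]
    exact Finset.sum_congr rfl fun a _ => by push_cast; ring
  rw [hT.thetaForm_eq hx', hT.thetaForm_eq hx, hb, basePart_fderiv_fibTranslate hsd,
    fibPart_fderiv_fibTranslate hsd, Pi.add_apply, hd, add_sub_assoc, ← Finset.sum_sub_distrib,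
    sub_eq_add_neg, ← Finset.sum_neg_distrib]
  congr 1
  refine Finset.sum_congr rfl fun a _ => ?_
  rw [hc]; push_cast; ring

end FrameCoordinates
end

noncomputable section

/-! ### Coefficient matrices of hermitian inner products -/

section HermitianMatrices

open Complex Matrix
open scoped ComplexOrder MatrixOrder

variable {ι : Type*} [Fintype ι] {g g' : Bilin (ι → ℂ)}

/-- The real inner product `2 Re ∑ M j k u_j v̄_k`. -/
def bilinOfMat (M : Matrix ι ι ℂ) : Bilin (ι → ℂ) :=
  LinearMap.toContinuousBilinearMap
    (LinearMap.mk₂ ℝ (fun u v : ι → ℂ => 2 * (u ⬝ᵥ M *ᵥ star v).re)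
      (fun u u' v => by rw [add_dotProduct, add_re, mul_add])
      (fun c u v => by rw [smul_dotProduct, real_smul, re_ofReal_mul, smul_eq_mul]; ring)
      (fun u v v' => by rw [star_add, mulVec_add, dotProduct_add, add_re, mul_add])
      (fun c u v => by
        rw [star_smul, star_trivial, mulVec_smul, dotProduct_smul, real_smul, re_ofReal_mul,
          smul_eq_mul]; ring))

theorem bilinOfMat_apply (M : Matrix ι ι ℂ) (u v : ι → ℂ) :
    bilinOfMat M u v = 2 * (u ⬝ᵥ M *ᵥ star v).re := rfl

theorem dotProduct_mulVec_star_swap {M : Matrix ι ι ℂ} (hM : M.IsHermitian) (u v : ι → ℂ) :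
    v ⬝ᵥ M *ᵥ star u = starRingEnd ℂ (u ⬝ᵥ M *ᵥ star v) := by
  rw [starRingEnd_apply, ← star_dotProduct_star, star_mulVec, star_star, hM.eq,
    dotProduct_mulVec]

theorem star_I_smul (v : ι → ℂ) : star (I • v) = (-I) • star v := by
  rw [star_smul]; simp

theorem isHermInner_bilinOfMat {M : Matrix ι ι ℂ} (hM : M.PosDef) : IsHermInner (bilinOfMat M) := by
  refine ⟨fun u v => ?_, fun u v => ?_, fun u hu => ?_⟩
  · rw [bilinOfMat_apply, bilinOfMat_apply, dotProduct_mulVec_star_swap hM.1, conj_re]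
  · rw [bilinOfMat_apply, bilinOfMat_apply, star_I_smul, mulVec_smul, dotProduct_smul, smul_dotProduct,
      smul_smul]
    simp
  · have := hM.dotProduct_mulVec_pos (x := star u) (by simpa using hu)
    rw [star_star] at this
    rw [bilinOfMat_apply]
    have := (Complex.pos_iff.1 this).1
    linarith

/-- `hermOf` is conjugate linear in its first argument, hence the interchange of the two vectors. -/
theorem hermOf_bilinOfMat {M : Matrix ι ι ℂ} (hM : M.IsHermitian) (u v : ι → ℂ) :
    hermOf (bilinOfMat M) u v = v ⬝ᵥ M *ᵥ star u := by
  rw [hermOf, bilinOfMat_apply, bilinOfMat_apply, smul_dotProduct, dotProduct_mulVec_star_swap hM u v]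
  apply Complex.ext <;> simp

theorem hermForm_apply (H : Matrix ι ι ℂ) (u v : ι → ℂ) :
    hermForm H ![u, v] = I * (u ⬝ᵥ H *ᵥ star v - v ⬝ᵥ H *ᵥ star u) := by
  simp only [hermForm, cformSum_apply, ContinuousAlternatingMap.smul_apply, wedgeOne_two, smul_eq_mul]
  simp only [dotProduct, mulVec, mul_sub, Finset.mul_sum, ← Finset.sum_sub_distrib]
  refine Finset.sum_congr rfl fun j _ => Finset.sum_congr rfl fun k _ => ?_
  simp only [dcoord, conjOne, Pi.star_apply]
  simp
  ring

theorem dotProduct_coframe (A : Matrix ι ι ℂ) (u v : ι → ℂ) :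
    u ⬝ᵥ (Aᵀ * conjMat A) *ᵥ star v = A *ᵥ u ⬝ᵥ star (A *ᵥ v) := by
  have h : conjMat A *ᵥ star v = star (A *ᵥ v) := by
    ext i; simp [mulVec, dotProduct, conjMat]
  rw [← mulVec_mulVec, h, dotProduct_mulVec, vecMul_transpose]

variable [DecidableEq ι]

/-- The coefficient matrix of the Kähler form of `g`. -/
def hermMat (g : Bilin (ι → ℂ)) : Matrix ι ι ℂ :=
  Matrix.of fun j k : ι => hermOf g (Pi.single k 1) (Pi.single j 1)

theorem hermMat_bilinOfMat {M : Matrix ι ι ℂ} (hM : M.IsHermitian) : hermMat (bilinOfMat M) = M := by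
  ext j k
  rw [hermMat, Matrix.of_apply, hermOf_bilinOfMat hM, ← Pi.single_star, star_one]
  simp

theorem hermMat_smul (c : ℝ) : hermMat (c • g) = (c : ℂ) • hermMat g := by
  ext j k
  simp [hermMat, hermOf]
  ring

/-- The form `hermOf g` is sesquilinear, so it is determined by its values on coordinate vectors,
and g is twice its real part. -/
theorem IsHermInner.eq_bilinOfMat (hg : IsHermInner g) : g = bilinOfMat (hermMat g) := by
  have hre : ∀ u v, (hermOf g u v).re = g u v / 2 := fun u v => by
    simp [hermOf]; ring
  have hI : ∀ u v, hermOf g (I • u) v = -I * hermOf g u v := fun u v => by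
    rw [hermOf, hermOf, smul_smul, I_mul_I, neg_one_smul, (g).map_neg, _root_.neg_apply]
    push_cast
    linear_combination ((1 / 2 : ℂ) * (g (I • u) v : ℂ)) * I_mul_I
  have hIr : ∀ u v, hermOf g u (I • v) = I * hermOf g u v := fun u v => by
    have h1 : g u (I • v) = -g (I • u) v := by
      rw [← hg.2.1 u, smul_smul, I_mul_I, neg_one_smul, map_neg]
    rw [hermOf, hermOf, h1, hg.2.1]
    push_cast
    linear_combination (-(1 / 2 : ℂ) * (g (I • u) v : ℂ)) * I_mul_I
  have hadd : ∀ u u' v, hermOf g (u + u') v = hermOf g u v + hermOf g u' v := fun u u' v => by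
    simp [hermOf]; ring
  have haddr : ∀ u v v', hermOf g u (v + v') = hermOf g u v + hermOf g u v' := fun u v v' => by
    simp [hermOf]; ring
  have hr : ∀ (c : ℝ) u v, hermOf g (c • u) v = c * hermOf g u v := fun c u v => by
    rw [hermOf, hermOf, smul_comm I c, (g).map_smul, (g).map_smul, _root_.smul_apply,
      _root_.smul_apply, smul_eq_mul, smul_eq_mul]
    push_cast; ring
  have hrr : ∀ (c : ℝ) u v, hermOf g u (c • v) = c * hermOf g u v := fun c u v => by
    simp only [hermOf, map_smul, smul_eq_mul]
    push_cast; ring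
  have hcomp : ∀ (c : ℂ) (u : ι → ℂ), c • u = c.re • u + c.im • I • u := fun c u => by
    ext i
    simp only [Pi.smul_apply, Pi.add_apply, smul_eq_mul, real_smul]
    conv_lhs => rw [← re_add_im c]
    ring
  have hs : ∀ (c : ℂ) u v, hermOf g (c • u) v = starRingEnd ℂ c * hermOf g u v := fun c u v => by
    rw [hcomp c u, hadd, hr, hr, hI]
    have : starRingEnd ℂ c = c.re - c.im * I := by apply Complex.ext <;> simp
    rw [this]
    ring
  have hsr : ∀ (c : ℂ) u v, hermOf g u (c • v) = c * hermOf g u v := fun c u v => by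
    rw [hcomp c v, haddr, hrr, hrr, hIr]
    conv_rhs => rw [← re_add_im c]
    ring
  let F : (ι → ℂ) →ₗ[ℂ] (ι → ℂ) →ₛₗ[starRingEnd ℂ] ℂ := LinearMap.mk₂'ₛₗ (RingHom.id ℂ) (starRingEnd ℂ)
    (fun u v => hermOf g v u) (fun u u' v => haddr v u u') (fun c u v => hsr c v u)
    (fun u v v' => hadd v v' u) (fun c u v => hs c v u)
  let F' : (ι → ℂ) →ₗ[ℂ] (ι → ℂ) →ₛₗ[starRingEnd ℂ] ℂ := LinearMap.mk₂'ₛₗ (RingHom.id ℂ) (starRingEnd ℂ)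
    (fun u v => u ⬝ᵥ hermMat g *ᵥ star v) (fun _ _ _ => add_dotProduct _ _ _)
    (fun _ _ _ => smul_dotProduct _ _ _) (fun _ _ _ => by rw [star_add, mulVec_add, dotProduct_add])
    (fun _ _ _ => by rw [star_smul, mulVec_smul, dotProduct_smul]; rfl)
  have hF : F = F' := by
    refine (Pi.basisFun ℂ ι).ext fun j => (Pi.basisFun ℂ ι).ext fun k => ?_
    change hermOf g _ _ = _ ⬝ᵥ hermMat g *ᵥ star _
    rw [Pi.basisFun_apply, Pi.basisFun_apply, ← Pi.single_star, star_one]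
    simp [hermMat]
  ext u v
  have := hre v u
  rw [bilinOfMat_apply, ← show F u v = u ⬝ᵥ hermMat g *ᵥ star v by rw [hF]; rfl]
  change g u v = 2 * (hermOf g v u).re
  rw [this, hg.1]
  ring

theorem IsHermInner.hermOf_eq (hg : IsHermInner g) (u v : ι → ℂ) :
    hermOf g u v = v ⬝ᵥ hermMat g *ᵥ star u := by
  have hM : (hermMat g).IsHermitian := by
    ext j k
    rw [conjTranspose_apply, hermMat, of_apply, of_apply, hermOf, hermOf]
    have h : g (I • Pi.single k 1) (Pi.single j 1) = -g (I • Pi.single j 1) (Pi.single k 1) := by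
      rw [← hg.2.1, hg.1, smul_smul, I_mul_I, neg_one_smul, map_neg]
    rw [h, hg.1]
    simp
  conv_lhs => rw [hg.eq_bilinOfMat]
  exact hermOf_bilinOfMat hM u v

theorem IsHermInner.hermMat_posDef (hg : IsHermInner g) : (hermMat g).PosDef := by
  refine PosDef.of_dotProduct_mulVec_pos ?_ fun x hx => ?_
  · ext j k
    rw [conjTranspose_apply, hermMat, of_apply, of_apply, hermOf, hermOf]
    have h : g (I • Pi.single k 1) (Pi.single j 1) = -g (I • Pi.single j 1) (Pi.single k 1) := by
      rw [← hg.2.1, hg.1, smul_smul, I_mul_I, neg_one_smul, map_neg]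
    rw [h, hg.1]
    simp
  · have h1 : hermOf g (star x) (star x) = star x ⬝ᵥ hermMat g *ᵥ x := by
      rw [hg.hermOf_eq, star_star]
    have h0 : g (I • star x) (star x) = 0 := by
      have : g (I • star x) (star x) = -g (I • star x) (star x) := by
        conv_lhs => rw [← hg.2.1, hg.1, smul_smul, I_mul_I, neg_one_smul, map_neg]
      linarith
    rw [← h1, hermOf, h0]
    have := hg.2.2 (star x) (by simpa using hx)
    simp only [ofReal_zero, mul_zero, add_zero]
    rw [Complex.pos_iff]
    constructor
    · simpa using this
    · simp

theorem IsHermInner.apply_eq (hg : IsHermInner g) (u v : ι → ℂ) :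
    g u v = 2 * (u ⬝ᵥ hermMat g *ᵥ star v).re := by
  conv_lhs => rw [hg.eq_bilinOfMat]
  rfl

theorem IsHermInner.kahlerForm_eq (hg : IsHermInner g) : kahlerForm g = hermForm (hermMat g) := by
  refine CForm.ext_two fun u v => ?_
  rw [kahlerForm_apply hg, hermForm_apply, dotProduct_mulVec_star_swap hg.hermMat_posDef.1 u v,
    hg.apply_eq, smul_dotProduct, sub_conj]
  simp
  linear_combination (-2 * ((u ⬝ᵥ hermMat g *ᵥ star v).im : ℂ)) * I_sq

/-- Polarization of quadratic forms. The base metrics are prescribed only through norms, and this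
recovers the full metric. -/
theorem IsHermInner.eq_bilinOfMat_of_diag (hg : IsHermInner g) {M : Matrix ι ι ℂ} (hM : M.IsHermitian)
    (h : ∀ u, (hermOf g u u).re = (u ⬝ᵥ M *ᵥ star u).re) : g = bilinOfMat M := by
  have hq : ∀ u, g u u = bilinOfMat M u u := fun u => by
    rw [bilinOfMat_apply, ← h, hermOf]; simp
  have hs : ∀ u v, bilinOfMat M u v = bilinOfMat M v u := fun u v => by
    rw [bilinOfMat_apply, bilinOfMat_apply, dotProduct_mulVec_star_swap hM, conj_re]
  ext u v
  have h1 := hq (u + v)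
  simp only [map_add, _root_.add_apply] at h1
  have h2 := hs u v
  have h3 := hg.1 u v
  linarith [hq u, hq v]

/-- Take a square root M = B*B and put A = B̄. The rows of A then form a unitary coframe: ∑ M_jk
dw^j dw̄^k = ∑ |e_l|² with e = A dw. -/
theorem _root_.Matrix.PosDef.exists_coframe {M : Matrix ι ι ℂ} (hM : M.PosDef) :
    ∃ A : Matrix ι ι ℂ, A.det ≠ 0 ∧ M = Aᵀ * conjMat A := by
  obtain ⟨B, hB⟩ := CStarAlgebra.nonneg_iff_eq_star_mul_self.mp hM.posSemidef.nonneg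
  refine ⟨conjMat B, fun h => ?_, ?_⟩
  · have h1 : (conjMat B).det = starRingEnd ℂ B.det := ((starRingEnd ℂ).map_det B).symm
    have h2 : B.det = 0 := by
      rw [h1] at h; simpa using h
    have := hM.det_pos
    rw [hB, det_mul, h2, mul_zero] at this
    exact lt_irrefl _ this
  · rw [hB]
    ext i j
    simp [mul_apply, conjMat, star_eq_conjTranspose]

end HermitianMatrices

end

noncomputable section

/-! ### Riemann relations and symplectic bases -/

section PeriodMatrices

open Complex Matrix
open scoped ComplexOrder

variable {m : ℕ} {T : Matrix (Fin m) (Fin m ⊕ Fin m) ℂ} {Q : Matrix (Fin m ⊕ Fin m) (Fin m ⊕ Fin m) ℝ}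
  {g : Bilin (Fin m → ℂ)}

theorem conjMat_mul {k l r : Type*} [Fintype l] (A : Matrix k l ℂ) (B : Matrix l r ℂ) :
    conjMat (A * B) = conjMat A * conjMat B := Matrix.map_mul

theorem conjMat_conjMat {k l : Type*} (A : Matrix k l ℂ) : conjMat (conjMat A) = A := by
  ext; simp [conjMat]

theorem conjMat_transpose {k l : Type*} (A : Matrix k l ℂ) : conjMat Aᵀ = (conjMat A)ᵀ := rfl

theorem conjMat_realMat {k l : Type*} (A : Matrix k l ℝ) : conjMat (realMat A) = realMat A := by
  ext; simp [conjMat, realMat]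

theorem conjMat_det {k : Type*} [Fintype k] [DecidableEq k] (A : Matrix k k ℂ) :
    (conjMat A).det = starRingEnd ℂ A.det := ((starRingEnd ℂ).map_det A).symm

theorem realMat_mul {k l r : Type*} [Fintype l] (A : Matrix k l ℝ) (B : Matrix l r ℝ) :
    realMat (A * B) = realMat A * realMat B := Matrix.map_mul (f := ofRealHom)

theorem realMat_one {k : Type*} [DecidableEq k] : realMat (1 : Matrix k k ℝ) = 1 := by
  ext i j; simp [realMat, Matrix.one_apply]; split_ifs <;> simp

theorem realMat_inv {k : Type*} [Fintype k] [DecidableEq k] {A : Matrix k k ℝ} (h : A.det ≠ 0) :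
    realMat A⁻¹ = (realMat A)⁻¹ := by
  refine (Matrix.inv_eq_left_inv ?_).symm
  rw [← realMat_mul, Matrix.nonsing_inv_mul _ (isUnit_iff_ne_zero.2 h), realMat_one]

theorem posDef_of_realMat {k : Type*} [Fintype k] {Y : Matrix k k ℝ} (h : (realMat Y).PosDef) :
    Y.PosDef := by
  refine PosDef.of_dotProduct_mulVec_pos ?_ fun x hx => ?_
  · ext i j
    have := congrFun (congrFun h.1 i) j
    simpa [realMat] using this
  · have h6 := h.dotProduct_mulVec_pos (x := fun i => (x i : ℂ)) (fun h => hx (by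
      ext i; exact ofReal_eq_zero.1 (congrFun h i)))
    have h7 : star (fun i => (x i : ℂ)) ⬝ᵥ realMat Y *ᵥ (fun i => (x i : ℂ)) =
        ((star x ⬝ᵥ Y *ᵥ x : ℝ) : ℂ) := by
      simp [dotProduct, mulVec, realMat]
    rw [h7] at h6
    exact_mod_cast h6

theorem posDef_realMat {k : Type*} [Fintype k] {Y : Matrix k k ℝ} (h : Y.PosDef) :
    (realMat Y).PosDef := by
  have hs : ∀ a b : k → ℝ, a ⬝ᵥ Y *ᵥ b = b ⬝ᵥ Y *ᵥ a := fun a b => by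
    have hY : Yᵀ = Y := h.1
    conv_lhs => rw [← hY, mulVec_transpose, dotProduct_comm, ← dotProduct_mulVec]
  refine PosDef.of_dotProduct_mulVec_pos ?_ fun x hx => ?_
  · ext i j
    have := congrFun (congrFun h.1 i) j
    simpa [realMat] using this
  · have e : star x ⬝ᵥ realMat Y *ᵥ x =
        (((fun i => (x i).re) ⬝ᵥ Y *ᵥ (fun i => (x i).re) +
          (fun i => (x i).im) ⬝ᵥ Y *ᵥ (fun i => (x i).im) : ℝ) : ℂ) + I *
        (((fun i => (x i).re) ⬝ᵥ Y *ᵥ (fun i => (x i).im) -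
          (fun i => (x i).im) ⬝ᵥ Y *ᵥ (fun i => (x i).re) : ℝ) : ℂ) := by
      simp only [dotProduct, mulVec, realMat, ofReal_add, ofReal_sub, ofReal_sum, ofReal_mul,
        Finset.mul_sum, ← Finset.sum_add_distrib, ← Finset.sum_sub_distrib]
      refine Finset.sum_congr rfl fun i _ => Finset.sum_congr rfl fun j _ => ?_
      simp only [Matrix.map_apply, Pi.star_apply]
      generalize x i = a
      generalize x j = b
      apply Complex.ext <;> simp <;> ring
    rw [e, hs (fun i => (x i).re) (fun i => (x i).im), sub_self, ofReal_zero, mul_zero, add_zero]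
    have hnn : ∀ a : k → ℝ, 0 ≤ a ⬝ᵥ Y *ᵥ a := fun a => by
      simpa using h.posSemidef.dotProduct_mulVec_nonneg a
    have hpos : ∀ a : k → ℝ, a ≠ 0 → 0 < a ⬝ᵥ Y *ᵥ a := fun a ha => by
      simpa using h.dotProduct_mulVec_pos ha
    have : 0 < (fun i => (x i).re) ⬝ᵥ Y *ᵥ (fun i => (x i).re) +
          (fun i => (x i).im) ⬝ᵥ Y *ᵥ (fun i => (x i).im) := by
      by_cases h1 : (fun i => (x i).re) = 0
      · refine add_pos_of_nonneg_of_pos (hnn _) (hpos _ fun h2 => hx ?_)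
        ext i
        exact Complex.ext (congrFun h1 i) (congrFun h2 i)
      · exact add_pos_of_pos_of_nonneg (hpos _ h1) (hnn _)
    exact_mod_cast this

/-- In the coordinates (w, w̄) the Kähler form has the off-diagonal blocks iH and -iHᵗ, and (T; T̄)
is the passage from lattice coordinates to (w, w̄). -/
theorem realMat_eq_of_kahler (hg : IsHermInner g)
    (hQ : ∀ a b, g (I • fun j => T j a) (fun j => T j b) = Q a b) :
    realMat Q = (fromRows T (conjMat T))ᵀ *
      fromBlocks 0 (I • hermMat g) (-(I • (hermMat g)ᵀ)) 0 * fromRows T (conjMat T) := by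
  rw [transpose_fromRows, fromCols_mul_fromBlocks, fromCols_mul_fromRows]
  ext a b
  have e : ∀ (A B : Matrix (Fin m) (Fin m ⊕ Fin m) ℂ) (M : Matrix (Fin m) (Fin m) ℂ),
      (Aᵀ * M * B) a b = (fun j => A j a) ⬝ᵥ M *ᵥ fun j => B j b := fun A B M => by
    rw [Matrix.mul_assoc]; rfl
  have h0 := hQ a b
  have h1 := hg.apply_eq (I • fun j => T j a) (fun j => T j b)
  have h2 := dotProduct_mulVec_star_swap hg.hermMat_posDef.1 (fun j => T j a) (fun j => T j b)
  have h3 : (star fun j => T j a) ⬝ᵥ (hermMat g)ᵀ *ᵥ (fun j => T j b) =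
      (fun j => T j b) ⬝ᵥ hermMat g *ᵥ (star fun j => T j a) := by
    rw [mulVec_transpose, dotProduct_comm, dotProduct_mulVec]
  rw [h0, smul_dotProduct] at h1
  have h4 : realMat Q a b = ((Q a b : ℝ) : ℂ) := rfl
  simp only [Matrix.mul_zero, zero_add, add_zero, Matrix.add_apply, Matrix.mul_neg, Matrix.neg_mul,
    Matrix.neg_apply, Matrix.mul_smul, Matrix.smul_mul, Matrix.smul_apply, e]
  have h5 : (fun j => conjMat T j a) = star fun j => T j a := rfl
  have h6 : (fun j => conjMat T j b) = star fun j => T j b := rfl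
  rw [h4, h5, h6, h3, h2, h1]
  generalize (fun j => T j a) ⬝ᵥ hermMat g *ᵥ (star fun j => T j b) = X
  apply Complex.ext <;> simp <;> ring

/-- Inverting `realMat_eq_of_kahler` gives (T; T̄) Q⁻¹ (T; T̄)ᵗ as the inverse of the block matrix.
Its lower left block is the formula for H⁻¹, its vanishing upper left block the Riemann bilinear
relation. -/
theorem matH_relations (hT : LinearIndependent ℝ fun (a : Fin m ⊕ Fin m) j => T j a)
    (hg : IsHermInner g) (hQ : ∀ a b, g (I • fun j => T j a) (fun j => T j b) = Q a b) :
    Q.det ≠ 0 ∧ I • (conjMat T * realMat Q⁻¹ * Tᵀ) = (hermMat g)⁻¹ ∧ T * realMat Q⁻¹ * Tᵀ = 0 := by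
  have hP := det_fromRows_conjMat_ne_zero hT
  have hreal := realMat_eq_of_kahler hg hQ
  set h := hermMat g
  set P := fromRows T (conjMat T) with hPdef
  have hdet : IsUnit h.det := isUnit_iff_ne_zero.2 hg.hermMat_posDef.det_pos.ne'
  have hdetT : IsUnit hᵀ.det := by rwa [det_transpose]
  set D := fromBlocks 0 (I • h) (-(I • hᵀ)) 0 with hD
  set D' : Matrix (Fin m ⊕ Fin m) (Fin m ⊕ Fin m) ℂ := fromBlocks 0 (I • h⁻¹ᵀ) (-(I • h⁻¹)) 0 with hD'
  have hDD : D * D' = 1 := by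
    rw [hD, hD', fromBlocks_multiply, ← fromBlocks_one]
    simp only [Matrix.mul_zero, Matrix.zero_mul, zero_add, add_zero, Matrix.mul_neg, Matrix.neg_mul,
      Matrix.mul_smul, Matrix.smul_mul, smul_smul, I_mul_I, transpose_nonsing_inv]
    rw [mul_nonsing_inv _ hdet, mul_nonsing_inv _ hdetT]
    have e : -(I • I • (1 : Matrix (Fin m) (Fin m) ℂ)) = 1 := by
      rw [smul_smul, I_mul_I, neg_one_smul, neg_neg]
    simp [e]
  have hDdet : D.det ≠ 0 := fun h0 => by
    have := congrArg det hDD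
    rw [det_mul, h0, zero_mul, det_one] at this
    exact zero_ne_one this
  have hQd : (realMat Q).det ≠ 0 := by
    rw [hreal, det_mul, det_mul, det_transpose]
    exact mul_ne_zero (mul_ne_zero hP hDdet) hP
  have hQ0 : Q.det ≠ 0 := fun h0 => hQd (by
    have : (realMat Q).det = ((Q.det : ℝ) : ℂ) := (ofRealHom.map_det Q).symm
    rw [this, h0, ofReal_zero])
  have hPu : IsUnit P.det := isUnit_iff_ne_zero.2 hP
  have hkey : P * realMat Q⁻¹ * Pᵀ = D' := by
    have h1 : D⁻¹ = D' := inv_eq_right_inv hDD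
    rw [realMat_inv hQ0, hreal, Matrix.mul_inv_rev, Matrix.mul_inv_rev, ← Matrix.mul_assoc, mul_nonsing_inv _ hPu,
      Matrix.one_mul, Matrix.mul_assoc, nonsing_inv_mul _ (by rwa [det_transpose]), Matrix.mul_one, h1]
  rw [hPdef, fromRows_mul, transpose_fromRows, fromRows_mul_fromCols] at hkey
  obtain ⟨k1, -, k2, -⟩ := fromBlocks_inj.1 hkey
  refine ⟨hQ0, ?_, k1⟩
  rw [k2, smul_neg, smul_smul, I_mul_I]
  simp

theorem matH_eq (hT : LinearIndependent ℝ fun (a : Fin m ⊕ Fin m) j => T j a)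
    (hg : IsHermInner g) (hQ : ∀ a b, g (I • fun j => T j a) (fun j => T j b) = Q a b) :
    matH Q T = hermMat g := by
  rw [matH, (matH_relations hT hg hQ).2.1, nonsing_inv_nonsing_inv _
    (isUnit_iff_ne_zero.2 hg.hermMat_posDef.det_pos.ne')]

theorem kahler_matrix_skew (hg : IsHermInner g)
    (hQ : ∀ a b, g (I • fun j => T j a) (fun j => T j b) = Q a b) : Qᵀ = -Q := by
  ext a b
  rw [transpose_apply, Matrix.neg_apply, ← hQ, ← hQ, ← hg.2.1, hg.1, smul_smul, I_mul_I,
    neg_one_smul, map_neg]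

/-- The period matrix of a lattice in a symplectic basis. -/
theorem exists_period (hT : LinearIndependent ℝ fun (a : Fin m ⊕ Fin m) j => T j a)
    (hg : IsHermInner g) (hQ : ∀ a b, g (I • fun j => T j a) (fun j => T j b) = Q a b)
    {S : Matrix (Fin m ⊕ Fin m) (Fin m ⊕ Fin m) ℝ} (hS : Sᵀ * Q * S = fromBlocks 0 1 (-1) 0)
    {K₁ K₂ : Matrix (Fin m) (Fin m) ℂ} (hK : T * realMat S = fromCols K₁ K₂) :
    K₁.det ≠ 0 ∧ (K₁⁻¹ * K₂)ᵀ = K₁⁻¹ * K₂ ∧ (imMat (K₁⁻¹ * K₂)).PosDef ∧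
      (hermMat g)⁻¹ = (2 : ℂ) • (conjMat K₁ * realMat (imMat (K₁⁻¹ * K₂)) * K₁ᵀ) := by
  obtain ⟨hQ0, h1, h2⟩ := matH_relations hT hg hQ
  have hJ : (fromBlocks 0 1 (-1) 0 : Matrix (Fin m ⊕ Fin m) (Fin m ⊕ Fin m) ℝ) *
      fromBlocks 0 (-1) 1 0 = 1 := by
    rw [fromBlocks_multiply, ← fromBlocks_one]; simp
  have hJd : IsUnit (fromBlocks 0 1 (-1) 0 : Matrix (Fin m ⊕ Fin m) (Fin m ⊕ Fin m) ℝ).det :=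
    isUnit_det_of_right_inverse hJ
  have hSd : IsUnit S.det := by
    rw [← hS, det_mul] at hJd
    exact isUnit_of_mul_isUnit_right hJd
  have hQi : Q⁻¹ = S * fromBlocks 0 (-1) 1 0 * Sᵀ := by
    refine inv_eq_right_inv ?_
    have e1 : Q = (Sᵀ)⁻¹ * fromBlocks 0 1 (-1) 0 * S⁻¹ := by
      rw [← hS, Matrix.mul_assoc, Matrix.mul_assoc, mul_nonsing_inv _ hSd, Matrix.mul_one,
        ← Matrix.mul_assoc, nonsing_inv_mul _ (by rwa [det_transpose]), Matrix.one_mul]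
    calc Q * (S * fromBlocks 0 (-1) 1 0 * Sᵀ)
        = (Sᵀ)⁻¹ * fromBlocks 0 1 (-1) 0 * (S⁻¹ * S) * fromBlocks 0 (-1) 1 0 * Sᵀ := by
          conv_lhs => rw [e1]
          simp only [Matrix.mul_assoc]
      _ = (Sᵀ)⁻¹ * (fromBlocks 0 1 (-1) 0 * fromBlocks 0 (-1) 1 0) * Sᵀ := by
          rw [nonsing_inv_mul _ hSd, Matrix.mul_one]
          simp only [Matrix.mul_assoc]
      _ = 1 := by rw [hJ, Matrix.mul_one, nonsing_inv_mul _ (by rwa [det_transpose])]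
  have hJm : realMat (fromBlocks 0 (-1) 1 0 : Matrix (Fin m ⊕ Fin m) (Fin m ⊕ Fin m) ℝ) =
      fromBlocks 0 (-1) 1 0 := by
    ext i j
    rcases i with i | i <;> rcases j with j | j <;> simp [realMat, Matrix.one_apply] <;>
      split_ifs <;> simp
  have hK' : realMat Sᵀ * Tᵀ = fromRows K₁ᵀ K₂ᵀ := by
    rw [← transpose_fromCols, ← hK, transpose_mul]; rfl
  have hKc : conjMat T * realMat S = fromCols (conjMat K₁) (conjMat K₂) := by
    rw [← conjMat_realMat S, ← conjMat_mul, hK]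
    ext i j; rcases j with j | j <;> rfl
  have e2 : T * realMat Q⁻¹ * Tᵀ = K₂ * K₁ᵀ - K₁ * K₂ᵀ := by
    rw [hQi, realMat_mul, realMat_mul, hJm, ← Matrix.mul_assoc, ← Matrix.mul_assoc, hK,
      Matrix.mul_assoc, hK', fromCols_mul_fromBlocks, fromCols_mul_fromRows]
    simp [sub_eq_add_neg]
  have e3 : conjMat T * realMat Q⁻¹ * Tᵀ = conjMat K₂ * K₁ᵀ - conjMat K₁ * K₂ᵀ := by
    rw [hQi, realMat_mul, realMat_mul, hJm, ← Matrix.mul_assoc, ← Matrix.mul_assoc, hKc,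
      Matrix.mul_assoc, hK', fromCols_mul_fromBlocks, fromCols_mul_fromRows]
    simp [sub_eq_add_neg]
  rw [e2, sub_eq_zero] at h2
  rw [e3] at h1
  have hpd := hg.hermMat_posDef.inv
  -- A null vector of K₁ᵗ would be isotropic for the positive definite matrix H⁻¹.
  have hK1 : K₁.det ≠ 0 := by
    intro h0
    rw [← det_transpose] at h0
    obtain ⟨v, hv, hv0⟩ := exists_mulVec_eq_zero_iff.2 h0
    have hpos := hpd.dotProduct_mulVec_pos hv
    have hz : star v ᵥ* conjMat K₁ = 0 := by
      have : star v ᵥ* conjMat K₁ = star (K₁ᵀ *ᵥ v) := by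
        rw [mulVec_transpose]
        ext i; simp [vecMul, dotProduct, conjMat]
      rw [this, hv0, star_zero]
    rw [← h1, smul_mulVec, sub_mulVec, ← mulVec_mulVec, hv0, mulVec_zero, ← mulVec_mulVec,
      zero_sub, dotProduct_smul, dotProduct_neg, dotProduct_mulVec, hz, zero_dotProduct] at hpos
    simp at hpos
  have hu : IsUnit K₁.det := isUnit_iff_ne_zero.2 hK1
  have huT : IsUnit K₁ᵀ.det := by rwa [det_transpose]
  set Z := K₁⁻¹ * K₂ with hZ
  have hK2 : K₂ = K₁ * Z := by rw [hZ, ← Matrix.mul_assoc, mul_nonsing_inv _ hu, Matrix.one_mul]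
  -- The Riemann relation T Q⁻¹ Tᵗ = 0 in the symplectic basis reads K₂ K₁ᵗ = K₁ K₂ᵗ.
  have hsymm : Zᵀ = Z := by
    rw [hK2, transpose_mul, ← Matrix.mul_assoc, Matrix.mul_assoc, Matrix.mul_assoc] at h2
    have h3 := congrArg (fun M => K₁⁻¹ * M * (K₁ᵀ)⁻¹) h2
    simp only [← Matrix.mul_assoc, nonsing_inv_mul _ hu, Matrix.one_mul] at h3
    simp only [Matrix.mul_assoc, mul_nonsing_inv _ huT, Matrix.mul_one] at h3
    exact h3.symm
  have him : conjMat Z - Z = (-2 * I) • realMat (imMat Z) := by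
    ext i j
    simp only [conjMat, realMat, imMat, Matrix.sub_apply, Matrix.map_apply, Matrix.smul_apply, smul_eq_mul]
    have := sub_conj (Z i j)
    push_cast at this
    linear_combination -this
  have hH : (hermMat g)⁻¹ = (2 : ℂ) • (conjMat K₁ * realMat (imMat Z) * K₁ᵀ) := by
    rw [← h1]
    have e4 : conjMat K₂ * K₁ᵀ - conjMat K₁ * K₂ᵀ = conjMat K₁ * (conjMat Z - Z) * K₁ᵀ := by
      have e6 : K₂ᵀ = Z * K₁ᵀ := by rw [hK2, transpose_mul, hsymm]
      have e7 : conjMat K₂ = conjMat K₁ * conjMat Z := by rw [← conjMat_mul, ← hK2]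
      rw [e6, e7, Matrix.mul_sub, Matrix.sub_mul]
      simp only [Matrix.mul_assoc]
    rw [e4, him, Matrix.mul_smul, Matrix.smul_mul, smul_smul]
    congr 1
    linear_combination (-2 : ℂ) * I_mul_I
  refine ⟨hK1, hsymm, ?_, hH⟩
  have hcd : IsUnit (conjMat K₁).det := by
    rw [conjMat_det]; exact isUnit_iff_ne_zero.2 (by simpa using hK1)
  -- Im Z is congruent to H⁻¹ up to the factor ½, so it is positive definite.
  have hY : realMat (imMat Z) = (1 / 2 : ℂ) • ((conjMat K₁)⁻¹ * (hermMat g)⁻¹ * ((conjMat K₁)⁻¹)ᴴ) := by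
    have e5 : ((conjMat K₁)⁻¹)ᴴ = (K₁ᵀ)⁻¹ := by
      rw [conjTranspose_nonsing_inv]; congr 1
      ext i j; simp [conjMat]
    rw [hH, e5, Matrix.mul_smul, Matrix.smul_mul, smul_smul]
    simp only [← Matrix.mul_assoc, nonsing_inv_mul _ hcd, Matrix.one_mul]
    rw [Matrix.mul_assoc, mul_nonsing_inv _ huT, Matrix.mul_one]
    norm_num
  have hYpd : (realMat (imMat Z)).PosDef := by
    rw [hY]
    refine PosDef.smul (hpd.mul_mul_conjTranspose_same ?_) (by
      rw [Complex.pos_iff]; norm_num)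
    refine Matrix.vecMul_injective_of_isUnit ?_
    rw [isUnit_iff_isUnit_det, det_nonsing_inv]
    exact (IsUnit.ringInverse hcd)
  exact posDef_of_realMat hYpd

/-- If v_l are the columns of A⁻¹, the vectors v_l/√2 and i v_l/√2 are a symplectic basis of the
Kähler form. The factor 1/√2 compensates g = 2 Re h. -/
theorem exists_symplectic_basis (hT : LinearIndependent ℝ fun (a : Fin m ⊕ Fin m) j => T j a)
    (hg : IsHermInner g) (hQ : ∀ a b, g (I • fun j => T j a) (fun j => T j b) = Q a b) :
    ∃ S : Matrix (Fin m ⊕ Fin m) (Fin m ⊕ Fin m) ℝ, Sᵀ * Q * S = fromBlocks 0 1 (-1) 0 := by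
  obtain ⟨A, hA, hAh⟩ := hg.hermMat_posDef.exists_coframe
  have hAu : IsUnit A.det := isUnit_iff_ne_zero.2 hA
  let b : Module.Basis (Fin m ⊕ Fin m) ℝ (Fin m → ℂ) :=
    basisOfLinearIndependentOfCardEqFinrank' _ hT (by
      rw [Module.finrank_pi_fintype]; simp; ring)
  have hb : ∀ a, b a = fun j => T j a := fun a => by simp [b]
  let σ : Fin m ⊕ Fin m → Fin m → ℂ := Sum.elim
    (fun l => A⁻¹ *ᵥ Pi.single l ((1 / Real.sqrt 2 : ℝ) : ℂ))
    (fun l => I • A⁻¹ *ᵥ Pi.single l ((1 / Real.sqrt 2 : ℝ) : ℂ))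
  have hgA : ∀ u v, g u v = 2 * (A *ᵥ u ⬝ᵥ star (A *ᵥ v)).re := fun u v => by
    rw [hg.apply_eq, hAh, dotProduct_coframe]
  have hAA : ∀ v, A *ᵥ (A⁻¹ *ᵥ v) = v := fun v => by
    rw [mulVec_mulVec, mul_nonsing_inv _ hAu, one_mulVec]
  have hsq : 2 * (Real.sqrt 2 / 2 * (Real.sqrt 2 / 2)) = 1 := by
    rw [div_mul_div_comm, Real.mul_self_sqrt (by norm_num)]; norm_num
  let S : Matrix (Fin m ⊕ Fin m) (Fin m ⊕ Fin m) ℝ := Matrix.of fun a c => b.repr (σ c) a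
  refine ⟨S, ?_⟩
  have hσ : ∀ c, σ c = ∑ a, S a c • fun j => T j a := fun c => by
    conv_lhs => rw [← b.sum_repr (σ c)]
    simp only [hb]; rfl
  have key : ∀ c d, (Sᵀ * Q * S) c d = g (I • σ c) (σ d) := fun c d => by
    rw [hσ c, hσ d]
    simp only [Finset.smul_sum, map_sum, _root_.sum_apply, smul_comm I, map_smul, _root_.smul_apply, hQ,
      Matrix.mul_apply, transpose_apply, smul_eq_mul]
    exact Finset.sum_congr rfl fun a _ => mul_comm _ _
  ext c d
  rw [key, hgA]
  rcases c with c | c <;> rcases d with d | d <;>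
    simp only [σ, Sum.elim_inl, Sum.elim_inr, mulVec_smul, hAA, fromBlocks_apply₁₁, fromBlocks_apply₁₂,
      fromBlocks_apply₂₁, fromBlocks_apply₂₂, star_smul, smul_dotProduct, dotProduct_smul, ← Pi.single_star,
      single_dotProduct, Matrix.neg_apply, Matrix.one_apply, Matrix.zero_apply, Pi.single_apply] <;>
    split_ifs <;> simp [hsq]

end PeriodMatrices

/-! ### Dual metrics on the base -/

section DualMetric

open Complex Matrix
open scoped ComplexOrder

variable {ι : Type*} [Fintype ι]

/-- Cauchy-Schwarz, with the supremum attained at f̄ / |f|; the case f = 0 is treated apart. -/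
theorem isLUB_normSq_pairing (f : ι → ℂ) :
    IsLUB {r : ℝ | ∃ y : ι → ℂ, ∑ l, ‖y l‖ ^ 2 ≤ 1 ∧ r = ‖f ⬝ᵥ y‖ ^ 2} (∑ l, ‖f l‖ ^ 2) := by
  constructor
  · rintro r ⟨y, hy, rfl⟩
    have h1 : ‖f ⬝ᵥ y‖ ≤ ∑ l, ‖f l‖ * ‖y l‖ :=
      (norm_sum_le _ _).trans (Finset.sum_le_sum fun l _ => (norm_mul _ _).le)
    calc ‖f ⬝ᵥ y‖ ^ 2 ≤ (∑ l, ‖f l‖ * ‖y l‖) ^ 2 := by gcongr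
      _ ≤ (∑ l, ‖f l‖ ^ 2) * ∑ l, ‖y l‖ ^ 2 := Finset.sum_mul_sq_le_sq_mul_sq _ _ _
      _ ≤ ∑ l, ‖f l‖ ^ 2 := mul_le_of_le_one_right (by positivity) hy
  · intro r hr
    set N := ∑ l, ‖f l‖ ^ 2 with hN
    have hN0 : 0 ≤ N := by positivity
    rcases hN0.eq_or_lt with h0 | hpos
    · rw [← h0]
      exact hr ⟨0, by simp, by simp⟩
    · refine hr ⟨fun l => (((Real.sqrt N)⁻¹ : ℝ) : ℂ) * starRingEnd ℂ (f l), ?_, ?_⟩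
      · have : ∀ l, ‖(((Real.sqrt N)⁻¹ : ℝ) : ℂ) * starRingEnd ℂ (f l)‖ ^ 2 = N⁻¹ * ‖f l‖ ^ 2 :=
          fun l => by
            rw [norm_mul, mul_pow, norm_real, Real.norm_eq_abs, sq_abs, inv_pow, Real.sq_sqrt hN0,
              RCLike.norm_conj]
        simp only [this, ← Finset.mul_sum, ← hN]
        exact (inv_mul_cancel₀ hpos.ne').le
      · have : (f ⬝ᵥ fun l => (((Real.sqrt N)⁻¹ : ℝ) : ℂ) * starRingEnd ℂ (f l)) =
            ((Real.sqrt N : ℝ) : ℂ) := by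
          have h2 : ∀ l, f l * ((((Real.sqrt N)⁻¹ : ℝ) : ℂ) * starRingEnd ℂ (f l)) =
              (((Real.sqrt N)⁻¹ * ‖f l‖ ^ 2 : ℝ) : ℂ) := fun l => by
            have := mul_conj' (f l)
            push_cast
            linear_combination (Real.sqrt N : ℂ)⁻¹ * this
          simp only [dotProduct, h2]
          rw [← ofReal_sum, ← Finset.mul_sum, ← hN]
          congr 1
          rw [inv_mul_eq_div, Real.div_sqrt]
        rw [this, norm_real, Real.norm_eq_abs, sq_abs, Real.sq_sqrt hN0]

variable [DecidableEq ι]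

/-- The matrix of the hermitian metric on the base that is dual to `h` under the pairing `c ∑ u_j v_j`. -/
def dualMat (c : ℂ) (h : Matrix ι ι ℂ) : Matrix ι ι ℂ := ((‖c‖ ^ 2 : ℝ) : ℂ) • (h⁻¹)ᵀ

/-- The coframe dual to e = A dw under the pairing c ∑ u_j v_j is f = c A⁻ᵗ dz. -/
theorem dualMat_eq_coframe (c : ℂ) (A : Matrix ι ι ℂ) :
    dualMat c (Aᵀ * conjMat A) = (c • (A⁻¹)ᵀ)ᵀ * conjMat (c • (A⁻¹)ᵀ) := by
  have h1 : (conjMat A)⁻¹ = conjMat A⁻¹ := by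
    have h2 : ∀ M : Matrix ι ι ℂ, conjMat M = Mᴴᵀ := fun M => rfl
    rw [h2, h2, ← transpose_nonsing_inv, conjTranspose_nonsing_inv]
  have h3 : conjMat (c • (A⁻¹)ᵀ) = starRingEnd ℂ c • (conjMat A⁻¹)ᵀ := by
    ext i j; simp [conjMat]
  rw [dualMat, Matrix.mul_inv_rev, h1, h3, transpose_mul, transpose_smul, transpose_transpose,
    Matrix.smul_mul, Matrix.mul_smul, smul_smul, mul_conj', ← transpose_nonsing_inv, transpose_transpose]
  push_cast
  rfl

theorem dualMat_posDef {c : ℂ} (hc : c ≠ 0) {h : Matrix ι ι ℂ} (hh : h.PosDef) :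
    (dualMat c h).PosDef := by
  refine hh.inv.transpose.smul ?_
  have : 0 < ‖c‖ ^ 2 := by positivity
  exact_mod_cast this

theorem dotProduct_star_self_re (y : ι → ℂ) : (y ⬝ᵥ star y).re = ∑ l, ‖y l‖ ^ 2 := by
  rw [dotProduct, re_sum]
  refine Finset.sum_congr rfl fun l _ => ?_
  rw [Pi.star_apply, ← starRingEnd_apply, mul_conj']
  norm_cast

theorem IsHermInner.isLUB_dualMat {g : Bilin (ι → ℂ)} (hg : IsHermInner g) (c : ℂ) (u : ι → ℂ) :
    IsLUB {r : ℝ | ∃ v : ι → ℂ, (hermOf g v v).re ≤ 1 ∧ r = ‖c * u ⬝ᵥ v‖ ^ 2}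
      (u ⬝ᵥ dualMat c (hermMat g) *ᵥ star u).re := by
  obtain ⟨A, hA, hAh⟩ := hg.hermMat_posDef.exists_coframe
  have hAu : IsUnit A.det := isUnit_iff_ne_zero.2 hA
  rw [hAh, dualMat_eq_coframe, dotProduct_coframe, dotProduct_star_self_re]
  convert isLUB_normSq_pairing ((c • (A⁻¹)ᵀ) *ᵥ u) using 1
  have key : ∀ v, c * u ⬝ᵥ v = (c • (A⁻¹)ᵀ) *ᵥ u ⬝ᵥ (A *ᵥ v) := fun v => by
    rw [smul_mulVec, smul_dotProduct, mulVec_transpose, ← dotProduct_mulVec, mulVec_mulVec,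
      nonsing_inv_mul _ hAu, one_mulVec, smul_eq_mul]
  have key2 : ∀ v, (hermOf g v v).re = ∑ l, ‖(A *ᵥ v) l‖ ^ 2 := fun v => by
    rw [hg.hermOf_eq, hAh, dotProduct_coframe, dotProduct_star_self_re]
  ext r
  constructor
  · rintro ⟨v, hv, rfl⟩
    exact ⟨A *ᵥ v, by rwa [← key2], by rw [key]⟩
  · rintro ⟨y, hy, rfl⟩
    have hy' : A *ᵥ (A⁻¹ *ᵥ y) = y := by rw [mulVec_mulVec, mul_nonsing_inv _ hAu, one_mulVec]
    exact ⟨A⁻¹ *ᵥ y, by rwa [key2, hy'], by rw [key, hy']⟩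

theorem IsHermInner.isLUB_iff_eq_dualMat {g g' : Bilin (ι → ℂ)} (hg : IsHermInner g)
    (hg' : IsHermInner g') {c : ℂ} (hc : c ≠ 0) :
    (∀ u, IsLUB {r : ℝ | ∃ v : ι → ℂ, (hermOf g v v).re ≤ 1 ∧ r = ‖c * u ⬝ᵥ v‖ ^ 2}
      (hermOf g' u u).re) ↔ g' = bilinOfMat (dualMat c (hermMat g)) := by
  have hM := (dualMat_posDef hc hg.hermMat_posDef).1
  refine ⟨fun h => hg'.eq_bilinOfMat_of_diag hM fun u => (h u).unique (hg.isLUB_dualMat c u), ?_⟩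
  rintro rfl u
  rw [hermOf_bilinOfMat hM]
  exact hg.isLUB_dualMat c u

/-- The matrix of the hermitian metric on a one dimensional base that is dual to the determinant
of `h` under the pairing given by `c`. -/
def detDualMat (c : ℂ) (h : Matrix ι ι ℂ) : Matrix (Fin 1) (Fin 1) ℂ :=
  Matrix.of fun _ _ => ((‖c‖ ^ 2 : ℝ) : ℂ) * h.det⁻¹

theorem detDualMat_eq_coframe (c : ℂ) (A : Matrix ι ι ℂ) :
    detDualMat c (Aᵀ * conjMat A) =
      (Matrix.of fun _ _ : Fin 1 => c * A.det⁻¹)ᵀ * conjMat (Matrix.of fun _ _ : Fin 1 => c * A.det⁻¹) := by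
  ext i j
  rw [detDualMat, of_apply, Matrix.mul_apply, Fin.sum_univ_one, det_mul, det_transpose, conjMat_det,
    mul_inv]
  simp only [transpose_apply, of_apply, conjMat, map_apply, map_mul, map_inv₀]
  have := mul_conj' c
  push_cast
  linear_combination (-(A.det⁻¹ * (starRingEnd ℂ A.det)⁻¹)) * this

theorem detDualMat_posDef {c : ℂ} (hc : c ≠ 0) {h : Matrix ι ι ℂ} (hh : h.PosDef) :
    (detDualMat c h).PosDef := by
  have h1 : (0 : ℂ) < ((‖c‖ ^ 2 : ℝ) : ℂ) * h.det⁻¹ := by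
    refine mul_pos ?_ ?_
    · have : 0 < ‖c‖ ^ 2 := by positivity
      exact_mod_cast this
    · rw [← Ring.inverse_eq_inv', ← det_nonsing_inv]
      exact hh.inv.det_pos
  have : detDualMat c h = (((‖c‖ ^ 2 : ℝ) : ℂ) * h.det⁻¹) • (1 : Matrix (Fin 1) (Fin 1) ℂ) := by
    ext i j
    fin_cases i; fin_cases j
    simp [detDualMat]
  rw [this]
  exact PosDef.one.smul h1

/-- The Gram determinant of the v_i is det H · |det v|², so |det v|² cancels and the condition
reduces to the standard basis. -/
theorem IsHermInner.det_iff_eq_detDualMat {g : Bilin (ι → ℂ)} {g' : Bilin (Fin 1 → ℂ)}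
    (hg : IsHermInner g) (hg' : IsHermInner g') {c : ℂ} (hc : c ≠ 0) :
    (∀ (u : Fin 1 → ℂ) (v : ι → ι → ℂ), hermOf g' u u *
      (Matrix.of fun i j => hermOf g (v i) (v j)).det = ((‖c * u 0 * (Matrix.of v).det‖ ^ 2 : ℝ) : ℂ)) ↔
      g' = bilinOfMat (detDualMat c (hermMat g)) := by
  have hM := (detDualMat_posDef hc hg.hermMat_posDef).1
  have hd : (hermMat g).det ≠ 0 := hg.hermMat_posDef.det_pos.ne'
  have hv : ∀ v : ι → ι → ℂ, (Matrix.of fun i j => hermOf g (v i) (v j)).det =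
      (hermMat g).det * ((‖(Matrix.of v).det‖ ^ 2 : ℝ) : ℂ) := fun v => by
    have : (Matrix.of fun i j => hermOf g (v i) (v j)) =
        (Matrix.of v * hermMat g * (conjMat (Matrix.of v))ᵀ)ᵀ := by
      ext i j
      rw [of_apply, hg.hermOf_eq, transpose_apply, Matrix.mul_assoc]
      rfl
    rw [this, det_transpose, det_mul, det_mul, det_transpose, conjMat_det]
    have := mul_conj' (Matrix.of v).det
    push_cast
    linear_combination (hermMat g).det * this
  have hu : ∀ u : Fin 1 → ℂ, u ⬝ᵥ detDualMat c (hermMat g) *ᵥ star u =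
      ((‖c * u 0‖ ^ 2 : ℝ) : ℂ) * (hermMat g).det⁻¹ := fun u => by
    simp only [dotProduct, mulVec, Fin.sum_univ_one, detDualMat, of_apply, Pi.star_apply]
    have := mul_conj' (u 0)
    rw [starRingEnd_apply] at this
    rw [norm_mul]
    push_cast
    linear_combination ((‖c‖ : ℂ) ^ 2 * (hermMat g).det⁻¹) * this
  constructor
  · intro h
    refine hg'.eq_bilinOfMat_of_diag hM fun u => congrArg re ?_
    have h1 := h u (1 : Matrix ι ι ℂ)
    have h2 := hv (1 : Matrix ι ι ℂ)
    have h3 : (Matrix.of (1 : Matrix ι ι ℂ) : Matrix ι ι ℂ).det = 1 := det_one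
    rw [h2, h3] at h1
    rw [hu, eq_mul_inv_iff_mul_eq₀ hd]
    simpa using h1
  · rintro rfl u v
    rw [hermOf_bilinOfMat hM, hu, hv, norm_mul _ (Matrix.of v).det, mul_pow]
    push_cast
    field_simp

end DualMetric
end

noncomputable section

/-! ### Constant combinations of closed 1-forms -/

section CyclicSum

variable {V : Type*} [NormedAddCommGroup V] [NormedSpace ℝ V] {κ : Type*} [Fintype κ]

/-- A constant skew combination of products of closed `1`-forms is closed. -/
theorem cyclic_sum_eq_zero {d : κ → V → V → ℝ} {Q : Matrix κ κ ℝ} (hQ : Q.transpose = -Q) {x : V}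
    (hd : ∀ a v, DifferentiableAt ℝ (fun y => d a y v) x)
    (hsymm : ∀ a u v, fderiv ℝ (fun y => d a y v) x u = fderiv ℝ (fun y => d a y u) x v) (u v w : V) :
    fderiv ℝ (fun y => ∑ a, ∑ b, Q a b * (d a y v * d b y w)) x u +
      fderiv ℝ (fun y => ∑ a, ∑ b, Q a b * (d a y w * d b y u)) x v +
      fderiv ℝ (fun y => ∑ a, ∑ b, Q a b * (d a y u * d b y v)) x w = 0 := by
  have hf : ∀ u v w, fderiv ℝ (fun y => ∑ a, ∑ b, Q a b * (d a y v * d b y w)) x u =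
      ∑ a, ∑ b, Q a b * (d a x v * fderiv ℝ (fun y => d b y w) x u) +
        ∑ a, ∑ b, Q a b * (fderiv ℝ (fun y => d a y v) x u * d b x w) := fun u v w => by
    have h : HasFDerivAt (fun y => ∑ a, ∑ b, Q a b * (d a y v * d b y w)) _ x :=
      HasFDerivAt.fun_sum fun a (_ : a ∈ Finset.univ) =>
      HasFDerivAt.fun_sum fun b (_ : b ∈ Finset.univ) =>
        ((hd a v).hasFDerivAt.mul (hd b w).hasFDerivAt).const_mul (Q a b)
    rw [h.fderiv]
    simp only [sum_apply, smul_apply, add_apply, smul_eq_mul, ← Finset.sum_add_distrib]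
    exact Finset.sum_congr rfl fun a _ => Finset.sum_congr rfl fun b _ => by ring
  have hswap : ∀ u v w, ∑ a, ∑ b, Q a b * (d a x v * fderiv ℝ (fun y => d b y w) x u) =
      -∑ a, ∑ b, Q a b * (fderiv ℝ (fun y => d a y u) x w * d b x v) := fun u v w => by
    rw [Finset.sum_comm, ← Finset.sum_neg_distrib]
    refine Finset.sum_congr rfl fun a _ => ?_
    rw [← Finset.sum_neg_distrib]
    refine Finset.sum_congr rfl fun b _ => ?_
    have : Q b a = -Q a b := congrFun (congrFun hQ a) b
    rw [this, hsymm a u w]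
    ring
  rw [hf, hf, hf, hswap u v w, hswap v w u, hswap w u v]
  ring

end CyclicSum

/-! ### Submersion metrics with flat fibres and constant period matrices -/

section Submersion

open Complex Matrix

variable {n m : ℕ}

/-- The metrics `gF`, `gS`, `G` form a submersion metric over `U` with flat fibres whose period
matrices in suitable local frames are constant. -/
structure FlatSubmersion (U : Set (Fin n → ℂ)) (Λ : (Fin n → ℂ) → AddSubgroup (Fin m → ℂ))
    (gF : (Fin n → ℂ) → (Fin m → ℂ) → Bilin (Fin m → ℂ)) (gS : (Fin n → ℂ) → Bilin (Fin n → ℂ))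
    (G : (Fin n ⊕ Fin m → ℂ) → Bilin (Fin n ⊕ Fin m → ℂ)) : Prop where
  isOpen : IsOpen U
  fib_const : ∀ z ∈ U, ∀ w, gF z w = gF z 0
  fib_herm : ∀ z ∈ U, IsHermInner (gF z 0)
  base_herm : ∀ z ∈ U, IsHermInner (gS z)
  sub : IsSubmersionMetric U Λ gF gS G
  frame : ∀ z₀ ∈ U, ∃ W T, ∃ Q : Matrix (Fin m ⊕ Fin m) (Fin m ⊕ Fin m) ℝ, z₀ ∈ W ∧ W ⊆ U ∧
    IsFrame Λ W T ∧ ∀ z ∈ W, ∀ a b, gF z 0 (I • fun j => T z j a) (fun j => T z j b) = Q a b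

/-- The projection to the vertical space along the horizontal space. -/
def thetaVec (T : (Fin n → ℂ) → Matrix (Fin m) (Fin m ⊕ Fin m) ℂ) (x : Fin n ⊕ Fin m → ℂ) :
    (Fin n ⊕ Fin m → ℂ) →L[ℝ] (Fin m → ℂ) :=
  ContinuousLinearMap.pi (thetaForm T x)

theorem thetaVec_apply (T : (Fin n → ℂ) → Matrix (Fin m) (Fin m ⊕ Fin m) ℂ)
    (x u : Fin n ⊕ Fin m → ℂ) (j : Fin m) : thetaVec T x u j = thetaForm T x j u := rfl

theorem thetaVec_smul (T : (Fin n → ℂ) → Matrix (Fin m) (Fin m ⊕ Fin m) ℂ) (c : ℂ)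
    (x u : Fin n ⊕ Fin m → ℂ) : thetaVec T x (c • u) = c • thetaVec T x u :=
  funext fun j => thetaForm_smul c x u j

theorem thetaVec_eq_fibPart (T : (Fin n → ℂ) → Matrix (Fin m) (Fin m ⊕ Fin m) ℂ)
    {x u : Fin n ⊕ Fin m → ℂ} (hu : basePart u = 0) : thetaVec T x u = fibPart u := by
  ext j
  rw [thetaVec_apply, thetaForm_apply, hu]
  simp

theorem hermSum_apply {V : Type*} [NormedAddCommGroup V] [NormedSpace ℝ V] {ι : Type*} [Fintype ι]
    (H : Matrix ι ι ℂ) (α : ι → V →L[ℝ] ℂ) (u v : V) :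
    (∑ j, ∑ k, (I * H j k) • wedgeOne ![α j, conjOne (α k)] : CForm V 2) ![u, v] =
      hermForm H ![fun j => α j u, fun j => α j v] := by
  simp only [hermForm, cformSum_apply, ContinuousAlternatingMap.smul_apply, wedgeOne_two]
  rfl

theorem unitarySum_apply {V : Type*} [NormedAddCommGroup V] [NormedSpace ℝ V] {ι : Type*} [Fintype ι]
    (A : Matrix ι ι ℂ) (α : ι → V →L[ℝ] ℂ) (u v : V) :
    (∑ l, I • wedgeOne ![∑ j, A l j • α j, conjOne (∑ j, A l j • α j)] : CForm V 2) ![u, v] =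
      hermForm (Aᵀ * conjMat A) ![fun j => α j u, fun j => α j v] := by
  rw [hermForm_apply, dotProduct_coframe, dotProduct_coframe]
  simp only [cformSum_apply, ContinuousAlternatingMap.smul_apply, wedgeOne_two, dotProduct]
  rw [← Finset.sum_sub_distrib, Finset.mul_sum]
  refine Finset.sum_congr rfl fun l _ => ?_
  have h : ∀ u, (∑ j, A l j • α j) u = (A *ᵥ fun j => α j u) l := fun u => by
    simp [mulVec, dotProduct]
  have h2 : ∀ u, conjOne (∑ j, A l j • α j) u = starRingEnd ℂ ((A *ᵥ fun j => α j u) l) := fun u =>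
    congrArg (starRingEnd ℂ) (h u)
  rw [h, h, h2, h2]
  rfl

namespace FlatSubmersion

variable {U W : Set (Fin n → ℂ)} {Λ : (Fin n → ℂ) → AddSubgroup (Fin m → ℂ)}
  {gF : (Fin n → ℂ) → (Fin m → ℂ) → Bilin (Fin m → ℂ)} {gS : (Fin n → ℂ) → Bilin (Fin n → ℂ)}
  {G : (Fin n ⊕ Fin m → ℂ) → Bilin (Fin n ⊕ Fin m → ℂ)}
  {T : (Fin n → ℂ) → Matrix (Fin m) (Fin m ⊕ Fin m) ℂ} {x : Fin n ⊕ Fin m → ℂ}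
  {Q : Matrix (Fin m ⊕ Fin m) (Fin m ⊕ Fin m) ℝ}

theorem metric_eq (h : FlatSubmersion U Λ gF gS G) (hT : IsFrame Λ W T) (hW : W ⊆ U)
    (hx : x ∈ totalSet m W) (u v : Fin n ⊕ Fin m → ℂ) :
    G x u v = gS (basePart x) (basePart u) (basePart v) +
      gF (basePart x) 0 (thetaVec T x u) (thetaVec T x v) := by
  rw [h.sub x (hW hx) u v _ _ (hT.isHorizontal hW hx u) (hT.isHorizontal hW hx v),
    h.fib_const _ (hW hx)]
  rfl

theorem isHermInner (h : FlatSubmersion U Λ gF gS G) (hx : x ∈ totalSet m U) : IsHermInner (G x) := by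
  obtain ⟨W, T, Q, hxW, hW, hT, -⟩ := h.frame _ hx
  have hG := h.metric_eq hT hW (x := x) hxW
  have hS := h.base_herm _ hx
  have hF := h.fib_herm _ hx
  have hnn : ∀ {ι : Type} [Fintype ι] {g : Bilin (ι → ℂ)} (_ : IsHermInner g) (v : ι → ℂ), 0 ≤ g v v :=
    fun hg v => by
      by_cases hv : v = 0
      · simp [hv]
      · exact (hg.2.2 v hv).le
  refine ⟨fun u v => ?_, fun u v => ?_, fun u hu => ?_⟩
  · rw [hG, hG, hS.1, hF.1]
  · rw [hG, hG, thetaVec_smul, thetaVec_smul, hF.2.1,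
      show basePart (I • u) = I • basePart u from rfl, show basePart (I • v) = I • basePart v from rfl,
      hS.2.1]
  · rw [hG]
    by_cases h0 : basePart u = 0
    · have h1 : thetaVec T x u ≠ 0 := fun h2 => hu (by
        rw [thetaVec_eq_fibPart T h0] at h2
        ext i
        rcases i with i | i
        · exact congrFun h0 i
        · exact congrFun h2 i)
      exact add_pos_of_nonneg_of_pos (hnn hS _) (hF.2.2 _ h1)
    · exact add_pos_of_pos_of_nonneg (hS.2.2 _ h0) (hnn hF _)

theorem kahlerForm_apply (h : FlatSubmersion U Λ gF gS G) (hT : IsFrame Λ W T) (hW : W ⊆ U)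
    (hx : x ∈ totalSet m W) (u v : Fin n ⊕ Fin m → ℂ) :
    kahlerForm (G x) ![u, v] = kahlerForm (gS (basePart x)) ![basePart u, basePart v] +
      kahlerForm (gF (basePart x) 0) ![thetaVec T x u, thetaVec T x v] := by
  rw [_root_.kahlerForm_apply (h.isHermInner (hW hx)), _root_.kahlerForm_apply (h.base_herm _ (hW hx)),
    _root_.kahlerForm_apply (h.fib_herm _ (hW hx)), h.metric_eq hT hW hx, thetaVec_smul]
  push_cast
  rfl

theorem kahlerForm_eq (h : FlatSubmersion U Λ gF gS G) (hT : IsFrame Λ W T) (hW : W ⊆ U)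
    (hx : x ∈ totalSet m W) :
    kahlerForm (G x) = (∑ j, ∑ k, (I * hermMat (gS (basePart x)) j k) • wedgeOne ![dz j, conjOne (dz k)]) +
      vertForm (hermMat (gF (basePart x) 0)) T x := by
  refine CForm.ext_two fun u v => ?_
  rw [h.kahlerForm_apply hT hW hx, ContinuousAlternatingMap.add_apply, hermSum_apply, vertForm,
    hermSum_apply, ← (h.base_herm _ (hW hx)).kahlerForm_eq, ← (h.fib_herm _ (hW hx)).kahlerForm_eq]
  rfl

theorem kahlerForm_eq_unitary (h : FlatSubmersion U Λ gF gS G) (hT : IsFrame Λ W T) (hW : W ⊆ U)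
    (hx : x ∈ totalSet m W) {A : Matrix (Fin m) (Fin m) ℂ} {B : Matrix (Fin n) (Fin n) ℂ}
    (hA : hermMat (gF (basePart x) 0) = Aᵀ * conjMat A)
    (hB : hermMat (gS (basePart x)) = Bᵀ * conjMat B) :
    kahlerForm (G x) = (∑ l, I • wedgeOne ![∑ j, B l j • dz j, conjOne (∑ j, B l j • dz j)]) +
      ∑ l, I • wedgeOne ![∑ j, A l j • thetaForm T x j, conjOne (∑ j, A l j • thetaForm T x j)] := by
  refine CForm.ext_two fun u v => ?_
  rw [h.kahlerForm_apply hT hW hx, ContinuousAlternatingMap.add_apply, unitarySum_apply,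
    unitarySum_apply, ← hA, ← hB, ← (h.base_herm _ (hW hx)).kahlerForm_eq,
    ← (h.fib_herm _ (hW hx)).kahlerForm_eq]
  rfl

theorem descends (h : FlatSubmersion U Λ gF gS G) : Descends U Λ fun x => kahlerForm (G x) := by
  intro W s hWo hWU hs hsΛ x hx
  obtain ⟨W', T, Q, hx', hW', hT, -⟩ := h.frame _ (hWU hx)
  have hsd := hs.differentiableAt (hWo.mem_nhds hx)
  refine CForm.ext_two fun u v => ?_
  have hθ : ∀ u, thetaVec T (fibTranslate s x) (fderiv ℝ (fibTranslate s) x u) = thetaVec T x u :=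
    fun u => funext fun j => hT.thetaForm_fibTranslate hWo hx hx' hs hsΛ u j
  rw [compContinuousLinearMap_two, h.kahlerForm_apply hT hW' (x := fibTranslate s x) hx',
    h.kahlerForm_apply hT hW' hx', hθ, hθ, basePart_fderiv_fibTranslate hsd,
    basePart_fderiv_fibTranslate hsd]
  rfl

/-- On vertical components the dx^a are coordinates in the basis τ_a, so the matrix Q appears with
coefficients independent of the point. -/
theorem vertical_eq (hT : IsFrame Λ W T)
    (hQ : ∀ z ∈ W, ∀ a b, gF z 0 (I • fun j => T z j a) (fun j => T z j b) = Q a b)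
    (hx : x ∈ totalSet m W) (u v : Fin n ⊕ Fin m → ℂ) :
    gF (basePart x) 0 (I • thetaVec T x u) (thetaVec T x v) =
      ∑ a, ∑ b, Q a b * (fderiv ℝ (frameCoord T a) x u * fderiv ℝ (frameCoord T b) x v) := by
  have hθ : ∀ u, thetaVec T x u = ∑ a, fderiv ℝ (frameCoord T a) x u • fun j => T (basePart x) j a :=
    fun u => by
      ext j
      rw [thetaVec_apply, hT.thetaForm_eq_sum hx, Finset.sum_apply]
      rfl
  rw [hθ, hθ]
  simp only [Finset.smul_sum, map_sum, _root_.sum_apply, smul_comm I, map_smul, _root_.smul_apply,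
    hQ _ hx, smul_eq_mul, Finset.mul_sum]
  rw [Finset.sum_comm]
  exact Finset.sum_congr rfl fun a _ => Finset.sum_congr rfl fun b _ => by ring

theorem contDiffOn_dcoord (hT : IsFrame Λ W T) (a : Fin m ⊕ Fin m) (u : Fin n ⊕ Fin m → ℂ) :
    ContDiffOn ℝ (⊤ : ℕ∞) (fun y => fderiv ℝ (frameCoord T a) y u) (totalSet m W) :=
  ((hT.contDiffOn_frameCoord a).fderiv_of_isOpen (totalSet_isOpen hT.1) (by simp)).clm_apply
    contDiffOn_const

theorem contDiffOn (h : FlatSubmersion U Λ gF gS G) (hS : ContDiffOn ℝ (⊤ : ℕ∞) gS U) :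
    ContDiffOn ℝ (⊤ : ℕ∞) G (totalSet m U) := by
  rw [contDiffOn_bilin_iff] at hS ⊢
  intro u v x hx
  obtain ⟨W, T, Q, hxW, hW, hT, hQ⟩ := h.frame _ hx
  have hopen := (totalSet_isOpen (m := m) hT.1).mem_nhds hxW
  -- Inserting -iu for u turns the formula for g(iu, v) into one for the metric itself.
  have h1 : ContDiffOn ℝ (⊤ : ℕ∞) (fun y => gS (basePart y) (basePart u) (basePart v) +
      ∑ a, ∑ b, Q a b * (fderiv ℝ (frameCoord T a) y ((-I) • u) * fderiv ℝ (frameCoord T b) y v))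
      (totalSet m W) := by
    refine ContDiffOn.add ?_ (ContDiffOn.sum fun a _ => ContDiffOn.sum fun b _ =>
      contDiffOn_const.mul ((contDiffOn_dcoord hT a _).mul (contDiffOn_dcoord hT b _)))
    exact (hS (basePart u) (basePart v)).comp
      ((baseCLM n m).restrictScalars ℝ).contDiff.contDiffOn fun y hy => hW hy
  refine ContDiffAt.contDiffWithinAt ((h1.contDiffAt hopen).congr_of_eventuallyEq ?_)
  filter_upwards [hopen] with y hy
  rw [h.metric_eq hT hW hy, ← vertical_eq hT hQ hy, thetaVec_smul, smul_smul]
  simp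

/-- The Kähler form is the pullback of ω_S plus ½ ∑ Q_ab dx^a ∧ dx^b. The second part is closed
because Q is constant and skew and second derivatives of the x^a are symmetric. -/
theorem isKahlerMetric (h : FlatSubmersion U Λ gF gS G) (hS : IsKahlerMetric U gS) :
    IsKahlerMetric (totalSet m U) G := by
  have hsm := h.contDiffOn hS.1
  refine ⟨hsm, fun x hx => h.isHermInner hx, fun x hx => ?_⟩
  have hUo := (totalSet_isOpen (m := m) h.isOpen)
  rw [extDeriv_kahlerForm_eq_zero_iff
    ((hsm.contDiffAt (hUo.mem_nhds hx)).differentiableAt (by simp))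
    (by filter_upwards [hUo.mem_nhds hx] with y hy using h.isHermInner hy)]
  obtain ⟨W, T, Q, hxW, hW, hT, hQ⟩ := h.frame _ hx
  have hopen := (totalSet_isOpen (m := m) hT.1).mem_nhds hxW
  have hSd : DifferentiableAt ℝ gS (basePart x) :=
    (hS.1.contDiffAt (h.isOpen.mem_nhds hx)).differentiableAt (by simp)
  have hbase := (extDeriv_kahlerForm_eq_zero_iff hSd (by
    filter_upwards [h.isOpen.mem_nhds hx] with y hy using h.base_herm y hy)).1 (hS.2.2 _ hx)
  have hdiff : ∀ a v, DifferentiableAt ℝ (fun y => fderiv ℝ (frameCoord T a) y v) x := fun a v =>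
    ((contDiffOn_dcoord hT a v).contDiffAt hopen).differentiableAt (by simp)
  have hcyc := cyclic_sum_eq_zero (d := fun a y v => fderiv ℝ (frameCoord T a) y v)
    (kahler_matrix_skew (h.fib_herm _ hx) (hQ _ hxW)) hdiff (fun a u v => by
      have hc : ContDiffAt ℝ 2 (frameCoord T a) x :=
        by
        exact_mod_cast contDiffAt_infty.1 ((hT.contDiffOn_frameCoord a).contDiffAt hopen) 2
      have h2 := hc.isSymmSndFDerivAt (by simp) u v
      have hd : DifferentiableAt ℝ (fderiv ℝ (frameCoord T a)) x :=
        (hc.fderiv_right (m := 1) (by norm_num)).differentiableAt one_ne_zero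
      have e : ∀ v, fderiv ℝ (fun y => fderiv ℝ (frameCoord T a) y v) x u =
        fderiv ℝ (fderiv ℝ (frameCoord T a)) x u v := fun v => by
          rw [fderiv_clm_apply hd (differentiableAt_const v)]; simp
      have e' : fderiv ℝ (fun y => fderiv ℝ (frameCoord T a) y u) x v =
        fderiv ℝ (fderiv ℝ (frameCoord T a)) x v u := by
          rw [fderiv_clm_apply hd (differentiableAt_const u)]; simp
      rw [e, e', h2])
  have hsplit : ∀ u v w, fderiv ℝ (fun y => G y (I • v) w) x u =
      fderiv ℝ (fun z => gS z (I • basePart v) (basePart w)) (basePart x) (basePart u) +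
      fderiv ℝ (fun y => ∑ a, ∑ b, Q a b *
        (fderiv ℝ (frameCoord T a) y v * fderiv ℝ (frameCoord T b) y w)) x u := fun u v w => by
    have he : (fun y => G y (I • v) w) =ᶠ[nhds x] fun y =>
        gS (basePart y) (I • basePart v) (basePart w) + ∑ a, ∑ b, Q a b *
        (fderiv ℝ (frameCoord T a) y v * fderiv ℝ (frameCoord T b) y w) := by
      filter_upwards [hopen] with y hy
      rw [h.metric_eq hT hW hy, thetaVec_smul, ← vertical_eq hT hQ hy]
      rfl
    have hd1 : HasFDerivAt (fun y : Fin n ⊕ Fin m → ℂ => gS (basePart y) (I • basePart v) (basePart w))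
        ((fderiv ℝ (fun z => gS z (I • basePart v) (basePart w)) (basePart x)).comp
          ((baseCLM n m).restrictScalars ℝ)) x := by
      have h3 : DifferentiableAt ℝ (fun z => gS z (I • basePart v) (basePart w)) (basePart x) := by
        fun_prop
      exact HasFDerivAt.comp (g := fun z => gS z (I • basePart v) (basePart w)) x h3.hasFDerivAt
        ((baseCLM n m).restrictScalars ℝ).hasFDerivAt
    have hd2 : DifferentiableAt ℝ (fun y => ∑ a, ∑ b, Q a b *
        (fderiv ℝ (frameCoord T a) y v * fderiv ℝ (frameCoord T b) y w)) x :=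
      DifferentiableAt.fun_sum fun a _ => DifferentiableAt.fun_sum fun b _ =>
        ((hdiff a v).mul (hdiff b w)).const_mul _
    rw [he.fderiv_eq, (hd1.fun_add hd2.hasFDerivAt).fderiv]
    rfl
  intro u v w
  rw [hsplit, hsplit, hsplit]
  linear_combination hbase (basePart u) (basePart v) (basePart w) + hcyc u v w

end FlatSubmersion

end Submersion
end

noncomputable section

/-! ### Real parts of closed forms and inversion of metrics -/

section RealParts

variable {V : Type*} [NormedAddCommGroup V] [NormedSpace ℝ V]

theorem extDeriv_comp_clm_eq_zero {α : V → CForm V 2} {x : V} (hα : DifferentiableAt ℝ α x)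
    (h : extDeriv α x = 0) (L : ℂ →L[ℝ] ℂ) :
    extDeriv (fun y => L.compContinuousAlternatingMap (α y)) x = 0 := by
  have hd : DifferentiableAt ℝ (fun y => L.compContinuousAlternatingMap (α y)) x :=
    (ContinuousLinearMap.compContinuousAlternatingMapCLM ℝ V ℂ ℂ (Fin 2) L).differentiableAt.comp x hα
  rw [extDeriv_two_eq_zero_iff hα] at h
  rw [extDeriv_two_eq_zero_iff hd]
  have key : ∀ u v w, fderiv ℝ (fun y => L.compContinuousAlternatingMap (α y) ![v, w]) x u =
      L (fderiv ℝ (fun y => α y ![v, w]) x u) := fun u v w => by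
    have h1 : DifferentiableAt ℝ (fun y => α y ![v, w]) x :=
      hα.continuousAlternatingMap_apply_const _
    exact congrArg (fun f => f u) (L.hasFDerivAt.comp x h1.hasFDerivAt).fderiv
  intro u v w
  rw [key, key, key, ← map_add, ← map_add, h, map_zero]

variable [FiniteDimensional ℝ V]

/-- The bilinear form `2 Re α`. -/
def twiceRe (α : CForm V 2) : Bilin V :=
  LinearMap.toContinuousBilinearMap
    (LinearMap.mk₂ ℝ (fun u v : V => 2 * (α ![u, v]).re)
      (fun u u' v => by rw [CForm.two_add_left, Complex.add_re, mul_add])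
      (fun c u v => by rw [CForm.two_smul_left]; simp; ring)
      (fun u v v' => by rw [CForm.two_add_right, Complex.add_re, mul_add])
      (fun c u v => by rw [CForm.two_smul_right]; simp; ring))

theorem isInvertible_of_pos {g : Bilin V} (hg : ∀ u, u ≠ 0 → 0 < g u u) : g.IsInvertible := by
  have hinj : Function.Injective ((LinearMap.toContinuousLinearMap.symm : (V →L[ℝ] ℝ) ≃ₗ[ℝ] _).toLinearMap ∘ₗ
      (g : V →ₗ[ℝ] V →L[ℝ] ℝ)) := by
    rw [injective_iff_map_eq_zero]
    intro u hu
    by_contra h0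
    have : g u u = 0 := congrArg (fun f : V →ₗ[ℝ] ℝ => f u) hu
    exact (hg u h0).ne' this
  have hinj' : Function.Injective (g : V →ₗ[ℝ] V →L[ℝ] ℝ) := fun u v h => hinj (by
    simp only [LinearMap.comp_apply]; rw [h])
  have hfr : Module.finrank ℝ V = Module.finrank ℝ (V →L[ℝ] ℝ) := by
    rw [← (LinearMap.toContinuousLinearMap : (V →ₗ[ℝ] ℝ) ≃ₗ[ℝ] _).finrank_eq]
    exact (Subspace.dual_finrank_eq (K := ℝ) (V := V)).symm
  refine ⟨(LinearEquiv.ofBijective (g : V →ₗ[ℝ] V →L[ℝ] ℝ)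
    ⟨hinj', (LinearMap.injective_iff_surjective_of_finrank_eq_finrank hfr).1 hinj'⟩).toContinuousLinearEquiv, ?_⟩
  ext u v
  rfl

theorem apply_inverse_comp {g : Bilin V} (hg : ∀ u, u ≠ 0 → 0 < g u u) (a : Bilin V) (u v : V) :
    g (g.inverse (a u)) v = a u v := by
  rw [(isInvertible_of_pos hg).self_apply_inverse]

end RealParts

/-! ### The hyperkähler structure -/

section Hyperkahler

open Complex Matrix

variable {m : ℕ} {U W : Set (Fin m → ℂ)} {Λ : (Fin m → ℂ) → AddSubgroup (Fin m → ℂ)}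
  {gF : (Fin m → ℂ) → (Fin m → ℂ) → Bilin (Fin m → ℂ)} {gS : (Fin m → ℂ) → Bilin (Fin m → ℂ)}
  {G : (Fin m ⊕ Fin m → ℂ) → Bilin (Fin m ⊕ Fin m → ℂ)}
  {Υ : (Fin m ⊕ Fin m → ℂ) → CForm (Fin m ⊕ Fin m → ℂ) 2} {g : (Fin m → ℂ) → ℂ}
  {T : (Fin m → ℂ) → Matrix (Fin m) (Fin m ⊕ Fin m) ℂ} {x : Fin m ⊕ Fin m → ℂ}
  {Q : Matrix (Fin m ⊕ Fin m) (Fin m ⊕ Fin m) ℝ}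

/-- `Υ = g ∑ dz^j ∧ dw^j` is a holomorphic symplectic form on the family. -/
structure IsSymplecticPairing (U : Set (Fin m → ℂ)) (Λ : (Fin m → ℂ) → AddSubgroup (Fin m → ℂ))
    (Υ : (Fin m ⊕ Fin m → ℂ) → CForm (Fin m ⊕ Fin m → ℂ) 2) (g : (Fin m → ℂ) → ℂ) : Prop where
  isOpen : IsOpen U
  symplectic : IsHolSymplectic (totalSet m U) Υ
  desc : Descends U Λ Υ
  hol : DifferentiableOn ℂ g U
  eq : ∀ x ∈ totalSet m U, Υ x = g (basePart x) • ∑ j, wedgeOne ![dz j, dw j]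

namespace IsSymplecticPairing

theorem apply (hΥ : IsSymplecticPairing U Λ Υ g) (hx : x ∈ totalSet m U) (u v : Fin m ⊕ Fin m → ℂ) :
    Υ x ![u, v] = g (basePart x) * (basePart u ⬝ᵥ fibPart v - basePart v ⬝ᵥ fibPart u) := by
  rw [hΥ.eq x hx, ContinuousAlternatingMap.smul_apply, cformSum_apply, smul_eq_mul]
  simp only [wedgeOne_two, dotProduct, ← Finset.sum_sub_distrib]
  rfl

theorem ne_zero (hΥ : IsSymplecticPairing U Λ Υ g) (hm : 0 < m) {z : Fin m → ℂ} (hz : z ∈ U) :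
    g z ≠ 0 := by
  intro h0
  have hx : (Sum.elim z 0 : Fin m ⊕ Fin m → ℂ) ∈ totalSet m U := hz
  have := hΥ.symplectic.2.2 _ hx (fun _ => 1) fun v => by
    rw [hΥ.apply hx]
    have : basePart (Sum.elim z 0 : Fin m ⊕ Fin m → ℂ) = z := rfl
    rw [this, h0, zero_mul]
  exact one_ne_zero (congrFun this (Sum.inl ⟨0, hm⟩))

/-- Translation by τ_a adds g ∑ dz^j ∧ dτ_a^j to Υ, so invariance forces this term to vanish: the
1-form ∑ τ_a^j dz^j is closed. -/
theorem frame_symm (hΥ : IsSymplecticPairing U Λ Υ g) (hm : 0 < m) (hT : IsFrame Λ W T) (hW : W ⊆ U)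
    {z : Fin m → ℂ} (hz : z ∈ W) (a : Fin m ⊕ Fin m) (u v : Fin m → ℂ) :
    (u ⬝ᵥ fun j => fderiv ℂ (fun z => T z j a) z v) = v ⬝ᵥ fun j => fderiv ℂ (fun z => T z j a) z u := by
  have hs : DifferentiableOn ℂ (fun z j => T z j a) W := differentiableOn_pi.2 fun j => hT.2.1 j a
  have hx : (Sum.elim z 0 : Fin m ⊕ Fin m → ℂ) ∈ totalSet m W := hz
  have h := hΥ.desc W (fun z j => T z j a) hT.1 hW hs (fun z hz => (hT.2.2 z hz).mem a) _ hx
  have hsd : DifferentiableAt ℂ (fun z j => T z j a) (basePart (Sum.elim z 0 : Fin m ⊕ Fin m → ℂ)) :=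
    hs.differentiableAt (hT.1.mem_nhds hz)
  have h1 := congrArg (fun α => α ![Sum.elim u 0, Sum.elim v 0]) h
  simp only [compContinuousLinearMap_two] at h1
  rw [hΥ.apply (x := fibTranslate (fun z j => T z j a) (Sum.elim z 0)) (hW hz), hΥ.apply (hW hx), basePart_fderiv_fibTranslate hsd,
    basePart_fderiv_fibTranslate hsd, fibPart_fderiv_fibTranslate hsd, fibPart_fderiv_fibTranslate hsd] at h1
  have hb : ∀ u, basePart (Sum.elim u 0 : Fin m ⊕ Fin m → ℂ) = u := fun _ => rfl
  have hf : ∀ u, fibPart (Sum.elim u 0 : Fin m ⊕ Fin m → ℂ) = 0 := fun _ => rfl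
  have hg := hΥ.ne_zero hm (hW hz)
  have hd : ∀ v, fderiv ℂ (fun z j => T z j a) z v = fun j => fderiv ℂ (fun z => T z j a) z v := fun v => by
    ext j
    exact (congrArg (fun L => L v) (fderiv_apply (i := j) (show DifferentiableAt ℂ (fun z j => T z j a) z from hsd))).symm
  simp only [hb, hf, zero_add, hd, dotProduct_zero, sub_zero, mul_zero] at h1
  have hb2 : basePart (fibTranslate (fun z j => T z j a) (Sum.elim z 0)) = z := rfl
  rw [hb2] at h1
  exact sub_eq_zero.1 ((mul_eq_zero.1 h1).resolve_left hg)

theorem differentiableAt_coeff (hΥ : IsSymplecticPairing U Λ Υ g) {z : Fin m → ℂ} (hz : z ∈ U) :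
    DifferentiableAt ℂ g z := hΥ.hol.differentiableAt (hΥ.isOpen.mem_nhds hz)

theorem eventuallyEq (hΥ : IsSymplecticPairing U Λ Υ g) (hx : x ∈ totalSet m U) :
    Υ =ᶠ[nhds x] fun y => g (basePart y) • ∑ j, wedgeOne ![dz j, dw j] := by
  filter_upwards [(totalSet_isOpen hΥ.isOpen).mem_nhds hx] with y hy using hΥ.eq y hy

theorem hasFDerivAt_coeff (hΥ : IsSymplecticPairing U Λ Υ g) (hx : x ∈ totalSet m U) :
    HasFDerivAt (fun y : Fin m ⊕ Fin m → ℂ => g (basePart y))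
      (((fderiv ℂ g (basePart x)).comp (baseCLM m m)).restrictScalars ℝ) x :=
  (HasFDerivAt.comp (g := g) x (hΥ.differentiableAt_coeff hx).hasFDerivAt
    (baseCLM m m).hasFDerivAt).restrictScalars ℝ

theorem differentiableAt (hΥ : IsSymplecticPairing U Λ Υ g) (hx : x ∈ totalSet m U) :
    DifferentiableAt ℝ Υ x :=
  ((hΥ.hasFDerivAt_coeff hx).differentiableAt.smul_const _).congr_of_eventuallyEq (hΥ.eventuallyEq hx)

/-- dΥ = 0 evaluated on two base vectors and one fibre vector. For m = 1 the identity is void, for m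
≥ 2 it forces dg = 0. -/
theorem coeff_closed (hΥ : IsSymplecticPairing U Λ Υ g) {z : Fin m → ℂ} (hz : z ∈ U)
    (u v q : Fin m → ℂ) : fderiv ℂ g z u * v ⬝ᵥ q = fderiv ℂ g z v * u ⬝ᵥ q := by
  have hx : (Sum.elim z 0 : Fin m ⊕ Fin m → ℂ) ∈ totalSet m U := hz
  have h := (extDeriv_two_eq_zero_iff (hΥ.differentiableAt hx)).1 (hΥ.symplectic.2.1 _ hx)
    (Sum.elim u 0) (Sum.elim v 0) (Sum.elim 0 q)
  have key : ∀ u v w, fderiv ℝ (fun y => Υ y ![v, w]) (Sum.elim z 0) u =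
      fderiv ℂ g z (basePart u) * (basePart v ⬝ᵥ fibPart w - basePart w ⬝ᵥ fibPart v) := by
    intro u v w
    have he : (fun y => Υ y ![v, w]) =ᶠ[nhds (Sum.elim z 0)] fun y =>
        g (basePart y) * (basePart v ⬝ᵥ fibPart w - basePart w ⬝ᵥ fibPart v) := by
      filter_upwards [(totalSet_isOpen hΥ.isOpen).mem_nhds hx] with y hy using hΥ.apply hy v w
    rw [he.fderiv_eq, ((hΥ.hasFDerivAt_coeff hx).mul_const' _).fderiv]
    rfl
  rw [key, key, key] at h
  have hb : ∀ u w, basePart (Sum.elim u w : Fin m ⊕ Fin m → ℂ) = u := fun _ _ => rfl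
  have hf : ∀ u w, fibPart (Sum.elim u w : Fin m ⊕ Fin m → ℂ) = w := fun _ _ => rfl
  simp only [hb, hf, dotProduct_zero, sub_zero, zero_sub, map_zero, zero_mul,
    add_zero, mul_neg] at h
  linear_combination h

/-- The horizontal distribution is Lagrangian for Υ: replacing dw by θ changes Υ by g ∑ x^a dz^j ∧
dτ_a^j, which vanishes by `frame_symm`. -/
theorem apply_theta (hΥ : IsSymplecticPairing U Λ Υ g) (hm : 0 < m) (hT : IsFrame Λ W T) (hW : W ⊆ U)
    (hx : x ∈ totalSet m W) (u v : Fin m ⊕ Fin m → ℂ) :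
    Υ x ![u, v] = g (basePart x) *
      (basePart u ⬝ᵥ thetaVec T x v - basePart v ⬝ᵥ thetaVec T x u) := by
  have hθ : ∀ u, thetaVec T x u = fibPart u - ∑ a, (frameCoord T a x : ℂ) •
      fun j => fderiv ℂ (fun z => T z j a) (basePart x) (basePart u) := fun u => by
    ext j
    rw [thetaVec_apply, hT.thetaForm_eq hx, Pi.sub_apply, Finset.sum_apply]
    rfl
  rw [hΥ.apply (hW hx), hθ, hθ, dotProduct_sub, dotProduct_sub, dotProduct_sum, dotProduct_sum]
  simp only [dotProduct_smul, hΥ.frame_symm hm hT hW hx _ (basePart u) (basePart v)]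
  ring

end IsSymplecticPairing

/-- The closed forms `g ∑ T_{ja} dz^j`. -/
def pairForm (g : (Fin m → ℂ) → ℂ) (T : (Fin m → ℂ) → Matrix (Fin m) (Fin m ⊕ Fin m) ℂ)
    (a : Fin m ⊕ Fin m) (z v : Fin m → ℂ) : ℂ := g z * v ⬝ᵥ fun j => T z j a

theorem hasFDerivAt_pairForm (hΥ : IsSymplecticPairing U Λ Υ g) (hT : IsFrame Λ W T) (hW : W ⊆ U)
    {z : Fin m → ℂ} (hz : z ∈ W) (a : Fin m ⊕ Fin m) (v : Fin m → ℂ) :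
    ∃ L : (Fin m → ℂ) →L[ℂ] ℂ, HasFDerivAt (fun z => pairForm g T a z v) L z ∧ ∀ u, L u =
      fderiv ℂ g z u * (v ⬝ᵥ fun j => T z j a) +
        g z * (v ⬝ᵥ fun j => fderiv ℂ (fun z => T z j a) z u) := by
  have h1 : HasFDerivAt (fun z => v ⬝ᵥ fun j => T z j a) (∑ j, v j • fderiv ℂ (fun z => T z j a) z) z :=
    HasFDerivAt.fun_sum fun j _ =>
      ((hT.2.1 j a).differentiableAt (hT.1.mem_nhds hz)).hasFDerivAt.const_mul _
  refine ⟨_, (hΥ.differentiableAt_coeff (hW hz)).hasFDerivAt.mul h1, fun u => ?_⟩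
  simp only [_root_.add_apply, _root_.smul_apply, _root_.sum_apply, smul_eq_mul, dotProduct]
  ring

theorem contDiffOn_pairForm (hΥ : IsSymplecticPairing U Λ Υ g) (hT : IsFrame Λ W T) (hW : W ⊆ U)
    (a : Fin m ⊕ Fin m) (v : Fin m → ℂ) :
    ContDiffOn ℝ (⊤ : ℕ∞) (fun z => pairForm g T a z v) W := by
  refine DifferentiableOn.contDiffOn_real hT.1 fun z hz => ?_
  obtain ⟨L, hL, -⟩ := hasFDerivAt_pairForm hΥ hT hW hz a v
  exact hL.differentiableAt.differentiableWithinAt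

/-- Insert H⁻¹ = i T̄ Q⁻¹ Tᵗ into |g|² H⁻¹. The metric becomes a combination of products of the
forms α_a = g ∑ T_ja dz^j with the constant coefficients of Q⁻¹; the real part separates into
products of real parts and products of imaginary parts. -/
theorem baseMetric_eq (h : FlatSubmersion U Λ gF gS G)
    (hS : ∀ z ∈ U, gS z = bilinOfMat (dualMat (g z) (hermMat (gF z 0)))) (hT : IsFrame Λ W T) (hW : W ⊆ U)
    (hQ : ∀ z ∈ W, ∀ a b, gF z 0 (I • fun j => T z j a) (fun j => T z j b) = Q a b)
    {z : Fin m → ℂ} (hz : z ∈ W) (v w : Fin m → ℂ) : gS z (I • v) w =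
      (∑ a, ∑ b, (-2 * Q⁻¹ a b) * ((pairForm g T a z w).re * (pairForm g T b z v).re)) +
      ∑ a, ∑ b, (-2 * Q⁻¹ a b) * ((pairForm g T a z w).im * (pairForm g T b z v).im) := by
  have h1 := (matH_relations (hT.2.2 z hz).1 (h.fib_herm z (hW hz)) (hQ z hz)).2.1
  have h2 : I • v ⬝ᵥ dualMat (g z) (hermMat (gF z 0)) *ᵥ star w =
      -∑ a, ∑ b, (Q⁻¹ a b : ℂ) * (starRingEnd ℂ (pairForm g T a z w) * pairForm g T b z v) := by
    rw [dualMat, ← h1]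
    have e1 : ∀ M : Matrix (Fin m) (Fin m) ℂ, v ⬝ᵥ Mᵀ *ᵥ star w = star w ⬝ᵥ M *ᵥ v := fun M => by
      rw [mulVec_transpose, dotProduct_comm, dotProduct_mulVec]
    have e2 : (T z)ᵀ *ᵥ v = fun b => v ⬝ᵥ fun j => T z j b := by
      rw [mulVec_transpose]; rfl
    have e3 : star w ᵥ* conjMat (T z) = fun a => starRingEnd ℂ (w ⬝ᵥ fun j => T z j a) := by
      ext a; simp [vecMul, dotProduct, conjMat]
    rw [smul_dotProduct, smul_mulVec, dotProduct_smul, e1, smul_mulVec, dotProduct_smul,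
      ← mulVec_mulVec, ← mulVec_mulVec, dotProduct_mulVec, e2, e3]
    have e4 := mul_conj' (g z)
    have e5 : ∀ a, starRingEnd ℂ (pairForm g T a z w) =
      starRingEnd ℂ (g z) * starRingEnd ℂ (w ⬝ᵥ fun j => T z j a) := fun a => map_mul _ _ _
    have e6 : ∀ b, pairForm g T b z v = g z * v ⬝ᵥ fun j => T z j b := fun _ => rfl
    simp only [e5, e6]
    have key : ∀ X Y : Fin m ⊕ Fin m → ℂ, I • ((‖g z‖ ^ 2 : ℝ) : ℂ) • I • (X ⬝ᵥ realMat Q⁻¹ *ᵥ Y) =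
        -∑ a, ∑ b, (Q⁻¹ a b : ℂ) * (starRingEnd ℂ (g z) * X a * (g z * Y b)) := fun X Y => by
      simp only [dotProduct, mulVec, smul_eq_mul, Finset.mul_sum, ← Finset.sum_neg_distrib]
      refine Finset.sum_congr rfl fun a _ => Finset.sum_congr rfl fun b _ => ?_
      have e7 : realMat Q⁻¹ a b = (Q⁻¹ a b : ℂ) := rfl
      rw [e7]
      push_cast
      rw [← e4]
      linear_combination (g z * starRingEnd ℂ (g z) * X a * (Q⁻¹ a b : ℂ) * Y b) * I_mul_I
    exact key _ _
  rw [hS z (hW hz), bilinOfMat_apply, h2, neg_re, re_sum, mul_neg, Finset.mul_sum,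
    ← Finset.sum_neg_distrib, ← Finset.sum_add_distrib]
  refine Finset.sum_congr rfl fun a _ => ?_
  rw [re_sum, Finset.mul_sum, ← Finset.sum_neg_distrib, ← Finset.sum_add_distrib]
  refine Finset.sum_congr rfl fun b _ => ?_
  rw [re_ofReal_mul, mul_re, conj_re, conj_im]
  ring

theorem inv_skew {κ : Type*} [Fintype κ] [DecidableEq κ] {Q : Matrix κ κ ℝ} (hQ : Qᵀ = -Q)
    (hdet : Q.det ≠ 0) (c : ℝ) : (c • Q⁻¹)ᵀ = -(c • Q⁻¹) := by
  have h1 : (-Q)⁻¹ = -Q⁻¹ := inv_eq_right_inv (by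
    rw [neg_mul_neg, mul_nonsing_inv _ (isUnit_iff_ne_zero.2 hdet)])
  rw [transpose_smul, transpose_nonsing_inv, hQ, h1, smul_neg]

/-- The 1-forms α_a are closed by `coeff_closed` and `frame_symm`, and Q⁻¹ is constant and skew, so
`cyclic_sum_eq_zero` applies to the real and to the imaginary parts. -/
theorem baseMetric_isKahlerMetric (hΥ : IsSymplecticPairing U Λ Υ g) (hm : 0 < m)
    (h : FlatSubmersion U Λ gF gS G)
    (hS : ∀ z ∈ U, gS z = bilinOfMat (dualMat (g z) (hermMat (gF z 0)))) : IsKahlerMetric U gS := by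
  have hsm : ContDiffOn ℝ (⊤ : ℕ∞) gS U := by
    rw [contDiffOn_bilin_iff]
    intro u v z hz
    obtain ⟨W, T, Q, hzW, hW, hT, hQ⟩ := h.frame z hz
    have hopen := hT.1.mem_nhds hzW
    have hp := fun a v => (contDiffOn_pairForm hΥ hT hW a v).contDiffAt hopen
    have hre := fun a v => reCLM.contDiff.contDiffAt.comp z (hp a v)
    have him := fun a v => imCLM.contDiff.contDiffAt.comp z (hp a v)
    have h1 := (ContDiffAt.sum fun a (_ : a ∈ Finset.univ) => ContDiffAt.sum fun b (_ : b ∈ Finset.univ) =>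
      (contDiffAt_const (c := -2 * Q⁻¹ a b)).mul ((hre a v).mul (hre b ((-I) • u)))).add
      (ContDiffAt.sum fun a (_ : a ∈ Finset.univ) => ContDiffAt.sum fun b (_ : b ∈ Finset.univ) =>
      (contDiffAt_const (c := -2 * Q⁻¹ a b)).mul ((him a v).mul (him b ((-I) • u))))
    refine (h1.congr_of_eventuallyEq ?_).contDiffWithinAt
    filter_upwards [hopen] with y hy
    have := baseMetric_eq h hS hT hW hQ hy ((-I) • u) v
    rw [smul_smul, mul_neg, I_mul_I, neg_neg, one_smul] at this
    exact this
  refine ⟨hsm, h.base_herm, fun z hz => ?_⟩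
  rw [extDeriv_kahlerForm_eq_zero_iff ((hsm.contDiffAt (h.isOpen.mem_nhds hz)).differentiableAt (by simp))
    (by filter_upwards [h.isOpen.mem_nhds hz] with y hy using h.base_herm y hy)]
  obtain ⟨W, T, Q, hzW, hW, hT, hQ⟩ := h.frame z hz
  have hopen := hT.1.mem_nhds hzW
  have hQ0 := (matH_relations (hT.2.2 z hzW).1 (h.fib_herm z hz) (hQ z hzW)).1
  have hskew := inv_skew (kahler_matrix_skew (h.fib_herm z hz) (hQ z hzW)) hQ0 (-2)
  have hdre : ∀ a v u, HasFDerivAt (𝕜 := ℝ) (fun z => (pairForm g T a z v).re)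
      (fderiv ℝ (fun z => (pairForm g T a z v).re) z) z ∧
      HasFDerivAt (𝕜 := ℝ) (fun z => (pairForm g T a z v).im)
      (fderiv ℝ (fun z => (pairForm g T a z v).im) z) z ∧
      fderiv ℝ (fun z => (pairForm g T a z v).re) z u = (fderiv ℂ g z u * (v ⬝ᵥ fun j => T z j a) +
        g z * (v ⬝ᵥ fun j => fderiv ℂ (fun z => T z j a) z u)).re ∧
      fderiv ℝ (fun z => (pairForm g T a z v).im) z u = (fderiv ℂ g z u * (v ⬝ᵥ fun j => T z j a) +
        g z * (v ⬝ᵥ fun j => fderiv ℂ (fun z => T z j a) z u)).im := fun a v u => by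
    obtain ⟨L, hL, hLu⟩ := hasFDerivAt_pairForm hΥ hT hW hzW a v
    have h1 := reCLM.hasFDerivAt.comp z (hL.restrictScalars ℝ)
    have h2 := imCLM.hasFDerivAt.comp z (hL.restrictScalars ℝ)
    refine ⟨h1.differentiableAt.hasFDerivAt, h2.differentiableAt.hasFDerivAt, ?_, ?_⟩
    · exact (congrArg (fun f => f u) h1.fderiv).trans (congrArg re (hLu u))
    · exact (congrArg (fun f => f u) h2.fderiv).trans (congrArg im (hLu u))
  have hsym : ∀ a u v, fderiv ℂ g z u * (v ⬝ᵥ fun j => T z j a) +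
        g z * (v ⬝ᵥ fun j => fderiv ℂ (fun z => T z j a) z u) =
        fderiv ℂ g z v * (u ⬝ᵥ fun j => T z j a) +
        g z * (u ⬝ᵥ fun j => fderiv ℂ (fun z => T z j a) z v) := fun a u v => by
    rw [hΥ.coeff_closed hz, hΥ.frame_symm hm hT hW hzW]
  have hc1 := cyclic_sum_eq_zero (d := fun a z v => (pairForm g T a z v).re) hskew (x := z)
    (fun a v => (hdre a v 0).1.differentiableAt) (fun a u v => by
      rw [(hdre a v u).2.2.1, (hdre a u v).2.2.1, hsym])
  have hc2 := cyclic_sum_eq_zero (d := fun a z v => (pairForm g T a z v).im) hskew (x := z)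
    (fun a v => (hdre a v 0).2.1.differentiableAt) (fun a u v => by
      rw [(hdre a v u).2.2.2, (hdre a u v).2.2.2, hsym])
  have hsplit : ∀ u v w, fderiv ℝ (fun y => gS y (I • v) w) z u =
      fderiv ℝ (fun y => ∑ a, ∑ b, ((-2 : ℝ) • Q⁻¹ : Matrix _ _ ℝ) a b *
        ((pairForm g T a y w).re * (pairForm g T b y v).re)) z u +
      fderiv ℝ (fun y => ∑ a, ∑ b, ((-2 : ℝ) • Q⁻¹ : Matrix _ _ ℝ) a b *
        ((pairForm g T a y w).im * (pairForm g T b y v).im)) z u := fun u v w => by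
    have he : (fun y => gS y (I • v) w) =ᶠ[nhds z] fun y =>
        (∑ a, ∑ b, ((-2 : ℝ) • Q⁻¹ : Matrix _ _ ℝ) a b *
          ((pairForm g T a y w).re * (pairForm g T b y v).re)) +
        ∑ a, ∑ b, ((-2 : ℝ) • Q⁻¹ : Matrix _ _ ℝ) a b *
          ((pairForm g T a y w).im * (pairForm g T b y v).im) := by
      filter_upwards [hopen] with y hy
      rw [baseMetric_eq h hS hT hW hQ hy]
      simp
    have hd1 : DifferentiableAt ℝ (fun y => ∑ a, ∑ b, ((-2 : ℝ) • Q⁻¹ : Matrix _ _ ℝ) a b *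
          ((pairForm g T a y w).re * (pairForm g T b y v).re)) z :=
      DifferentiableAt.fun_sum fun a _ => DifferentiableAt.fun_sum fun b _ =>
        ((hdre a w 0).1.differentiableAt.mul (hdre b v 0).1.differentiableAt).const_mul _
    have hd2 : DifferentiableAt ℝ (fun y => ∑ a, ∑ b, ((-2 : ℝ) • Q⁻¹ : Matrix _ _ ℝ) a b *
          ((pairForm g T a y w).im * (pairForm g T b y v).im)) z :=
      DifferentiableAt.fun_sum fun a _ => DifferentiableAt.fun_sum fun b _ =>
        ((hdre a w 0).2.1.differentiableAt.mul (hdre b v 0).2.1.differentiableAt).const_mul _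
    rw [he.fderiv_eq, fderiv_fun_add hd1 hd2]
    rfl
  intro u v w
  rw [hsplit, hsplit, hsplit]
  -- In `baseMetric_eq` the arguments occur in the order w, v, which reverses the cyclic order.
  have k1 := hc1 u w v
  have k2 := hc2 u w v
  linear_combination k1 + k2

/-- The pairing of A⁻ᵗ dz with Aθ does not depend on A. -/
theorem symplectic_eq_coframe (hΥ : IsSymplecticPairing U Λ Υ g) (hm : 0 < m) (hT : IsFrame Λ W T)
    (hW : W ⊆ U) (hx : x ∈ totalSet m W) {A : Matrix (Fin m) (Fin m) ℂ} (hA : A.det ≠ 0) :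
    Υ x = ∑ l, wedgeOne ![∑ j, (g (basePart x) • (A⁻¹)ᵀ) l j • dz j, ∑ j, A l j • thetaForm T x j] := by
  refine CForm.ext_two fun u v => ?_
  have h1 : ∀ (B : Matrix (Fin m) (Fin m) ℂ) l (u : Fin m ⊕ Fin m → ℂ),
      (∑ j, B l j • dz (m := m) j) u = (B *ᵥ basePart u) l := fun B l u => by
    simp [mulVec, dotProduct, dz, dcoord, basePart]
  have h2 : ∀ l (u : Fin m ⊕ Fin m → ℂ),
      (∑ j, A l j • thetaForm T x j) u = (A *ᵥ thetaVec T x u) l := fun l u => by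
    simp [mulVec, dotProduct, thetaVec_apply]
  have h3 : ∀ u v : Fin m → ℂ, (g (basePart x) • (A⁻¹)ᵀ) *ᵥ u ⬝ᵥ A *ᵥ v = g (basePart x) * u ⬝ᵥ v := fun u v => by
    rw [smul_mulVec, smul_dotProduct, mulVec_transpose, ← dotProduct_mulVec, mulVec_mulVec,
      nonsing_inv_mul _ (isUnit_iff_ne_zero.2 hA), one_mulVec, smul_eq_mul]
  rw [hΥ.apply_theta hm hT hW hx, mul_sub, ← h3, ← h3, cformSum_apply]
  simp only [wedgeOne_two, h1, h2]
  rw [Finset.sum_sub_distrib]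
  rfl

/-- With e = Aθ and f = g A⁻ᵗ dz the Kähler form is i ∑ f∧f̄ + i ∑ e∧ē and Υ = ∑ f∧e, which is the
situation of `wedgePow_quaternionic`. -/
theorem volume_hyperkahler (hΥ : IsSymplecticPairing U Λ Υ g) (hm : 0 < m)
    (h : FlatSubmersion U Λ gF gS G)
    (hS : ∀ z ∈ U, gS z = bilinOfMat (dualMat (g z) (hermMat (gF z 0)))) (hx : x ∈ totalSet m U) :
    wedgePow (kahlerForm (G x)).toAlternatingMap (2 * m) =
      (((2 * m).choose m : ℂ) • wedge (wedgePow (Υ x).toAlternatingMap m)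
        (conjForm (wedgePow (Υ x).toAlternatingMap m))).domDomCongr (finCongr (by ring)) := by
  obtain ⟨W, T, Q, hxW, hW, hT, -⟩ := h.frame _ hx
  have hF := (h.fib_herm _ hx).hermMat_posDef
  obtain ⟨A, hA, hAh⟩ := hF.exists_coframe
  have hB : hermMat (gS (basePart x)) = (g (basePart x) • (A⁻¹)ᵀ)ᵀ * conjMat (g (basePart x) • (A⁻¹)ᵀ) := by
    rw [hS _ hx, hermMat_bilinOfMat (dualMat_posDef (hΥ.ne_zero hm hx) hF).1, hAh, dualMat_eq_coframe]
  rw [h.kahlerForm_eq_unitary hT hW hxW hAh hB, symplectic_eq_coframe hΥ hm hT hW hxW hA,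
    wedgePow_quaternionic]

theorem exists_theta_eq (T : (Fin m → ℂ) → Matrix (Fin m) (Fin m ⊕ Fin m) ℂ) (x : Fin m ⊕ Fin m → ℂ)
    (p q : Fin m → ℂ) : ∃ u, basePart u = p ∧ thetaVec T x u = q := by
  let u₀ : Fin m ⊕ Fin m → ℂ := Sum.elim p fun _ => 0
  let u₁ : Fin m ⊕ Fin m → ℂ := Sum.elim (fun _ => 0) (q - thetaVec T x u₀)
  refine ⟨u₀ + u₁, ?_, ?_⟩
  · ext i; simp [basePart, u₀, u₁]
  · rw [map_add, thetaVec_eq_fibPart T (u := u₁) rfl]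
    exact add_sub_cancel _ _

/-- The complex structure determined by the metric and the symplectic form. -/
def secondCpx (G : (Fin m ⊕ Fin m → ℂ) → Bilin (Fin m ⊕ Fin m → ℂ))
    (Υ : (Fin m ⊕ Fin m → ℂ) → CForm (Fin m ⊕ Fin m → ℂ) 2) (x : Fin m ⊕ Fin m → ℂ) :
    (Fin m ⊕ Fin m → ℂ) →L[ℝ] (Fin m ⊕ Fin m → ℂ) :=
  (G x).inverse ∘L twiceRe (Υ x)

theorem apply_secondCpx (h : FlatSubmersion U Λ gF gS G) (hx : x ∈ totalSet m U)
    (u v : Fin m ⊕ Fin m → ℂ) : G x (secondCpx G Υ x u) v = 2 * (Υ x ![u, v]).re :=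
  apply_inverse_comp (h.isHermInner hx).2.2 (twiceRe (Υ x)) u v

theorem IsSymplecticPairing.apply_I_smul (hΥ : IsSymplecticPairing U Λ Υ g) (hx : x ∈ totalSet m U)
    (u v : Fin m ⊕ Fin m → ℂ) :
    Υ x ![I • u, v] = I * Υ x ![u, v] ∧ Υ x ![u, I • v] = I * Υ x ![u, v] := by
  have hb : ∀ u : Fin m ⊕ Fin m → ℂ, basePart (I • u) = I • basePart u := fun _ => rfl
  have hf : ∀ u : Fin m ⊕ Fin m → ℂ, fibPart (I • u) = I • fibPart u := fun _ => rfl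
  rw [hΥ.apply hx, hΥ.apply hx, hΥ.apply hx, hb, hb, hf, hf]
  simp only [smul_dotProduct, dotProduct_smul, smul_eq_mul]
  constructor <;> ring

/-- In the adapted unitary coframe the endomorphism is (f, e) ↦ (-ē, f̄), whose square is -1. The
duality of f and e, i.e. the isometry of the pairing, enters here. -/
theorem secondCpx_sq (hΥ : IsSymplecticPairing U Λ Υ g) (hm : 0 < m)
    (h : FlatSubmersion U Λ gF gS G)
    (hS : ∀ z ∈ U, gS z = bilinOfMat (dualMat (g z) (hermMat (gF z 0)))) (hx : x ∈ totalSet m U)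
    (u : Fin m ⊕ Fin m → ℂ) : secondCpx G Υ x (secondCpx G Υ x u) = -u := by
  obtain ⟨W, T, Q, hxW, hW, hT, -⟩ := h.frame _ hx
  have hF := (h.fib_herm _ hx).hermMat_posDef
  obtain ⟨A, hA, hAh⟩ := hF.exists_coframe
  have hg := hΥ.ne_zero hm hx
  have hAu : IsUnit A.det := isUnit_iff_ne_zero.2 hA
  set B := g (basePart x) • (A⁻¹)ᵀ with hBdef
  have hBu : IsUnit B.det := by
    rw [hBdef, det_smul, det_transpose]
    exact ((isUnit_iff_ne_zero.2 hg).pow _).mul ((isUnit_nonsing_inv_det A) hAu)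
  have hB : hermMat (gS (basePart x)) = Bᵀ * conjMat B := by
    rw [hS _ hx, hermMat_bilinOfMat (dualMat_posDef hg hF).1, hAh, dualMat_eq_coframe]
  have hG : ∀ u v, G x u v = 2 * (B *ᵥ basePart u ⬝ᵥ star (B *ᵥ basePart v)).re +
      2 * (A *ᵥ thetaVec T x u ⬝ᵥ star (A *ᵥ thetaVec T x v)).re := fun u v => by
    rw [h.metric_eq hT hW hxW, (h.base_herm _ hx).apply_eq, (h.fib_herm _ hx).apply_eq, hB, hAh,
      dotProduct_coframe, dotProduct_coframe]
  have hΥe : ∀ u v, Υ x ![u, v] = B *ᵥ basePart u ⬝ᵥ A *ᵥ thetaVec T x v -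
      B *ᵥ basePart v ⬝ᵥ A *ᵥ thetaVec T x u := fun u v => by
    have h3 : ∀ u v : Fin m → ℂ, B *ᵥ u ⬝ᵥ A *ᵥ v = g (basePart x) * u ⬝ᵥ v := fun u v => by
      rw [hBdef, smul_mulVec, smul_dotProduct, mulVec_transpose, ← dotProduct_mulVec, mulVec_mulVec,
        nonsing_inv_mul _ hAu, one_mulVec, smul_eq_mul]
    rw [hΥ.apply_theta hm hT hW hxW, h3, h3, mul_sub]
  have hinj : ∀ w w', (∀ v, G x w v = G x w' v) → w = w' := fun w w' hw => by
    by_contra hne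
    have := (h.isHermInner hx).2.2 (w - w') (sub_ne_zero.2 hne)
    rw [(G x).map_sub, _root_.sub_apply, hw, sub_self] at this
    exact lt_irrefl _ this
  -- The candidate for Ju, with f(u') = -conj e(u) and e(u') = conj f(u).
  obtain ⟨u', hu1, hu2⟩ := exists_theta_eq T x (B⁻¹ *ᵥ (-star (A *ᵥ thetaVec T x u)))
    (A⁻¹ *ᵥ star (B *ᵥ basePart u))
  have hB1 : B *ᵥ basePart u' = -star (A *ᵥ thetaVec T x u) := by
    rw [hu1, mulVec_mulVec, mul_nonsing_inv _ hBu, one_mulVec]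
  have hA1 : A *ᵥ thetaVec T x u' = star (B *ᵥ basePart u) := by
    rw [hu2, mulVec_mulVec, mul_nonsing_inv _ hAu, one_mulVec]
  have hre : ∀ p q : Fin m → ℂ, (star p ⬝ᵥ star q).re = (p ⬝ᵥ q).re := fun p q => by
    rw [star_dotProduct_star, ← starRingEnd_apply, conj_re, dotProduct_comm]
  have hre' : ∀ p q : Fin m → ℂ, (star p ⬝ᵥ q).re = (p ⬝ᵥ star q).re := fun p q => by
    rw [← hre, star_star]
  have hJ : secondCpx G Υ x u = u' := hinj _ _ fun v => by
    rw [apply_secondCpx h hx, hG, hΥe, hB1, hA1, sub_re, neg_dotProduct, neg_re, hre, hre,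
      dotProduct_comm (A *ᵥ thetaVec T x u)]
    ring
  refine hinj _ _ fun v => ?_
  rw [apply_secondCpx h hx, hJ, map_neg, _root_.neg_apply, hG, hΥe, hB1, hA1, sub_re, neg_dotProduct,
    neg_re, hre', dotProduct_comm (B *ᵥ basePart v), hre']
  ring

/-- The fundamental forms of J and IJ are 2 Re Υ and 2 Im Υ, closed because Υ is. J anticommutes
with i because Υ is complex bilinear whereas G is hermitian. -/
theorem isHyperkahler (hΥ : IsSymplecticPairing U Λ Υ g) (hm : 0 < m)
    (h : FlatSubmersion U Λ gF gS G)
    (hS : ∀ z ∈ U, gS z = bilinOfMat (dualMat (g z) (hermMat (gF z 0)))) :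
    IsHyperkahler (totalSet m U) G := by
  have hK := h.isKahlerMetric (baseMetric_isKahlerMetric hΥ hm h hS)
  have hUo := totalSet_isOpen (m := m) h.isOpen
  have hinj : ∀ x ∈ totalSet m U, ∀ w w', (∀ v, G x w v = G x w' v) → w = w' := fun x hx w w' hw => by
    by_contra hne
    have := (h.isHermInner hx).2.2 (w - w') (sub_ne_zero.2 hne)
    rw [(G x).map_sub, _root_.sub_apply, hw, sub_self] at this
    exact lt_irrefl _ this
  have hskewI : ∀ x ∈ totalSet m U, ∀ u v, G x (I • u) v = -G x u (I • v) := fun x hx u v => by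
    rw [← (h.isHermInner hx).2.1 u, smul_smul, I_mul_I, neg_one_smul, map_neg, neg_neg]
  have hJ := fun x (hx : x ∈ totalSet m U) u v => apply_secondCpx (Υ := Υ) h hx u v
  have hform : ∀ x ∈ totalSet m U, fundForm (G x) (secondCpx G Υ x) =
      (ofRealCLM ∘L ((2 : ℝ) • reCLM)).compContinuousAlternatingMap (Υ x) := fun x hx =>
    CForm.ext_two fun u v => by
      rw [fundForm_apply, hJ x hx, hJ x hx, CForm.two_swap (Υ x) u v]
      change _ = (((2 : ℝ) * (Υ x ![u, v]).re : ℝ) : ℂ)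
      congr 1
      rw [neg_re]; ring
  have hform' : ∀ x ∈ totalSet m U, fundForm (G x) ((cpx _).comp (secondCpx G Υ x)) =
      (ofRealCLM ∘L ((2 : ℝ) • imCLM)).compContinuousAlternatingMap (Υ x) := fun x hx =>
    CForm.ext_two fun u v => by
      have e : ∀ u v, G x ((cpx _).comp (secondCpx G Υ x) u) v = 2 * (Υ x ![u, v]).im := fun u v => by
        change G x (I • secondCpx G Υ x u) v = _
        rw [hskewI x hx, hJ x hx, (hΥ.apply_I_smul hx u v).2]
        simp
      rw [fundForm_apply, e, e, CForm.two_swap (Υ x) u v]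
      change _ = (((2 : ℝ) * (Υ x ![u, v]).im : ℝ) : ℂ)
      congr 1
      rw [neg_im]; ring
  refine ⟨hK, secondCpx G Υ, ?_, fun x hx => secondCpx_sq hΥ hm h hS hx, fun x hx u => ?_,
    fun x hx u v => ?_, fun x hx => ?_, fun x hx => ?_⟩
  · intro x hx
    have h1 : ContDiffAt ℝ (⊤ : ℕ∞) (fun y => (G y).inverse) x :=
      ContDiffAt.comp x (isInvertible_of_pos (h.isHermInner hx).2.2).contDiffAt_map_inverse
        (hK.1.contDiffAt (hUo.mem_nhds hx))
    have h2 : ContDiffOn ℝ (⊤ : ℕ∞) (fun y => twiceRe (Υ y)) (totalSet m U) := by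
      rw [contDiffOn_bilin_iff]
      intro u v
      have h3 : ContDiffOn ℝ (⊤ : ℕ∞) (fun y : Fin m ⊕ Fin m → ℂ => g (basePart y)) (totalSet m U) :=
        (hΥ.hol.contDiffOn_real hΥ.isOpen).comp
          ((baseCLM m m).restrictScalars ℝ).contDiff.contDiffOn fun y hy => hy
      refine (contDiffOn_const (c := (2 : ℝ))).mul (reCLM.contDiff.comp_contDiffOn
        ((h3.mul (contDiffOn_const (c := basePart u ⬝ᵥ fibPart v - basePart v ⬝ᵥ fibPart u))).congr
          fun y hy => hΥ.apply hy u v))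
    exact (h1.clm_comp (h2.contDiffAt (hUo.mem_nhds hx))).contDiffWithinAt
  · refine hinj x hx _ _ fun v => ?_
    rw [map_neg, _root_.neg_apply, hskewI x hx, hJ x hx, hJ x hx, (hΥ.apply_I_smul hx u v).1,
      (hΥ.apply_I_smul hx u v).2, neg_neg]
  · rw [hJ x hx, CForm.two_swap, neg_re, mul_neg, ← hJ x hx, secondCpx_sq hΥ hm h hS hx, map_neg,
      _root_.neg_apply, neg_neg, (h.isHermInner hx).1]
  · have he : (fun y => fundForm (G y) (secondCpx G Υ y)) =ᶠ[nhds x]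
        fun y => (ofRealCLM ∘L ((2 : ℝ) • reCLM)).compContinuousAlternatingMap (Υ y) := by
      filter_upwards [hUo.mem_nhds hx] with y hy using hform y hy
    rw [he.extDeriv_eq]
    exact extDeriv_comp_clm_eq_zero (hΥ.differentiableAt hx) (hΥ.symplectic.2.1 x hx) _
  · have he : (fun y => fundForm (G y) ((cpx _).comp (secondCpx G Υ y))) =ᶠ[nhds x]
        fun y => (ofRealCLM ∘L ((2 : ℝ) • imCLM)).compContinuousAlternatingMap (Υ y) := by
      filter_upwards [hUo.mem_nhds hx] with y hy using hform' y hy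
    rw [he.extDeriv_eq]
    exact extDeriv_comp_clm_eq_zero (hΥ.differentiableAt hx) (hΥ.symplectic.2.1 x hx) _

end Hyperkahler
end

noncomputable section

/-! ### Derivatives of determinants and inverses -/

section MatrixDerivatives

variable {E κ : Type*} [NormedAddCommGroup E] [NormedSpace ℝ E] [Fintype κ] [DecidableEq κ]

theorem hasDerivAt_det_one_add_smul (M : Matrix κ κ ℝ) :
    HasDerivAt (fun r : ℝ => (1 + r • M).det) M.trace 0 := by
  set q := (Matrix.det (1 + (Polynomial.X : Polynomial ℝ) • M.map Polynomial.C)).divX.divX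
  have h : (fun r : ℝ => (1 + r • M).det) = fun r => 1 + M.trace * r + q.eval r * r ^ 2 :=
    funext fun r => Matrix.det_one_add_smul r M
  rw [h]
  have h1 := (((hasDerivAt_id' (0 : ℝ)).const_mul M.trace).const_add 1).fun_add
    ((q.hasDerivAt 0).fun_mul (hasDerivAt_pow 2 (0 : ℝ)))
  exact h1.congr_deriv (by simp)

/-- Jacobi's formula, from det(A + rB) = det A · det(1 + r A⁻¹B). -/
theorem hasFDerivAt_det {Y : E → Matrix κ κ ℝ} {Y' : κ → κ → E →L[ℝ] ℝ} {x : E}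
    (hY : ∀ i j, HasFDerivAt (fun y => Y y i j) (Y' i j) x) (hdet : (Y x).det ≠ 0) :
    HasFDerivAt (fun y => (Y y).det) ((Y x).det • ∑ i, ∑ j, (Y x)⁻¹ i j • Y' j i) x := by
  have hF : Differentiable ℝ fun A : κ → κ → ℝ => (Matrix.of A).det := by
    simp only [Matrix.det_apply', Matrix.of_apply]
    fun_prop
  let A : κ → κ → ℝ := Y x
  have hline : ∀ B : κ → κ → ℝ, fderiv ℝ (fun A : κ → κ → ℝ => (Matrix.of A).det) A B =
      (Y x).det * ((Y x)⁻¹ * Matrix.of B).trace := by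
    intro B
    have h1 : HasDerivAt (fun r : ℝ => A + r • B) B 0 := by
      simpa using ((hasDerivAt_id (0 : ℝ)).smul_const B).const_add A
    have h2 := (show HasFDerivAt (fun A : κ → κ → ℝ => (Matrix.of A).det) _
      (A + (0 : ℝ) • B) from (hF _).hasFDerivAt).comp_hasDerivAt 0 h1
    rw [zero_smul, add_zero] at h2
    refine h2.unique ?_
    have h3 := (hasDerivAt_det_one_add_smul ((Y x)⁻¹ * Matrix.of B)).const_mul (Y x).det
    refine h3.congr_of_eventuallyEq (Filter.Eventually.of_forall fun r => ?_)
    simp only [Function.comp_apply]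
    rw [← Matrix.det_mul]
    congr 1
    rw [Matrix.mul_add, Matrix.mul_one, Matrix.mul_smul, ← Matrix.mul_assoc,
      Matrix.mul_nonsing_inv _ (isUnit_iff_ne_zero.2 hdet), Matrix.one_mul]
    rfl
  have hYp : HasFDerivAt (fun y => (Y y : κ → κ → ℝ))
      (ContinuousLinearMap.pi fun i => ContinuousLinearMap.pi fun j => Y' i j) x :=
    hasFDerivAt_pi.2 fun i => hasFDerivAt_pi.2 fun j => hY i j
  have h := (hF (Y x)).hasFDerivAt.comp x hYp
  refine h.congr_fderiv ?_
  ext v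
  rw [ContinuousLinearMap.comp_apply]
  refine (hline _).trans ?_
  simp [Matrix.trace, Matrix.mul_apply, _root_.sum_apply]

theorem hasFDerivAt_log_det {Y : E → Matrix κ κ ℝ} {Y' : κ → κ → E →L[ℝ] ℝ} {x : E}
    (hY : ∀ i j, HasFDerivAt (fun y => Y y i j) (Y' i j) x) (hdet : (Y x).det ≠ 0) :
    HasFDerivAt (fun y => Real.log (Y y).det) (∑ i, ∑ j, (Y x)⁻¹ i j • Y' j i) x := by
  have h := (hasFDerivAt_det hY hdet).log hdet
  rwa [smul_smul, inv_mul_cancel₀ hdet, one_smul] at h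

/-- Differentiability is Cramer's rule; the derivative is then found by differentiating Y Y⁻¹ = 1.
-/
theorem hasFDerivAt_matrix_inv {Y : E → Matrix κ κ ℝ} {Y' : κ → κ → E →L[ℝ] ℝ} {x : E}
    (hY : ∀ i j, HasFDerivAt (fun y => Y y i j) (Y' i j) x) (hdet : (Y x).det ≠ 0) (i j : κ) :
    HasFDerivAt (fun y => (Y y)⁻¹ i j)
      (-∑ k, ∑ l, ((Y x)⁻¹ i k * (Y x)⁻¹ l j) • Y' k l) x := by
  have hF : ∀ a b, DifferentiableAt ℝ (fun A : κ → κ → ℝ => (Matrix.of A)⁻¹ a b) (Y x) := by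
    intro a b
    have hopen : IsOpen {A : κ → κ → ℝ | (Matrix.of A).det ≠ 0} := by
      refine isOpen_ne.preimage ?_
      simp only [Matrix.det_apply', Matrix.of_apply]
      fun_prop
    have h := ContDiffOn.matrix_inv (𝕜 := ℝ) (n := 1) (s := {A : κ → κ → ℝ | (Matrix.of A).det ≠ 0})
      (A := fun A : κ → κ → ℝ => Matrix.of A) (fun i j => by
        simp only [Matrix.of_apply]; fun_prop) (fun _ h => h) a b
    exact (h.differentiableOn one_ne_zero).differentiableAt (hopen.mem_nhds hdet)
  have hYp : HasFDerivAt (fun y => (Y y : κ → κ → ℝ))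
      (ContinuousLinearMap.pi fun i => ContinuousLinearMap.pi fun j => Y' i j) x :=
    hasFDerivAt_pi.2 fun i => hasFDerivAt_pi.2 fun j => hY i j
  have hP : ∀ a b, DifferentiableAt ℝ (fun y => (Y y)⁻¹ a b) x := fun a b =>
    DifferentiableAt.comp (g := fun A : κ → κ → ℝ => (Matrix.of A)⁻¹ a b) x (hF a b)
      hYp.differentiableAt
  have hu : ∀ᶠ y in nhds x, (Y y).det ≠ 0 :=
    (hasFDerivAt_det hY hdet).continuousAt.eventually_ne hdet
  convert (hP i j).hasFDerivAt using 1
  ext v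
  set D : Matrix κ κ ℝ := Matrix.of fun a b => Y' a b v
  set P' : Matrix κ κ ℝ := Matrix.of fun a b => fderiv ℝ (fun y => (Y y)⁻¹ a b) x v
  have hrel : D * (Y x)⁻¹ + Y x * P' = 0 := by
    ext a b
    have h1 : HasFDerivAt (fun y => ∑ k, Y y a k * (Y y)⁻¹ k b)
        (∑ k, (Y x a k • fderiv ℝ (fun y => (Y y)⁻¹ k b) x + (Y x)⁻¹ k b • Y' a k)) x :=
      HasFDerivAt.fun_sum fun k _ => (hY a k).mul (hP k b).hasFDerivAt
    have h2 : (fun y => ∑ k, Y y a k * (Y y)⁻¹ k b) =ᶠ[nhds x] fun _ => (1 : Matrix κ κ ℝ) a b := by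
      filter_upwards [hu] with y hy
      rw [← Matrix.mul_apply, Matrix.mul_nonsing_inv _ (isUnit_iff_ne_zero.2 hy)]
    have h3 := congrArg (fun L : E →L[ℝ] ℝ => L v)
      (h1.unique ((hasFDerivAt_const _ x).congr_of_eventuallyEq h2))
    simp only [_root_.sum_apply, _root_.add_apply, _root_.smul_apply, smul_eq_mul,
      _root_.zero_apply, Finset.sum_add_distrib] at h3
    simp only [Matrix.add_apply, Matrix.mul_apply, Matrix.zero_apply, D, P', Matrix.of_apply]
    rw [← h3, add_comm]
    congr 1
    exact Finset.sum_congr rfl fun k _ => mul_comm _ _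
  have hP' : P' = -((Y x)⁻¹ * D * (Y x)⁻¹) := by
    have h := congrArg (fun M => (Y x)⁻¹ * M) hrel
    simp only [Matrix.mul_add, Matrix.mul_zero, ← Matrix.mul_assoc] at h
    rw [Matrix.nonsing_inv_mul _ (isUnit_iff_ne_zero.2 hdet), Matrix.one_mul] at h
    exact (neg_eq_of_add_eq_zero_right h).symm
  have h := congrFun (congrFun hP' i) j
  simp only [P', Matrix.of_apply] at h
  rw [h]
  simp only [_root_.neg_apply, _root_.sum_apply, _root_.smul_apply, smul_eq_mul, Matrix.neg_apply,
    Matrix.mul_apply, D, Matrix.of_apply, Finset.sum_mul]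
  rw [Finset.sum_comm]
  congr 1
  exact Finset.sum_congr rfl fun k _ => Finset.sum_congr rfl fun l _ => by ring

end MatrixDerivatives

/-! ### Pluriharmonic factors -/

section Ddbar

theorem hasFDerivAt_conj {κ : Type*} [Fintype κ] {f : (κ → ℂ) → ℂ} {f' : (κ → ℂ) →L[ℂ] ℂ} {z : κ → ℂ}
    (h : HasFDerivAt f f' z) :
    HasFDerivAt (fun y => starRingEnd ℂ (f y)) (conjOne (f'.restrictScalars ℝ)) z :=
  (Complex.conjCLE : ℂ →L[ℝ] ℂ).hasFDerivAt.comp z (h.restrictScalars ℝ)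

theorem conjOne_apply {V : Type*} [NormedAddCommGroup V] [NormedSpace ℝ V] (θ : V →L[ℝ] ℂ) (v : V) :
    conjOne θ v = starRingEnd ℂ (θ v) := rfl

theorem hasFDerivAt_log_normSq {κ : Type*} [Fintype κ] {h : (κ → ℂ) → ℂ} {h' : (κ → ℂ) →L[ℂ] ℂ} {z : κ → ℂ}
    (hh : HasFDerivAt h h' z) (h0 : h z ≠ 0) {f' : (κ → ℂ) →L[ℝ] ℂ} {f : (κ → ℂ) → ℝ}
    (hf : HasFDerivAt (fun y => (f y : ℂ)) f' z) {c : ℝ} :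
    HasFDerivAt (fun y => ((c + (Real.log (‖h y‖ ^ 2) + f y) : ℝ) : ℂ))
      ((((h z)⁻¹ • h').restrictScalars ℝ + conjOne (((h z)⁻¹ • h').restrictScalars ℝ)) + f') z := by
  have h1 := (hh.restrictScalars ℝ).mul (hasFDerivAt_conj hh)
  have hre := (Complex.reCLM.hasFDerivAt.comp z h1)
  have e1 : ∀ y, (Complex.reCLM ∘ (h * fun y => starRingEnd ℂ (h y))) y = ‖h y‖ ^ 2 := fun y => by
    simp only [Function.comp_apply, Pi.mul_apply, Complex.mul_conj, Complex.normSq_eq_norm_sq,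
      Complex.reCLM_apply, Complex.ofReal_re]
  have hre' : HasFDerivAt (fun y => ‖h y‖ ^ 2) _ z := hre.congr_of_eventuallyEq
    (Filter.Eventually.of_forall fun y => (e1 y).symm)
  have hlog := hre'.log (by positivity)
  have h2 := (((Complex.ofRealCLM.hasFDerivAt.comp z hlog).add hf).const_add (c : ℂ))
  refine (h2.congr_of_eventuallyEq (Filter.Eventually.of_forall fun y => ?_)).congr_fderiv ?_
  · simp
  · congr 1
    ext v
    have hn : ((‖h z‖ ^ 2 : ℝ) : ℂ) = h z * starRingEnd ℂ (h z) := by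
      rw [Complex.mul_conj, Complex.normSq_eq_norm_sq]
    have h0' : starRingEnd ℂ (h z) ≠ 0 := (map_ne_zero _).2 h0
    have key : ∀ a b : ℂ, ((((‖h z‖ ^ 2)⁻¹ * (a * starRingEnd ℂ b + starRingEnd ℂ a * b).re : ℝ)) : ℂ)
        = (h z)⁻¹ * (starRingEnd ℂ (h z))⁻¹ * (a * starRingEnd ℂ b + starRingEnd ℂ a * b) := by
      intro a b
      rw [Complex.ofReal_mul, Complex.ofReal_inv, hn, mul_inv]
      congr 1
      have := Complex.add_conj (a * starRingEnd ℂ b)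
      rw [map_mul, Complex.conj_conj] at this
      rw [this]; simp
    have e2 : (h z)⁻¹ * h' v + (starRingEnd ℂ (h z))⁻¹ * starRingEnd ℂ (h' v) =
        (((‖h z‖ ^ 2)⁻¹ * (h z * starRingEnd ℂ (h' v) + starRingEnd ℂ (h z) * h' v).re : ℝ) : ℂ) := by
      rw [key]
      field_simp
      ring
    have e3 : (((h z)⁻¹ • h').restrictScalars ℝ + conjOne (((h z)⁻¹ • h').restrictScalars ℝ)) v =
        (h z)⁻¹ * h' v + (starRingEnd ℂ (h z))⁻¹ * starRingEnd ℂ (h' v) := by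
      simp [conjOne_apply]
    rw [e3, e2]
    rfl

variable {κ : Type*} [DecidableEq κ]

theorem wirt_eq {f : (κ → ℂ) → ℂ} {f' : (κ → ℂ) →L[ℝ] ℂ} {z : κ → ℂ} (h : HasFDerivAt f f' z)
    (j : κ) : wirt j f z =
      (1 / 2) * (f' (Pi.single j 1) - Complex.I * f' (Pi.single j Complex.I)) := by
  rw [wirt, h.fderiv]

theorem wirtBar_eq {f : (κ → ℂ) → ℂ} {f' : (κ → ℂ) →L[ℝ] ℂ} {z : κ → ℂ} (h : HasFDerivAt f f' z)
    (j : κ) : wirtBar j f z =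
      (1 / 2) * (f' (Pi.single j 1) + Complex.I * f' (Pi.single j Complex.I)) := by
  rw [wirtBar, h.fderiv]

theorem wirt_congr {f g : (κ → ℂ) → ℂ} {z : κ → ℂ} (h : f =ᶠ[nhds z] g) (j : κ) :
    wirt j f z = wirt j g z := by
  rw [wirt, wirt, h.fderiv_eq]

theorem clm_single_I (L : (κ → ℂ) →L[ℂ] ℂ) (j : κ) :
    L (Pi.single j Complex.I) = Complex.I * L (Pi.single j 1) := by
  rw [← smul_eq_mul, ← map_smul, ← Pi.single_smul, smul_eq_mul, mul_one]

variable [Fintype κ]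

theorem wirt_mul {f g : (κ → ℂ) → ℂ} {z : κ → ℂ} (hf : DifferentiableAt ℝ f z)
    (hg : DifferentiableAt ℝ g z) (j : κ) :
    wirt j (fun y => f y * g y) z = wirt j f z * g z + f z * wirt j g z := by
  rw [wirt, fderiv_fun_mul hf hg, wirt, wirt]
  simp only [_root_.add_apply, _root_.smul_apply, smul_eq_mul]
  ring

theorem wirt_sum {σ : Type*} {s : Finset σ} {f : σ → (κ → ℂ) → ℂ} {z : κ → ℂ}
    (hf : ∀ i ∈ s, DifferentiableAt ℝ (f i) z) (j : κ) :
    wirt j (fun y => ∑ i ∈ s, f i y) z = ∑ i ∈ s, wirt j (f i) z := by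
  simp only [wirt, fderiv_fun_sum hf, _root_.sum_apply, Finset.mul_sum, ← Finset.sum_sub_distrib]

/-- ∂̄ log |h|² is the conjugate of the holomorphic function ∂h/h, which ∂ annihilates; the constant
K drops out as well. -/
theorem ddbar_log_normSq_mul {W : Set (κ → ℂ)} (hW : IsOpen W) {h : (κ → ℂ) → ℂ}
    (hh : DifferentiableOn ℂ h W) (h0 : ∀ y ∈ W, h y ≠ 0) {K : ℝ} (hK : 0 < K)
    {F φ : (κ → ℂ) → ℝ} (hφ : ∀ y ∈ W, 0 < φ y)
    (hφ' : ContDiffOn ℝ 2 (fun y => (Real.log (φ y) : ℂ)) W)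
    (hF : ∀ y ∈ W, F y = K * (‖h y‖ ^ 2 * φ y)) {z : κ → ℂ} (hz : z ∈ W) :
    ddbar (fun y => (Real.log (F y) : ℂ)) z = ddbar (fun y => (Real.log (φ y) : ℂ)) z := by
  have hlog : ∀ y ∈ W, HasFDerivAt (fun y => (Real.log (F y) : ℂ))
      ((((h y)⁻¹ • fderiv ℂ h y).restrictScalars ℝ +
        conjOne (((h y)⁻¹ • fderiv ℂ h y).restrictScalars ℝ)) +
        fderiv ℝ (fun y => (Real.log (φ y) : ℂ)) y) y := by
    intro y hy
    have h1 := hasFDerivAt_log_normSq (hh.differentiableAt (hW.mem_nhds hy)).hasFDerivAt (h0 y hy)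
      (((hφ'.contDiffAt (hW.mem_nhds hy)).differentiableAt two_ne_zero).hasFDerivAt)
      (c := Real.log K)
    refine h1.congr_of_eventuallyEq ?_
    filter_upwards [hW.mem_nhds hy] with x hx
    have := h0 x hx
    have h3 := hφ x hx
    rw [hF x hx, Real.log_mul hK.ne' (by positivity), Real.log_mul (by positivity) h3.ne']
  unfold ddbar
  refine Finset.sum_congr rfl fun j _ => Finset.sum_congr rfl fun k _ => ?_
  congr 1
  have hbar : (wirtBar k fun y => (Real.log (F y) : ℂ)) =ᶠ[nhds z] fun y =>
      starRingEnd ℂ ((h y)⁻¹ * fderiv ℂ h y (Pi.single k 1)) +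
        wirtBar k (fun y => (Real.log (φ y) : ℂ)) y := by
    filter_upwards [hW.mem_nhds hz] with y hy
    rw [wirtBar_eq (hlog y hy), wirtBar]
    simp only [_root_.add_apply, conjOne_apply, ContinuousLinearMap.coe_restrictScalars',
      _root_.smul_apply, clm_single_I, smul_eq_mul, map_mul, Complex.conj_I]
    linear_combination (1 / 2 * (h y)⁻¹ * (fderiv ℂ h y (Pi.single k 1)) -
      1 / 2 * starRingEnd ℂ (h y)⁻¹ * starRingEnd ℂ (fderiv ℂ h y (Pi.single k 1))) * Complex.I_sq
  have hd1 : DifferentiableAt ℂ (fun y => (h y)⁻¹ * fderiv ℂ h y (Pi.single k 1)) z :=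
    ((hh.differentiableAt (hW.mem_nhds hz)).inv (h0 z hz)).mul
      (differentiableAt_fderiv_apply hW hh hz _)
  have hd2 : DifferentiableAt ℝ (wirtBar k (fun y => (Real.log (φ y) : ℂ))) z := by
    have h1 : DifferentiableAt ℝ (fderiv ℝ (fun y => (Real.log (φ y) : ℂ))) z :=
      ((hφ'.contDiffAt (hW.mem_nhds hz)).fderiv_right (m := 1) (by norm_num)).differentiableAt
        one_ne_zero
    unfold wirtBar
    fun_prop
  rw [wirt_congr hbar, wirt_eq ((hasFDerivAt_conj hd1.hasFDerivAt).fun_add hd2.hasFDerivAt), wirt]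
  simp only [_root_.add_apply, conjOne_apply, ContinuousLinearMap.coe_restrictScalars',
    clm_single_I, map_mul, Complex.conj_I]
  linear_combination (1 / 2 * starRingEnd ℂ (fderiv ℂ (fun y => (h y)⁻¹ *
    fderiv ℂ h y (Pi.single k 1)) z (Pi.single j 1))) * Complex.I_sq

end Ddbar

end

noncomputable section

open Matrix

/-! ### The Hessian of log det Im Z -/

section SiegelForms

variable {m : ℕ}

theorem siegelWith_apply {V : Type*} [NormedAddCommGroup V] [NormedSpace ℝ V]
    (x : Sym2 (Fin m) → ℂ) (ζ : Sym2 (Fin m) → V →L[ℝ] ℂ) (u v : V) :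
    siegelWith x ζ ![u, v] = Complex.I / 4 *
      ((realMat (imMat (symMat x))⁻¹ * symMat (fun s => ζ s u) * realMat (imMat (symMat x))⁻¹ *
          conjMat (symMat fun s => ζ s v)).trace -
        (realMat (imMat (symMat x))⁻¹ * symMat (fun s => ζ s v) * realMat (imMat (symMat x))⁻¹ *
          conjMat (symMat fun s => ζ s u)).trace) := by
  have key : ∀ P A B : Matrix (Fin m) (Fin m) ℂ, (P * A * P * B).trace =
      ∑ a, ∑ b, ∑ c, ∑ d, P a b * P c d * (A b c * B d a) := by
    intro P A B
    rw [Matrix.mul_assoc, Matrix.mul_assoc]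
    simp only [Matrix.trace, Matrix.diag_apply, Matrix.mul_apply, Finset.mul_sum]
    exact Finset.sum_congr rfl fun a _ => Finset.sum_congr rfl fun b _ => Finset.sum_congr rfl
      fun c _ => Finset.sum_congr rfl fun d _ => by ring
  rw [key, key]
  simp only [siegelWith, cformSum_apply, ← Finset.sum_sub_distrib, Finset.mul_sum]
  refine Finset.sum_congr rfl fun a _ => Finset.sum_congr rfl fun b _ => Finset.sum_congr rfl
      fun c _ => Finset.sum_congr rfl fun d _ => ?_
  rw [ContinuousAlternatingMap.smul_apply, wedgeOne_two]
  simp only [realMat, symMat, conjMat, Matrix.map_apply, Matrix.of_apply, conjOne_apply, smul_eq_mul]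
  ring

theorem siegelForm_comp {V : Type*} [NormedAddCommGroup V] [NormedSpace ℝ V]
    (x : Sym2 (Fin m) → ℂ) (L : V →L[ℝ] (Sym2 (Fin m) → ℂ)) :
    (siegelForm x).compContinuousLinearMap L = siegelWith x fun s => (dcoord s).comp L := by
  refine CForm.ext_two fun u v => ?_
  rw [compContinuousLinearMap_two, siegelForm, siegelWith_apply, siegelWith_apply]
  rfl

variable {κ : Type*} [Fintype κ] {W : Set (κ → ℂ)}
  {Z : (κ → ℂ) → Sym2 (Fin m) → ℂ}

theorem siegelForm_comp_fderiv (hW : IsOpen W) (hZ : DifferentiableOn ℂ Z W) {z : κ → ℂ}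
    (hz : z ∈ W) : (siegelForm (Z z)).compContinuousLinearMap (fderiv ℝ Z z) =
      siegelWith (Z z) (fun s => fderiv ℝ (fun y => Z y s) z) := by
  rw [siegelForm_comp]
  congr 1
  funext s
  have h : DifferentiableAt ℝ Z z :=
    (hZ.differentiableAt (hW.mem_nhds hz)).restrictScalars ℝ
  exact (((dcoord s).hasFDerivAt.comp z h.hasFDerivAt).fderiv).symm

theorem hasFDerivAt_im_symMat (hW : IsOpen W) (hZ : DifferentiableOn ℂ Z W) {z : κ → ℂ}
    (hz : z ∈ W) (i j : Fin m) : HasFDerivAt (fun y => imMat (symMat (Z y)) i j)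
      (Complex.imCLM.comp ((fderiv ℂ (fun y => Z y s(i, j)) z).restrictScalars ℝ)) z :=
  Complex.imCLM.hasFDerivAt.comp z
    (((differentiableAt_pi.1 (hZ.differentiableAt (hW.mem_nhds hz)) s(i, j)).hasFDerivAt).restrictScalars ℝ)

theorem contDiffOn_im_symMat (hW : IsOpen W) (hZ : DifferentiableOn ℂ Z W) (i j : Fin m) :
    ContDiffOn ℝ (⊤ : ℕ∞) (fun y => imMat (symMat (Z y)) i j) W :=
  Complex.imCLM.contDiff.comp_contDiffOn
    (DifferentiableOn.contDiffOn_real hW (differentiableOn_pi.1 hZ s(i, j)))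

theorem contDiffOn_log_det_im (hW : IsOpen W) (hZ : DifferentiableOn ℂ Z W)
    (hm : Set.MapsTo Z W (siegelSpace m)) :
    ContDiffOn ℝ (⊤ : ℕ∞) (fun y => (Real.log (imMat (symMat (Z y))).det : ℂ)) W :=
  Complex.ofRealCLM.contDiff.comp_contDiffOn
    ((ContDiffOn.matrix_det (contDiffOn_im_symMat hW hZ)).log fun _ hy => (hm hy).det_pos.ne')

variable [DecidableEq κ]

/-- Jacobi's formula d log det Y = tr(Y⁻¹ dY), together with ∂̄ Im Z = (i/2) times the conjugate of
∂Z for holomorphic Z. -/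
theorem wirtBar_log_det_im (hW : IsOpen W) (hZ : DifferentiableOn ℂ Z W)
    (hm : Set.MapsTo Z W (siegelSpace m)) {z : κ → ℂ} (hz : z ∈ W) (k : κ) :
    wirtBar k (fun y => (Real.log (imMat (symMat (Z y))).det : ℂ)) z =
      ∑ a, ∑ b, (((imMat (symMat (Z z)))⁻¹ a b : ℝ) : ℂ) *
        (Complex.I / 2 * starRingEnd ℂ (fderiv ℂ (fun y => Z y s(b, a)) z (Pi.single k 1))) := by
  have h := Complex.ofRealCLM.hasFDerivAt.comp z
    (hasFDerivAt_log_det (hasFDerivAt_im_symMat hW hZ hz) (hm hz).det_pos.ne')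
  rw [wirtBar_eq (f := fun y => (Real.log (imMat (symMat (Z y))).det : ℂ)) h]
  simp only [ContinuousLinearMap.comp_apply, _root_.sum_apply, _root_.smul_apply, map_sum,
    Finset.mul_sum, ← Finset.sum_add_distrib]
  refine Finset.sum_congr rfl fun a _ => Finset.sum_congr rfl fun b _ => ?_
  simp only [ContinuousLinearMap.coe_restrictScalars', clm_single_I]
  generalize fderiv ℂ (fun y => Z y s(b, a)) z (Pi.single k 1) = d
  apply Complex.ext <;> simp <;> ring

/-- Here ∂ Im Z = -(i/2) ∂Z, and the sign in d(Y⁻¹) = -Y⁻¹ dY Y⁻¹ turns this into i/2. -/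
theorem wirt_im_inv (hW : IsOpen W) (hZ : DifferentiableOn ℂ Z W)
    (hm : Set.MapsTo Z W (siegelSpace m)) {z : κ → ℂ} (hz : z ∈ W) (j : κ) (a b : Fin m) :
    DifferentiableAt ℝ (fun y => (((imMat (symMat (Z y)))⁻¹ a b : ℝ) : ℂ)) z ∧
    wirt j (fun y => (((imMat (symMat (Z y)))⁻¹ a b : ℝ) : ℂ)) z =
      Complex.I / 2 * (realMat (imMat (symMat (Z z)))⁻¹ *
        symMat (fun s => fderiv ℂ (fun y => Z y s) z (Pi.single j 1)) *
        realMat (imMat (symMat (Z z)))⁻¹) a b := by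
  have h := Complex.ofRealCLM.hasFDerivAt.comp z
    (hasFDerivAt_matrix_inv (hasFDerivAt_im_symMat hW hZ hz) (hm hz).det_pos.ne' a b)
  refine ⟨h.differentiableAt, ?_⟩
  rw [wirt_eq (f := fun y => (((imMat (symMat (Z y)))⁻¹ a b : ℝ) : ℂ)) h]
  simp only [Matrix.mul_apply, Finset.sum_mul]
  rw [Finset.sum_comm]
  simp only [ContinuousLinearMap.comp_apply, _root_.neg_apply, _root_.sum_apply, _root_.smul_apply,
    map_sum, map_neg, Finset.mul_sum, ← Finset.sum_sub_distrib, ← Finset.sum_neg_distrib]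
  refine Finset.sum_congr rfl fun c _ => Finset.sum_congr rfl fun d _ => ?_
  simp only [ContinuousLinearMap.coe_restrictScalars', clm_single_I, realMat, symMat,
    Matrix.map_apply, Matrix.of_apply]
  generalize fderiv ℂ (fun y => Z y s(c, d)) z (Pi.single j 1) = e
  apply Complex.ext <;> simp <;> ring

/-- In ∂̄ log det Y = (i/2) tr(Y⁻¹ · conj ∂Z) the second factor is antiholomorphic, so ∂ only sees
Y⁻¹. The two factors i/2 give the coefficient -1/4. -/
theorem ddbar_log_det_im (hW : IsOpen W) (hZ : DifferentiableOn ℂ Z W)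
    (hm : Set.MapsTo Z W (siegelSpace m)) {z : κ → ℂ} (hz : z ∈ W) :
    (-Complex.I) • ddbar (fun y => (Real.log (imMat (symMat (Z y))).det : ℂ)) z =
      siegelWith (Z z) (fun s => fderiv ℝ (fun y => Z y s) z) := by
  set P := realMat (imMat (symMat (Z z)))⁻¹ with hP
  set D : κ → Matrix (Fin m) (Fin m) ℂ := fun j =>
    symMat (fun s => fderiv ℂ (fun y => Z y s) z (Pi.single j 1)) with hD
  have hd : ∀ s, DifferentiableOn ℂ (fun y => Z y s) W := differentiableOn_pi.1 hZ
  have hcoef : ∀ j k, wirt j (wirtBar k (fun y => (Real.log (imMat (symMat (Z y))).det : ℂ))) z =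
      -(1 / 4) * (P * D j * P * conjMat (D k)).trace := by
    intro j k
    have he : ∀ a b, DifferentiableAt ℝ (fun y => Complex.I / 2 *
        starRingEnd ℂ (fderiv ℂ (fun y => Z y s(b, a)) y (Pi.single k 1))) z := fun a b =>
      (hasFDerivAt_conj (differentiableAt_fderiv_apply hW (hd s(b, a)) hz
        (Pi.single k 1)).hasFDerivAt).differentiableAt.const_mul _
    have he' : ∀ a b, wirt j (fun y => Complex.I / 2 *
        starRingEnd ℂ (fderiv ℂ (fun y => Z y s(b, a)) y (Pi.single k 1))) z = 0 := fun a b => by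
      rw [wirt_eq ((hasFDerivAt_conj (differentiableAt_fderiv_apply hW (hd s(b, a)) hz
        (Pi.single k 1)).hasFDerivAt).const_mul _)]
      simp only [_root_.smul_apply, conjOne_apply, ContinuousLinearMap.coe_restrictScalars',
        clm_single_I, map_mul, Complex.conj_I, smul_eq_mul]
      linear_combination (1 / 4 * Complex.I * starRingEnd ℂ (fderiv ℂ (fun y =>
        fderiv ℂ (fun y => Z y s(b, a)) y (Pi.single k 1)) z (Pi.single j 1))) * Complex.I_sq
    rw [wirt_congr (Filter.eventuallyEq_of_mem (hW.mem_nhds hz) fun y hy =>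
      wirtBar_log_det_im hW hZ hm hy k)]
    have h1 : ∀ a b, DifferentiableAt ℝ (fun y => (((imMat (symMat (Z y)))⁻¹ a b : ℝ) : ℂ)) z :=
      fun a b => (wirt_im_inv hW hZ hm hz j a b).1
    rw [wirt_sum fun a _ => DifferentiableAt.fun_sum fun b _ => (h1 a b).fun_mul (he a b)]
    simp only [Matrix.trace, Matrix.diag_apply, Matrix.mul_apply (M := P * D j * P), Finset.mul_sum]
    refine Finset.sum_congr rfl fun a _ => ?_
    rw [wirt_sum fun b _ => (h1 a b).fun_mul (he a b)]
    refine Finset.sum_congr rfl fun b _ => ?_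
    rw [wirt_mul (h1 a b) (he a b), he', (wirt_im_inv hW hZ hm hz j a b).2]
    rw [show conjMat (D k) b a = starRingEnd ℂ (fderiv ℂ (fun y => Z y s(b, a)) z (Pi.single k 1))
      from rfl]
    change Complex.I / 2 * (P * D j * P) a b * _ + _ = _
    linear_combination (1 / 4 * (P * D j * P) a b *
      starRingEnd ℂ (fderiv ℂ (fun y => Z y s(b, a)) z (Pi.single k 1))) * Complex.I_sq
  have hlin : ∀ u : κ → ℂ, symMat (fun s => fderiv ℝ (fun y => Z y s) z u) = ∑ j, u j • D j := by
    intro u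
    ext a b
    have h1 : fderiv ℝ (fun y => Z y s(a, b)) z =
        (fderiv ℂ (fun y => Z y s(a, b)) z).restrictScalars ℝ :=
      (((hd s(a, b)).differentiableAt (hW.mem_nhds hz)).hasFDerivAt.restrictScalars ℝ).fderiv
    simp only [symMat, Matrix.of_apply, h1, ContinuousLinearMap.coe_restrictScalars',
      Matrix.sum_apply, Matrix.smul_apply, hD, smul_eq_mul]
    rw [fderiv_apply_eq_sum_single]
    exact Finset.sum_congr rfl fun j _ => mul_comm _ _
  have htr : ∀ u v : κ → ℂ, (P * (∑ j, u j • D j) * P * conjMat (∑ k, v k • D k)).trace =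
      ∑ j, ∑ k, u j * starRingEnd ℂ (v k) * (P * D j * P * conjMat (D k)).trace := by
    intro u v
    have hc : conjMat (∑ k, v k • D k) = ∑ k, starRingEnd ℂ (v k) • conjMat (D k) := by
      ext a b
      simp [conjMat, Matrix.sum_apply]
    simp only [hc, Matrix.sum_mul, Matrix.mul_smul, Matrix.smul_mul,
      Matrix.trace_sum, Matrix.trace_smul, smul_eq_mul, Finset.mul_sum]
    rw [Finset.sum_comm]
    exact Finset.sum_congr rfl fun j _ => Finset.sum_congr rfl fun k _ => by ring
  refine CForm.ext_two fun u v => ?_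
  rw [siegelWith_apply, hlin, hlin, htr, htr]
  simp only [ContinuousAlternatingMap.smul_apply, ddbar, cformSum_apply, hcoef, wedgeOne_two,
    Finset.smul_sum, Finset.mul_sum, ← Finset.sum_sub_distrib, smul_eq_mul]
  refine Finset.sum_congr rfl fun j _ => Finset.sum_congr rfl fun k _ => ?_
  simp only [dcoord, conjOne_apply, ContinuousLinearMap.proj_apply]
  ring

end SiegelForms

end

noncomputable section

open Matrix Complex
open scoped ComplexOrder

/-! ### The Siegel form is Kähler -/

section SiegelKahler

variable {m : ℕ}

theorem symMat_transpose (x : Sym2 (Fin m) → ℂ) : (symMat x)ᵀ = symMat x := by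
  ext a b
  simp only [symMat, Matrix.transpose_apply, Matrix.of_apply, Sym2.eq_swap]

theorem trace_conj_swap {P : Matrix (Fin m) (Fin m) ℂ} (hP : conjMat P = P)
    (A B : Matrix (Fin m) (Fin m) ℂ) :
    starRingEnd ℂ (P * A * P * conjMat B).trace = (P * B * P * conjMat A).trace := by
  have h : starRingEnd ℂ (P * A * P * conjMat B).trace = (conjMat (P * A * P * conjMat B)).trace := by
    simp only [Matrix.trace, map_sum]
    rfl
  rw [h, conjMat_mul, conjMat_mul, conjMat_mul, hP, conjMat_conjMat, Matrix.mul_assoc (P * conjMat A),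
    Matrix.trace_mul_comm, ← Matrix.mul_assoc]

/-- A primitive of the Siegel form. -/
def siegelPrimitive (x : Sym2 (Fin m) → ℂ) : CForm (Sym2 (Fin m) → ℂ) 1 :=
  ∑ a, ∑ b, ((1 / 2 : ℂ) * (((imMat (symMat x))⁻¹ a b : ℝ) : ℂ)) •
    wedgeOne ![conjOne (dcoord s(b, a))]

theorem wedgeOne_one {V : Type*} [NormedAddCommGroup V] [NormedSpace ℝ V] (θ : V →L[ℝ] ℂ) (v : V) :
    wedgeOne ![θ] ![v] = θ v := by
  rw [wedgeOne_apply, Matrix.det_fin_one]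
  simp

theorem siegelPrimitive_apply (x v : Sym2 (Fin m) → ℂ) : siegelPrimitive x ![v] =
    ∑ a, ∑ b, (((imMat (symMat x))⁻¹ a b : ℝ) : ℂ) * (1 / 2 * starRingEnd ℂ (v s(b, a))) := by
  simp only [siegelPrimitive, cformSum_apply, ContinuousAlternatingMap.smul_apply, wedgeOne_one,
    smul_eq_mul, conjOne_apply, dcoord, ContinuousLinearMap.proj_apply]
  exact Finset.sum_congr rfl fun a _ => Finset.sum_congr rfl fun b _ => by ring

theorem contDiff_im_symMat (i j : Fin m) :
    ContDiff ℝ (⊤ : ℕ∞) fun x : Sym2 (Fin m) → ℂ => imMat (symMat x) i j :=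
  Complex.imCLM.contDiff.comp (contDiff_apply ℝ ℂ s(i, j))

/-- This set contains the Siegel space and is visibly open, so it serves as a neighbourhood of each
of its points. -/
theorem isOpen_det_im_ne_zero :
    IsOpen {x : Sym2 (Fin m) → ℂ | (imMat (symMat x)).det ≠ 0} := by
  refine isOpen_ne.preimage ?_
  have h := ContDiffOn.matrix_det (s := Set.univ) (A := fun x : Sym2 (Fin m) → ℂ => imMat (symMat x))
    fun i j => (contDiff_im_symMat i j).contDiffOn
  exact continuousOn_univ.1 h.continuousOn

theorem contDiffOn_inv_im (a b : Fin m) : ContDiffOn ℝ (⊤ : ℕ∞)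
    (fun x : Sym2 (Fin m) → ℂ => (((imMat (symMat x))⁻¹ a b : ℝ) : ℂ))
    {x | (imMat (symMat x)).det ≠ 0} :=
  Complex.ofRealCLM.contDiff.comp_contDiffOn
    (ContDiffOn.matrix_inv (fun i j => (contDiff_im_symMat i j).contDiffOn) (fun _ h => h) a b)

theorem contDiffOn_siegelForm : ContDiffOn ℝ (⊤ : ℕ∞) (siegelForm (m := m))
    {x | (imMat (symMat x)).det ≠ 0} := by
  unfold siegelForm siegelWith
  refine ContDiffOn.sum fun a _ => ContDiffOn.sum fun b _ => ContDiffOn.sum fun c _ =>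
    ContDiffOn.sum fun d _ => ContDiffOn.fun_smul ?_ contDiffOn_const
  exact (contDiffOn_const.mul (contDiffOn_inv_im a b)).mul (contDiffOn_inv_im c d)

theorem contDiffOn_siegelPrimitive : ContDiffOn ℝ (⊤ : ℕ∞) (siegelPrimitive (m := m))
    {x | (imMat (symMat x)).det ≠ 0} := by
  unfold siegelPrimitive
  exact ContDiffOn.sum fun a _ => ContDiffOn.sum fun b _ => ContDiffOn.fun_smul
    (contDiffOn_const.mul (contDiffOn_inv_im a b)) contDiffOn_const

/-- The derivative of ½ tr(Y⁻¹ dZ̄) is -½ tr(Y⁻¹ dY Y⁻¹ ∧ dZ̄) with dY = (dZ - dZ̄)/2i. The dZ̄ part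
of dY drops out because its contribution is symmetric. -/
theorem extDeriv_siegelPrimitive {x : Sym2 (Fin m) → ℂ} (hx : (imMat (symMat x)).det ≠ 0) :
    extDeriv siegelPrimitive x = siegelForm x := by
  have hd : DifferentiableAt ℝ (siegelPrimitive (m := m)) x :=
    (contDiffOn_siegelPrimitive.contDiffAt (isOpen_det_im_ne_zero.mem_nhds hx)).differentiableAt
      (by simp)
  set P := realMat (imMat (symMat x))⁻¹ with hP
  have hinv : ∀ a b, HasFDerivAt (fun y : Sym2 (Fin m) → ℂ => (imMat (symMat y))⁻¹ a b)
      (-∑ k, ∑ l, ((imMat (symMat x))⁻¹ a k * (imMat (symMat x))⁻¹ l b) •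
        (Complex.imCLM.comp (dcoord s(k, l)))) x := fun a b =>
    hasFDerivAt_matrix_inv (Y := fun y => imMat (symMat y)) (fun i j => (Complex.imCLM.comp (dcoord s(i, j))).hasFDerivAt) hx a b
  have hfd : ∀ u v : Sym2 (Fin m) → ℂ, fderiv ℝ (fun y => siegelPrimitive y ![v]) x u =
      -(1 / 2) * (P * realMat (imMat (symMat u)) * P * conjMat (symMat v)).trace := by
    intro u v
    have h1 : HasFDerivAt (fun y => siegelPrimitive y ![v])
        (∑ a, ∑ b, (1 / 2 * starRingEnd ℂ (v s(b, a))) • Complex.ofRealCLM.comp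
          (-∑ k, ∑ l, ((imMat (symMat x))⁻¹ a k * (imMat (symMat x))⁻¹ l b) •
        (Complex.imCLM.comp (dcoord s(k, l))))) x := by
      simp only [siegelPrimitive_apply]
      exact HasFDerivAt.fun_sum fun a _ => HasFDerivAt.fun_sum fun b _ =>
        (Complex.ofRealCLM.hasFDerivAt.comp x (hinv a b)).mul_const _
    have h2 : ∀ a b, (P * realMat (imMat (symMat u)) * P) a b =
        ∑ k, ∑ l, (((imMat (symMat x))⁻¹ a k : ℝ) : ℂ) * (((imMat (symMat x))⁻¹ l b : ℝ) : ℂ) *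
          ((u s(k, l)).im : ℂ) := fun a b => by
      simp only [Matrix.mul_apply, Finset.sum_mul]
      rw [Finset.sum_comm]
      exact Finset.sum_congr rfl fun k _ => Finset.sum_congr rfl fun l _ => by
        simp only [hP, realMat, imMat, symMat, Matrix.map_apply, Matrix.of_apply]
        ring
    rw [h1.fderiv]
    simp only [Matrix.trace, Matrix.diag_apply, Matrix.mul_apply (N := conjMat (symMat v)), h2,
      _root_.sum_apply, Finset.mul_sum, _root_.smul_apply, ContinuousLinearMap.comp_apply,
      _root_.neg_apply, map_neg, map_sum, smul_eq_mul]
    refine Finset.sum_congr rfl fun a _ => Finset.sum_congr rfl fun b _ => ?_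
    rw [Finset.sum_mul, Finset.mul_sum, mul_neg, Finset.mul_sum, ← Finset.sum_neg_distrib]
    refine Finset.sum_congr rfl fun k _ => ?_
    rw [Finset.sum_mul, Finset.mul_sum, Finset.mul_sum, ← Finset.sum_neg_distrib]
    refine Finset.sum_congr rfl fun l _ => ?_
    simp only [conjMat, symMat, Matrix.map_apply, Matrix.of_apply, Complex.ofRealCLM_apply,
      Complex.imCLM_apply, dcoord, ContinuousLinearMap.proj_apply, Complex.ofReal_mul]
    ring
  have him : ∀ u : Sym2 (Fin m) → ℂ, realMat (imMat (symMat u)) =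
      (-(I / 2)) • (symMat u - conjMat (symMat u)) := fun u => by
    ext a b
    simp only [realMat, imMat, conjMat, Matrix.map_apply, Matrix.smul_apply, Matrix.sub_apply,
      smul_eq_mul]
    apply Complex.ext <;> simp <;> ring
  have hPr : conjMat P = P := conjMat_realMat _
  refine CForm.ext_two fun u v => ?_
  rw [extDeriv_one_apply hd, hfd, hfd, siegelForm, siegelWith_apply, him, him]
  have hcross : (P * conjMat (symMat u) * P * conjMat (symMat v)).trace =
      (P * conjMat (symMat v) * P * conjMat (symMat u)).trace := by
    have := trace_conj_swap hPr (conjMat (symMat u)) (symMat v)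
    rw [Matrix.mul_assoc (P * conjMat (symMat u)), Matrix.trace_mul_comm, ← Matrix.mul_assoc]
  simp only [Matrix.mul_smul, Matrix.smul_mul, Matrix.trace_smul, Matrix.mul_sub, Matrix.sub_mul,
    Matrix.trace_sub, smul_eq_mul, hcross]
  change _ = I / 4 * ((P * symMat u * P * conjMat (symMat v)).trace -
    (P * symMat v * P * conjMat (symMat u)).trace)
  ring

theorem siegelForm_apply (x u v : Sym2 (Fin m) → ℂ) :
    siegelForm x ![u, v] = I / 4 *
      ((realMat (imMat (symMat x))⁻¹ * symMat u * realMat (imMat (symMat x))⁻¹ *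
          conjMat (symMat v)).trace -
        (realMat (imMat (symMat x))⁻¹ * symMat v * realMat (imMat (symMat x))⁻¹ *
          conjMat (symMat u)).trace) :=
  siegelWith_apply _ _ _ _

/-- With P = AᵗĀ = A*A the trace is the squared Frobenius norm of Ā u A*, and this matrix vanishes
only for u = 0. -/
theorem trace_siegel_pos {P : Matrix (Fin m) (Fin m) ℝ} (hP : P.PosDef) {u : Sym2 (Fin m) → ℂ}
    (hu : u ≠ 0) : 0 < (realMat P * symMat u * realMat P * conjMat (symMat u)).trace.re := by
  obtain ⟨A, hA, hPA⟩ := (posDef_realMat hP).exists_coframe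
  have hPA' : realMat P = Aᴴ * A := by
    rw [← conjMat_realMat, hPA, conjMat_mul, conjMat_conjMat]; rfl
  set M := conjMat A * symMat u * Aᴴ with hM
  have hMH : Mᴴ = A * conjMat (symMat u) * Aᵀ := by
    rw [hM, conjTranspose_mul, conjTranspose_mul, conjTranspose_conjTranspose, ← Matrix.mul_assoc]
    congr 1
    · congr 1
      conv_rhs => rw [← symMat_transpose]
      rfl
    · ext i j; simp [conjMat]
  have htr : (realMat P * symMat u * realMat P * conjMat (symMat u)).trace = (M * Mᴴ).trace := by
    nth_rw 2 [hPA']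
    rw [hPA, hMH, Matrix.mul_assoc Aᵀ, Matrix.mul_assoc Aᵀ, Matrix.mul_assoc Aᵀ, Matrix.trace_mul_comm]
    simp only [hM, Matrix.mul_assoc]
  rw [htr]
  have h0 : 0 ≤ (M * Mᴴ).trace := (posSemidef_self_mul_conjTranspose M).trace_nonneg
  have h1 : (M * Mᴴ).trace ≠ 0 := by
    rw [Ne, trace_mul_conjTranspose_self_eq_zero_iff]
    intro h
    apply hu
    have hA1 : IsUnit (conjMat A).det := by
      rw [conjMat_det]; exact isUnit_iff_ne_zero.2 (by simpa using hA)
    have hA2 : IsUnit (Aᴴ).det := by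
      rw [det_conjTranspose]; exact isUnit_iff_ne_zero.2 (by simpa using hA)
    have h2 : symMat u = (conjMat A)⁻¹ * M * (Aᴴ)⁻¹ := by
      rw [hM, Matrix.mul_assoc, Matrix.mul_assoc, Matrix.mul_assoc, mul_nonsing_inv _ hA2,
        Matrix.mul_one, ← Matrix.mul_assoc, nonsing_inv_mul _ hA1, Matrix.one_mul]
    rw [h, Matrix.mul_zero, Matrix.zero_mul] at h2
    funext s
    induction s using Sym2.ind with
    | _ a b => exact congrFun (congrFun h2 a) b
  exact (Complex.pos_iff.1 (lt_of_le_of_ne h0 h1.symm)).1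

theorem isKahlerForm_siegelForm : IsKahlerForm (siegelSpace m) (siegelForm (m := m)) := by
  have hdet : ∀ x ∈ siegelSpace m, (imMat (symMat x)).det ≠ 0 := fun x hx => hx.det_pos.ne'
  have hI : ∀ u : Sym2 (Fin m) → ℂ, symMat (I • u) = I • symMat u := fun u => rfl
  have hcI : ∀ A : Matrix (Fin m) (Fin m) ℂ, conjMat (I • A) = (-I) • conjMat A := fun A => by
    ext; simp [conjMat]
  refine ⟨⟨contDiffOn_siegelForm.mono hdet, fun x _ v => ?_⟩, fun x hx => ?_, fun x _ u v => ?_,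
    fun x hx u hu => ?_⟩
  · have hv : v = ![v 0, v 1] := by ext i; fin_cases i <;> rfl
    rw [hv, siegelForm_apply, ← trace_conj_swap (conjMat_realMat _) (symMat (v 0)) (symMat (v 1))]
    generalize (realMat (imMat (symMat x))⁻¹ * symMat (v 0) * realMat (imMat (symMat x))⁻¹ *
      conjMat (symMat (v 1))).trace = t
    simp [Complex.mul_im]
  · have h : (siegelForm (m := m)) =ᶠ[nhds x] extDeriv siegelPrimitive := by
      filter_upwards [isOpen_det_im_ne_zero.mem_nhds (hdet x hx)] with y hy
      exact (extDeriv_siegelPrimitive hy).symm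
    rw [h.extDeriv_eq]
    exact extDeriv_extDeriv_apply (r := 2) (by
      exact_mod_cast contDiffAt_infty.1 (contDiffOn_siegelPrimitive.contDiffAt
        (isOpen_det_im_ne_zero.mem_nhds (hdet x hx))) 2) (by simp)
  · simp only [siegelForm_apply, hI, hcI, Matrix.mul_smul, Matrix.smul_mul, Matrix.trace_smul,
      smul_eq_mul]
    linear_combination (-(I / 4) * ((realMat (imMat (symMat x))⁻¹ * symMat u *
      realMat (imMat (symMat x))⁻¹ * conjMat (symMat v)).trace -
        (realMat (imMat (symMat x))⁻¹ * symMat v * realMat (imMat (symMat x))⁻¹ *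
          conjMat (symMat u)).trace)) * I_sq
  · have h := trace_siegel_pos (PosDef.inv hx) hu
    simp only [siegelForm_apply, hI, hcI, Matrix.mul_smul, Matrix.smul_mul, Matrix.trace_smul,
      smul_eq_mul]
    generalize (realMat (imMat (symMat x))⁻¹ * symMat u * realMat (imMat (symMat x))⁻¹ *
      conjMat (symMat u)).trace = t at h ⊢
    have e : I / 4 * (-I * t - I * t) = t / 2 := by linear_combination (-t / 2) * I_sq
    rw [e]
    simpa using h

end SiegelKahler

end

noncomputable section

open Matrix Complex
open scoped ComplexOrder

/-! ### Invariance of the Siegel form under the symplectic group -/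

section SymplecticInvariance

variable {m : ℕ}

/-- The coordinates of a symmetric matrix. -/
def symCoord (Z : Matrix (Fin m) (Fin m) ℂ) : Sym2 (Fin m) → ℂ :=
  fun s => Z (Quot.out s).1 (Quot.out s).2

theorem symMat_symCoord {Z : Matrix (Fin m) (Fin m) ℂ} (hZ : Zᵀ = Z) : symMat (symCoord Z) = Z := by
  ext a b
  have h : s((Quot.out s(a, b)).1, (Quot.out s(a, b)).2) = s(a, b) := Quot.out_eq _
  change Z (Quot.out s(a, b)).1 (Quot.out s(a, b)).2 = Z a b
  rcases Sym2.eq_iff.1 h with ⟨h1, h2⟩ | ⟨h1, h2⟩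
  · rw [h1, h2]
  · rw [h1, h2]
    exact congrFun (congrFun hZ a) b

theorem conjMat_add {k l : Type*} (A B : Matrix k l ℂ) :
    conjMat (A + B) = conjMat A + conjMat B := by
  ext; simp [conjMat]

section Blocks

variable {A B C D : Matrix (Fin m) (Fin m) ℂ}

/-- The block relations say that the matrix preserves the standard symplectic pairing; here it is
applied to the columns (Z; 1) and (W; 1). -/
theorem mobius_key (h1 : Aᵀ * C = Cᵀ * A) (h2 : Bᵀ * D = Dᵀ * B) (h3 : Aᵀ * D - Cᵀ * B = 1)
    {Z W : Matrix (Fin m) (Fin m) ℂ} (hW : Wᵀ = W) :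
    (C * W + D)ᵀ * (A * Z + B) - (A * W + B)ᵀ * (C * Z + D) = Z - W := by
  have h3' : Dᵀ * A - Bᵀ * C = 1 := by
    have := congrArg Matrix.transpose h3
    simpa [Matrix.transpose_sub, Matrix.transpose_mul] using this
  simp only [Matrix.transpose_add, Matrix.transpose_mul, hW]
  have e : (W * Cᵀ + Dᵀ) * (A * Z + B) - (W * Aᵀ + Bᵀ) * (C * Z + D) =
      W * (Cᵀ * A - Aᵀ * C) * Z - W * (Aᵀ * D - Cᵀ * B) + (Dᵀ * A - Bᵀ * C) * Z +
        (Dᵀ * B - Bᵀ * D) := by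
    noncomm_ring
  rw [e, h1, h2, h3, h3']
  simp
  abel

/-- Take W = Z̄ in `mobius_key`. A null vector v of CZ + D would satisfy v*(Z - Z̄)v = 0, against Im
Z > 0. -/
theorem mobius_denom_isUnit (h1 : Aᵀ * C = Cᵀ * A) (h2 : Bᵀ * D = Dᵀ * B)
    (h3 : Aᵀ * D - Cᵀ * B = 1) (hC : conjMat C = C)
    (hD : conjMat D = D) {Z : Matrix (Fin m) (Fin m) ℂ} (hZ : Zᵀ = Z) (hY : (imMat Z).PosDef) :
    IsUnit (C * Z + D).det := by
  rw [isUnit_iff_ne_zero]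
  intro h0
  obtain ⟨v, hv, hv0⟩ := Matrix.exists_mulVec_eq_zero_iff.2 h0
  have hZc : (conjMat Z)ᵀ = conjMat Z := by rw [← conjMat_transpose, hZ]
  have hk := mobius_key h1 h2 h3 (Z := Z) hZc
  have hN : (C * conjMat Z + D)ᵀ = (C * Z + D)ᴴ := by
    have : C * conjMat Z + D = conjMat (C * Z + D) := by rw [conjMat_add, conjMat_mul, hC, hD]
    rw [this]; rfl
  rw [hN] at hk
  have h4 : star v ⬝ᵥ (Z - conjMat Z) *ᵥ v = 0 := by
    rw [← hk, Matrix.sub_mulVec, dotProduct_sub, ← Matrix.mulVec_mulVec, ← Matrix.mulVec_mulVec, hv0,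
      Matrix.mulVec_zero, dotProduct_zero, sub_zero, Matrix.dotProduct_mulVec,
      ← Matrix.star_mulVec, hv0, star_zero, zero_dotProduct]
  have h5 : Z - conjMat Z = (2 * I) • realMat (imMat Z) := by
    ext i j
    simp only [conjMat, realMat, imMat, Matrix.sub_apply, Matrix.map_apply, Matrix.smul_apply,
      smul_eq_mul]
    have := sub_conj (Z i j)
    push_cast at this
    linear_combination this
  rw [h5, Matrix.smul_mulVec, dotProduct_smul, smul_eq_mul] at h4
  have h6 := (posDef_realMat hY).dotProduct_mulVec_pos hv
  rcases mul_eq_zero.1 h4 with h | h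
  · simp at h
  · exact h6.ne' h

/-- `mobius_key` divided by the two denominators. With W = Z̄ it yields the imaginary part of the
transform, with W fixed and Z variable it yields the differential. -/
theorem mobius_sub (h1 : Aᵀ * C = Cᵀ * A) (h2 : Bᵀ * D = Dᵀ * B) (h3 : Aᵀ * D - Cᵀ * B = 1)
    {Z W : Matrix (Fin m) (Fin m) ℂ} (hW : Wᵀ = W) (hNZ : IsUnit (C * Z + D).det)
    (hNW : IsUnit (C * W + D).det) :
    ((A * W + B) * (C * W + D)⁻¹)ᵀ = (A * W + B) * (C * W + D)⁻¹ ∧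
    (A * Z + B) * (C * Z + D)⁻¹ - (A * W + B) * (C * W + D)⁻¹ =
      ((C * W + D)⁻¹)ᵀ * (Z - W) * (C * Z + D)⁻¹ := by
  have hNWt : IsUnit ((C * W + D)ᵀ).det := by rwa [det_transpose]
  have hs : ((A * W + B) * (C * W + D)⁻¹)ᵀ = (A * W + B) * (C * W + D)⁻¹ := by
    have hk := mobius_key h1 h2 h3 (Z := W) hW
    rw [sub_self, sub_eq_zero] at hk
    rw [transpose_mul, transpose_nonsing_inv]
    have := congrArg (fun M => ((C * W + D)ᵀ)⁻¹ * M * (C * W + D)⁻¹) hk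
    simp only [← Matrix.mul_assoc, nonsing_inv_mul _ hNWt, Matrix.one_mul] at this
    rw [this, Matrix.mul_assoc, mul_nonsing_inv _ hNW, Matrix.mul_one]
  refine ⟨hs, ?_⟩
  conv_lhs => rw [← hs]
  rw [← mobius_key h1 h2 h3 (Z := Z) hW, transpose_mul, Matrix.mul_sub, Matrix.sub_mul,
    transpose_nonsing_inv]
  congr 1
  · rw [← Matrix.mul_assoc, nonsing_inv_mul _ hNWt, Matrix.one_mul]
  · rw [Matrix.mul_assoc, Matrix.mul_assoc _ _ ((C * Z + D)⁻¹), mul_nonsing_inv _ hNZ, Matrix.mul_one]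

theorem mobius_im (h1 : Aᵀ * C = Cᵀ * A) (h2 : Bᵀ * D = Dᵀ * B) (h3 : Aᵀ * D - Cᵀ * B = 1)
    (hA : conjMat A = A) (hB : conjMat B = B) (hC : conjMat C = C) (hD : conjMat D = D)
    {Z : Matrix (Fin m) (Fin m) ℂ} (hZ : Zᵀ = Z) (hN : IsUnit (C * Z + D).det) :
    realMat (imMat ((A * Z + B) * (C * Z + D)⁻¹)) =
      (conjMat (C * Z + D)⁻¹)ᵀ * realMat (imMat Z) * (C * Z + D)⁻¹ := by
  have him : ∀ Z : Matrix (Fin m) (Fin m) ℂ, realMat (imMat Z) = (-(I / 2)) • (Z - conjMat Z) :=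
    fun Z => by
      ext a b
      simp only [realMat, imMat, conjMat, Matrix.map_apply, Matrix.smul_apply, Matrix.sub_apply,
        smul_eq_mul]
      apply Complex.ext <;> simp <;> ring
  have hZc : (conjMat Z)ᵀ = conjMat Z := by rw [← conjMat_transpose, hZ]
  have hNc : C * conjMat Z + D = conjMat (C * Z + D) := by rw [conjMat_add, conjMat_mul, hC, hD]
  have hKc : A * conjMat Z + B = conjMat (A * Z + B) := by rw [conjMat_add, conjMat_mul, hA, hB]
  have hNcu : IsUnit (C * conjMat Z + D).det := by
    rw [hNc, conjMat_det]; exact hN.map _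
  have hinv : conjMat (C * Z + D)⁻¹ = (C * conjMat Z + D)⁻¹ := by
    refine (Matrix.inv_eq_left_inv ?_).symm
    rw [hNc, ← conjMat_mul, nonsing_inv_mul _ hN]
    ext i j
    simp [conjMat, Matrix.one_apply, apply_ite]
  have h := (mobius_sub h1 h2 h3 hZc hN hNcu).2
  rw [him, him, conjMat_mul, hinv, ← hKc, h]
  simp only [Matrix.mul_smul, Matrix.smul_mul]

end Blocks

/-- With N = CZ + D the differential is N⁻ᵗ dZ N⁻¹ and the imaginary part becomes N̄⁻ᵗ (Im Z) N⁻¹,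
so all factors N cancel in tr(Y⁻¹ dZ Y⁻¹ dZ̄). -/
theorem isSpInvariant_siegelForm : IsSpInvariant (siegelForm (m := m)) := by
  intro M hM
  set A := realMat M.toBlocks₁₁ with hAdef
  set B := realMat M.toBlocks₁₂ with hBdef
  set C := realMat M.toBlocks₂₁ with hCdef
  set D := realMat M.toBlocks₂₂ with hDdef
  rw [← Matrix.fromBlocks_toBlocks M, SymplecticGroup.fromBlocks_mem_iff] at hM
  have ht : ∀ X : Matrix (Fin m) (Fin m) ℝ, realMat Xᵀ = (realMat X)ᵀ := fun X => rfl
  have h1 : Aᵀ * C = Cᵀ * A := by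
    have := congrArg realMat hM.1
    rwa [realMat_mul, realMat_mul, ht, ht] at this
  have h2 : Bᵀ * D = Dᵀ * B := by
    have := congrArg realMat hM.2.1
    rwa [realMat_mul, realMat_mul, ht, ht] at this
  have h3 : Aᵀ * D - Cᵀ * B = 1 := by
    have := congrArg realMat hM.2.2
    rw [realMat_one] at this
    rw [← this]
    have hs : ∀ X Y : Matrix (Fin m) (Fin m) ℝ, realMat (X - Y) = realMat X - realMat Y :=
      fun X Y => by ext; simp [realMat]
    rw [hs, realMat_mul, realMat_mul, ht, ht]
  have hA : conjMat A = A := conjMat_realMat _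
  have hB : conjMat B = B := conjMat_realMat _
  have hC : conjMat C = C := conjMat_realMat _
  have hD : conjMat D = D := conjMat_realMat _
  set N : (Sym2 (Fin m) → ℂ) → Matrix (Fin m) (Fin m) ℂ := fun x => C * symMat x + D with hNdef
  have hmob : ∀ x, mobius M (symMat x) = (A * symMat x + B) * (N x)⁻¹ := fun x => rfl
  have hNu : ∀ x ∈ siegelSpace m, IsUnit (N x).det := fun x hx =>
    mobius_denom_isUnit h1 h2 h3 hC hD (symMat_transpose x) hx
  set V : Set (Sym2 (Fin m) → ℂ) := {x | (N x).det ≠ 0} with hV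
  have hVs : ∀ x ∈ siegelSpace m, x ∈ V := fun x hx => (hNu x hx).ne_zero
  have hNd : ∀ i j, ContDiff ℂ (⊤ : ℕ∞) fun x => N x i j := fun i j => by
    simp only [hNdef, Matrix.add_apply, Matrix.mul_apply, symMat, Matrix.of_apply]
    fun_prop
  have hVo : IsOpen V := by
    refine isOpen_ne.preimage ?_
    have h := ContDiffOn.matrix_det (s := Set.univ) (A := N) fun i j => (hNd i j).contDiffOn
    exact continuousOn_univ.1 h.continuousOn
  have hNi : ∀ i j, ContDiffOn ℂ (⊤ : ℕ∞) (fun x => (N x)⁻¹ i j) V := fun i j =>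
    ContDiffOn.matrix_inv (fun i j => (hNd i j).contDiffOn) (fun _ h => h) i j
  set φ : (Sym2 (Fin m) → ℂ) → Sym2 (Fin m) → ℂ := fun x => symCoord (mobius M (symMat x)) with hφ
  have hsym : ∀ x ∈ V, symMat (φ x) = mobius M (symMat x) := fun x hx =>
    symMat_symCoord (by
      rw [hmob]
      exact (mobius_sub h1 h2 h3 (symMat_transpose x) (isUnit_iff_ne_zero.2 hx)
        (isUnit_iff_ne_zero.2 hx)).1)
  have hder : ∀ x ∈ V, ∃ L : (Sym2 (Fin m) → ℂ) →L[ℂ] (Sym2 (Fin m) → ℂ), HasFDerivAt φ L x ∧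
      ∀ u, symMat (L u) = ((N x)⁻¹)ᵀ * symMat u * (N x)⁻¹ := by
    intro x hx
    have hcomp : ∀ a b, HasFDerivAt (fun y => φ y s(a, b))
        (∑ k, (N x)⁻¹ k b • ∑ l, (N x)⁻¹ l a •
          (ContinuousLinearMap.proj s(l, k) : (Sym2 (Fin m) → ℂ) →L[ℂ] ℂ)) x := by
      intro a b
      have hlin : ∀ k, HasFDerivAt (fun y : Sym2 (Fin m) → ℂ => ∑ l, (N x)⁻¹ l a * (y s(l, k) - x s(l, k)))
          (∑ l, (N x)⁻¹ l a •
          (ContinuousLinearMap.proj s(l, k) : (Sym2 (Fin m) → ℂ) →L[ℂ] ℂ)) x := fun k =>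
        HasFDerivAt.fun_sum fun l _ =>
          ((ContinuousLinearMap.proj (R := ℂ) (φ := fun _ : Sym2 (Fin m) => ℂ)
            s(l, k)).hasFDerivAt.sub_const _).const_mul _
      -- By `mobius_sub`, φ(y) = φ(x) + N(x)⁻ᵗ (y - x) N(y)⁻¹. At y = x the derivative of N(y)⁻¹ is
      -- multiplied by zero, so only its existence matters.
      have hsum : HasFDerivAt (fun y : Sym2 (Fin m) → ℂ => φ x s(a, b) + ∑ k, (∑ l, (N x)⁻¹ l a *
          (y s(l, k) - x s(l, k))) * (N y)⁻¹ k b)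
          (∑ k, ((∑ l, (N x)⁻¹ l a * (x s(l, k) - x s(l, k))) • fderiv ℂ (fun y => (N y)⁻¹ k b) x +
            (N x)⁻¹ k b • ∑ l, (N x)⁻¹ l a •
          (ContinuousLinearMap.proj s(l, k) : (Sym2 (Fin m) → ℂ) →L[ℂ] ℂ))) x :=
        (HasFDerivAt.fun_sum fun k _ => (hlin k).mul
          (((hNi k b).contDiffAt (hVo.mem_nhds hx)).differentiableAt (by simp)).hasFDerivAt).const_add _
      refine (hsum.congr_of_eventuallyEq ?_).congr_fderiv ?_
      swap
      · refine Finset.sum_congr rfl fun k _ => ?_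
        simp only [sub_self, mul_zero, Finset.sum_const_zero]
        ext u
        simp
      filter_upwards [hVo.mem_nhds hx] with y hy
      have h := congrFun (congrFun (mobius_sub h1 h2 h3 (Z := symMat y) (symMat_transpose x)
        (isUnit_iff_ne_zero.2 hy) (isUnit_iff_ne_zero.2 hx)).2 a) b
      have e1 : φ y s(a, b) = ((A * symMat y + B) * (N y)⁻¹) a b :=
        congrFun (congrFun ((hsym y hy).trans (hmob y)) a) b
      have e2 : φ x s(a, b) = ((A * symMat x + B) * (N x)⁻¹) a b :=
        congrFun (congrFun ((hsym x hx).trans (hmob x)) a) b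
      rw [Matrix.sub_apply, sub_eq_iff_eq_add'] at h
      rw [e1, e2]
      refine h.trans ?_
      simp only [Matrix.mul_apply, Matrix.transpose_apply, Matrix.sub_apply, symMat, Matrix.of_apply, hNdef]
    have hd : DifferentiableAt ℂ φ x := differentiableAt_pi.2 fun s => by
      induction s using Sym2.ind with
      | _ a b => exact (hcomp a b).differentiableAt
    refine ⟨fderiv ℂ φ x, hd.hasFDerivAt, fun u => ?_⟩
    ext a b
    have h := (hasFDerivAt_pi'.1 hd.hasFDerivAt s(a, b)).unique (hcomp a b)
    have h' := congrArg (fun L : (Sym2 (Fin m) → ℂ) →L[ℂ] ℂ => L u) h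
    refine h'.trans ?_
    simp only [_root_.sum_apply, _root_.smul_apply, smul_eq_mul, Matrix.mul_apply,
      ContinuousLinearMap.proj_apply, Finset.sum_mul, Finset.mul_sum, Matrix.transpose_apply, symMat,
      Matrix.of_apply]
    exact Finset.sum_congr rfl fun k _ => Finset.sum_congr rfl fun l _ => by ring
  have him : ∀ x ∈ siegelSpace m, realMat (imMat (symMat (φ x))) =
      (conjMat (N x)⁻¹)ᵀ * realMat (imMat (symMat x)) * (N x)⁻¹ := fun x hx => by
    rw [hsym x (hVs x hx), hmob]
    exact mobius_im h1 h2 h3 hA hB hC hD (symMat_transpose x) (hNu x hx)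
  have hmaps : Set.MapsTo φ (siegelSpace m) (siegelSpace m) := fun x hx => by
    refine posDef_of_realMat (Y := imMat (symMat (φ x))) ?_
    rw [him x hx]
    refine (posDef_realMat hx).conjTranspose_mul_mul_same (B := (N x)⁻¹)
      (Matrix.mulVec_injective_of_isUnit ?_)
    rw [isUnit_iff_isUnit_det, det_nonsing_inv]
    exact (hNu x hx).ringInverse
  refine ⟨φ, fun x hx => ?_, hmaps, fun x hx => ⟨hsym x (hVs x hx), ?_⟩⟩
  · obtain ⟨L, hL, -⟩ := hder x (hVs x hx)
    exact hL.differentiableAt.differentiableWithinAt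
  · obtain ⟨L, hL, hLs⟩ := hder x (hVs x hx)
    have hfd : fderiv ℝ φ x = L.restrictScalars ℝ := (hL.restrictScalars ℝ).fderiv
    set E := (N x)⁻¹ with hE
    set Y := imMat (symMat x) with hY
    have hYd : Y.det ≠ 0 := hx.det_pos.ne'
    have hY'd : (imMat (symMat (φ x))).det ≠ 0 := (hmaps hx).det_pos.ne'
    set P := realMat Y⁻¹ with hP
    have hNE : N x * E = 1 := mul_nonsing_inv _ (hNu x hx)
    have hEN : E * N x = 1 := nonsing_inv_mul _ (hNu x hx)
    have hYP : realMat Y * P = 1 := by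
      rw [hP, ← realMat_mul, mul_nonsing_inv _ (isUnit_iff_ne_zero.2 hYd), realMat_one]
    have hc1 : conjMat (1 : Matrix (Fin m) (Fin m) ℂ) = 1 := by
      ext i j; simp [conjMat, Matrix.one_apply, apply_ite]
    have hEcNc : conjMat E * conjMat (N x) = 1 := by rw [← conjMat_mul, hEN, hc1]
    have hNcEc : conjMat (N x) * conjMat E = 1 := by rw [← conjMat_mul, hNE, hc1]
    have hP' : realMat (imMat (symMat (φ x)))⁻¹ = N x * P * (conjMat (N x))ᵀ := by
      rw [realMat_inv hY'd, him x hx]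
      refine Matrix.inv_eq_right_inv ?_
      calc (conjMat E)ᵀ * realMat Y * E * (N x * P * (conjMat (N x))ᵀ)
          = (conjMat E)ᵀ * (realMat Y * (E * N x) * P) * (conjMat (N x))ᵀ := by
            simp only [Matrix.mul_assoc]
        _ = (conjMat (N x) * conjMat E)ᵀ := by
            rw [hEN, Matrix.mul_one, hYP, Matrix.mul_one, transpose_mul]
        _ = 1 := by rw [hNcEc, transpose_one]
    -- This matrix is real, hence equal to its conjugate. The two occurrences in the trace need the
    -- two different expressions to cancel.
    have hP'' : realMat (imMat (symMat (φ x)))⁻¹ = conjMat (N x) * P * (N x)ᵀ := by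
      rw [← conjMat_realMat, hP', conjMat_mul, conjMat_mul, hP, conjMat_realMat, conjMat_transpose,
        conjMat_conjMat]
    have htr : ∀ u v : Sym2 (Fin m) → ℂ,
        (realMat (imMat (symMat (φ x)))⁻¹ * symMat (L u) * realMat (imMat (symMat (φ x)))⁻¹ *
          conjMat (symMat (L v))).trace = (P * symMat u * P * conjMat (symMat v)).trace := by
      intro u v
      nth_rw 2 [hP']
      rw [hP'', hLs, hLs, conjMat_mul, conjMat_mul, conjMat_transpose]
      have hNEt : (N x)ᵀ * Eᵀ = 1 := by rw [← transpose_mul, hEN, transpose_one]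
      have hNEct : (conjMat (N x))ᵀ * (conjMat E)ᵀ = 1 := by
        rw [← transpose_mul, hEcNc, transpose_one]
      calc _ = (conjMat (N x) * (P * ((N x)ᵀ * Eᵀ) * symMat u * (E * N x) * P *
              ((conjMat (N x))ᵀ * (conjMat E)ᵀ) * conjMat (symMat v) * conjMat E)).trace := by
            simp only [Matrix.mul_assoc]
        _ = _ := by
            rw [hNEt, hNEct, hEN, Matrix.trace_mul_comm, Matrix.mul_assoc _ (conjMat E), hEcNc]
            simp only [Matrix.mul_one]
    refine CForm.ext_two fun u v => ?_
    rw [compContinuousLinearMap_two, hfd, siegelForm_apply, siegelForm_apply]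
    simp only [ContinuousLinearMap.coe_restrictScalars', htr]
    rfl

end SymplecticInvariance

end

noncomputable section

open Complex

/-! ### Closedness in complex dimension one -/

section OneDimensional

/-- Three vectors in a real plane are linearly dependent. So every hermitian metric on a
one-dimensional base has closed Kähler form. -/
theorem cform_three_eq_zero (α : CForm (Fin 1 → ℂ) 3) : α = 0 := by
  ext v
  have h : ¬ LinearIndependent ℝ v := fun h => by
    have h1 := h.fintype_card_le_finrank
    rw [Fintype.card_fin, Module.finrank_pi_fintype ℝ] at h1
    simp [Complex.finrank_real_complex] at h1
  exact α.toAlternatingMap.map_linearDependent v h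

end OneDimensional

/-! ### The hyperbolic metric -/

section Hyperbolic

theorem hyperbolicMetric_apply (x u v : Fin 1 → ℂ) : hyperbolicMetric x u v =
    1 / (2 * (x 0).im ^ 2) * (u 0 * starRingEnd ℂ (v 0)).re := by
  simp [hyperbolicMetric]

theorem hasFDerivAt_im (x : Fin 1 → ℂ) :
    HasFDerivAt (fun y : Fin 1 → ℂ => (y 0).im) (Complex.imCLM.comp (dcoord (0 : Fin 1))) x :=
  (Complex.imCLM.comp (dcoord (0 : Fin 1))).hasFDerivAt

theorem contDiff_im : ContDiff ℝ (⊤ : ℕ∞) fun y : Fin 1 → ℂ => (y 0).im :=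
  (Complex.imCLM.comp (dcoord (0 : Fin 1))).contDiff

theorem isOpen_upperHalf : IsOpen upperHalf :=
  isOpen_lt continuous_const (Complex.continuous_im.comp (continuous_apply 0))

theorem contDiffOn_hyperbolicMetric : ContDiffOn ℝ (⊤ : ℕ∞) hyperbolicMetric upperHalf := by
  have h : ContDiffOn ℝ (⊤ : ℕ∞) (fun x : Fin 1 → ℂ => 1 / (2 * (x 0).im ^ 2)) upperHalf := by
    refine contDiffOn_const.div (contDiffOn_const.mul (contDiff_im.contDiffOn.pow 2)) fun x hx => ?_
    have : (0 : ℝ) < (x 0).im := hx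
    positivity
  refine contDiffOn_bilin_iff.2 fun u v => ?_
  simp only [hyperbolicMetric_apply]
  exact h.mul contDiffOn_const

theorem isHermInner_hyperbolicMetric {x : Fin 1 → ℂ} (hx : x ∈ upperHalf) :
    IsHermInner (hyperbolicMetric x) := by
  have hx' : (0 : ℝ) < (x 0).im := hx
  refine ⟨fun u v => ?_, fun u v => ?_, fun u hu => ?_⟩
  · simp only [hyperbolicMetric_apply, mul_re, conj_re, conj_im]
    ring
  · simp only [hyperbolicMetric_apply, Pi.smul_apply, smul_eq_mul, mul_re, mul_im, conj_re, conj_im,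
      I_re, I_im]
    ring
  · rw [hyperbolicMetric_apply, mul_conj, ofReal_re]
    have : u 0 ≠ 0 := fun h => hu (funext fun i => by rw [Subsingleton.elim i 0, h]; rfl)
    have := normSq_pos.2 this
    positivity

theorem isKahlerMetric_hyperbolicMetric : IsKahlerMetric upperHalf hyperbolicMetric :=
  ⟨contDiffOn_hyperbolicMetric, fun _ hx => isHermInner_hyperbolicMetric hx,
    fun _ _ => cform_three_eq_zero _⟩

/-- The Levi-Civita connection of the hyperbolic metric. -/
def hyperbolicConnection (x : Fin 1 → ℂ) : (Fin 1 → ℂ) →L[ℝ] (Fin 1 → ℂ) →L[ℝ] (Fin 1 → ℂ) :=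
  (x 0).im⁻¹ • (ContinuousLinearMap.mul ℝ (Fin 1 → ℂ)).comp (cpx (Fin 1))

theorem hyperbolicConnection_apply (x u v : Fin 1 → ℂ) :
    hyperbolicConnection x u v = fun i => ((x 0).im⁻¹ : ℝ) * (I * u i * v i) := by
  ext i
  simp [hyperbolicConnection, cpx, mul_assoc]

theorem hasFDerivAt_hyperbolicConnection {x : Fin 1 → ℂ} (hx : x ∈ upperHalf) :
    HasFDerivAt hyperbolicConnection ((-((x 0).im ^ 2)⁻¹ •
      Complex.imCLM.comp (dcoord (0 : Fin 1))).smulRight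
      ((ContinuousLinearMap.mul ℝ (Fin 1 → ℂ)).comp (cpx (Fin 1)))) x :=
  (((hasDerivAt_inv (ne_of_gt hx)).comp_hasFDerivAt x (hasFDerivAt_im x)).smul_const
    ((ContinuousLinearMap.mul ℝ (Fin 1 → ℂ)).comp (cpx (Fin 1))) :)

/-- For a metric conformal to |dτ|² with factor proportional to (Im τ)⁻² the connection is Γ_u v =
iuv / Im τ. Relative to the metric of curvature -1 the factor ½ doubles the curvature. -/
theorem hasConstCurvature_hyperbolicMetric : HasConstCurvature upperHalf hyperbolicMetric (-2) := by
  refine ⟨hyperbolicConnection, ⟨?_, fun x _ u v => ?_, fun x hx u v w => ?_⟩, fun x hx u v w => ?_⟩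
  · have h : ContDiffOn ℝ (⊤ : ℕ∞) (fun x : Fin 1 → ℂ => (x 0).im⁻¹) upperHalf :=
      contDiff_im.contDiffOn.inv fun x hx => ne_of_gt hx
    refine contDiffOn_clm_apply.2 fun u => contDiffOn_clm_apply.2 fun v => ?_
    simp only [hyperbolicConnection_apply]
    exact contDiffOn_pi.2 fun i => (Complex.ofRealCLM.contDiff.comp_contDiffOn h).mul contDiffOn_const
  · simp only [hyperbolicConnection_apply]
    ext i
    ring
  · have hx' : (x 0).im ≠ 0 := ne_of_gt hx
    have hd : DifferentiableAt ℝ hyperbolicMetric x :=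
      (contDiffOn_hyperbolicMetric.contDiffAt (isOpen_upperHalf.mem_nhds hx)).differentiableAt (by simp)
    rw [← fderiv_bilin_apply hd]
    have h0 : HasFDerivAt (fun y : Fin 1 → ℂ => 2 * (y 0).im ^ 2) _ x :=
      ((hasFDerivAt_im x).pow 2).const_mul 2
    have h1 := ((hasDerivAt_inv (x := 2 * (x 0).im ^ 2) (by positivity)).comp_hasFDerivAt x h0).mul_const
      (v 0 * starRingEnd ℂ (w 0)).re
    have e : (fun y => hyperbolicMetric y v w) = fun y => ((fun t : ℝ => t⁻¹) ∘
        fun y : Fin 1 → ℂ => 2 * (y 0).im ^ 2) y * (v 0 * starRingEnd ℂ (w 0)).re := by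
      funext y
      rw [hyperbolicMetric_apply, one_div]
      rfl
    rw [e, h1.fderiv]
    simp only [hyperbolicMetric_apply, hyperbolicConnection_apply]
    simp only [_root_.smul_apply, ContinuousLinearMap.comp_apply, dcoord,
      ContinuousLinearMap.proj_apply, Complex.imCLM_apply, smul_eq_mul, mul_re, mul_im, conj_re,
      conj_im, I_re, I_im, ofReal_re, ofReal_im]
    field_simp
    ring
  · have hx' : (x 0).im ≠ 0 := ne_of_gt hx
    rw [curvature, (hasFDerivAt_hyperbolicConnection hx).fderiv]
    ext i
    rw [Subsingleton.elim i 0]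
    simp only [hyperbolicMetric_apply, hyperbolicConnection_apply, ContinuousLinearMap.smulRight_apply,
      Pi.add_apply, Pi.sub_apply, Pi.smul_apply, _root_.smul_apply, ContinuousLinearMap.comp_apply,
      dcoord, ContinuousLinearMap.proj_apply, Complex.imCLM_apply, ContinuousLinearMap.mul_apply',
      Pi.mul_apply, cpx, ContinuousLinearMap.id_apply, smul_eq_mul, real_smul]
    apply Complex.ext <;>
    · simp only [add_re, add_im, sub_re, sub_im, mul_re, mul_im, conj_re,
        conj_im, I_re, I_im, ofReal_re, ofReal_im]
      field_simp
      ring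

end Hyperbolic

end

noncomputable section

open Matrix Complex

/-! ### Polarized families of flat fibre metrics -/

section PolarizedFibres

variable {n m : ℕ} {U W : Set (Fin n → ℂ)} {Λ : (Fin n → ℂ) → AddSubgroup (Fin m → ℂ)} {ε : ℝ}
  {η : (Fin n → ℂ) → CForm (Fin m → ℂ) 2} {ω : (Fin n ⊕ Fin m → ℂ) → CForm (Fin n ⊕ Fin m → ℂ) 2}
  {gF : (Fin n → ℂ) → (Fin m → ℂ) → Bilin (Fin m → ℂ)} {gS : (Fin n → ℂ) → Bilin (Fin n → ℂ)}
  {G : (Fin n ⊕ Fin m → ℂ) → Bilin (Fin n ⊕ Fin m → ℂ)}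
  {T : (Fin n → ℂ) → Matrix (Fin m) (Fin m ⊕ Fin m) ℂ}
  {Q : Matrix (Fin m ⊕ Fin m) (Fin m ⊕ Fin m) ℝ}

/-- The flat fibre metrics `gF` of volume `ε` are proportional to the metrics of the invariant forms
`η`, which are locally constant in frames of `Λ`. -/
structure IsPolarizedFibre (U : Set (Fin n → ℂ)) (Λ : (Fin n → ℂ) → AddSubgroup (Fin m → ℂ)) (ε : ℝ)
    (η : (Fin n → ℂ) → CForm (Fin m → ℂ) 2)
    (gF : (Fin n → ℂ) → (Fin m → ℂ) → Bilin (Fin m → ℂ)) : Prop where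
  lattice : IsLatticeBundle U Λ
  herm : ∀ z ∈ U, IsHermInner (metricOfForm (η z))
  const : ∀ z ∈ U, ∀ w, gF z w = gF z 0
  scale : ∀ z ∈ U, ∃ c : ℝ, 0 < c ∧ gF z 0 = c • metricOfForm (η z)
  vol : ∀ z ∈ U, ∀ τ, IsLatticeBasis (Λ z) τ →
    Real.sqrt (Matrix.of fun a b => gF z 0 (I • τ a) (τ b)).det = ε
  loc : ∀ W T, IsFrame Λ W T → W ⊆ U → IsConnected W →
    ∃ Q : Matrix (Fin m ⊕ Fin m) (Fin m ⊕ Fin m) ℝ, ∀ z ∈ W, ∀ a b,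
      metricOfForm (η z) (I • fun j => T z j a) (fun j => T z j b) = Q a b

theorem IsFrame.mono {W' : Set (Fin n → ℂ)} (hT : IsFrame Λ W T) (hW' : IsOpen W') (h : W' ⊆ W) :
    IsFrame Λ W' T :=
  ⟨hW', fun j a => (hT.2.1 j a).mono h, fun z hz => hT.2.2 z (h hz)⟩

theorem IsLatticeBundle.exists_connected_frame (hL : IsLatticeBundle U Λ) {z : Fin n → ℂ}
    (hz : z ∈ U) : ∃ W T, z ∈ W ∧ W ⊆ U ∧ IsFrame Λ W T ∧ IsConnected W := by
  obtain ⟨W, T, hzW, hW, hT⟩ := hL.2 z hz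
  obtain ⟨r, hr, hb⟩ := Metric.isOpen_iff.1 hT.1 z hzW
  exact ⟨Metric.ball z r, T, Metric.mem_ball_self hr, hb.trans hW, hT.mono Metric.isOpen_ball hb,
    (convex_ball z r).isConnected ⟨z, Metric.mem_ball_self hr⟩⟩

theorem IsHermInner.kahler_det_pos {g : Bilin (Fin m → ℂ)} (hg : IsHermInner g)
    {L : AddSubgroup (Fin m → ℂ)} {τ : Fin m ⊕ Fin m → Fin m → ℂ} (hτ : IsLatticeBasis L τ) :
    0 < (Matrix.of fun a b => g (I • τ a) (τ b)).det := by
  have h := hg.gram_det_pos hτ.basis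
  rw [← kahler_gram_eq] at h
  simpa only [hτ.basis_apply] using h

/-- The factor that normalizes the volume. -/
def volumeScale (m : ℕ) (ε q : ℝ) : ℝ := (ε / Real.sqrt q) ^ (1 / (m : ℝ))

theorem sqrt_det_smul {c : ℝ} (hc : 0 < c) :
    Real.sqrt (c • Q).det = c ^ m * Real.sqrt Q.det := by
  rw [det_smul, Real.sqrt_mul (by positivity), Fintype.card_sum, Fintype.card_fin, ← two_mul, mul_comm 2,
    pow_mul, Real.sqrt_sq (by positivity)]

/-- Q has size 2m, so scaling by c multiplies √(det Q) by c^m; this is the origin of the exponent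
1/m. -/
theorem volumeScale_eq_iff (hm : 0 < m) (hε : 0 < ε) {c : ℝ} (hc : 0 < c) (hQ : 0 < Q.det) :
    Real.sqrt (c • Q).det = ε ↔ c = volumeScale m ε Q.det := by
  have hq := Real.sqrt_pos.2 hQ
  rw [sqrt_det_smul hc, ← eq_div_iff hq.ne', volumeScale, one_div]
  constructor
  · intro h
    rw [← h, Real.pow_rpow_inv_natCast hc.le hm.ne']
  · intro h
    rw [h, Real.rpow_inv_natCast_pow (by positivity) hm.ne']

theorem volumeScale_pos (hε : 0 < ε) {q : ℝ} (hq : 0 < q) : 0 < volumeScale m ε q :=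
  Real.rpow_pos_of_pos (div_pos hε (Real.sqrt_pos.2 hq)) _

namespace IsPolarizedFibre

theorem frame_data (h : IsPolarizedFibre U Λ ε η gF) (hm : 0 < m) (hε : 0 < ε) {z : Fin n → ℂ}
    (hz : z ∈ U) {T : Matrix (Fin m) (Fin m ⊕ Fin m) ℂ}
    (hT : IsLatticeBasis (Λ z) (fun a j => T j a))
    (hQ : ∀ a b, metricOfForm (η z) (I • fun j => T j a) (fun j => T j b) = Q a b) :
    0 < Q.det ∧ gF z 0 = volumeScale m ε Q.det • metricOfForm (η z) ∧
      hermMat (metricOfForm (η z)) = matH Q T ∧ hermMat (gF z 0) = matHeps ε Q T := by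
  have hQ' : (Matrix.of fun a b => metricOfForm (η z) (I • fun j => T j a) (fun j => T j b)) = Q := by
    ext a b; exact hQ a b
  have hdet : 0 < Q.det := by
    have := (h.herm z hz).kahler_det_pos hT
    rwa [hQ'] at this
  obtain ⟨c, hc, hgc⟩ := h.scale z hz
  have hv := h.vol z hz _ hT
  have hcQ : (Matrix.of fun a b => gF z 0 (I • fun j => T j a) (fun j => T j b)) = c • Q := by
    ext a b
    simp [hgc, hQ]
  rw [hcQ, volumeScale_eq_iff hm hε hc hdet] at hv
  have hH := (matH_eq hT.1 (h.herm z hz) hQ).symm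
  refine ⟨hdet, hv ▸ hgc, hH, ?_⟩
  rw [hgc, hermMat_smul, hH, hv]
  rfl

theorem fib_herm (h : IsPolarizedFibre U Λ ε η gF) {z : Fin n → ℂ} (hz : z ∈ U) :
    IsHermInner (gF z 0) := by
  obtain ⟨c, hc, hgc⟩ := h.scale z hz
  rw [hgc]
  exact (h.herm z hz).smul hc

theorem flatSubmersion (h : IsPolarizedFibre U Λ ε η gF) (hm : 0 < m) (hε : 0 < ε)
    (hS : ∀ z ∈ U, IsHermInner (gS z)) (hG : IsSubmersionMetric U Λ gF gS G) :
    FlatSubmersion U Λ gF gS G where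
  isOpen := h.lattice.1
  fib_const := h.const
  fib_herm := fun z hz => h.fib_herm hz
  base_herm := hS
  sub := hG
  frame := fun z hz => by
    obtain ⟨W, T, hzW, hW, hT, hc⟩ := h.lattice.exists_connected_frame hz
    obtain ⟨Q, hQ⟩ := h.loc W T hT hW hc
    refine ⟨W, T, volumeScale m ε Q.det • Q, hzW, hW, hT, fun y hy a b => ?_⟩
    rw [(h.frame_data hm hε (hW hy) (hT.2.2 y hy) (hQ y hy)).2.1, _root_.smul_apply,
      _root_.smul_apply, hQ y hy, Matrix.smul_apply]

end IsPolarizedFibre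

theorem exists_polarizedFibre (hm : 0 < m) (hε : 0 < ε) (hL : IsLatticeBundle U Λ)
    (hη : ∀ z ∈ U, IsHermInner (metricOfForm (η z)) ∧ kahlerForm (metricOfForm (η z)) = η z) :
    ∃ gF, IsFlatFibreMetric U Λ ε gF ∧
      ∀ z ∈ U, ∃ c : ℝ, ∀ w, kahlerForm (gF z w) = (c : ℂ) • η z := by
  have hex : ∀ z, ∃ g : Bilin (Fin m → ℂ), z ∈ U → IsFlatKahlerTorus (Λ z) ε (fun _ => g) ∧
      ∃ c : ℝ, kahlerForm g = (c : ℂ) • η z := by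
    intro z
    by_cases hz : z ∈ U
    swap
    -- Outside U the value is arbitrary.
    · exact ⟨0, fun h => absurd h hz⟩
    obtain ⟨W, T, hzW, hW, hT⟩ := hL.2 z hz
    have hτ := hT.2.2 z hzW
    have hdet := (hη z hz).1.kahler_det_pos hτ
    set Q := Matrix.of fun a b => metricOfForm (η z) (I • fun j => T z j a) (fun j => T z j b)
    have hc := volumeScale_pos (m := m) hε hdet
    refine ⟨volumeScale m ε Q.det • metricOfForm (η z), fun _ =>
      ⟨(isFlatKahlerTorus_iff hτ).2 ⟨fun _ => rfl, (hη z hz).1.smul hc, ?_⟩,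
        volumeScale m ε Q.det, by rw [kahlerForm_smul, (hη z hz).2]⟩⟩
    exact (volumeScale_eq_iff hm hε hc hdet).2 rfl
  choose g hg using hex
  exact ⟨fun z _ => g z, fun z hz => (hg z hz).1, fun z hz =>
    (hg z hz).2.imp fun c hc _ => hc⟩

theorem Cohomologous.symm {L : AddSubgroup (Fin m → ℂ)} {α β : (Fin m → ℂ) → CForm (Fin m → ℂ) 2}
    (h : Cohomologous L α β) : Cohomologous L β α := by
  obtain ⟨γ, hγ, hp, he⟩ := h
  refine ⟨fun w => (-1 : ℝ) • γ w, hγ.const_smul _, fun l hl w => by simp only [hp l hl w], fun w => ?_⟩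
  rw [show (fun w => (-1 : ℝ) • γ w) = (-1 : ℝ) • γ from rfl, extDeriv_smul, ← he w]
  ext v
  simp

theorem Cohomologous.trans {L : AddSubgroup (Fin m → ℂ)} {α β δ : (Fin m → ℂ) → CForm (Fin m → ℂ) 2}
    (h : Cohomologous L α β) (h' : Cohomologous L β δ) : Cohomologous L α δ := by
  obtain ⟨γ, hγ, hp, he⟩ := h
  obtain ⟨γ', hγ', hp', he'⟩ := h'
  refine ⟨fun w => γ w + γ' w, hγ.add hγ', fun l hl w => by simp only [hp l hl w, hp' l hl w],
    fun w => ?_⟩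
  rw [extDeriv_fun_add ((hγ.differentiable (by simp)) w) ((hγ'.differentiable (by simp)) w), ← he, ← he']
  abel

theorem Cohomologous.smul {L : AddSubgroup (Fin m → ℂ)} {α β : (Fin m → ℂ) → CForm (Fin m → ℂ) 2}
    (h : Cohomologous L α β) (c : ℝ) :
    Cohomologous L (fun w => (c : ℂ) • α w) (fun w => (c : ℂ) • β w) := by
  obtain ⟨γ, hγ, hp, he⟩ := h
  refine ⟨fun w => c • γ w, hγ.const_smul _, fun l hl w => by simp only [hp l hl w], fun w => ?_⟩
  rw [show (fun w => c • γ w) = c • γ from rfl, extDeriv_smul, ← he w]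
  ext v
  simp [mul_sub]

/-- The data that a constant polarization provides. -/
structure IsClassRepresentative (U : Set (Fin n → ℂ)) (Λ : (Fin n → ℂ) → AddSubgroup (Fin m → ℂ))
    (ω : (Fin n ⊕ Fin m → ℂ) → CForm (Fin n ⊕ Fin m → ℂ) 2)
    (η : (Fin n → ℂ) → CForm (Fin m → ℂ) 2) : Prop where
  lattice : IsLatticeBundle U Λ
  cohomologous : ∀ z ∈ U, Cohomologous (Λ z) (restrictFib ω z) (fun _ => η z)
  herm : ∀ z ∈ U, IsHermInner (metricOfForm (η z))
  kahler : ∀ z ∈ U, kahlerForm (metricOfForm (η z)) = η z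
  loc : ∀ W T, IsFrame Λ W T → W ⊆ U → IsConnected W →
    ∃ Q : Matrix (Fin m ⊕ Fin m) (Fin m ⊕ Fin m) ℝ, ∀ z ∈ W, ∀ a b,
      η z ![fun j => T z j a, fun j => T z j b] = (Q a b : ℂ)

theorem IsConstPolarization.exists_representative (hm : 0 < m) (hL : IsLatticeBundle U Λ)
    (h : IsConstPolarization U Λ ω) : ∃ η, IsClassRepresentative U Λ ω η := by
  obtain ⟨η, h1, h2⟩ := h.exists_class hm hL
  exact ⟨η, hL, fun z hz => (h1 z hz).1, fun z hz => (h1 z hz).2.1, fun z hz => (h1 z hz).2.2, h2⟩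

theorem IsClassRepresentative.exists_fibreMetric (h : IsClassRepresentative U Λ ω η) (hm : 0 < m)
    (hε : 0 < ε) : ∃ gF, IsFlatFibreMetric U Λ ε gF ∧ HasPolarizedClass U Λ ω gF := by
  obtain ⟨gF, hgF, hc⟩ := exists_polarizedFibre hm hε h.lattice fun z hz => ⟨h.herm z hz, h.kahler z hz⟩
  refine ⟨gF, hgF, fun z hz => ?_⟩
  obtain ⟨c, hc⟩ := hc z hz
  refine ⟨c, ?_⟩
  rw [funext hc]
  exact ((h.cohomologous z hz).smul c).symm

/-- A flat fibre metric is invariant, so its Kähler form and the multiple of η are invariant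
representatives of one class and therefore equal. Positivity of both metrics forces the factor to be
positive. -/
theorem IsClassRepresentative.isPolarizedFibre (h : IsClassRepresentative U Λ ω η) (hm : 0 < m)
    (hF : IsFlatFibreMetric U Λ ε gF) (hP : HasPolarizedClass U Λ ω gF) :
    IsPolarizedFibre U Λ ε η gF := by
  have hflat : ∀ z ∈ U, ∀ τ, IsLatticeBasis (Λ z) τ → (∀ w, gF z w = gF z 0) ∧ IsHermInner (gF z 0) ∧
      Real.sqrt (Matrix.of fun a b => gF z 0 (I • τ a) (τ b)).det = ε := fun z hz τ hτ =>
    (isFlatKahlerTorus_iff hτ).1 (hF z hz)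
  have hbasis : ∀ z ∈ U, ∃ τ, IsLatticeBasis (Λ z) τ := fun z hz => by
    obtain ⟨W, T, hzW, -, hT⟩ := h.lattice.2 z hz
    exact ⟨_, hT.2.2 z hzW⟩
  refine ⟨h.lattice, h.herm, fun z hz => ?_, fun z hz => ?_, fun z hz τ hτ => (hflat z hz τ hτ).2.2,
    fun W T hT hW hc => ?_⟩
  · obtain ⟨τ, hτ⟩ := hbasis z hz
    exact (hflat z hz τ hτ).1
  · obtain ⟨τ, hτ⟩ := hbasis z hz
    obtain ⟨hconst, hherm, -⟩ := hflat z hz τ hτ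
    obtain ⟨c, hc⟩ := hP z hz
    have h1 : kahlerForm (gF z 0) = (c : ℂ) • η z := by
      refine Cohomologous.const_eq hm hτ (((?_ : Cohomologous (Λ z) (fun _ => kahlerForm (gF z 0))
        (fun w => (c : ℂ) • restrictFib ω z w))).trans ((h.cohomologous z hz).smul c))
      simpa only [hconst] using hc
    have h2 : ∀ u v, gF z 0 u v = c * metricOfForm (η z) u v := fun u v => by
      have h3 := hherm.apply_eq_kahlerForm u v
      have h4 := (h.herm z hz).apply_eq_kahlerForm u v
      rw [h1, ContinuousAlternatingMap.smul_apply] at h3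
      rw [h.kahler z hz] at h4
      rw [← h4, smul_eq_mul] at h3
      exact_mod_cast h3
    refine ⟨c, ?_, by ext u v; simpa using h2 u v⟩
    have hne : (Pi.single ⟨0, hm⟩ 1 : Fin m → ℂ) ≠ 0 := by simp
    have h5 := hherm.2.2 _ hne
    rw [h2] at h5
    exact pos_of_mul_pos_left h5 ((h.herm z hz).2.2 _ hne).le
  · obtain ⟨Q, hQ⟩ := h.loc W T hT hW hc
    refine ⟨Q, fun z hz a b => ?_⟩
    have h1 := kahlerForm_apply (h.herm z (hW hz)) (fun j => T z j a) (fun j => T z j b)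
    rw [h.kahler z (hW hz), hQ z hz] at h1
    exact_mod_cast h1.symm

theorem IsClassRepresentative.isPolarizationMatrix (h : IsClassRepresentative U Λ ω η)
    (hT : IsFrame Λ W T) (hW : W ⊆ U) (hne : W.Nonempty)
    (hQ : ∀ z ∈ W, ∀ a b, metricOfForm (η z) (I • fun j => T z j a) (fun j => T z j b) = Q a b) :
    IsPolarizationMatrix Λ ω W T Q ∧
      ∀ z ∈ W, Cohomologous (Λ z) (restrictFib ω z) (fun _ => hermForm (matH Q (T z))) := by
  have hη : ∀ z ∈ W, η z = hermForm (matH Q (T z)) := fun z hz => by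
    rw [← h.kahler z (hW hz), (h.herm z (hW hz)).kahlerForm_eq,
      matH_eq (hT.2.2 z hz).1 (h.herm z (hW hz)) (hQ z hz)]
  obtain ⟨z₀, hz₀⟩ := hne
  refine ⟨⟨kahler_matrix_skew (h.herm z₀ (hW hz₀)) (hQ z₀ hz₀), fun z hz =>
    ⟨η z, fun a b => ?_, h.cohomologous z (hW hz)⟩⟩, fun z hz => ?_⟩
  · rw [← h.kahler z (hW hz), kahlerForm_apply (h.herm z (hW hz)), hQ z hz]
  · rw [← hη z hz]
    exact h.cohomologous z (hW hz)

/-- At each point use θ of any frame there; by `IsFrame.thetaForm_eq_of_isHorizontal` the result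
does not depend on the frame. Smoothness is not needed for existence, since the defining property
determines the metric pointwise. -/
theorem exists_submersionMetric (hL : IsLatticeBundle U Λ)
    (gF : (Fin n → ℂ) → (Fin m → ℂ) → Bilin (Fin m → ℂ)) (gS : (Fin n → ℂ) → Bilin (Fin n → ℂ)) :
    ∃ G, IsSubmersionMetric U Λ gF gS G := by
  have hex : ∀ x : Fin n ⊕ Fin m → ℂ, ∃ g : Bilin (Fin n ⊕ Fin m → ℂ), x ∈ totalSet m U →
      ∀ u v : Fin n ⊕ Fin m → ℂ, ∀ p q : Fin m → ℂ,
        IsHorizontal U Λ x (u - vert n m p) → IsHorizontal U Λ x (v - vert n m q) →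
          g u v = gS (basePart x) (basePart u) (basePart v) + gF (basePart x) (fibPart x) p q := by
    intro x
    by_cases hx : x ∈ totalSet m U
    swap
    · exact ⟨0, fun h => absurd h hx⟩
    obtain ⟨W, T, hxW, hW, hT⟩ := hL.2 _ hx
    let b : (Fin n ⊕ Fin m → ℂ) →L[ℝ] (Fin n → ℂ) := (baseCLM n m).restrictScalars ℝ
    refine ⟨(gS (basePart x)).bilinearComp b b +
      (gF (basePart x) (fibPart x)).bilinearComp (thetaVec T x) (thetaVec T x),
      fun _ u v p q hp hq => ?_⟩
    rw [hT.thetaForm_eq_of_isHorizontal hxW hp, hT.thetaForm_eq_of_isHorizontal hxW hq]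
    rfl
  choose G hG using hex
  exact ⟨G, fun x hx => hG x hx⟩

end PolarizedFibres

end

noncomputable section

open Matrix Complex

/-! ### The period map and the Ricci form of the base -/

section PeriodMap

variable {n m : ℕ} {U W : Set (Fin n → ℂ)} {Λ : (Fin n → ℂ) → AddSubgroup (Fin m → ℂ)}
  {T : (Fin n → ℂ) → Matrix (Fin m) (Fin m ⊕ Fin m) ℂ}
  {Q S : Matrix (Fin m ⊕ Fin m) (Fin m ⊕ Fin m) ℝ}

/-- Write TS = (K₁, K₂) and put R = K₁, Z = K₁⁻¹K₂. The relations hold fibrewise by `exists_period`,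
and Z is holomorphic by Cramer's rule. -/
theorem exists_periodMap (hT : IsFrame Λ W T) {g : (Fin n → ℂ) → Bilin (Fin m → ℂ)}
    (hg : ∀ z ∈ W, IsHermInner (g z))
    (hQ : ∀ z ∈ W, ∀ a b, g z (I • fun j => T z j a) (fun j => T z j b) = Q a b)
    (hS : Sᵀ * Q * S = fromBlocks 0 1 (-1) 0) :
    ∃ R Z, IsPeriodMap W T S R Z ∧ ∀ z ∈ W, (hermMat (g z))⁻¹ =
      (2 : ℂ) • (conjMat (R z) * realMat (imMat (symMat (Z z))) * (R z)ᵀ) := by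
  set K₁ : (Fin n → ℂ) → Matrix (Fin m) (Fin m) ℂ := fun z => (T z * realMat S).toCols₁
  set K₂ : (Fin n → ℂ) → Matrix (Fin m) (Fin m) ℂ := fun z => (T z * realMat S).toCols₂
  have hK : ∀ z, T z * realMat S = fromCols (K₁ z) (K₂ z) := fun z => (fromCols_toCols _).symm
  have hper := fun z hz => exists_period (hT.2.2 z hz).1 (hg z hz) (hQ z hz) hS (hK z)
  have hd : ∀ j a, DifferentiableOn ℂ (fun z => (T z * realMat S) j a) W := fun j a => by
    simp only [Matrix.mul_apply]
    exact DifferentiableOn.fun_sum fun b _ => (hT.2.1 j b).mul_const _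
  have hsym : ∀ z ∈ W, symMat (symCoord ((K₁ z)⁻¹ * K₂ z)) = (K₁ z)⁻¹ * K₂ z := fun z hz =>
    symMat_symCoord (hper z hz).2.1
  refine ⟨K₁, fun z => symCoord ((K₁ z)⁻¹ * K₂ z), ⟨fun j k => hd j _, ?_, fun z hz => ⟨?_, ?_, ?_⟩⟩,
    fun z hz => ?_⟩
  · refine differentiableOn_pi.2 fun s => ?_
    have hinv : ∀ i j, DifferentiableOn ℂ (fun z => (K₁ z)⁻¹ i j) W := fun i j =>
      (ContDiffOn.matrix_inv (n := (⊤ : ℕ∞)) (fun i j =>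
        DifferentiableOn.contDiffOn_complex hT.1 (hd i (Sum.inl j))) (fun z hz => (hper z hz).1) i
          j).differentiableOn (by simp)
    simp only [symCoord, Matrix.mul_apply]
    exact DifferentiableOn.fun_sum fun b _ => (hinv _ b).fun_mul (hd b (Sum.inr _))
  · exact (isUnit_iff_isUnit_det _).2 (isUnit_iff_ne_zero.2 (hper z hz).1)
  · change (imMat _).PosDef
    rw [hsym z hz]
    exact (hper z hz).2.2.1
  · rw [hsym z hz, mul_fromCols, Matrix.mul_one, ← Matrix.mul_assoc,
      mul_nonsing_inv _ (isUnit_iff_ne_zero.2 (hper z hz).1), Matrix.one_mul, hK]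
  · rw [hsym z hz]
    exact (hper z hz).2.2.2

/-- In log det of the base metric the factor |h|² with h holomorphic is pluriharmonic, which leaves
log det Im Z. -/
theorem ricciForm_eq_siegel (hW : IsOpen W) {Z : (Fin n → ℂ) → Sym2 (Fin m) → ℂ}
    (hZ : DifferentiableOn ℂ Z W) (hmaps : Set.MapsTo Z W (siegelSpace m))
    {gS : (Fin n → ℂ) → Bilin (Fin n → ℂ)} {h : (Fin n → ℂ) → ℂ} (hh : DifferentiableOn ℂ h W)
    (h0 : ∀ y ∈ W, h y ≠ 0) {K : ℝ} (hK : 0 < K)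
    (hdet : ∀ y ∈ W, (hermMat (gS y)).det =
      ((K * (‖h y‖ ^ 2 * (imMat (symMat (Z y))).det) : ℝ) : ℂ)) {z : Fin n → ℂ} (hz : z ∈ W) :
    ricciForm gS z = (-I) • ddbar (fun y => (Real.log (imMat (symMat (Z y))).det : ℂ)) z ∧
      ricciForm gS z = siegelWith (Z z) (fun s => fderiv ℝ (fun y => Z y s) z) ∧
      ricciForm gS z = (siegelForm (Z z)).compContinuousLinearMap (fderiv ℝ Z z) := by
  have h1 : ricciForm gS z =
      (-I) • ddbar (fun y => (Real.log (imMat (symMat (Z y))).det : ℂ)) z := by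
    rw [ricciForm]
    congr 1
    refine ddbar_log_normSq_mul hW hh h0 hK (fun y hy => (hmaps hy).det_pos)
      (contDiffOn_infty.1 (contDiffOn_log_det_im hW hZ hmaps) 2) (fun y hy => ?_) hz
    -- `ricciForm` uses the transpose of `hermMat`, with the same determinant.
    rw [← Matrix.det_transpose, ← ofReal_re (K * (‖h y‖ ^ 2 * (imMat (symMat (Z y))).det)), ← hdet y hy]
    rfl
  have h2 := h1.trans (ddbar_log_det_im hW hZ hmaps hz)
  exact ⟨h1, h2, h2.trans (siegelForm_comp_fderiv hW hZ hz).symm⟩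

theorem det_inv_smul_period {H R : Matrix (Fin m) (Fin m) ℂ} {Y : Matrix (Fin m) (Fin m) ℝ}
    (hH : H⁻¹ = (2 : ℂ) • (conjMat R * realMat Y * Rᵀ)) (c : ℝ) :
    ((c : ℂ) • H)⁻¹.det = (((2 / c) ^ m * (‖R.det‖ ^ 2 * Y.det) : ℝ) : ℂ) := by
  have hY : (realMat Y).det = (Y.det : ℂ) := (ofRealHom.map_det Y).symm
  have h1 := congrArg Matrix.det hH
  rw [det_nonsing_inv, Ring.inverse_eq_inv', det_smul, det_mul, det_mul, det_transpose, conjMat_det, hY,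
    Fintype.card_fin] at h1
  have h2 : ((‖R.det‖ ^ 2 : ℝ) : ℂ) = R.det * starRingEnd ℂ R.det := by
    rw [mul_conj, normSq_eq_norm_sq]
  rw [det_nonsing_inv, Ring.inverse_eq_inv', det_smul, mul_inv, h1, Fintype.card_fin, ofReal_mul,
    ofReal_mul, h2, ofReal_pow, ofReal_div, div_pow, ofReal_ofNat]
  ring

end PeriodMap

/-! ### The base metric in the hyperkähler setting -/

section HyperkahlerBase

variable {m : ℕ} {U W : Set (Fin m → ℂ)} {Λ : (Fin m → ℂ) → AddSubgroup (Fin m → ℂ)} {ε : ℝ}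
  {Υ : (Fin m ⊕ Fin m → ℂ) → CForm (Fin m ⊕ Fin m → ℂ) 2} {g : (Fin m → ℂ) → ℂ}
  {gF : (Fin m → ℂ) → (Fin m → ℂ) → Bilin (Fin m → ℂ)} {gS : (Fin m → ℂ) → Bilin (Fin m → ℂ)}

theorem IsSymplecticPairing.isBaseMetricHK_iff (hΥ : IsSymplecticPairing U Λ Υ g) (hm : 0 < m)
    (hF : ∀ z ∈ U, IsHermInner (gF z 0)) : IsBaseMetricHK U Υ gF gS ↔
      ∀ z ∈ U, gS z = bilinOfMat (dualMat (g z) (hermMat (gF z 0))) := by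
  have hset : ∀ z ∈ U, ∀ u : Fin m ⊕ Fin m → ℂ, {r : ℝ | ∃ v : Fin m → ℂ,
      (hermOf (gF z 0) v v).re ≤ 1 ∧ r = ‖Υ (Sum.elim z 0) ![u, vert m m v]‖ ^ 2} =
      {r | ∃ v, (hermOf (gF z 0) v v).re ≤ 1 ∧ r = ‖g z * basePart u ⬝ᵥ v‖ ^ 2} := by
    intro z hz u
    have h1 : ∀ v : Fin m → ℂ, Υ (Sum.elim z 0) ![u, vert m m v] = g z * basePart u ⬝ᵥ v := fun v => by
      rw [hΥ.apply (x := Sum.elim z 0) hz, show basePart (vert m m v) = 0 from rfl, zero_dotProduct,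
        sub_zero]
      rfl
    simp only [h1]
  refine forall₂_congr fun z hz => ?_
  have hg := hΥ.ne_zero hm hz
  constructor
  · rintro ⟨hS, h⟩
    refine ((hF z hz).isLUB_iff_eq_dualMat hS hg).1 fun u => ?_
    have h1 := h (Sum.elim u 0)
    rwa [hset z hz] at h1
  · intro h
    have hS : IsHermInner (gS z) := by
      rw [h]
      exact isHermInner_bilinOfMat (dualMat_posDef hg (hF z hz).hermMat_posDef)
    refine ⟨hS, fun u => ?_⟩
    rw [hset z hz]
    exact ((hF z hz).isLUB_iff_eq_dualMat hS hg).2 h _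

theorem det_dualMat (c : ℂ) (h : Matrix (Fin m) (Fin m) ℂ) :
    (dualMat c h).det = ((‖c ^ m‖ ^ 2 : ℝ) : ℂ) * h⁻¹.det := by
  rw [dualMat, det_smul, det_transpose, Fintype.card_fin, norm_pow]
  push_cast
  ring

end HyperkahlerBase

end

noncomputable section

open Matrix Complex

/-! ### Formulas in a frame, common to both settings -/

section FrameFormulas

variable {n m : ℕ} {U W : Set (Fin n → ℂ)} {Λ : (Fin n → ℂ) → AddSubgroup (Fin m → ℂ)} {ε : ℝ}
  {η : (Fin n → ℂ) → CForm (Fin m → ℂ) 2} {ω : (Fin n ⊕ Fin m → ℂ) → CForm (Fin n ⊕ Fin m → ℂ) 2}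
  {gF : (Fin n → ℂ) → (Fin m → ℂ) → Bilin (Fin m → ℂ)} {gS : (Fin n → ℂ) → Bilin (Fin n → ℂ)}
  {T : (Fin n → ℂ) → Matrix (Fin m) (Fin m ⊕ Fin m) ℂ} {h : (Fin n → ℂ) → ℂ}

/-- For the Ricci form the base metric matters only through its determinant |h|² / det H(ε), where h
= g^m in the hyperkähler and h = g in the Calabi-Yau setting. The period map rewrites this as a
constant times |h det R|² det Im Z. -/
theorem IsClassRepresentative.frame_formulas (hη : IsClassRepresentative U Λ ω η)
    (hP : IsPolarizedFibre U Λ ε η gF) (hm : 0 < m) (hε : 0 < ε) (hh : DifferentiableOn ℂ h U)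
    (h0 : ∀ z ∈ U, h z ≠ 0)
    (hdet : ∀ z ∈ U, (hermMat (gS z)).det = ((‖h z‖ ^ 2 : ℝ) : ℂ) * (hermMat (gF z 0))⁻¹.det)
    (hT : IsFrame Λ W T) (hW : W ⊆ U) (hc : IsConnected W) :
    ∃ Q : Matrix (Fin m ⊕ Fin m) (Fin m ⊕ Fin m) ℝ,
      IsPolarizationMatrix Λ ω W T Q ∧ 0 < Q.det ∧
      (∀ z ∈ W, (∀ w, kahlerForm (gF z w) = hermForm (matHeps ε Q (T z))) ∧
        Cohomologous (Λ z) (restrictFib ω z) (fun _ => hermForm (matH Q (T z)))) ∧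
      (∀ z ∈ W, hermMat (gF z 0) = matHeps ε Q (T z)) ∧
      (∃ S : Matrix (Fin m ⊕ Fin m) (Fin m ⊕ Fin m) ℝ, Sᵀ * Q * S = fromBlocks 0 1 (-1) 0) ∧
      ∀ S : Matrix (Fin m ⊕ Fin m) (Fin m ⊕ Fin m) ℝ, Sᵀ * Q * S = fromBlocks 0 1 (-1) 0 →
        ∃ R Z, IsPeriodMap W T S R Z ∧ ∀ z ∈ W,
          (matH Q (T z))⁻¹ =
            (2 : ℂ) • (conjMat (R z) * realMat (imMat (symMat (Z z))) * (R z)ᵀ) ∧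
          ricciForm gS z = (-I) • ddbar (fun y => (Real.log (imMat (symMat (Z y))).det : ℂ)) z ∧
          ricciForm gS z = siegelWith (Z z) (fun s => fderiv ℝ (fun y => Z y s) z) ∧
          ricciForm gS z = (siegelForm (Z z)).compContinuousLinearMap (fderiv ℝ Z z) := by
  obtain ⟨Q, hQ⟩ := hP.loc W T hT hW hc
  obtain ⟨z₀, hz₀⟩ := hc.nonempty
  have hfr := fun z hz => hP.frame_data hm hε (hW hz) (hT.2.2 z hz) (hQ z hz)
  obtain ⟨hpol, hcoh⟩ := hη.isPolarizationMatrix hT hW hc.nonempty hQ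
  refine ⟨Q, hpol, (hfr z₀ hz₀).1, fun z hz => ⟨fun w => ?_, hcoh z hz⟩, fun z hz => (hfr z hz).2.2.2,
    exists_symplectic_basis (hT.2.2 z₀ hz₀).1 (hη.herm z₀ (hW hz₀)) (hQ z₀ hz₀), fun S hS => ?_⟩
  · rw [hP.const z (hW hz), (hP.fib_herm (hW hz)).kahlerForm_eq, (hfr z hz).2.2.2]
  · obtain ⟨R, Z, hRZ, hH⟩ := exists_periodMap hT (fun z hz => hη.herm z (hW hz)) hQ hS
    have hH' : ∀ z ∈ W, (matH Q (T z))⁻¹ =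
        (2 : ℂ) • (conjMat (R z) * realMat (imMat (symMat (Z z))) * (R z)ᵀ) := fun z hz => by
      rw [← (hfr z hz).2.2.1]; exact hH z hz
    refine ⟨R, Z, hRZ, fun z hz => ⟨hH' z hz, ?_⟩⟩
    have hcpos := volumeScale_pos (m := m) hε (hfr z₀ hz₀).1
    have hRd : DifferentiableOn ℂ (fun z => (R z).det) W :=
      (ContDiffOn.matrix_det (n := (⊤ : ℕ∞)) fun i j =>
        DifferentiableOn.contDiffOn_complex hT.1 (hRZ.1 i j)).differentiableOn (by simp)
    refine ricciForm_eq_siegel hT.1 hRZ.2.1 (fun y hy => (hRZ.2.2 y hy).2.1)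
      (h := fun z => h z * (R z).det) ((hh.mono hW).mul hRd)
      (fun y hy => mul_ne_zero (h0 y (hW hy))
        ((isUnit_iff_isUnit_det _).1 (hRZ.2.2 y hy).1).ne_zero)
      -- The 2 comes from H⁻¹ = 2 R̄ (Im Z) Rᵗ, the denominator from H(ε)⁻¹.
      (K := (2 / volumeScale m ε Q.det) ^ m) (by positivity) (fun y hy => ?_) hz
    rw [hdet y (hW hy), (hfr y hy).2.2.2, matHeps, det_inv_smul_period (hH' y hy), norm_mul, mul_pow]
    simp only [volumeScale]
    push_cast
    ring

end FrameFormulas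

/-! ### The lemma in the hyperkähler setting -/

section HyperkahlerSetting

variable {m : ℕ} {U : Set (Fin m → ℂ)} {Λ : (Fin m → ℂ) → AddSubgroup (Fin m → ℂ)} {ε : ℝ}
  {ω Υ : (Fin m ⊕ Fin m → ℂ) → CForm (Fin m ⊕ Fin m → ℂ) 2} {g : (Fin m → ℂ) → ℂ}
  {η : (Fin m → ℂ) → CForm (Fin m → ℂ) 2}
  {gF : (Fin m → ℂ) → (Fin m → ℂ) → Bilin (Fin m → ℂ)} {gS : (Fin m → ℂ) → Bilin (Fin m → ℂ)}
  {G : (Fin m ⊕ Fin m → ℂ) → Bilin (Fin m ⊕ Fin m → ℂ)}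

theorem IsSymplecticPairing.exists_semiFlat (hΥ : IsSymplecticPairing U Λ Υ g) (hm : 0 < m)
    (hL : IsLatticeBundle U Λ) (hF : ∀ z ∈ U, IsHermInner (gF z 0)) :
    ∃ gS G, IsBaseMetricHK U Υ gF gS ∧ IsSubmersionMetric U Λ gF gS G := by
  obtain ⟨G, hG⟩ := exists_submersionMetric hL gF
    (fun z => bilinOfMat (dualMat (g z) (hermMat (gF z 0))))
  exact ⟨_, G, (hΥ.isBaseMetricHK_iff hm hF).2 fun _ _ => rfl, hG⟩

theorem IsPolarizedFibre.hyperkahler (hP : IsPolarizedFibre U Λ ε η gF)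
    (hΥ : IsSymplecticPairing U Λ Υ g) (hm : 0 < m) (hε : 0 < ε) (hB : IsBaseMetricHK U Υ gF gS)
    (hG : IsSubmersionMetric U Λ gF gS G) :
    (∀ z ∈ U, gS z = bilinOfMat (dualMat (g z) (hermMat (gF z 0)))) ∧
    (∀ z ∈ U, hermMat (gS z) = dualMat (g z) (hermMat (gF z 0))) ∧ FlatSubmersion U Λ gF gS G := by
  have hS := (hΥ.isBaseMetricHK_iff hm fun z hz => hP.fib_herm hz).1 hB
  refine ⟨hS, fun z hz => ?_, hP.flatSubmersion hm hε (fun z hz => (hB z hz).1) hG⟩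
  rw [hS z hz]
  exact hermMat_bilinOfMat (dualMat_posDef (hΥ.ne_zero hm hz) (hP.fib_herm hz).hermMat_posDef).1

theorem semiFlat_hyperkahler (hm : 0 < m) (hL : IsLatticeBundle U Λ)
    (hω : IsConstPolarization U Λ ω) (hε : 0 < ε) (hΥ : IsSymplecticPairing U Λ Υ g) :
    (∃ gF gS G, IsSemiFlatHK U Λ ω Υ ε gF gS G) ∧
    ∀ gF gS G, IsSemiFlatHK U Λ ω Υ ε gF gS G →
      Descends U Λ (fun x => kahlerForm (G x)) ∧
      IsKahlerMetric (totalSet m U) G ∧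
      (∀ x ∈ totalSet m U,
        wedgePow (kahlerForm (G x)).toAlternatingMap (2 * m) =
          (((2 * m).choose m : ℂ) • wedge (wedgePow (Υ x).toAlternatingMap m)
            (conjForm (wedgePow (Υ x).toAlternatingMap m))).domDomCongr
              (finCongr (by ring))) ∧
      IsHyperkahler (totalSet m U) G ∧
      IsKahlerMetric U gS ∧
      ∀ (W : Set (Fin m → ℂ)) (T : (Fin m → ℂ) → Matrix (Fin m) (Fin m ⊕ Fin m) ℂ),
        IsFrame Λ W T → W ⊆ U → IsConnected W →
        ∃ Q : Matrix (Fin m ⊕ Fin m) (Fin m ⊕ Fin m) ℝ,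
          IsPolarizationMatrix Λ ω W T Q ∧ 0 < Q.det ∧
          (∀ z ∈ W, (∀ w, kahlerForm (gF z w) = hermForm (matHeps ε Q (T z))) ∧
            Cohomologous (Λ z) (restrictFib ω z) (fun _ => hermForm (matH Q (T z)))) ∧
          (∀ x ∈ totalSet m W, kahlerForm (G x) =
            (∑ j, ∑ k, (Complex.I * (‖g (basePart x)‖ ^ 2 : ℝ) *
                (matHeps ε Q (T (basePart x)))⁻¹ k j) • wedgeOne ![dz j, conjOne (dz k)]) +
              vertForm (matHeps ε Q (T (basePart x))) T x) ∧
          (∃ S : Matrix (Fin m ⊕ Fin m) (Fin m ⊕ Fin m) ℝ,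
            S.transpose * Q * S = Matrix.fromBlocks 0 1 (-1) 0) ∧
          ∀ S : Matrix (Fin m ⊕ Fin m) (Fin m ⊕ Fin m) ℝ,
            S.transpose * Q * S = Matrix.fromBlocks 0 1 (-1) 0 →
            ∃ R Z, IsPeriodMap W T S R Z ∧ ∀ z ∈ W,
              (matH Q (T z))⁻¹ =
                (2 : ℂ) • (conjMat (R z) * realMat (imMat (symMat (Z z))) * (R z).transpose) ∧
              ricciForm gS z = (-Complex.I) •
                ddbar (fun y => (Real.log (imMat (symMat (Z y))).det : ℂ)) z ∧
              ricciForm gS z = siegelWith (Z z) (fun s => fderiv ℝ (fun y => Z y s) z) ∧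
              ricciForm gS z = (siegelForm (Z z)).compContinuousLinearMap (fderiv ℝ Z z) := by
  obtain ⟨η, hη⟩ := hω.exists_representative hm hL
  refine ⟨?_, ?_⟩
  · obtain ⟨gF, hF, hC⟩ := hη.exists_fibreMetric hm hε
    obtain ⟨gS, G, hB, hG⟩ := hΥ.exists_semiFlat hm hL
      (fun z hz => (hη.isPolarizedFibre hm hF hC).fib_herm hz)
    exact ⟨gF, gS, G, hF, hC, hB, hG⟩
  rintro gF gS G ⟨hF, hC, hB, hG⟩
  have hP := hη.isPolarizedFibre hm hF hC
  obtain ⟨hS, hSm, hsub⟩ := hP.hyperkahler hΥ hm hε hB hG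
  have hKS := baseMetric_isKahlerMetric hΥ hm hsub hS
  refine ⟨hsub.descends, hsub.isKahlerMetric hKS, fun x hx => volume_hyperkahler hΥ hm hsub hS hx,
    isHyperkahler hΥ hm hsub hS, hKS, fun W T hT hW hc => ?_⟩
  obtain ⟨Q, h1, h2, h3, h4, h5⟩ := hη.frame_formulas hP hm hε (gS := gS) (h := fun z => g z ^ m)
    (hΥ.hol.pow m) (fun z hz => pow_ne_zero _ (hΥ.ne_zero hm hz))
    (fun z hz => by rw [hSm z hz, det_dualMat]) hT hW hc
  refine ⟨Q, h1, h2, h3, fun x hx => ?_, h5⟩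
  rw [hsub.kahlerForm_eq hT hW hx, hSm _ (hW hx), h4 _ hx]
  congr 1
  refine Finset.sum_congr rfl fun j _ => Finset.sum_congr rfl fun k _ => ?_
  rw [dualMat, Matrix.smul_apply, transpose_apply, smul_eq_mul, mul_assoc]

end HyperkahlerSetting

end

noncomputable section

open Matrix Complex
open scoped ComplexOrder

/-! ### Forms of top degree -/

section TopForms

variable {V : Type*} [NormedAddCommGroup V] [NormedSpace ℝ V]

theorem wedgeOne_matrix_mul {p : ℕ} (M : Matrix (Fin p) (Fin p) ℂ) (θ : Fin p → V →L[ℝ] ℂ) :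
    wedgeOne (fun i => ∑ j, M i j • θ j) = M.det • wedgeOne θ := by
  ext v
  rw [ContinuousAlternatingMap.smul_apply, wedgeOne_apply, wedgeOne_apply, smul_eq_mul, ← det_mul]
  congr 1
  ext i j
  simp [Matrix.mul_apply]

theorem det_of_cons {m : ℕ} (c : ℂ) (b : Fin m → ℂ) (A : Matrix (Fin m) (Fin m) ℂ) :
    (Matrix.of (Fin.cons (Fin.cons c 0) fun l => Fin.cons (b l) (A l)) :
      Matrix (Fin (m + 1)) (Fin (m + 1)) ℂ).det = c * A.det := by
  rw [det_succ_row_zero, Fin.sum_univ_succ, Finset.sum_eq_zero fun j _ => by simp]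
  simp only [Fin.val_zero, pow_zero, one_mul, of_apply, Fin.cons_zero, add_zero]
  congr 2

end TopForms

/-! ### The determinant of a submersion metric -/

section SubmersionDet

variable {n m : ℕ} {U W : Set (Fin n → ℂ)} {Λ : (Fin n → ℂ) → AddSubgroup (Fin m → ℂ)}
  {gF : (Fin n → ℂ) → (Fin m → ℂ) → Bilin (Fin m → ℂ)} {gS : (Fin n → ℂ) → Bilin (Fin n → ℂ)}
  {G : (Fin n ⊕ Fin m → ℂ) → Bilin (Fin n ⊕ Fin m → ℂ)} {x : Fin n ⊕ Fin m → ℂ}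

/-- The passage from (dz, dw) to (dz, θ) is unipotent, and in the latter coframe the metric is block
diagonal. -/
theorem FlatSubmersion.det_hermMat (h : FlatSubmersion U Λ gF gS G) (hx : x ∈ totalSet m U) :
    (hermMat (G x)).det = (hermMat (gS (basePart x))).det * (hermMat (gF (basePart x) 0)).det := by
  obtain ⟨W, T, Q, hxW, hW, hT, -⟩ := h.frame _ hx
  have hS := h.base_herm _ hx
  have hF := h.fib_herm _ hx
  set D := fromBlocks (hermMat (gS (basePart x))) 0 0 (hermMat (gF (basePart x) 0))
  set B : Matrix (Fin n ⊕ Fin m) (Fin n ⊕ Fin m) ℂ :=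
    fromBlocks 1 0 (-Matrix.of fun j p => christoffel T p x j) 1 with hB
  have hBu : ∀ u, B *ᵥ u = Sum.elim (basePart u) (thetaVec T x u) := fun u => by
    have hu : u = Sum.elim (basePart u) (fibPart u) := by ext (i | i) <;> rfl
    conv_lhs => rw [hu]
    rw [hB, fromBlocks_mulVec]
    ext (i | i)
    · simp
    · simp only [Sum.elim_inr, thetaVec_apply, thetaForm_apply, Pi.add_apply, neg_mulVec, Pi.neg_apply,
        one_mulVec, Sum.elim_comp_inl, Sum.elim_comp_inr]
      rw [mulVec, dotProduct, add_comm, sub_eq_add_neg]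
      rfl
  have hD : D.IsHermitian := hS.hermMat_posDef.1.fromBlocks (by simp) hF.hermMat_posDef.1
  have hM : (Bᵀ * D * conjMat B).IsHermitian := by
    have : conjMat B = Bᵀᴴ := rfl
    rw [this]
    exact isHermitian_mul_mul_conjTranspose _ hD
  have hG : G x = bilinOfMat (Bᵀ * D * conjMat B) := by
    ext u v
    have h1 : conjMat B *ᵥ star v = star (B *ᵥ v) := by
      ext i; simp [mulVec, dotProduct, conjMat]
    have h2 : ∀ (a c : Fin n → ℂ) (b d : Fin m → ℂ), Sum.elim a b ⬝ᵥ Sum.elim c d = a ⬝ᵥ c + b ⬝ᵥ d :=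
      fun a c b d => by simp [dotProduct]
    have h3 : star (Sum.elim (basePart v) (thetaVec T x v)) =
        Sum.elim (star (basePart v)) (star (thetaVec T x v)) := by
      ext (i | i) <;> rfl
    rw [h.metric_eq hT hW hxW, hS.apply_eq, hF.apply_eq, bilinOfMat_apply, ← mulVec_mulVec, h1,
      ← mulVec_mulVec, dotProduct_mulVec u, vecMul_transpose, hBu, hBu, h3, fromBlocks_mulVec, h2, add_re]
    simp
    ring
  have hBd : B.det = 1 := by rw [hB, det_fromBlocks_zero₁₂, det_one, det_one, one_mul]
  rw [hG, hermMat_bilinOfMat hM, det_mul, det_mul, det_transpose, conjMat_det, hBd, map_one, mul_one,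
    one_mul, det_fromBlocks_zero₁₂]

end SubmersionDet

theorem ddbar_const {κ : Type*} [Fintype κ] [DecidableEq κ] (c : ℂ) (x : κ → ℂ) :
    ddbar (fun _ : κ → ℂ => c) x = 0 := by
  have h1 : ∀ k, wirtBar k (fun _ : κ → ℂ => c) = fun _ => 0 := fun k => by
    ext y; simp [wirtBar]
  have h2 : ∀ j, wirt j (fun _ : κ → ℂ => (0 : ℂ)) x = 0 := fun j => by simp [wirt]
  ext v
  simp only [ddbar, h1, h2, cformSum_apply, ContinuousAlternatingMap.smul_apply, zero_smul]
  simp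

/-! ### The Calabi-Yau setting -/

section CalabiYau

variable {m : ℕ} {U : Set (Fin 1 → ℂ)} {Λ : (Fin 1 → ℂ) → AddSubgroup (Fin m → ℂ)} {ε : ℝ}
  {ω : (Fin 1 ⊕ Fin m → ℂ) → CForm (Fin 1 ⊕ Fin m → ℂ) 2}
  {Ω : (Fin 1 ⊕ Fin m → ℂ) → CForm (Fin 1 ⊕ Fin m → ℂ) (m + 1)} {g : (Fin 1 → ℂ) → ℂ}
  {η : (Fin 1 → ℂ) → CForm (Fin m → ℂ) 2} {x : Fin 1 ⊕ Fin m → ℂ}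
  {gF : (Fin 1 → ℂ) → (Fin m → ℂ) → Bilin (Fin m → ℂ)} {gS : (Fin 1 → ℂ) → Bilin (Fin 1 → ℂ)}
  {G : (Fin 1 ⊕ Fin m → ℂ) → Bilin (Fin 1 ⊕ Fin m → ℂ)}

/-- `Ω = g dz ∧ dw^1 ∧ ⋯ ∧ dw^m` is a holomorphic volume form on the family. -/
structure IsVolumePairing (U : Set (Fin 1 → ℂ))
    (Ω : (Fin 1 ⊕ Fin m → ℂ) → CForm (Fin 1 ⊕ Fin m → ℂ) (m + 1)) (g : (Fin 1 → ℂ) → ℂ) : Prop where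
  isOpen : IsOpen U
  vol : IsHolVolume (totalSet m U) Ω
  hol : DifferentiableOn ℂ g U
  eq : ∀ x ∈ totalSet m U, Ω x = g (basePart x) • wedgeOne (Fin.cons (dz 0) dw)

theorem IsVolumePairing.ne_zero (hΩ : IsVolumePairing U Ω g) {z : Fin 1 → ℂ} (hz : z ∈ U) : g z ≠ 0 := by
  intro h0
  have hx : (Sum.elim z 0 : Fin 1 ⊕ Fin m → ℂ) ∈ totalSet m U := hz
  refine hΩ.vol.2 _ hx ?_
  rw [hΩ.eq _ hx, show basePart (Sum.elim z 0 : Fin 1 ⊕ Fin m → ℂ) = z from rfl, h0]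
  ext v
  simp

theorem IsVolumePairing.apply_vert (hΩ : IsVolumePairing U Ω g) (hx : x ∈ totalSet m U)
    (u : Fin 1 ⊕ Fin m → ℂ) (v : Fin m → Fin m → ℂ) :
    Ω x (Fin.cons u fun i => vert 1 m (v i)) =
      g (basePart x) * basePart u 0 * (Matrix.of v).det := by
  rw [hΩ.eq x hx, ContinuousAlternatingMap.smul_apply, wedgeOne_apply, smul_eq_mul, mul_assoc]
  congr 1
  rw [← det_transpose (Matrix.of v), ← det_of_cons _ fun i => dw (n := 1) i u]
  congr 1
  ext i j
  refine Fin.cases ?_ (fun i => ?_) i <;> refine Fin.cases ?_ (fun j => ?_) j <;> rfl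

theorem IsVolumePairing.isBaseMetricCY_iff (hΩ : IsVolumePairing U Ω g)
    (hF : ∀ z ∈ U, IsHermInner (gF z 0)) : IsBaseMetricCY U Ω gF gS ↔
      ∀ z ∈ U, gS z = bilinOfMat (detDualMat (g z) (hermMat (gF z 0))) := by
  refine forall₂_congr fun z hz => ?_
  have hg := hΩ.ne_zero hz
  constructor
  · rintro ⟨hS, h⟩
    refine ((hF z hz).det_iff_eq_detDualMat hS hg).1 fun u v => ?_
    have h1 := h (Sum.elim u 0) v
    rwa [hΩ.apply_vert hz] at h1
  · intro h
    have hS : IsHermInner (gS z) := by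
      rw [h]
      exact isHermInner_bilinOfMat (detDualMat_posDef hg (hF z hz).hermMat_posDef)
    refine ⟨hS, fun u v => ?_⟩
    rw [hΩ.apply_vert hz]
    exact ((hF z hz).det_iff_eq_detDualMat hS hg).2 h _ _

theorem det_detDualMat (c : ℂ) (h : Matrix (Fin m) (Fin m) ℂ) :
    (detDualMat c h).det = ((‖c‖ ^ 2 : ℝ) : ℂ) * h⁻¹.det := by
  rw [det_fin_one, det_nonsing_inv, Ring.inverse_eq_inv']
  rfl

/-- Closedness is automatic on a one-dimensional base. Smoothness is seen from det H⁻¹ = det(i T̄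
Q⁻¹ Tᵗ), a polynomial in the entries of T and T̄. -/
theorem IsVolumePairing.baseMetric_isKahlerMetric (hΩ : IsVolumePairing U Ω g)
    (h : FlatSubmersion U Λ gF gS G)
    (hS : ∀ z ∈ U, gS z = bilinOfMat (detDualMat (g z) (hermMat (gF z 0)))) : IsKahlerMetric U gS := by
  refine ⟨?_, h.base_herm, fun z _ => cform_three_eq_zero _⟩
  rw [contDiffOn_bilin_iff]
  intro u v z hz
  obtain ⟨W, T, Q, hzW, hW, hT, hQ⟩ := h.frame z hz
  have hopen := hT.1.mem_nhds hzW
  have hg : ContDiffOn ℝ (⊤ : ℕ∞) g W := (hΩ.hol.mono hW).contDiffOn_real hT.1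
  have hTe : ∀ j a, ContDiffOn ℝ (⊤ : ℕ∞) (fun y => T y j a) W := fun j a =>
    (hT.2.1 j a).contDiffOn_real hT.1
  have hdet : ContDiffOn ℝ (⊤ : ℕ∞)
      (fun y => (I • (conjMat (T y) * realMat Q⁻¹ * (T y)ᵀ)).det) W := by
    refine ContDiffOn.matrix_det fun i j => ?_
    simp only [Matrix.smul_apply, Matrix.mul_apply, smul_eq_mul]
    exact contDiffOn_const.mul (ContDiffOn.sum fun a _ => (ContDiffOn.sum fun b _ =>
      (conjCLE.contDiff.comp_contDiffOn (hTe i b)).mul contDiffOn_const).mul (hTe j a))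
  have h1 : ContDiffOn ℝ (⊤ : ℕ∞) (fun y => 2 * (u 0 * (((g y * starRingEnd ℂ (g y)) *
      (I • (conjMat (T y) * realMat Q⁻¹ * (T y)ᵀ)).det) * starRingEnd ℂ (v 0))).re) W :=
    contDiffOn_const.mul (reCLM.contDiff.comp_contDiffOn (contDiffOn_const.mul
      (((hg.mul (conjCLE.contDiff.comp_contDiffOn hg)).mul hdet).mul contDiffOn_const)))
  refine ((h1.contDiffAt hopen).congr_of_eventuallyEq ?_).contDiffWithinAt
  filter_upwards [hopen] with y hy
  rw [hS y (hW hy), bilinOfMat_apply, (matH_relations (hT.2.2 y hy).1 (h.fib_herm y (hW hy)) (hQ y hy)).2.1,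
    mul_conj, normSq_eq_norm_sq, det_nonsing_inv, Ring.inverse_eq_inv', dotProduct, Fin.sum_univ_one, mulVec,
    dotProduct, Fin.sum_univ_one]
  rfl

/-- The coframe e₀ = (g / det A) dz, e_l = (Aθ)_l is unitary. It arises from (dz, dw) by a
triangular matrix of determinant g, so its product is Ω and `wedgePow_unitary` applies. -/
theorem volume_calabiYau (hΩ : IsVolumePairing U Ω g) (h : FlatSubmersion U Λ gF gS G)
    (hS : ∀ z ∈ U, gS z = bilinOfMat (detDualMat (g z) (hermMat (gF z 0)))) (hx : x ∈ totalSet m U) :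
    wedgePow (kahlerForm (G x)).toAlternatingMap (m + 1) =
      ((((m + 1).factorial : ℂ) * Complex.I ^ ((m + 1) ^ 2)) •
        wedge (Ω x).toAlternatingMap (conjForm (Ω x).toAlternatingMap)).domDomCongr
          (finCongr (by ring)) := by
  obtain ⟨W, T, Q, hxW, hW, hT, -⟩ := h.frame _ hx
  have hF := (h.fib_herm _ hx).hermMat_posDef
  obtain ⟨A, hA, hAh⟩ := hF.exists_coframe
  set c := g (basePart x) * A.det⁻¹ with hc
  have hB : hermMat (gS (basePart x)) =
      (Matrix.of fun _ _ : Fin 1 => c)ᵀ * conjMat (Matrix.of fun _ _ : Fin 1 => c) := by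
    rw [hS _ hx, hermMat_bilinOfMat (detDualMat_posDef (hΩ.ne_zero hx) hF).1, hAh, detDualMat_eq_coframe]
  set e : Fin (m + 1) → (Fin 1 ⊕ Fin m → ℂ) →L[ℝ] ℂ :=
    Fin.cons (c • dz 0) fun l => ∑ j, A l j • thetaForm T x j with he
  have hk : kahlerForm (G x) = ∑ l, I • wedgeOne ![e l, conjOne (e l)] := by
    rw [h.kahlerForm_eq_unitary hT hW hxW hAh hB,
      Fin.sum_univ_succ fun l => I • wedgeOne ![e l, conjOne (e l)], Fin.sum_univ_one, Fin.sum_univ_one]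
    rfl
  have hΩe : Ω x = wedgeOne e := by
    set M : Matrix (Fin (m + 1)) (Fin (m + 1)) ℂ := Matrix.of (Fin.cons (Fin.cons c 0)
      fun l => Fin.cons (-∑ j, A l j * christoffel T 0 x j) (A l)) with hM
    have heM : e = fun i => ∑ j, M i j • (Fin.cons (dz 0) dw : Fin (m + 1) → _ →L[ℝ] ℂ) j := by
      funext i
      ext u
      rw [Fin.sum_univ_succ]
      refine Fin.cases ?_ (fun l => ?_) i
      · simp [he, hM]
      · simp only [he, hM, of_apply, Fin.cons_zero, Fin.cons_succ, thetaForm, Fin.sum_univ_one,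
          _root_.add_apply, _root_.smul_apply, _root_.sum_apply, _root_.sub_apply, smul_eq_mul, neg_mul,
          Finset.sum_mul, mul_sub, Finset.sum_sub_distrib]
        rw [sub_eq_neg_add]
        simp only [mul_assoc]
    rw [heM, wedgeOne_matrix_mul, hM, det_of_cons, hc, inv_mul_cancel_right₀ hA, hΩ.eq x hx]
  rw [hk, hΩe, wedgePow_unitary]

/-- The base metric has determinant |g|² / det H, so the determinant of the metric on X is |g|²,
whose logarithm is pluriharmonic. -/
theorem isCalabiYau (hΩ : IsVolumePairing U Ω g) (h : FlatSubmersion U Λ gF gS G)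
    (hS : ∀ z ∈ U, gS z = bilinOfMat (detDualMat (g z) (hermMat (gF z 0)))) :
    IsCalabiYau (totalSet m U) G := by
  refine ⟨h.isKahlerMetric (hΩ.baseMetric_isKahlerMetric h hS), fun x hx => ?_⟩
  have hgd : DifferentiableOn ℂ (fun y : Fin 1 ⊕ Fin m → ℂ => g (basePart y)) (totalSet m U) :=
    hΩ.hol.comp (baseCLM 1 m).differentiable.differentiableOn fun y hy => hy
  have hF : ∀ y ∈ totalSet m U, (Matrix.det (Matrix.of fun j k : Fin 1 ⊕ Fin m =>
      hermOf (G y) (Pi.single j 1) (Pi.single k 1))).re = 1 * (‖g (basePart y)‖ ^ 2 * 1) := fun y hy => by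
    have h1 : (Matrix.det (Matrix.of fun j k : Fin 1 ⊕ Fin m =>
        hermOf (G y) (Pi.single j 1) (Pi.single k 1))) = (hermMat (G y)).det := (det_transpose _).symm
    have hFp := (h.fib_herm _ hy).hermMat_posDef
    rw [h1, h.det_hermMat hy, hS _ hy, hermMat_bilinOfMat (detDualMat_posDef (hΩ.ne_zero hy) hFp).1,
      det_detDualMat, mul_assoc, ← det_mul, nonsing_inv_mul _ (isUnit_iff_ne_zero.2 hFp.det_pos.ne'), det_one,
      mul_one, ofReal_re, one_mul, mul_one]
  rw [ricciForm, ddbar_log_normSq_mul (totalSet_isOpen hΩ.isOpen) hgd (fun y hy => hΩ.ne_zero hy) one_pos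
    (φ := fun _ => 1) (fun _ _ => one_pos) contDiffOn_const hF hx]
  rw [ddbar_const]
  ext v
  simp

theorem semiFlat_calabiYau (hm : 0 < m) (hL : IsLatticeBundle U Λ)
    (hω : IsConstPolarization U Λ ω) (hε : 0 < ε) (hΩ : IsVolumePairing U Ω g) :
    (∃ gF gS G, IsSemiFlatCY U Λ ω Ω ε gF gS G) ∧
    ∀ gF gS G, IsSemiFlatCY U Λ ω Ω ε gF gS G →
      Descends U Λ (fun x => kahlerForm (G x)) ∧
      IsKahlerMetric (totalSet m U) G ∧
      (∀ x ∈ totalSet m U,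
        wedgePow (kahlerForm (G x)).toAlternatingMap (m + 1) =
          ((((m + 1).factorial : ℂ) * Complex.I ^ ((m + 1) ^ 2)) •
            wedge (Ω x).toAlternatingMap (conjForm (Ω x).toAlternatingMap)).domDomCongr
              (finCongr (by ring))) ∧
      IsCalabiYau (totalSet m U) G ∧
      IsKahlerMetric U gS ∧
      ∀ (W : Set (Fin 1 → ℂ)) (T : (Fin 1 → ℂ) → Matrix (Fin m) (Fin m ⊕ Fin m) ℂ),
        IsFrame Λ W T → W ⊆ U → IsConnected W →
        ∃ Q : Matrix (Fin m ⊕ Fin m) (Fin m ⊕ Fin m) ℝ,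
          IsPolarizationMatrix Λ ω W T Q ∧ 0 < Q.det ∧
          (∀ z ∈ W, (∀ w, kahlerForm (gF z w) = hermForm (matHeps ε Q (T z))) ∧
            Cohomologous (Λ z) (restrictFib ω z) (fun _ => hermForm (matH Q (T z)))) ∧
          (∀ x ∈ totalSet m W, kahlerForm (G x) =
            (Complex.I * (‖g (basePart x)‖ ^ 2 : ℝ) *
                (matHeps ε Q (T (basePart x))).det⁻¹) • wedgeOne ![dz 0, conjOne (dz 0)] +
              vertForm (matHeps ε Q (T (basePart x))) T x) ∧
          (∃ S : Matrix (Fin m ⊕ Fin m) (Fin m ⊕ Fin m) ℝ,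
            S.transpose * Q * S = Matrix.fromBlocks 0 1 (-1) 0) ∧
          ∀ S : Matrix (Fin m ⊕ Fin m) (Fin m ⊕ Fin m) ℝ,
            S.transpose * Q * S = Matrix.fromBlocks 0 1 (-1) 0 →
            ∃ R Z, IsPeriodMap W T S R Z ∧ ∀ z ∈ W,
              (matH Q (T z))⁻¹ =
                (2 : ℂ) • (conjMat (R z) * realMat (imMat (symMat (Z z))) * (R z).transpose) ∧
              ricciForm gS z = (-Complex.I) •
                ddbar (fun y => (Real.log (imMat (symMat (Z y))).det : ℂ)) z ∧
              ricciForm gS z = siegelWith (Z z) (fun s => fderiv ℝ (fun y => Z y s) z) ∧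
              ricciForm gS z = (siegelForm (Z z)).compContinuousLinearMap (fderiv ℝ Z z) := by
  obtain ⟨η, hη⟩ := hω.exists_representative hm hL
  refine ⟨?_, ?_⟩
  · obtain ⟨gF, hF, hC⟩ := hη.exists_fibreMetric hm hε
    obtain ⟨G, hG⟩ := exists_submersionMetric hL gF
      (fun z => bilinOfMat (detDualMat (g z) (hermMat (gF z 0))))
    exact ⟨gF, _, G, hF, hC, (hΩ.isBaseMetricCY_iff fun z hz =>
      (hη.isPolarizedFibre hm hF hC).fib_herm hz).2 fun _ _ => rfl, hG⟩
  rintro gF gS G ⟨hF, hC, hB, hG⟩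
  have hP := hη.isPolarizedFibre hm hF hC
  have hS := (hΩ.isBaseMetricCY_iff fun z hz => hP.fib_herm hz).1 hB
  have hsub := hP.flatSubmersion hm hε (fun z hz => (hB z hz).1) hG
  have hSm : ∀ z ∈ U, hermMat (gS z) = detDualMat (g z) (hermMat (gF z 0)) := fun z hz => by
    rw [hS z hz]
    exact hermMat_bilinOfMat (detDualMat_posDef (hΩ.ne_zero hz) (hP.fib_herm hz).hermMat_posDef).1
  have hKS := hΩ.baseMetric_isKahlerMetric hsub hS
  refine ⟨hsub.descends, hsub.isKahlerMetric hKS, fun x hx => volume_calabiYau hΩ hsub hS hx,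
    isCalabiYau hΩ hsub hS, hKS, fun W T hT hW hc => ?_⟩
  obtain ⟨Q, h1, h2, h3, h4, h5⟩ := hη.frame_formulas hP hm hε (gS := gS) hΩ.hol
    (fun z hz => hΩ.ne_zero hz) (fun z hz => by rw [hSm z hz, det_detDualMat]) hT hW hc
  refine ⟨Q, h1, h2, h3, fun x hx => ?_, h5⟩
  rw [hsub.kahlerForm_eq hT hW hx, hSm _ (hW hx), h4 _ hx, Fin.sum_univ_one, Fin.sum_univ_one, mul_assoc]
  rfl

end CalabiYau

end

noncomputable section

open Matrix Complex
open scoped ComplexOrder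

/-! ### Flat metrics on elliptic curves -/

section EllipticCurves

theorem metricOfForm_kahlerForm {ι : Type*} [Fintype ι] {g : Bilin (ι → ℂ)} (hg : IsHermInner g) :
    metricOfForm (kahlerForm g) = g := by
  ext u v
  rw [metricOfForm_apply, kahlerForm_apply hg, hg.2.1, ofReal_re]

theorem IsHermInner.exists_scalar {g : Bilin (Fin 1 → ℂ)} (hg : IsHermInner g) :
    ∃ r : ℝ, 0 < r ∧ hermMat g = (Matrix.of fun _ _ => (r : ℂ)) ∧
      ∀ u v, g (I • u) v = 2 * r * (starRingEnd ℂ (u 0) * v 0).im := by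
  obtain ⟨h1, h2⟩ := Complex.pos_iff.1 (hg.hermMat_posDef.diag_pos (i := 0))
  have hr : hermMat g 0 0 = ((hermMat g 0 0).re : ℂ) := Complex.ext rfl (by simpa using h2.symm)
  have hM : hermMat g = Matrix.of fun _ _ => ((hermMat g 0 0).re : ℂ) := by
    ext i j
    rw [Subsingleton.elim i 0, Subsingleton.elim j 0, of_apply, ← hr]
  refine ⟨_, h1, hM, fun u v => ?_⟩
  rw [hg.apply_eq, dotProduct, Fin.sum_univ_one, mulVec, dotProduct, Fin.sum_univ_one, hr]
  simp
  ring

variable {L : AddSubgroup (Fin 1 → ℂ)} {τ : Fin 1 ⊕ Fin 1 → Fin 1 → ℂ} {ε : ℝ}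

/-- The oriented area of the cell spanned by two vectors. -/
def cellArea (τ : Fin 1 ⊕ Fin 1 → Fin 1 → ℂ) : ℝ :=
  (starRingEnd ℂ (τ (Sum.inl 0) 0) * τ (Sum.inr 0) 0).im

theorem im_conj_mul_eq (τ : Fin 1 ⊕ Fin 1 → Fin 1 → ℂ) (a b : Fin 1 ⊕ Fin 1) :
    (starRingEnd ℂ (τ a 0) * τ b 0).im =
      cellArea τ * (fromBlocks 0 1 (-1) 0 : Matrix (Fin 1 ⊕ Fin 1) (Fin 1 ⊕ Fin 1) ℝ) a b := by
  rcases a with a | a <;> rcases b with b | b <;>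
  rw [Subsingleton.elim a 0, Subsingleton.elim b 0] <;> simp [cellArea] <;> ring

theorem det_fromBlocks_standard :
    (fromBlocks 0 1 (-1) 0 : Matrix (Fin 1 ⊕ Fin 1) (Fin 1 ⊕ Fin 1) ℝ).det = 1 := by
  rw [← det_submatrix_equiv_self (finSumFinEquiv (m := 1) (n := 1)).symm, det_fin_two]
  have h0 : (finSumFinEquiv (m := 1) (n := 1)).symm 0 = Sum.inl 0 := by decide
  have h1 : (finSumFinEquiv (m := 1) (n := 1)).symm 1 = Sum.inr 0 := by decide
  simp only [submatrix_apply, h0, h1]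
  simp

/-- A hermitian metric on ℂ is one positive scalar r, and the area of the cell is 2r times the
absolute value of `cellArea`. So the area determines the metric, and no polarization is required. -/
theorem IsHermInner.elliptic {g : Bilin (Fin 1 → ℂ)} (hg : IsHermInner g)
    (hε : 0 < ε) (h : Real.sqrt (Matrix.of fun a b => g (I • τ a) (τ b)).det = ε) :
    cellArea τ ≠ 0 ∧ (hermMat g = Matrix.of fun _ _ => ((ε / (2 * |cellArea τ|) : ℝ) : ℂ)) ∧
      ∀ a b, g (I • τ a) (τ b) = ε / |cellArea τ| * cellArea τ *
        (fromBlocks 0 1 (-1) 0 : Matrix (Fin 1 ⊕ Fin 1) (Fin 1 ⊕ Fin 1) ℝ) a b := by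
  obtain ⟨r, hr, hM, hv⟩ := hg.exists_scalar
  have hQ : (Matrix.of fun a b => g (I • τ a) (τ b)) = (2 * r * cellArea τ) •
      (fromBlocks 0 1 (-1) 0 : Matrix (Fin 1 ⊕ Fin 1) (Fin 1 ⊕ Fin 1) ℝ) := by
    ext a b
    rw [of_apply, hv, im_conj_mul_eq, Matrix.smul_apply, smul_eq_mul]
    ring
  have h1 : 2 * r * |cellArea τ| = ε := by
    rw [← h, hQ, det_smul, det_fromBlocks_standard, mul_one, Fintype.card_sum, Fintype.card_fin,
      Real.sqrt_sq_eq_abs, abs_mul, abs_of_pos (by positivity : 0 < 2 * r)]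
  have h0 : cellArea τ ≠ 0 := fun h0 => by
    rw [h0, abs_zero, mul_zero] at h1
    exact hε.ne h1
  have h0' := abs_pos.2 h0
  have hr2 : r = ε / (2 * |cellArea τ|) := by
    rw [← h1]; field_simp
  refine ⟨h0, hr2 ▸ hM, fun a b => ?_⟩
  rw [hv, im_conj_mul_eq, hr2]
  field_simp

variable {U W : Set (Fin 1 → ℂ)} {Λ : (Fin 1 → ℂ) → AddSubgroup (Fin 1 → ℂ)}
  {gF : (Fin 1 → ℂ) → (Fin 1 → ℂ) → Bilin (Fin 1 → ℂ)} {gS : (Fin 1 → ℂ) → Bilin (Fin 1 → ℂ)}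
  {G : (Fin 1 ⊕ Fin 1 → ℂ) → Bilin (Fin 1 ⊕ Fin 1 → ℂ)}

theorem IsFlatFibreMetric.elliptic (hF : IsFlatFibreMetric U Λ ε gF) (hε : 0 < ε)
    {z : Fin 1 → ℂ} (hz : z ∈ U) (hτ : IsLatticeBasis (Λ z) τ) :
    cellArea τ ≠ 0 ∧ (hermMat (gF z 0) = Matrix.of fun _ _ => ((ε / (2 * |cellArea τ|) : ℝ) : ℂ)) ∧
      ∀ a b, gF z 0 (I • τ a) (τ b) = ε / |cellArea τ| * cellArea τ *
        (fromBlocks 0 1 (-1) 0 : Matrix (Fin 1 ⊕ Fin 1) (Fin 1 ⊕ Fin 1) ℝ) a b := by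
  obtain ⟨-, h1, h2⟩ := (isFlatKahlerTorus_iff hτ).1 (hF z hz)
  exact h1.elliptic hε h2

theorem IsFlatFibreMetric.const_herm (hF : IsFlatFibreMetric U Λ ε gF) (hL : IsLatticeBundle U Λ)
    {z : Fin 1 → ℂ} (hz : z ∈ U) : (∀ w, gF z w = gF z 0) ∧ IsHermInner (gF z 0) := by
  obtain ⟨W, T, hzW, -, hT⟩ := hL.2 z hz
  obtain ⟨h1, h2, -⟩ := (isFlatKahlerTorus_iff (hT.2.2 z hzW)).1 (hF z hz)
  exact ⟨h1, h2⟩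

theorem IsFrame.continuousOn_cellArea {T : (Fin 1 → ℂ) → Matrix (Fin 1) (Fin 1 ⊕ Fin 1) ℂ}
    (hT : IsFrame Λ W T) : ContinuousOn (fun z => cellArea fun a j => T z j a) W :=
  continuous_im.comp_continuousOn ((continuous_conj.comp_continuousOn (hT.2.1 0 _).continuousOn).mul
    (hT.2.1 0 _).continuousOn)

/-- The period matrix is ±ε times the standard symplectic matrix, with the sign of the oriented cell
area. -/
theorem IsFlatFibreMetric.flatSubmersion (hF : IsFlatFibreMetric U Λ ε gF) (hL : IsLatticeBundle U Λ)
    (hε : 0 < ε) (hS : ∀ z ∈ U, IsHermInner (gS z)) (hG : IsSubmersionMetric U Λ gF gS G) :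
    FlatSubmersion U Λ gF gS G where
  isOpen := hL.1
  fib_const := fun z hz => (hF.const_herm hL hz).1
  fib_herm := fun z hz => (hF.const_herm hL hz).2
  base_herm := hS
  sub := hG
  frame := fun z₀ hz₀ => by
    obtain ⟨W, T, hzW, hW, hT⟩ := hL.2 z₀ hz₀
    set A : (Fin 1 → ℂ) → ℝ := fun z => cellArea fun a j => T z j a
    have hA0 : A z₀ ≠ 0 := (hF.elliptic hε hz₀ (hT.2.2 z₀ hzW)).1
    -- The frame is restricted to where the orientation agrees with that at z₀, so that the sign is
    -- constant.
    have hopen : IsOpen (W ∩ {z | 0 < A z₀ * A z}) :=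
      (hT.continuousOn_cellArea.const_mul (A z₀)).isOpen_inter_preimage hT.1 isOpen_Ioi
    refine ⟨W ∩ {z | 0 < A z₀ * A z}, T, (ε / |A z₀| * A z₀) • fromBlocks 0 1 (-1) 0,
      ⟨hzW, mul_self_pos.2 hA0⟩, Set.inter_subset_left.trans hW, hT.mono hopen Set.inter_subset_left,
      fun z hz a b => ?_⟩
    rw [(hF.elliptic hε (hW hz.1) (hT.2.2 z hz.1)).2.2, Matrix.smul_apply, smul_eq_mul]
    congr 1
    change ε / |A z| * A z = ε / |A z₀| * A z₀
    rcases pos_and_pos_or_neg_and_neg_of_mul_pos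
      (show 0 < A z₀ * A z from hz.2) with ⟨h1, h2⟩ | ⟨h1, h2⟩
    · rw [abs_of_pos h1, abs_of_pos h2, div_mul_cancel₀ _ h1.ne', div_mul_cancel₀ _ h2.ne']
    · rw [abs_of_neg h1, abs_of_neg h2, div_neg, div_neg, neg_mul, neg_mul, div_mul_cancel₀ _ h1.ne,
        div_mul_cancel₀ _ h2.ne]

theorem exists_flatFibreMetric (hL : IsLatticeBundle U Λ) (hε : 0 < ε) :
    ∃ gF, IsFlatFibreMetric U Λ ε gF := by
  have h1 : IsHermInner (bilinOfMat (1 : Matrix (Fin 1) (Fin 1) ℂ)) := isHermInner_bilinOfMat PosDef.one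
  obtain ⟨gF, hF, -⟩ := exists_polarizedFibre (m := 1) one_pos hε hL
    -- The standard metric of ℂ may be used on every fibre, as only the area has to be adjusted.
    (η := fun _ => kahlerForm (bilinOfMat 1)) fun z _ => by
      rw [metricOfForm_kahlerForm h1]
      exact ⟨h1, rfl⟩
  exact ⟨gF, hF⟩

end EllipticCurves

/-! ### Holomorphic symplectic forms on elliptic fibrations -/

section EllipticSymplectic

variable {U : Set (Fin 1 → ℂ)} {Λ : (Fin 1 → ℂ) → AddSubgroup (Fin 1 → ℂ)}
  {Ω : (Fin 1 ⊕ Fin 1 → ℂ) → CForm (Fin 1 ⊕ Fin 1 → ℂ) 2}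

theorem wedgeOne_dz_dw_apply (u v : Fin 1 ⊕ Fin 1 → ℂ) :
    (wedgeOne ![dz 0, dw 0] : CForm (Fin 1 ⊕ Fin 1 → ℂ) 2) ![u, v] =
      basePart u 0 * fibPart v 0 - basePart v 0 * fibPart u 0 :=
  wedgeOne_two _ _ u v

theorem CForm.complex_smul {ι : Type*} [Fintype ι] {α : CForm (ι → ℂ) 2}
    (h : ∀ v k, α (Function.update v k (I • v k)) = I * α v) (c : ℂ) (u v : ι → ℂ) :
    α ![c • u, v] = c * α ![u, v] ∧ α ![u, c • v] = c * α ![u, v] := by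
  have hl : ∀ u v, α ![I • u, v] = I * α ![u, v] := fun u v => by
    have h1 := h ![u, v] 0
    have h2 : Function.update ![u, v] 0 (I • ![u, v] 0) = ![I • u, v] := by
      ext i; fin_cases i <;> simp
    rwa [h2] at h1
  have hc : ∀ u : ι → ℂ, c • u = c.re • u + c.im • I • u := fun u => by
    ext i
    simp only [Pi.smul_apply, Pi.add_apply, smul_eq_mul, real_smul]
    conv_lhs => rw [← re_add_im c]
    ring
  have hl' : ∀ u v, α ![c • u, v] = c * α ![u, v] := fun u v => by
    rw [hc, CForm.two_add_left, CForm.two_smul_left, CForm.two_smul_left, hl, real_smul, real_smul]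
    conv_rhs => rw [← re_add_im c]
    ring
  refine ⟨hl' u v, ?_⟩
  rw [CForm.two_swap, hl', CForm.two_swap α u v, mul_neg, neg_neg]

/-- The coefficient of a `2`-form with respect to `dz ∧ dw`. -/
def pairCoeff (α : CForm (Fin 1 ⊕ Fin 1 → ℂ) 2) : ℂ :=
  α ![Pi.single (Sum.inl 0) 1, Pi.single (Sum.inr 0) 1]

theorem eq_pairCoeff_smul {α : CForm (Fin 1 ⊕ Fin 1 → ℂ) 2}
    (h : ∀ v k, α (Function.update v k (I • v k)) = I * α v) :
    α = pairCoeff α • wedgeOne ![dz 0, dw 0] := by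
  refine CForm.ext_two fun u v => ?_
  have hu : ∀ u : Fin 1 ⊕ Fin 1 → ℂ, u = u (Sum.inl 0) • Pi.single (Sum.inl 0) 1 +
      u (Sum.inr 0) • Pi.single (Sum.inr 0) 1 := fun u => by
    ext i
    rcases i with i | i <;> rw [Subsingleton.elim i 0] <;> simp
  have h0 : ∀ u : Fin 1 ⊕ Fin 1 → ℂ, α ![u, u] = 0 := fun u =>
    α.map_eq_zero_of_eq ![u, u] (i := 0) (j := 1) rfl (by decide)
  rw [ContinuousAlternatingMap.smul_apply, wedgeOne_dz_dw_apply]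
  conv_lhs => rw [hu u, hu v]
  simp only [CForm.two_add_left, CForm.two_add_right, (CForm.complex_smul h _ _ _).1,
    (CForm.complex_smul h _ _ _).2, h0, smul_eq_mul]
  rw [CForm.two_swap α (Pi.single (Sum.inl 0) 1) (Pi.single (Sum.inr 0) 1)]
  simp only [pairCoeff, basePart, fibPart]
  ring

theorem IsHolSymplectic.differentiableOn_pairCoeff (hΩ : IsHolSymplectic (totalSet 1 U) Ω) :
    DifferentiableOn ℂ (fun x => pairCoeff (Ω x)) (totalSet 1 U) := hΩ.1.2 _

/-- Translation by a section of Λ fixes vertical vectors and base components, so it preserves dz∧dw.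
Invariance of Ω thus becomes periodicity of its coefficient. -/
theorem pairCoeff_fibTranslate (hΩ : IsHolSymplectic (totalSet 1 U) Ω) (hD : Descends U Λ Ω)
    (hL : IsLatticeBundle U Λ) {z : Fin 1 → ℂ} (hz : z ∈ U) :
    IsPeriodic (Λ z) fun w => pairCoeff (Ω (Sum.elim z w)) := by
  obtain ⟨W, T, hzW, hW, hT⟩ := hL.2 z hz
  have key : ∀ a w, pairCoeff (Ω (Sum.elim z (w + fun j => T z j a))) = pairCoeff (Ω (Sum.elim z w)) := by
    intro a w
    have hs : DifferentiableOn ℂ (fun z j => T z j a) W := differentiableOn_pi.2 fun j => hT.2.1 j a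
    have hx : (Sum.elim z w : Fin 1 ⊕ Fin 1 → ℂ) ∈ totalSet 1 W := hzW
    have hsd : DifferentiableAt ℂ (fun z j => T z j a) (basePart (Sum.elim z w : Fin 1 ⊕ Fin 1 → ℂ)) :=
      hs.differentiableAt (hT.1.mem_nhds hzW)
    have h1 := congrArg (fun α => α ![Pi.single (Sum.inl 0) 1, Pi.single (Sum.inr 0) 1])
      (hD W (fun z j => T z j a) hT.1 hW hs (fun z hz => (hT.2.2 z hz).mem a) _ hx)
    have h2 : (Sum.elim z (w + fun j => T z j a) : Fin 1 ⊕ Fin 1 → ℂ) ∈ totalSet 1 U := hz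
    simp only [compContinuousLinearMap_two] at h1
    rw [show fibTranslate (fun z j => T z j a) (Sum.elim z w : Fin 1 ⊕ Fin 1 → ℂ) =
      Sum.elim z (w + fun j => T z j a) from rfl, eq_pairCoeff_smul (hΩ.1.1 _ h2),
      ContinuousAlternatingMap.smul_apply, wedgeOne_dz_dw_apply] at h1
    rw [basePart_fderiv_fibTranslate hsd, basePart_fderiv_fibTranslate hsd,
      fibPart_fderiv_fibTranslate hsd, fibPart_fderiv_fibTranslate hsd] at h1
    have hb1 : basePart (Pi.single (Sum.inl 0) 1 : Fin 1 ⊕ Fin 1 → ℂ) 0 = 1 := by simp [basePart]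
    have hb2 : basePart (Pi.single (Sum.inr 0) 1 : Fin 1 ⊕ Fin 1 → ℂ) = 0 := by ext; simp [basePart]
    have hb3 : fibPart (Pi.single (Sum.inr 0) 1 : Fin 1 ⊕ Fin 1 → ℂ) 0 = 1 := by simp [fibPart]
    rw [hb1, hb2, map_zero, add_zero, hb3] at h1
    simpa [pairCoeff] using h1
  -- Frames give invariance under generators only; the general lattice vector is reached by
  -- induction.
  have hall : ∀ l ∈ AddSubgroup.closure (Set.range fun a j => T z j a), ∀ w,
      pairCoeff (Ω (Sum.elim z (w + l))) = pairCoeff (Ω (Sum.elim z w)) := by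
    intro l hl
    induction hl using AddSubgroup.closure_induction with
    | mem l hl =>
      obtain ⟨a, rfl⟩ := hl
      exact key a
    | zero => intro w; rw [add_zero]
    | add l l' _ _ h h' => intro w; rw [← add_assoc, h', h]
    | neg l _ h => intro w; rw [← h (w + -l), neg_add_cancel_right]
  intro l hl
  rw [(hT.2.2 z hzW).2] at hl
  exact hall l hl

/-- A periodic entire function is bounded, hence constant by Liouville's theorem. -/
theorem pairCoeff_eq (hΩ : IsHolSymplectic (totalSet 1 U) Ω) (hD : Descends U Λ Ω)
    (hL : IsLatticeBundle U Λ) {z : Fin 1 → ℂ} (hz : z ∈ U) (w : Fin 1 → ℂ) :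
    pairCoeff (Ω (Sum.elim z w)) = pairCoeff (Ω (Sum.elim z 0)) := by
  have hp := pairCoeff_fibTranslate hΩ hD hL hz
  obtain ⟨W, T, hzW, hW, hT⟩ := hL.2 z hz
  have hd : Differentiable ℂ fun w : Fin 1 → ℂ => pairCoeff (Ω (Sum.elim z w)) := fun w => by
    have h1 : DifferentiableAt ℂ (fun w : Fin 1 → ℂ => (Sum.elim z w : Fin 1 ⊕ Fin 1 → ℂ)) w := by
      refine differentiableAt_pi.2 fun i => ?_
      rcases i with i | i
      · exact differentiableAt_const _
      · exact differentiableAt_apply i w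
    have h2 : DifferentiableAt ℂ (fun x => pairCoeff (Ω x)) (Sum.elim z w : Fin 1 ⊕ Fin 1 → ℂ) :=
      hΩ.differentiableOn_pairCoeff.differentiableAt ((totalSet_isOpen hL.1).mem_nhds hz)
    exact h2.comp w h1
  refine hd.apply_eq_apply_of_bounded ?_ w 0
  obtain ⟨K, hK, -, hcov⟩ := (hT.2.2 z hzW).exists_cell
  refine (hK.image hd.continuous).isBounded.subset ?_
  rintro _ ⟨x, rfl⟩
  obtain ⟨y, hy, l, hl, rfl⟩ := hcov x
  exact ⟨y, hy, (hp l hl y).symm⟩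

theorem IsHolSymplectic.exists_coeff (hΩ : IsHolSymplectic (totalSet 1 U) Ω) (hD : Descends U Λ Ω)
    (hL : IsLatticeBundle U Λ) : ∃ g : (Fin 1 → ℂ) → ℂ, DifferentiableOn ℂ g U ∧
      ∀ x ∈ totalSet 1 U, Ω x = g (basePart x) • wedgeOne ![dz 0, dw 0] := by
  refine ⟨fun z => pairCoeff (Ω (Sum.elim z 0)), ?_, fun x hx => ?_⟩
  · have h1 : Differentiable ℂ (fun z : Fin 1 → ℂ => (Sum.elim z 0 : Fin 1 ⊕ Fin 1 → ℂ)) := by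
      refine differentiable_pi.2 fun i => ?_
      rcases i with i | i
      · exact differentiable_apply i
      · exact differentiable_const _
    exact hΩ.differentiableOn_pairCoeff.comp h1.differentiableOn fun z hz => hz
  · have hx' : x = Sum.elim (basePart x) (fibPart x) := by ext (i | i) <;> rfl
    dsimp only
    rw [← pairCoeff_eq hΩ hD hL hx (fibPart x), ← hx']
    exact eq_pairCoeff_smul (hΩ.1.1 x hx)

theorem isSymplecticPairing_smul (hΩ : IsHolSymplectic (totalSet 1 U) Ω) (hD : Descends U Λ Ω)
    (hL : IsLatticeBundle U Λ) {g : (Fin 1 → ℂ) → ℂ} (hg : DifferentiableOn ℂ g U)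
    (heq : ∀ x ∈ totalSet 1 U, Ω x = g (basePart x) • wedgeOne ![dz 0, dw 0]) {c : ℝ} (hc : c ≠ 0) :
    IsSymplecticPairing U Λ (fun x => c • Ω x) (fun z => (c : ℂ) * g z) where
  isOpen := hL.1
  symplectic := by
    refine ⟨⟨fun x hx v k => ?_, fun v => ?_⟩, fun x hx => ?_, fun x hx u hu => ?_⟩
    · rw [ContinuousAlternatingMap.smul_apply, ContinuousAlternatingMap.smul_apply, hΩ.1.1 x hx,
        mul_smul_comm]
    · simp only [ContinuousAlternatingMap.smul_apply, real_smul]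
      exact (hΩ.1.2 v).const_mul _
    · rw [show (fun x => c • Ω x) = c • Ω from rfl, extDeriv_smul, hΩ.2.1 x hx, smul_zero]
    · refine hΩ.2.2 x hx u fun v => ?_
      have := hu v
      rw [ContinuousAlternatingMap.smul_apply] at this
      exact (smul_eq_zero.1 this).resolve_left hc
  desc := fun W s hW hWU hs hsΛ x hx => by
    refine CForm.ext_two fun u v => ?_
    have h := congrArg (fun α => α ![u, v]) (hD W s hW hWU hs hsΛ x hx)
    simp only [compContinuousLinearMap_two] at h
    rw [compContinuousLinearMap_two, ContinuousAlternatingMap.smul_apply,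
      ContinuousAlternatingMap.smul_apply, h]
  hol := hg.const_mul _
  eq := fun x hx => by
    refine CForm.ext_two fun u v => ?_
    rw [Fin.sum_univ_one, heq x hx]
    simp only [ContinuousAlternatingMap.smul_apply, smul_eq_mul, real_smul]
    ring

end EllipticSymplectic

end

noncomputable section

open Matrix Complex

/-! ### The Siegel form in degree one -/

section UpperHalfPlane

variable {n : ℕ} {W : Set (Fin n → ℂ)} {x : Fin 1 → ℂ}

/-- The point of the Siegel space of degree one with the single entry `x 0`. -/
def siegelOne (x : Fin 1 → ℂ) : Sym2 (Fin 1) → ℂ := fun _ => x 0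

theorem imMat_siegelOne (x : Fin 1 → ℂ) :
    imMat (symMat (siegelOne x)) = Matrix.of fun _ _ => (x 0).im := rfl

theorem inv_of_one {K : Type*} [Field K] {r : K} (hr : r ≠ 0) :
    (Matrix.of fun _ _ : Fin 1 => r)⁻¹ = Matrix.of fun _ _ => r⁻¹ := by
  refine Matrix.inv_eq_left_inv ?_
  ext i j
  rw [Subsingleton.elim i j]
  simp [Matrix.mul_apply, hr]

theorem siegelOne_mem (hx : x ∈ upperHalf) : siegelOne x ∈ siegelSpace 1 := by
  have hx' : (0 : ℝ) < (x 0).im := hx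
  change (imMat _).PosDef
  rw [imMat_siegelOne]
  have : (Matrix.of fun _ _ : Fin 1 => (x 0).im) = Matrix.diagonal fun _ => (x 0).im := by
    ext i j
    rw [Subsingleton.elim i j]
    simp
  rw [this]
  exact PosDef.diagonal fun _ => hx'

theorem siegelWith_one {V : Type*} [NormedAddCommGroup V] [NormedSpace ℝ V] (hx : x ∈ upperHalf)
    (ζ : V →L[ℝ] ℂ) : siegelWith (siegelOne x) (fun _ => ζ) =
      (I / 4 / ((x 0).im ^ 2 : ℝ)) • wedgeOne ![ζ, conjOne ζ] := by
  have hx' : (x 0).im ≠ 0 := (show (0 : ℝ) < (x 0).im from hx).ne'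
  simp only [siegelWith, Fin.sum_univ_one, imMat_siegelOne, inv_of_one hx', of_apply]
  congr 1
  push_cast
  field_simp

theorem kahlerForm_hyperbolicMetric_comp {V : Type*} [NormedAddCommGroup V] [NormedSpace ℝ V]
    (hx : x ∈ upperHalf) (L : V →L[ℝ] (Fin 1 → ℂ)) :
    (kahlerForm (hyperbolicMetric x)).compContinuousLinearMap L =
      (I / 4 / ((x 0).im ^ 2 : ℝ)) • wedgeOne ![(dcoord 0).comp L, conjOne ((dcoord 0).comp L)] := by
  refine CForm.ext_two fun u v => ?_
  rw [compContinuousLinearMap_two, kahlerForm_apply (isHermInner_hyperbolicMetric hx),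
    hyperbolicMetric_apply, ContinuousAlternatingMap.smul_apply, wedgeOne_two, conjOne_apply, conjOne_apply]
  change _ = _ • (L u 0 * starRingEnd ℂ (L v 0) - L v 0 * starRingEnd ℂ (L u 0))
  have h1 : L v 0 * starRingEnd ℂ (L u 0) = starRingEnd ℂ (L u 0 * starRingEnd ℂ (L v 0)) := by
    rw [map_mul, conj_conj, mul_comm]
  have h2 : ((I • L u) 0 * starRingEnd ℂ (L v 0)).re = -(L u 0 * starRingEnd ℂ (L v 0)).im := by
    rw [Pi.smul_apply, smul_eq_mul, mul_assoc, I_mul_re]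
  rw [h1, sub_conj, h2, smul_eq_mul]
  push_cast
  linear_combination (-((L u 0 * starRingEnd ℂ (L v 0)).im : ℂ) / (2 * ((x 0).im : ℂ) ^ 2)) * I_sq

theorem ricciForm_eq_hyperbolic (hW : IsOpen W) {τ : (Fin n → ℂ) → Fin 1 → ℂ}
    (hτ : DifferentiableOn ℂ τ W) (hmaps : Set.MapsTo τ W upperHalf)
    {gS : (Fin n → ℂ) → Bilin (Fin n → ℂ)} {h : (Fin n → ℂ) → ℂ} (hh : DifferentiableOn ℂ h W)
    (h0 : ∀ y ∈ W, h y ≠ 0) {K : ℝ} (hK : 0 < K)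
    (hdet : ∀ y ∈ W, (hermMat (gS y)).det = ((K * (‖h y‖ ^ 2 * (τ y 0).im) : ℝ) : ℂ))
    {z : Fin n → ℂ} (hz : z ∈ W) :
    ricciForm gS z = (-I) • ddbar (fun y => (Real.log (τ y 0).im : ℂ)) z ∧
      ricciForm gS z = (I / 4 / ((τ z 0).im ^ 2 : ℝ)) •
        wedgeOne ![fderiv ℝ (fun y => τ y 0) z, conjOne (fderiv ℝ (fun y => τ y 0) z)] ∧
      ricciForm gS z =
        (kahlerForm (hyperbolicMetric (τ z))).compContinuousLinearMap (fderiv ℝ τ z) := by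
  have hdetY : ∀ y, (imMat (symMat (siegelOne (τ y)))).det = (τ y 0).im := fun y => by
    rw [imMat_siegelOne, det_fin_one, of_apply]
  have hZ : DifferentiableOn ℂ (fun y => siegelOne (τ y)) W :=
    differentiableOn_pi.2 fun _ => differentiableOn_pi.1 hτ 0
  obtain ⟨h1, h2, -⟩ := ricciForm_eq_siegel hW hZ (fun y hy => siegelOne_mem (hmaps hy)) hh h0 hK
    (fun y hy => by rw [hdetY]; exact hdet y hy) hz
  have h3 : ricciForm gS z = siegelWith (siegelOne (τ z)) fun _ => fderiv ℝ (fun y => τ y 0) z := h2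
  rw [siegelWith_one (hmaps hz)] at h3
  refine ⟨?_, h3, ?_⟩
  · simpa only [hdetY] using h1
  · have h4 : (dcoord 0).comp (fderiv ℝ τ z) = fderiv ℝ (fun y => τ y 0) z :=
      (fderiv_apply (i := 0) ((hτ.differentiableAt (hW.mem_nhds hz)).restrictScalars ℝ)).symm
    rw [kahlerForm_hyperbolicMetric_comp (hmaps hz), h4]
    exact h3

end UpperHalfPlane

/-! ### Elliptic fibrations -/

section EllipticFibrations

variable {U W : Set (Fin 1 → ℂ)} {Λ : (Fin 1 → ℂ) → AddSubgroup (Fin 1 → ℂ)}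
  {Ω Υ : (Fin 1 ⊕ Fin 1 → ℂ) → CForm (Fin 1 ⊕ Fin 1 → ℂ) 2} {g : (Fin 1 → ℂ) → ℂ} {ε : ℝ}
  {gF : (Fin 1 → ℂ) → (Fin 1 → ℂ) → Bilin (Fin 1 → ℂ)} {gS : (Fin 1 → ℂ) → Bilin (Fin 1 → ℂ)}
  {G : (Fin 1 ⊕ Fin 1 → ℂ) → Bilin (Fin 1 ⊕ Fin 1 → ℂ)} {x : Fin 1 ⊕ Fin 1 → ℂ}
  {τ₁ τ₂ : (Fin 1 → ℂ) → ℂ}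

/-- A unitary coframe a, b with Υ = a∧b gives the factor 2! · i⁴ = 2. The normalization Υ = Ω/√2 of
the corollary removes it. -/
theorem volume_elliptic (hΥ : IsSymplecticPairing U Λ Υ g) (h : FlatSubmersion U Λ gF gS G)
    (hS : ∀ z ∈ U, gS z = bilinOfMat (dualMat (g z) (hermMat (gF z 0)))) (hx : x ∈ totalSet 1 U) :
    wedgePow (kahlerForm (G x)).toAlternatingMap 2 =
      (2 : ℂ) • wedge (Υ x).toAlternatingMap (conjForm (Υ x).toAlternatingMap) := by
  obtain ⟨W, T, Q, hxW, hW, hT, -⟩ := h.frame _ hx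
  have hF := (h.fib_herm _ hx).hermMat_posDef
  obtain ⟨A, hA, hAh⟩ := hF.exists_coframe
  have hB : hermMat (gS (basePart x)) = (g (basePart x) • (A⁻¹)ᵀ)ᵀ * conjMat (g (basePart x) • (A⁻¹)ᵀ) := by
    rw [hS _ hx, hermMat_bilinOfMat (dualMat_posDef (hΥ.ne_zero one_pos hx) hF).1, hAh, dualMat_eq_coframe]
  have hk := h.kahlerForm_eq_unitary hT hW hxW hAh hB
  have hΥe := symplectic_eq_coframe hΥ one_pos hT hW hxW hA
  rw [Fin.sum_univ_one] at hΥe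
  set a := ∑ j, (g (basePart x) • (A⁻¹)ᵀ) 0 j • dz (m := 1) j
  set b := ∑ j, A 0 j • thetaForm T x j
  have hk' : kahlerForm (G x) = ∑ l, I • wedgeOne ![![a, b] l, conjOne (![a, b] l)] := by
    rw [hk, Fin.sum_univ_two]
    congr 1 <;> exact Fin.sum_univ_one _
  rw [hk', hΥe, wedgePow_unitary]
  have hI : ((Nat.factorial 2 : ℕ) : ℂ) * I ^ (2 ^ 2) = 2 := by
    rw [show 2 ^ 2 = 4 from rfl, I_pow_four]; simp
  rw [hI]
  rfl

theorem hermMat_base_elliptic {c : ℂ} (hc : c ≠ 0) {gE : Bilin (Fin 1 → ℂ)} {r : ℝ} (hr : 0 < r)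
    (hE : hermMat gE = Matrix.of fun _ _ => (r : ℂ)) (hgE : IsHermInner gE) :
    hermMat (bilinOfMat (dualMat c (hermMat gE))) = Matrix.of fun _ _ => ((‖c‖ ^ 2 / r : ℝ) : ℂ) := by
  rw [hermMat_bilinOfMat (dualMat_posDef hc hgE.hermMat_posDef).1, dualMat, hE,
    inv_of_one (ofReal_ne_zero.2 hr.ne')]
  ext i j
  simp [div_eq_mul_inv]

/-- Cramer's rule for w = aτ₁ + bτ₂ with A = Im(τ̄₁τ₂): Im(τ̄₁w) = bA and Im(τ̄₂w) = -aA. -/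
theorem christoffel_frameTwo (hT : IsFrame Λ W (frameTwo τ₁ τ₂)) (hx : x ∈ totalSet 1 W) {A : ℝ}
    (hA : A ≠ 0) (hA' : A = (starRingEnd ℂ (τ₁ (basePart x)) * τ₂ (basePart x)).im) :
    christoffel (frameTwo τ₁ τ₂) 0 x 0 = (1 / A : ℂ) *
      (((starRingEnd ℂ (τ₁ (basePart x)) * fibPart x 0).im : ℂ) *
          fderiv ℂ τ₂ (basePart x) (Pi.single 0 1) -
        ((starRingEnd ℂ (τ₂ (basePart x)) * fibPart x 0).im : ℂ) *
          fderiv ℂ τ₁ (basePart x) (Pi.single 0 1)) := by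
  have hw := hT.fibPart_eq hx 0
  rw [hT.christoffel_eq hx]
  rw [Fintype.sum_sum_type, Fin.sum_univ_one, Fin.sum_univ_one] at hw ⊢
  set a := frameCoord (frameTwo τ₁ τ₂) (Sum.inl 0) x
  set b := frameCoord (frameTwo τ₁ τ₂) (Sum.inr 0) x
  change fibPart x 0 = a * τ₁ (basePart x) + b * τ₂ (basePart x) at hw
  change (a : ℂ) * fderiv ℂ τ₁ (basePart x) (Pi.single 0 1) +
    b * fderiv ℂ τ₂ (basePart x) (Pi.single 0 1) = _
  have h1 : (starRingEnd ℂ (τ₁ (basePart x)) * fibPart x 0).im = b * A := by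
    rw [hw, hA']
    simp
    ring
  have h2 : (starRingEnd ℂ (τ₂ (basePart x)) * fibPart x 0).im = -(a * A) := by
    rw [hw, hA']
    simp
    ring
  rw [h1, h2]
  have hA2 : (A : ℂ) ≠ 0 := ofReal_ne_zero.2 hA
  push_cast
  field_simp
  ring

theorem im_div_eq (a b : ℂ) : ‖a‖ ^ 2 * (b / a).im = (starRingEnd ℂ a * b).im := by
  by_cases ha : a = 0
  · simp [ha]
  rw [← normSq_eq_norm_sq, ← im_ofReal_mul, ← mul_conj]
  congr 1
  field_simp

theorem semiFlat_elliptic (hL : IsLatticeBundle U Λ) (hε : 0 < ε)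
    (hΩ : IsHolSymplectic (totalSet 1 U) Ω) (hD : Descends U Λ Ω) :
    ∃ g : (Fin 1 → ℂ) → ℂ, DifferentiableOn ℂ g U ∧
      (∀ x ∈ totalSet 1 U, Ω x = g (basePart x) • wedgeOne ![dz 0, dw 0]) ∧
      (∃ gF gS G, IsFlatFibreMetric U Λ ε gF ∧
        IsBaseMetricHK U (fun x => (1 / Real.sqrt 2 : ℝ) • Ω x) gF gS ∧
        IsSubmersionMetric U Λ gF gS G) ∧
      ∀ gF gS G, IsFlatFibreMetric U Λ ε gF →
        IsBaseMetricHK U (fun x => (1 / Real.sqrt 2 : ℝ) • Ω x) gF gS →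
        IsSubmersionMetric U Λ gF gS G →
        Descends U Λ (fun x => kahlerForm (G x)) ∧
        IsHyperkahler (totalSet 1 U) G ∧
        (∀ x ∈ totalSet 1 U, wedgePow (kahlerForm (G x)).toAlternatingMap 2 =
          wedge (Ω x).toAlternatingMap (conjForm (Ω x).toAlternatingMap)) ∧
        IsKahlerMetric U gS ∧
        ∀ (W : Set (Fin 1 → ℂ)) (τ₁ τ₂ : (Fin 1 → ℂ) → ℂ),
          IsFrame Λ W (frameTwo τ₁ τ₂) → W ⊆ U →
          (∀ z ∈ W, 0 < (starRingEnd ℂ (τ₁ z) * τ₂ z).im) →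
          (∀ x ∈ totalSet 1 W, ∀ (A : ℝ) (Γ : ℂ) (w : ℂ), w = fibPart x 0 →
            A = (starRingEnd ℂ (τ₁ (basePart x)) * τ₂ (basePart x)).im →
            Γ = (1 / A : ℂ) *
              (((starRingEnd ℂ (τ₁ (basePart x)) * w).im : ℂ) *
                  fderiv ℂ τ₂ (basePart x) (Pi.single 0 1) -
                ((starRingEnd ℂ (τ₂ (basePart x)) * w).im : ℂ) *
                  fderiv ℂ τ₁ (basePart x) (Pi.single 0 1)) →
            kahlerForm (G x) =
              (Complex.I * (‖g (basePart x)‖ ^ 2 : ℝ) * (A / ε : ℝ)) •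
                  wedgeOne ![dz 0, conjOne (dz 0)] +
                (Complex.I / 2 * (ε / A : ℝ)) •
                  wedgeOne ![dw 0 - Γ • dz 0, conjOne (dw 0 - Γ • dz 0)]) ∧
          ∀ τ : (Fin 1 → ℂ) → Fin 1 → ℂ, (τ = fun z _ => τ₂ z / τ₁ z) →
            DifferentiableOn ℂ τ W ∧ Set.MapsTo τ W upperHalf ∧ ∀ z ∈ W,
              ricciForm gS z =
                (-Complex.I) • ddbar (fun y => (Real.log (τ y 0).im : ℂ)) z ∧
              ricciForm gS z = (Complex.I / 4 / ((τ z 0).im ^ 2 : ℝ)) •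
                wedgeOne ![fderiv ℝ (fun y => τ y 0) z, conjOne (fderiv ℝ (fun y => τ y 0) z)] ∧
              ricciForm gS z =
                (kahlerForm (hyperbolicMetric (τ z))).compContinuousLinearMap
                  (fderiv ℝ τ z) := by
  obtain ⟨g, hg, heq⟩ := hΩ.exists_coeff hD hL
  have hc : (1 / Real.sqrt 2 : ℝ) ≠ 0 := by positivity
  have hc2 : (1 / Real.sqrt 2 : ℝ) ^ 2 = 1 / 2 := by
    rw [div_pow, one_pow, Real.sq_sqrt (by norm_num)]
  have hc3 : ((1 / Real.sqrt 2 : ℝ) : ℂ) * ((1 / Real.sqrt 2 : ℝ) : ℂ) = 1 / 2 := by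
    rw [← ofReal_mul, ← pow_two, hc2]
    simp
  have hΥ := isSymplecticPairing_smul hΩ hD hL hg heq hc
  refine ⟨g, hg, heq, ?_, fun gF gS G hF hB hG => ?_⟩
  · obtain ⟨gF, hF⟩ := exists_flatFibreMetric hL hε
    obtain ⟨gS, G, hB, hG⟩ := hΥ.exists_semiFlat one_pos hL (fun z hz => (hF.const_herm hL hz).2)
    exact ⟨gF, gS, G, hF, hB, hG⟩
  have hS := (hΥ.isBaseMetricHK_iff one_pos fun z hz => (hF.const_herm hL hz).2).1 hB
  have hsub := hF.flatSubmersion hL hε (fun z hz => (hB z hz).1) hG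
  refine ⟨hsub.descends, isHyperkahler hΥ one_pos hsub hS, fun x hx => ?_,
    baseMetric_isKahlerMetric hΥ one_pos hsub hS, fun W τ₁ τ₂ hT hW hpos => ?_⟩
  · rw [volume_elliptic hΥ hsub hS hx]
    have h1 : ((1 / Real.sqrt 2 : ℝ) • Ω x).toAlternatingMap =
        ((1 / Real.sqrt 2 : ℝ) : ℂ) • (Ω x).toAlternatingMap := by
      ext v; simp
    rw [h1, conjForm_smul, wedge_smul_left, wedge_smul_right, conj_ofReal, smul_smul, smul_smul,
      mul_assoc, hc3, mul_one_div_cancel two_ne_zero, one_smul]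
  have hgF : ∀ z ∈ W, hermMat (gF z 0) = Matrix.of fun _ _ =>
      ((ε / (2 * (starRingEnd ℂ (τ₁ z) * τ₂ z).im) : ℝ) : ℂ) := fun z hz => by
    have h1 := (hF.elliptic hε (hW hz) (hT.2.2 z hz)).2.1
    rwa [show cellArea (fun a j => frameTwo τ₁ τ₂ z j a) = (starRingEnd ℂ (τ₁ z) * τ₂ z).im from rfl,
      abs_of_pos (hpos z hz)] at h1
  -- The ½ from the factor 1/√2 in Υ cancels the 2 in the fibre coefficient ε / (2A).
  have hgS : ∀ z ∈ W, hermMat (gS z) = Matrix.of fun _ _ =>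
      ((‖g z‖ ^ 2 * ((starRingEnd ℂ (τ₁ z) * τ₂ z).im / ε) : ℝ) : ℂ) := fun z hz => by
    have hA := hpos z hz
    rw [hS z (hW hz), hermMat_base_elliptic (hΥ.ne_zero one_pos (hW hz)) (by positivity) (hgF z hz)
      (hF.const_herm hL (hW hz)).2, norm_mul, mul_pow, norm_real, Real.norm_eq_abs, sq_abs, hc2]
    congr
    field_simp
  refine ⟨fun x hx A Γ w hw hA hΓ => ?_, ?_⟩
  · have hApos : 0 < A := hA ▸ hpos _ hx
    have hθ : thetaForm (frameTwo τ₁ τ₂) x 0 = dw 0 - Γ • dz 0 := by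
      rw [thetaForm, Fin.sum_univ_one, christoffel_frameTwo hT hx hApos.ne' hA, hΓ, hw]
    rw [hsub.kahlerForm_eq hT hW hx, vertForm, hgF _ hx, hgS _ hx, ← hA]
    simp only [Fin.sum_univ_one, of_apply, hθ]
    congr 2
    · push_cast; ring
    · push_cast; field_simp
  · rintro τ rfl
    have h0 : ∀ z ∈ W, τ₁ z ≠ 0 := fun z hz h => by
      have := hpos z hz
      simp [h] at this
    have h1 : DifferentiableOn ℂ τ₁ W := hT.2.1 0 (Sum.inl 0)
    have h2 : DifferentiableOn ℂ τ₂ W := hT.2.1 0 (Sum.inr 0)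
    have hτ : DifferentiableOn ℂ (fun z (_ : Fin 1) => τ₂ z / τ₁ z) W :=
      by
      simp only [div_eq_mul_inv]
      exact differentiableOn_pi.2 fun _ => h2.mul (h1.inv h0)
    have hmaps : Set.MapsTo (fun z (_ : Fin 1) => τ₂ z / τ₁ z) W upperHalf := fun z hz => by
      have h3 := hpos z hz
      rw [← im_div_eq] at h3
      exact pos_of_mul_pos_right h3 (by positivity)
    -- Since Im(τ̄₁τ₂) = |τ₁|² Im τ, the base coefficient |g|² Im(τ̄₁τ₂) / ε equals |gτ₁|² Im τ / ε.
    refine ⟨hτ, hmaps, fun z hz => ricciForm_eq_hyperbolic hT.1 hτ hmaps (h := fun y => g y * τ₁ y)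
      ((hg.mono hW).mul h1) (fun y hy => mul_ne_zero ?_ (h0 y hy)) (K := 1 / ε) (by positivity)
      (fun y hy => ?_) hz⟩
    · exact right_ne_zero_of_mul (hΥ.ne_zero one_pos (hW hy))
    · rw [hgS y hy, det_fin_one, of_apply, norm_mul, mul_pow, mul_assoc (‖g y‖ ^ 2), im_div_eq]
      congr 1
      ring

end EllipticFibrations

end

/-! ### Assembly of the settings -/

theorem lemma4p2 :
    -- the form on the Siegel upper half space comes from an invariant Kähler metric
    (∀ m : ℕ, 0 < m →
      IsKahlerForm (siegelSpace m) (siegelForm (m := m)) ∧ IsSpInvariant (siegelForm (m := m))) ∧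
    -- the hyperbolic metric of constant Gauß curvature -2
    (IsKahlerMetric upperHalf hyperbolicMetric ∧
      HasConstCurvature upperHalf hyperbolicMetric (-2)) ∧
    -- the hyperkähler setting
    (∀ (m : ℕ) (_ : 0 < m) (U : Set (Fin m → ℂ)) (Λ : (Fin m → ℂ) → AddSubgroup (Fin m → ℂ))
      (ω Υ : (Fin m ⊕ Fin m → ℂ) → CForm (Fin m ⊕ Fin m → ℂ) 2) (g : (Fin m → ℂ) → ℂ) (ε : ℝ),
      IsLatticeBundle U Λ → IsConstPolarization U Λ ω → 0 < ε →
      IsHolSymplectic (totalSet m U) Υ → Descends U Λ Υ → DifferentiableOn ℂ g U →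
      (∀ x ∈ totalSet m U, Υ x = g (basePart x) • ∑ j, wedgeOne ![dz j, dw j]) →
      (∃ gF gS G, IsSemiFlatHK U Λ ω Υ ε gF gS G) ∧
      ∀ gF gS G, IsSemiFlatHK U Λ ω Υ ε gF gS G →
        Descends U Λ (fun x => kahlerForm (G x)) ∧
        IsKahlerMetric (totalSet m U) G ∧
        (∀ x ∈ totalSet m U,
          wedgePow (kahlerForm (G x)).toAlternatingMap (2 * m) =
            (((2 * m).choose m : ℂ) • wedge (wedgePow (Υ x).toAlternatingMap m)
              (conjForm (wedgePow (Υ x).toAlternatingMap m))).domDomCongr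
                (finCongr (by ring))) ∧
        IsHyperkahler (totalSet m U) G ∧
        IsKahlerMetric U gS ∧
        ∀ (W : Set (Fin m → ℂ)) (T : (Fin m → ℂ) → Matrix (Fin m) (Fin m ⊕ Fin m) ℂ),
          IsFrame Λ W T → W ⊆ U → IsConnected W →
          ∃ Q : Matrix (Fin m ⊕ Fin m) (Fin m ⊕ Fin m) ℝ,
            IsPolarizationMatrix Λ ω W T Q ∧ 0 < Q.det ∧
            (∀ z ∈ W, (∀ w, kahlerForm (gF z w) = hermForm (matHeps ε Q (T z))) ∧
              Cohomologous (Λ z) (restrictFib ω z) (fun _ => hermForm (matH Q (T z)))) ∧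
            (∀ x ∈ totalSet m W, kahlerForm (G x) =
              (∑ j, ∑ k, (Complex.I * (‖g (basePart x)‖ ^ 2 : ℝ) *
                  (matHeps ε Q (T (basePart x)))⁻¹ k j) • wedgeOne ![dz j, conjOne (dz k)]) +
                vertForm (matHeps ε Q (T (basePart x))) T x) ∧
            (∃ S : Matrix (Fin m ⊕ Fin m) (Fin m ⊕ Fin m) ℝ,
              S.transpose * Q * S = Matrix.fromBlocks 0 1 (-1) 0) ∧
            ∀ S : Matrix (Fin m ⊕ Fin m) (Fin m ⊕ Fin m) ℝ,
              S.transpose * Q * S = Matrix.fromBlocks 0 1 (-1) 0 →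
              ∃ R Z, IsPeriodMap W T S R Z ∧ ∀ z ∈ W,
                (matH Q (T z))⁻¹ =
                  (2 : ℂ) • (conjMat (R z) * realMat (imMat (symMat (Z z))) * (R z).transpose) ∧
                ricciForm gS z = (-Complex.I) •
                  ddbar (fun y => (Real.log (imMat (symMat (Z y))).det : ℂ)) z ∧
                ricciForm gS z = siegelWith (Z z) (fun s => fderiv ℝ (fun y => Z y s) z) ∧
                ricciForm gS z = (siegelForm (Z z)).compContinuousLinearMap (fderiv ℝ Z z)) ∧
    -- the Calabi-Yau setting
    (∀ (m : ℕ) (_ : 0 < m) (U : Set (Fin 1 → ℂ)) (Λ : (Fin 1 → ℂ) → AddSubgroup (Fin m → ℂ))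
      (ω : (Fin 1 ⊕ Fin m → ℂ) → CForm (Fin 1 ⊕ Fin m → ℂ) 2)
      (Ω : (Fin 1 ⊕ Fin m → ℂ) → CForm (Fin 1 ⊕ Fin m → ℂ) (m + 1))
      (g : (Fin 1 → ℂ) → ℂ) (ε : ℝ),
      IsLatticeBundle U Λ → IsConstPolarization U Λ ω → 0 < ε →
      IsHolVolume (totalSet m U) Ω → Descends U Λ Ω → DifferentiableOn ℂ g U →
      (∀ x ∈ totalSet m U, Ω x = g (basePart x) • wedgeOne (Fin.cons (dz 0) dw)) →
      (∃ gF gS G, IsSemiFlatCY U Λ ω Ω ε gF gS G) ∧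
      ∀ gF gS G, IsSemiFlatCY U Λ ω Ω ε gF gS G →
        Descends U Λ (fun x => kahlerForm (G x)) ∧
        IsKahlerMetric (totalSet m U) G ∧
        (∀ x ∈ totalSet m U,
          wedgePow (kahlerForm (G x)).toAlternatingMap (m + 1) =
            ((((m + 1).factorial : ℂ) * Complex.I ^ ((m + 1) ^ 2)) •
              wedge (Ω x).toAlternatingMap (conjForm (Ω x).toAlternatingMap)).domDomCongr
                (finCongr (by ring))) ∧
        IsCalabiYau (totalSet m U) G ∧
        IsKahlerMetric U gS ∧
        ∀ (W : Set (Fin 1 → ℂ)) (T : (Fin 1 → ℂ) → Matrix (Fin m) (Fin m ⊕ Fin m) ℂ),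
          IsFrame Λ W T → W ⊆ U → IsConnected W →
          ∃ Q : Matrix (Fin m ⊕ Fin m) (Fin m ⊕ Fin m) ℝ,
            IsPolarizationMatrix Λ ω W T Q ∧ 0 < Q.det ∧
            (∀ z ∈ W, (∀ w, kahlerForm (gF z w) = hermForm (matHeps ε Q (T z))) ∧
              Cohomologous (Λ z) (restrictFib ω z) (fun _ => hermForm (matH Q (T z)))) ∧
            (∀ x ∈ totalSet m W, kahlerForm (G x) =
              (Complex.I * (‖g (basePart x)‖ ^ 2 : ℝ) *
                  (matHeps ε Q (T (basePart x))).det⁻¹) • wedgeOne ![dz 0, conjOne (dz 0)] +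
                vertForm (matHeps ε Q (T (basePart x))) T x) ∧
            (∃ S : Matrix (Fin m ⊕ Fin m) (Fin m ⊕ Fin m) ℝ,
              S.transpose * Q * S = Matrix.fromBlocks 0 1 (-1) 0) ∧
            ∀ S : Matrix (Fin m ⊕ Fin m) (Fin m ⊕ Fin m) ℝ,
              S.transpose * Q * S = Matrix.fromBlocks 0 1 (-1) 0 →
              ∃ R Z, IsPeriodMap W T S R Z ∧ ∀ z ∈ W,
                (matH Q (T z))⁻¹ =
                  (2 : ℂ) • (conjMat (R z) * realMat (imMat (symMat (Z z))) * (R z).transpose) ∧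
                ricciForm gS z = (-Complex.I) •
                  ddbar (fun y => (Real.log (imMat (symMat (Z y))).det : ℂ)) z ∧
                ricciForm gS z = siegelWith (Z z) (fun s => fderiv ℝ (fun y => Z y s) z) ∧
                ricciForm gS z = (siegelForm (Z z)).compContinuousLinearMap (fderiv ℝ Z z)) ∧
    -- elliptic fibrations
    (∀ (U : Set (Fin 1 → ℂ)) (Λ : (Fin 1 → ℂ) → AddSubgroup (Fin 1 → ℂ))
      (Ω : (Fin 1 ⊕ Fin 1 → ℂ) → CForm (Fin 1 ⊕ Fin 1 → ℂ) 2) (ε : ℝ),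
      IsLatticeBundle U Λ → 0 < ε → IsHolSymplectic (totalSet 1 U) Ω → Descends U Λ Ω →
      ∃ g : (Fin 1 → ℂ) → ℂ, DifferentiableOn ℂ g U ∧
        (∀ x ∈ totalSet 1 U, Ω x = g (basePart x) • wedgeOne ![dz 0, dw 0]) ∧
        (∃ gF gS G, IsFlatFibreMetric U Λ ε gF ∧
          IsBaseMetricHK U (fun x => (1 / Real.sqrt 2 : ℝ) • Ω x) gF gS ∧
          IsSubmersionMetric U Λ gF gS G) ∧
        ∀ gF gS G, IsFlatFibreMetric U Λ ε gF →
          IsBaseMetricHK U (fun x => (1 / Real.sqrt 2 : ℝ) • Ω x) gF gS →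
          IsSubmersionMetric U Λ gF gS G →
          Descends U Λ (fun x => kahlerForm (G x)) ∧
          IsHyperkahler (totalSet 1 U) G ∧
          (∀ x ∈ totalSet 1 U, wedgePow (kahlerForm (G x)).toAlternatingMap 2 =
            wedge (Ω x).toAlternatingMap (conjForm (Ω x).toAlternatingMap)) ∧
          IsKahlerMetric U gS ∧
          ∀ (W : Set (Fin 1 → ℂ)) (τ₁ τ₂ : (Fin 1 → ℂ) → ℂ),
            IsFrame Λ W (frameTwo τ₁ τ₂) → W ⊆ U →
            (∀ z ∈ W, 0 < (starRingEnd ℂ (τ₁ z) * τ₂ z).im) →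
            (∀ x ∈ totalSet 1 W, ∀ (A : ℝ) (Γ : ℂ) (w : ℂ), w = fibPart x 0 →
              A = (starRingEnd ℂ (τ₁ (basePart x)) * τ₂ (basePart x)).im →
              Γ = (1 / A : ℂ) *
                (((starRingEnd ℂ (τ₁ (basePart x)) * w).im : ℂ) *
                    fderiv ℂ τ₂ (basePart x) (Pi.single 0 1) -
                  ((starRingEnd ℂ (τ₂ (basePart x)) * w).im : ℂ) *
                    fderiv ℂ τ₁ (basePart x) (Pi.single 0 1)) →
              kahlerForm (G x) =
                (Complex.I * (‖g (basePart x)‖ ^ 2 : ℝ) * (A / ε : ℝ)) •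
                    wedgeOne ![dz 0, conjOne (dz 0)] +
                  (Complex.I / 2 * (ε / A : ℝ)) •
                    wedgeOne ![dw 0 - Γ • dz 0, conjOne (dw 0 - Γ • dz 0)]) ∧
            ∀ τ : (Fin 1 → ℂ) → Fin 1 → ℂ, (τ = fun z _ => τ₂ z / τ₁ z) →
              DifferentiableOn ℂ τ W ∧ Set.MapsTo τ W upperHalf ∧ ∀ z ∈ W,
                ricciForm gS z =
                  (-Complex.I) • ddbar (fun y => (Real.log (τ y 0).im : ℂ)) z ∧
                ricciForm gS z = (Complex.I / 4 / ((τ z 0).im ^ 2 : ℝ)) •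
                  wedgeOne ![fderiv ℝ (fun y => τ y 0) z, conjOne (fderiv ℝ (fun y => τ y 0) z)] ∧
                ricciForm gS z =
                  (kahlerForm (hyperbolicMetric (τ z))).compContinuousLinearMap
                    (fderiv ℝ τ z)) :=
  ⟨fun _ _ => ⟨isKahlerForm_siegelForm, isSpInvariant_siegelForm⟩,
    ⟨isKahlerMetric_hyperbolicMetric, hasConstCurvature_hyperbolicMetric⟩,
    fun _ hm _ _ _ _ _ _ hL hω hε hΥ hD hg heq => semiFlat_hyperkahler hm hL hω hε ⟨hL.1, hΥ, hD, hg, heq⟩,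
    fun _ hm _ _ _ _ _ _ hL hω hε hΩ _ hg heq => semiFlat_calabiYau hm hL hω hε ⟨hL.1, hΩ, hg, heq⟩,
    fun _ _ _ _ hL hε hΩ hD => semiFlat_elliptic hL hε hΩ hD⟩
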